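/- **Model.** Let $\mathcal X_1,\mathcal X_2$ be compact metric spaces with Borel probability measures $P_1,P_2$, let $d_{\mathcal X_2}(y,y')\le D_2$ for all $y,y'\in\mathcal X_2$, and let $f:\mathcal X_1\times\mathcal X_2\to\mathbb R$ satisfy $|f(x,y)-f(x',y')|\le L\max(d_{\mathcal X_1}(x,x'),d_{\mathcal X_2}(y,y'))$ with $L>0$. Let $m,n\ge1$. The latent features $x_1(u)\sim P_1$ ($u\in[m]$) and $x_2(i)\sim P_2$ ($i\in[n]$), the noise terms $\eta(u,i)$ with $\mathbb E\,\eta(u,i)=0$, $\mathrm{Var}\,\eta(u,i)=\gamma^2$, $|\eta(u,i)|\le B_e$ a.s. ($B_e\ge 0$), and the indicators of the events $(u,i)\in\mathcal D$, each of probability $p\in[0,1]$, are all mutually independent. Put $A(u,i)=f(x_1(u),x_2(i))$ and $Z(u,i)=A(u,i)+\eta(u,i)$; $Z(u,i)$ is observed iff $(u,i)\in\mathcal D$. Put $B_0=LD_2+2B_e$ and assume $|f|\le 2B_0$. For $r\ge0$ let $\phi_2(r)=\operatorname{ess\,inf}_{y_0\sim P_2}P_2(\{y:d_{\mathcal X_2}(y_0,y)\le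 r\})$. **Item-item estimator** (parameters $\beta$ real, $k\ge1$ an integer). For columns $i,j$ let $O^{ij}=\{u:(u,i)\in\mathcal D,(u,j)\in\mathcal D\}$, $$m_{ij}=\frac1{|O^{ij}|}\sum_{u\in O^{ij}}(Z(u,i)-Z(u,j)),\qquad s_{ij}^2=\frac1{|O^{ij}|-1}\sum_{u\in O^{ij}}(Z(u,i)-Z(u,j)-m_{ij})^2 .$$ For $(u,i)$ let $S$ be the set of columns $j\ne i$ with $(u,j)\in\mathcal D$ and $|O^{ij}|\ge\beta$, and let $S^k$ consist of the $\min(k,|S|)$ columns of $S$ with smallest $s^2_{ij}$. Ties are broken by an arbitrary priority order on the columns, which may depend on $(u,i)$ and on $\mathcal D$ but not on the values of $Z$. The estimate is $\hat A(u,i)=\frac1{|S^k|}\sum_{j\in S^k}(Z(u,j)+m_{ij})$, and $\hat A(u,i)=0$ if $S^k=\emptyset$. Let $MSE(\hat A)=\mathbb E\big[\frac1{mn}\sum_{u,i}(\hat A(u,i)-A(u,i))^2\big]$. **Theorem 4.2 (item-item).** Let $\delta>0$, $c_\phi\ge0$, $c_\beta\in(0,1)$, $c_k\in[0,1)$, $\zeta>0$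 and suppose that $$p\ge\max\{m^{-1/2+\delta},n^{-1+\delta}\},\qquad \phi_2\big(\sqrt{\zeta/L^2}\big)\ge c_\phi(np)^{-2/3},$$ $$\beta=c_\beta mp^2,\qquad k\le\tfrac{c_k}2(n-1)p\,\phi_2\big(\sqrt{\zeta/L^2}\big).$$ Let $$F_1=\zeta+2\beta^{-1/3}+\frac{\gamma^2}k,\quad F_2=\beta^{-1/3},\quad F_3=3\exp(-c_1(np)^{1/3})+\big(n+\tfrac92np\big)\exp(-c_2\beta^{1/3}),$$ $$c_1=\min\Big\{\frac1{24},\frac{c_\phi(1-c_k)^2}8\Big\},\quad c_2=\min\Big\{\frac{c_\beta^2}2,\frac3{6B_0^2+4B_0},\frac1{8B_0^2(2B_0^2+1)}\Big\}.$$ Suppose further that the problem is large enough that $F_1\le2B_0$ and $c_\beta^2\beta^{1/3}\le(1-c_\beta)^2mp^2$ (the latter holds automatically if $c_\beta\le\frac12$, and in general as soon as $mp^2\ge c_\beta^{7/2}(1-c_\beta)^{-3}$). Then the squared error is integrable and $$MSE(\hat A)\le2F_1\ln\Big(\frac{2B_0}{F_1}\Big)+(F_1+F_2)^2+2F_2+4B_0^2F_3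 .$$ Moreover, if $c_\phi>0$ and $B_0>0$, then along any sequence of sizes $m,n\to\infty$ and probabilities $p\le 1$ that eventually satisfy $p\ge\max\{m^{-1/2+\delta},n^{-1+\delta}\}$ and $\log n<(mp^2)^{\delta'/3}$ for a fixed $\delta'\in(0,1)$, with $\beta=c_\beta mp^2$ and all constants fixed, $F_3\to0$. -/

import Mathlib

open MeasureTheory ProbabilityTheory Filter Topology

/-- Lower bound on the mass of balls: the essential infimum over centres `x`, drawn from `μ`,
of the `μ`-mass of the closed ball of radius `r` around `x`. -/
noncomputable def ballMass {X : Type*} [MetricSpace X] [MeasurableSpace X]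
    (μ : Measure X) (r : ℝ) : ℝ :=
  essInf (fun x => μ.real (Metric.closedBall x r)) μ

section Estimator

variable {m n : ℕ}

/-- Rows in which column `i` is observed. The pattern `o u i` tells whether entry `(u, i)` is
observed. -/
def colObs (o : Fin m → Fin n → Bool) (i : Fin n) : Finset (Fin m) :=
  Finset.univ.filter fun u => o u i = true

/-- Rows in which both columns `i` and `j` are observed. -/
def colOverlap (o : Fin m → Fin n → Bool) (i j : Fin n) : Finset (Fin m) :=
  colObs o i ∩ colObs o j

/-- Sample mean of the difference of columns `i` and `j` over their overlap. -/
noncomputable def colMean (Z : Fin m → Fin n → ℝ) (o : Fin m → Fin n → Bool) (i j : Fin n) : ℝ :=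
  (∑ u ∈ colOverlap o i j, (Z u i - Z u j)) / ((colOverlap o i j).card : ℝ)

/-- Sample variance of the difference of columns `i` and `j` over their overlap. -/
noncomputable def colVar (Z : Fin m → Fin n → ℝ) (o : Fin m → Fin n → Bool) (i j : Fin n) : ℝ :=
  (∑ u ∈ colOverlap o i j, (Z u i - Z u j - colMean Z o i j) ^ 2) /
    (((colOverlap o i j).card : ℝ) - 1)

open scoped Classical in
/-- Columns other than `i` that are observed in row `u` and overlap with column `i` in at least
`β` rows. -/
noncomputable def colBase (o : Fin m → Fin n → Bool) (β : ℝ) (u : Fin m) (i : Fin n) :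
    Finset (Fin n) :=
  Finset.univ.filter fun j => j ≠ i ∧ o u j = true ∧ β ≤ ((colOverlap o i j).card : ℝ)

/-- Column `a` is ranked before column `b` as a neighbour of column `i`: it has a smaller sample
variance, or the same one and a higher priority (smaller value of `τ`). -/
def RankedBefore (Z : Fin m → Fin n → ℝ) (o : Fin m → Fin n → Bool) (τ : Equiv.Perm (Fin n))
    (i a b : Fin n) : Prop :=
  colVar Z o i a < colVar Z o i b ∨ (colVar Z o i a = colVar Z o i b ∧ τ a < τ b)

open scoped Classical in
/-- The at most `k` columns of `colBase` with the smallest sample variance, ties being broken by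
the priority `τ`: a candidate is kept when fewer than `k` candidates are ranked before it. -/
noncomputable def colNearest (Z : Fin m → Fin n → ℝ) (o : Fin m → Fin n → Bool) (β : ℝ) (k : ℕ)
    (τ : Equiv.Perm (Fin n)) (u : Fin m) (i : Fin n) : Finset (Fin n) :=
  (colBase o β u i).filter fun j =>
    ((colBase o β u i).filter fun j' => RankedBefore Z o τ i j' j).card < k

/-- Item-item `k`-nearest-neighbour estimate of entry `(u, i)`; it is `0` if there is no
neighbour. -/
noncomputable def itemEstimate (Z : Fin m → Fin n → ℝ) (o : Fin m → Fin n → Bool) (β : ℝ) (k : ℕ)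
    (τ : Equiv.Perm (Fin n)) (u : Fin m) (i : Fin n) : ℝ :=
  (∑ j ∈ colNearest Z o β k τ u i, (Z u j + colMean Z o i j)) /
    ((colNearest Z o β k τ u i).card : ℝ)

end Estimator

section Model

variable {X₁ X₂ Ω : Type*} [MeasurableSpace X₁] [MeasurableSpace X₂] [MeasurableSpace Ω]
  {m n : ℕ}

/-- Sources of randomness: row features, column features, noise terms, observation indicators. -/
abbrev Source (m n : ℕ) : Type :=
  (Fin m ⊕ Fin n) ⊕ ((Fin m × Fin n) ⊕ (Fin m × Fin n))

/-- The σ-algebra generated by one source of randomness. -/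
@[reducible]
def sourceSigma (x₁ : Fin m → Ω → X₁) (x₂ : Fin n → Ω → X₂) (η : Fin m → Fin n → Ω → ℝ)
    (o : Fin m → Fin n → Ω → Bool) : Source m n → MeasurableSpace Ω
  | .inl (.inl u) => MeasurableSpace.comap (x₁ u) inferInstance
  | .inl (.inr i) => MeasurableSpace.comap (x₂ i) inferInstance
  | .inr (.inl e) => MeasurableSpace.comap (η e.1 e.2) inferInstance
  | .inr (.inr e) => MeasurableSpace.comap (o e.1 e.2) inferInstance

/-- The random data of the latent variable model: latent row features with law `μ₁`, latent column
features with law `μ₂`, centred noise of variance `γ ^ 2` bounded by `Be`, and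
observation indicators that are true with probability `p`, all mutually independent.
The noise terms need not be identically distributed. -/
structure IsLatentModel (P : Measure Ω) (μ₁ : Measure X₁) (μ₂ : Measure X₂) (γ Be p : ℝ)
    (x₁ : Fin m → Ω → X₁) (x₂ : Fin n → Ω → X₂) (η : Fin m → Fin n → Ω → ℝ)
    (o : Fin m → Fin n → Ω → Bool) : Prop where
  measurable_row : ∀ u, Measurable (x₁ u)
  measurable_col : ∀ i, Measurable (x₂ i)
  measurable_noise : ∀ u i, Measurable (η u i)
  measurable_obs : ∀ u i, Measurable (o u i)
  law_row : ∀ u, P.map (x₁ u) = μ₁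
  law_col : ∀ i, P.map (x₂ i) = μ₂
  noise_mean : ∀ u i, ∫ ω, η u i ω ∂P = 0
  noise_var : ∀ u i, Var[η u i; P] = γ ^ 2
  noise_bound : ∀ u i, ∀ᵐ ω ∂P, |η u i ω| ≤ Be
  obs_prob : ∀ u i, P {ω | o u i ω = true} = ENNReal.ofReal p
  indep : iIndep (sourceSigma x₁ x₂ η o) P

/-- The unknown matrix `A(u, i) = f (x₁ u, x₂ i)`. -/
def signal (f : X₁ → X₂ → ℝ) (x₁ : Fin m → Ω → X₁) (x₂ : Fin n → Ω → X₂) (ω : Ω) :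
    Fin m → Fin n → ℝ :=
  fun u i => f (x₁ u ω) (x₂ i ω)

/-- The noisy matrix `Z = A + η`. The estimator reads only its observed entries. -/
def noisy (f : X₁ → X₂ → ℝ) (x₁ : Fin m → Ω → X₁) (x₂ : Fin n → Ω → X₂)
    (η : Fin m → Fin n → Ω → ℝ) (ω : Ω) : Fin m → Fin n → ℝ :=
  fun u i => signal f x₁ x₂ ω u i + η u i ω

/-- Squared error of the item-item estimate, averaged over the entries, at the outcome `ω`.
The priority used to break ties at entry `(u, i)` is `τ o u i`, where `o` is the observation
pattern. -/
noncomputable def avgSqError (f : X₁ → X₂ → ℝ) (x₁ : Fin m → Ω → X₁) (x₂ : Fin n → Ω → X₂)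
    (η : Fin m → Fin n → Ω → ℝ) (o : Fin m → Fin n → Ω → Bool) (β : ℝ) (k : ℕ)
    (τ : (Fin m → Fin n → Bool) → Fin m → Fin n → Equiv.Perm (Fin n)) (ω : Ω) : ℝ :=
  (1 / ((m : ℝ) * n)) * ∑ u : Fin m, ∑ i : Fin n,
    (itemEstimate (noisy f x₁ x₂ η ω) (fun v j => o v j ω) β k
        (τ (fun v j => o v j ω) u i) u i
      - signal f x₁ x₂ ω u i) ^ 2

end Model

section Bounds

/-- `F₁ = ζ + 2 β^(-1/3) + γ² / k`. -/
noncomputable def boundF1 (ζ β γ : ℝ) (k : ℕ) : ℝ :=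
  ζ + 2 * β ^ (-(1 / 3) : ℝ) + γ ^ 2 / k

/-- `F₂ = β^(-1/3)`. -/
noncomputable def boundF2 (β : ℝ) : ℝ := β ^ (-(1 / 3) : ℝ)

/-- The constant `c₁`. -/
noncomputable def constC1 (cφ ck : ℝ) : ℝ := min (1 / 24) (cφ * (1 - ck) ^ 2 / 8)

/-- The constant `c₂`. -/
noncomputable def constC2 (cβ B₀ : ℝ) : ℝ :=
  min (cβ ^ 2 / 2)
    (min (3 / (6 * B₀ ^ 2 + 4 * B₀)) (1 / (8 * B₀ ^ 2 * (2 * B₀ ^ 2 + 1))))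

/-- `F₃ = 3 exp(-c₁ (n p)^(1/3)) + (n + (9/2) n p) exp(-c₂ β^(1/3))`. -/
noncomputable def boundF3 (c₁ c₂ : ℝ) (n : ℕ) (p β : ℝ) : ℝ :=
  3 * Real.exp (-c₁ * (n * p) ^ (1 / 3 : ℝ))
    + (n + 9 / 2 * (n * p)) * Real.exp (-c₂ * β ^ (1 / 3 : ℝ))

end Bounds

/-! Condition on the observation pattern and the column features, so that only row features and
noise stay random, and put α = β^(-1/3). Over an overlap of at least β = α⁻³ rows, the first two
sample moments of the centred difference of two columns are within O(α) of their means, outside an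
event of probability O(exp(-c/α)). Chernoff bounds make all overlaps comparable and supply k columns
at distance at most √(ζ/L²). These have difference variance at most ζ, so every selected column has
variance at most ζ + O(α). A failure costs at most (2B₀)² times its probability, which produces F₃.

If (u,i) is not observed, row u lies in no overlap with column i. The selection is then independent
of row u, and bias plus variance give ζ + O(α) + γ²/k
(`ColumnModel.integral_nbrErr_sq_le_of_notMem`). The asserted bound contains 2F log(2B₀/F) + F²
instead of F, but `le_two_mul_log_add_sq_or` shows that this is at least F or at least the trivial
bound (2B₀)².

If (u,i) is observed, row u lies in the overlap of i with every candidate, and its noise influences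
both the selection and the average. Removing row u splits each score into a part free of row u and
D²/N, where D is the deviation of row u from the mean of the other rows and N is the size of the
overlap; the error is η(u,i) minus the average of D(N-1)/N. The selected set is optimal for the full
scores and another set, independent of row u, is optimal for the leave-one-out parts. Subtracting
the two relations shows that selecting cannot raise the sum of D²/N above its value on the
independent set. This gives O(γ² + ζ + α) (`ColumnModel.integral_nbrErr_sq_le_of_mem`), which
suffices unless γ² is large compared with α.

In that remaining case the noise itself helps. The noise of column j in the rows other than u
smooths the law of its centred sum of squares, while row u moves the comparison of scores by a
bounded amount h. Up to events on which sample means are large, the indicator that j is selected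
lies between two indicators that do not involve η(u,j) and differ only on a window of length h at
the selection threshold. By `ColumnModel.window_residSq` the window carries at most a fraction θ < 1
of the mass below the threshold, plus an exponentially small term. Hence η(u,j) is almost
uncorrelated with the selection, and `ColumnModel.integral_selectedSum_sq_le` recovers the factor
1/k with losses governed by θ.

The window estimate `window_bound` is an exchangeable-pair argument. Resample one noise variable at
a time, and integrate the sum of the mean changes of the squares against a decreasing ramp of the
centred sum of squares. By exchange symmetry this integral equals a sum of downward changes times
increments of the ramp, hence it dominates the quadratic variation on the window. It is also at most
the height of the ramp times a sum of independent centred variables, restricted to the half-line,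
and that sum rarely exceeds a multiple of λV, where V is the total variance. As the quadratic
variation is rarely much below V, the ratio of the two masses is of order (height)·λ.

The numerical part divides all quantities by α. `LargeNoise` collects the parameters for which both
crude bounds exceed the target; they force B₀/α ≥ 16 and enough noise for θ ≤ 0.52, and
`LargeNoise.smoothBound_le_normBound` checks that the smoothing bound is then below the target. The
probabilistic work takes place on a product space indexed by the sources of randomness, and
`IsLatentModel.map_toCells` carries it to the given space. The limit assertion holds because log n
is of smaller order than β^(1/3). -/

open Finset Real

local notation "Pr" => Measure.pi

set_option linter.unusedSectionVars false

/-! ### Resampling coordinates in a product space; bounded measurable functions. -/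

section Mix

variable {ι Y : Type*}

open scoped Classical in
/-- The configuration that agrees with `a` on `A` and with `b` elsewhere. -/
noncomputable def mix (A : Set ι) (a b : ι → Y) : ι → Y := fun i => if i ∈ A then a i else b i

lemma mix_of_mem {A : Set ι} {i : ι} (h : i ∈ A) (a b : ι → Y) : mix A a b i = a i := by
  simp [mix, h]

lemma mix_of_notMem {A : Set ι} {i : ι} (h : i ∉ A) (a b : ι → Y) : mix A a b i = b i := by
  simp [mix, h]

variable [MeasurableSpace Y]

lemma measurable_mix (A : Set ι) : Measurable (fun p : (ι → Y) × (ι → Y) => mix A p.1 p.2) := by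
  refine measurable_pi_iff.2 fun i => ?_
  by_cases h : i ∈ A
  · simp only [mix_of_mem h]; fun_prop
  · simp only [mix_of_notMem h]; fun_prop

lemma measurable_mix_left (A : Set ι) (b : ι → Y) : Measurable (fun a : ι → Y => mix A a b) :=
  (measurable_mix A).comp measurable_prodMk_right

/-- Bounded measurable real functions. -/
@[fun_prop]
structure BddMeas {α : Type*} [MeasurableSpace α] (G : α → ℝ) : Prop where
  meas : Measurable G
  bdd : ∃ C, ∀ x, |G x| ≤ C

namespace BddMeas

variable {α β : Type*} [MeasurableSpace α] [MeasurableSpace β] {G H : α → ℝ}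

lemma integrable (hG : BddMeas G) (P : Measure α) [IsFiniteMeasure P] : Integrable G P := by
  obtain ⟨C, hC⟩ := hG.bdd
  exact Integrable.of_bound hG.meas.aestronglyMeasurable C (ae_of_all _ hC)

@[fun_prop]
lemma const (c : ℝ) : BddMeas (fun _ : α => c) := ⟨measurable_const, |c|, fun _ => le_rfl⟩

@[fun_prop]
lemma add (hG : BddMeas G) (hH : BddMeas H) : BddMeas (fun x => G x + H x) := by
  obtain ⟨C, hC⟩ := hG.bdd
  obtain ⟨D, hD⟩ := hH.bdd
  exact ⟨hG.meas.add hH.meas, C + D, fun x => (abs_add_le _ _).trans (add_le_add (hC x) (hD x))⟩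

@[fun_prop]
lemma neg (hG : BddMeas G) : BddMeas (fun x => - G x) := by
  obtain ⟨C, hC⟩ := hG.bdd
  exact ⟨hG.meas.neg, C, fun x => by simpa using hC x⟩

@[fun_prop]
lemma sub (hG : BddMeas G) (hH : BddMeas H) : BddMeas (fun x => G x - H x) := by
  simpa [sub_eq_add_neg] using hG.add hH.neg

@[fun_prop]
lemma mul (hG : BddMeas G) (hH : BddMeas H) : BddMeas (fun x => G x * H x) := by
  obtain ⟨C, hC⟩ := hG.bdd
  obtain ⟨D, hD⟩ := hH.bdd
  refine ⟨hG.meas.mul hH.meas, C * D, fun x => ?_⟩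
  rw [abs_mul]
  exact mul_le_mul (hC x) (hD x) (abs_nonneg _) ((abs_nonneg _).trans (hC x))

lemma const_mul (c : ℝ) (hG : BddMeas G) : BddMeas (fun x => c * G x) := (const c).mul hG

@[fun_prop]
lemma div_const (hG : BddMeas G) (c : ℝ) : BddMeas (fun x => G x / c) := by
  simpa [div_eq_mul_inv] using hG.mul (const c⁻¹)

@[fun_prop]
lemma pow (hG : BddMeas G) (n : ℕ) : BddMeas (fun x => G x ^ n) := by
  induction n with
  | zero => simpa using const 1
  | succ n ih => simpa [pow_succ] using ih.mul hG

@[fun_prop]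
lemma abs (hG : BddMeas G) : BddMeas (fun x => |G x|) := by
  obtain ⟨C, hC⟩ := hG.bdd
  exact ⟨measurable_norm.comp hG.meas, C, fun x => by simpa using hC x⟩

@[fun_prop]
lemma max (hG : BddMeas G) (hH : BddMeas H) : BddMeas (fun x => Max.max (G x) (H x)) := by
  obtain ⟨C, hC⟩ := hG.bdd
  obtain ⟨D, hD⟩ := hH.bdd
  exact ⟨hG.meas.max hH.meas, Max.max C D, fun x =>
    (abs_max_le_max_abs_abs).trans (max_le_max (hC x) (hD x))⟩

lemma sum {κ : Type*} (s : Finset κ) {G : κ → α → ℝ} (h : ∀ i ∈ s, BddMeas (G i)) :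
    BddMeas (fun x => ∑ i ∈ s, G i x) := by
  classical
  induction s using Finset.induction_on with
  | empty => simpa using const 0
  | insert a s ha ih =>
    simp only [sum_insert ha]
    exact (h a (by simp)).add (ih fun i hi => h i (by simp [hi]))

@[fun_prop]
lemma finset_sum {κ : Type*} (s : Finset κ) {G : κ → α → ℝ} (h : ∀ i, BddMeas (G i)) :
    BddMeas (fun x => ∑ i ∈ s, G i x) := sum s fun i _ => h i

lemma comp {g : β → α} (hG : BddMeas G) (hg : Measurable g) : BddMeas (fun x => G (g x)) := by
  obtain ⟨C, hC⟩ := hG.bdd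
  exact ⟨hG.meas.comp hg, C, fun x => hC _⟩

@[fun_prop]
lemma exp (hG : BddMeas G) : BddMeas (fun x => exp (G x)) := by
  obtain ⟨C, hC⟩ := hG.bdd
  refine ⟨measurable_exp.comp hG.meas, Real.exp C, fun x => ?_⟩
  rw [abs_of_pos (exp_pos _)]
  exact exp_le_exp.2 ((le_abs_self _).trans (hC x))

open scoped Classical in
lemma ite {p : α → Prop} (hp : MeasurableSet {x | p x}) (hG : BddMeas G) (hH : BddMeas H) :
    BddMeas (fun x => if p x then G x else H x) := by
  obtain ⟨C, hC⟩ := hG.bdd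
  obtain ⟨D, hD⟩ := hH.bdd
  refine ⟨Measurable.ite hp hG.meas hH.meas, Max.max C D, fun x => ?_⟩
  all_goals grind

lemma integral_add {P : Measure α} [IsFiniteMeasure P] (hG : BddMeas G := by fun_prop)
    (hH : BddMeas H := by fun_prop) : ∫ x, (G x + H x) ∂P = ∫ x, G x ∂P + ∫ x, H x ∂P :=
  MeasureTheory.integral_add (hG.integrable P) (hH.integrable P)

lemma integral_sub {P : Measure α} [IsFiniteMeasure P] (hG : BddMeas G := by fun_prop)
    (hH : BddMeas H := by fun_prop) : ∫ x, (G x - H x) ∂P = ∫ x, G x ∂P - ∫ x, H x ∂P :=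
  MeasureTheory.integral_sub (hG.integrable P) (hH.integrable P)

lemma integral_mono (hG : BddMeas G) (hH : BddMeas H) (P : Measure α) [IsFiniteMeasure P]
    (h : ∀ x, G x ≤ H x) : ∫ x, G x ∂P ≤ ∫ x, H x ∂P :=
  MeasureTheory.integral_mono (hG.integrable P) (hH.integrable P) h

lemma integral_left {G : α × β → ℝ} (hG : BddMeas G) (P : Measure α) [IsProbabilityMeasure P] :
    BddMeas (fun y => ∫ x, G (x, y) ∂P) := by
  obtain ⟨C, hC⟩ := hG.bdd
  refine ⟨?_, C, fun y => ?_⟩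
  · exact (hG.meas.stronglyMeasurable.integral_prod_left' (μ := P)).measurable
  · have := norm_integral_le_of_norm_le_const (μ := P) (f := fun x => G (x, y)) (C := C)
      (ae_of_all _ fun x => hC _)
    simpa using this

end BddMeas

lemma BddMeas.mix {G : (ι → Y) → ℝ} (hG : BddMeas G) (A : Set ι) :
    BddMeas (fun p : (ι → Y) × (ι → Y) => G (mix A p.1 p.2)) := hG.comp (measurable_mix A)

variable [Fintype ι] (ν : ι → Measure Y) [∀ i, IsProbabilityMeasure (ν i)]

lemma measurePreserving_mix (A : Set ι) :
    MeasurePreserving (fun p : (ι → Y) × (ι → Y) => mix A p.1 p.2) ((Pr ν).prod (Pr ν)) (Pr ν) := by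
  classical
  refine ⟨measurable_mix A, ?_⟩
  refine (Measure.pi_eq fun s hs => ?_).symm
  rw [Measure.map_apply (measurable_mix A) (MeasurableSet.univ_pi hs)]
  have : (fun p : (ι → Y) × (ι → Y) => mix A p.1 p.2) ⁻¹' (Set.univ.pi s)
      = (Set.univ.pi fun i => if i ∈ A then s i else Set.univ) ×ˢ
        (Set.univ.pi fun i => if i ∈ A then Set.univ else s i) := by
    ext p
    simp only [Set.mem_preimage, Set.mem_pi, Set.mem_univ, true_imp_iff, Set.mem_prod]
    constructor
    · intro h
      constructor <;> intro i <;> have := h i <;> by_cases hi : i ∈ A <;> simp_all [mix]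
    · rintro ⟨h1, h2⟩ i
      have h1 := h1 i
      have h2 := h2 i
      by_cases hi : i ∈ A <;> simp_all [mix]
  rw [this, Measure.prod_prod, Measure.pi_pi, Measure.pi_pi, ← prod_mul_distrib]
  refine prod_congr rfl fun i _ => ?_
  by_cases hi : i ∈ A <;> simp [hi]

lemma BddMeas.integral_mix_left {G : (ι → Y) → ℝ} (hG : BddMeas G) (A : Set ι) :
    BddMeas (fun b => ∫ a, G (_root_.mix A a b) ∂Pr ν) := (hG.mix A).integral_left _

/-- Resampling the coordinates in `A` does not change expectations. -/
lemma integral_eq_integral_mix {G : (ι → Y) → ℝ} (hG : BddMeas G) (A : Set ι) :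
    ∫ b, G b ∂Pr ν = ∫ b, ∫ a, G (mix A a b) ∂Pr ν ∂Pr ν := by
  have h := (measurePreserving_mix ν A).map_eq
  conv_lhs => rw [← h]
  rw [integral_map (measurable_mix A).aemeasurable (by rw [h]; exact hG.meas.aestronglyMeasurable),
    integral_prod_symm _ ((hG.mix A).integrable _)]

end Mix

/-! ### Independence of disjoint blocks and exponential tail bounds. -/

section Blocks

variable {ι Y : Type*}

lemma DependsOn.apply_mix {β : Type*} {f : (ι → Y) → β} {A : Set ι} (hf : DependsOn f A)
    (a b : ι → Y) : f (mix A a b) = f a := hf fun _ hi => mix_of_mem hi a b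

lemma DependsOn.apply_mix_compl {β : Type*} {f : (ι → Y) → β} {A B : Set ι}
    (hf : DependsOn f B) (h : Disjoint A B) (a b : ι → Y) : f (mix A a b) = f b :=
  hf fun _ hi => mix_of_notMem (fun hA => Set.disjoint_left.1 h hA hi) a b

variable [MeasurableSpace Y] [Fintype ι] (ν : ι → Measure Y) [∀ i, IsProbabilityMeasure (ν i)]

/-- Resampling the coordinates in `A` renews `f` and leaves `g` untouched, so the double integral
factorises. -/
lemma integral_mul_of_dependsOn {f g : (ι → Y) → ℝ} {A B : Set ι} (hf : BddMeas f)
    (hg : BddMeas g) (hfA : DependsOn f A) (hgB : DependsOn g B) (hAB : Disjoint A B) :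
    ∫ ω, f ω * g ω ∂Pr ν = (∫ ω, f ω ∂Pr ν) * ∫ ω, g ω ∂Pr ν := by
  rw [integral_eq_integral_mix ν (hf.mul hg) A]
  simp only [hfA.apply_mix, hgB.apply_mix_compl hAB]
  simp only [integral_mul_const, integral_const_mul]

variable {κ : Type*} {X : κ → (ι → Y) → ℝ} {B : κ → Set ι} {s : Finset κ}

lemma integral_exp_sum (hX : ∀ v ∈ s, BddMeas (X v)) (hB : ∀ v ∈ s, DependsOn (X v) (B v))
    (hd : (s : Set κ).PairwiseDisjoint B) : ∫ ω, exp (∑ v ∈ s, X v ω) ∂Pr ν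
      = ∏ v ∈ s, ∫ ω, exp (X v ω) ∂Pr ν := by
  classical
  induction s using Finset.induction_on with
  | empty => simp
  | insert a s ha ih =>
    simp only [sum_insert ha, prod_insert ha, exp_add]
    rw [integral_mul_of_dependsOn ν (A := B a) (B := ⋃ v ∈ s, B v) (hX a (by simp)).exp
      (BddMeas.sum s fun v hv => hX v (by simp [hv])).exp, ih (fun v hv => hX v (by simp [hv]))
      (fun v hv => hB v (by simp [hv])) (hd.subset (by simp))]
    · intro x y hxy
      simp only [hB a (by simp) hxy]
    · intro x y hxy
      have : ∑ v ∈ s, X v x = ∑ v ∈ s, X v y := sum_congr rfl fun v hv =>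
        hB v (by simp [hv]) fun i hi => hxy i (Set.mem_biUnion hv hi)
      simp only [this]
    · refine Set.disjoint_iUnion₂_right.2 fun v hv => hd (by simp) (by simp [hv]) ?_
      rintro rfl
      exact ha hv

lemma measureReal_le_exp_of_mgf_le {α : Type*} [MeasurableSpace α] {P : Measure α} [IsProbabilityMeasure P]
    {S : α → ℝ} (hS : BddMeas S) {E : Set α} {c : ℝ}
    (hE : ∀ ω ∈ E, 0 ≤ S ω) (hc : ∫ ω, exp (S ω) ∂P ≤ c) : P.real E ≤ c := by
  have h1 : P.real E ≤ P.real {ω | 1 ≤ exp (S ω)} :=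
    measureReal_mono (fun ω h => one_le_exp (hE ω h))
  have h2 := mul_meas_ge_le_integral_of_nonneg (μ := P) (f := fun ω => exp (S ω))
    (ae_of_all _ fun ω => (exp_pos _).le) (hS.exp.integrable P) 1
  linarith

/-- Exponential Markov inequality for a sum of functions of disjoint blocks. -/
lemma measureReal_le_exp_sum (hX : ∀ v ∈ s, BddMeas (X v))
    (hB : ∀ v ∈ s, DependsOn (X v) (B v)) (hd : (s : Set κ).PairwiseDisjoint B)
    {c : κ → ℝ} (hc : ∀ v ∈ s, ∫ ω, exp (X v ω) ∂Pr ν ≤ exp (c v)) {r : ℝ}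
    {E : Set (ι → Y)} (hE : ∀ ω ∈ E, r ≤ ∑ v ∈ s, X v ω) :
    (Pr ν).real E ≤ exp (∑ v ∈ s, c v - r) := by
  refine measureReal_le_exp_of_mgf_le (S := fun ω => ∑ v ∈ s, X v ω - r)
    ((BddMeas.sum s hX).sub (.const r)) (fun ω h => sub_nonneg.2 (hE ω h)) ?_
  simp only [exp_sub, integral_div]
  gcongr
  rw [integral_exp_sum ν hX hB hd, exp_sum]
  exact prod_le_prod (fun v _ => integral_nonneg fun ω => (exp_pos _).le) hc

/-- The difference of the two sides vanishes at `0` and has derivative `exp (-x) - (1 - x) ≥ 0`. -/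
lemma exp_neg_le_quadratic {w : ℝ} (hw : 0 ≤ w) : exp (-w) ≤ 1 - w + w ^ 2 / 2 := by
  have h : ∀ x : ℝ, 0 ≤ x → 0 ≤ 1 - x + x ^ 2 / 2 - exp (-x) := by
    have hm : MonotoneOn (fun x : ℝ => 1 - x + x ^ 2 / 2 - exp (-x)) (Set.Ici 0) := by
      refine monotoneOn_of_deriv_nonneg (convex_Ici 0) (by fun_prop) (by fun_prop) ?_
      intro x hx
      have hd : HasDerivAt (fun x : ℝ => 1 - x + x ^ 2 / 2 - exp (-x))
          (0 - 1 + 2 * x / 2 - exp (-x) * (-1)) x := by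
        refine (((hasDerivAt_const x (1 : ℝ)).sub (hasDerivAt_id x)).add ?_).sub ?_
        · simpa using ((hasDerivAt_pow 2 x).div_const 2)
        · exact (hasDerivAt_neg x).exp
      rw [hd.deriv]
      have := add_one_le_exp (-x)
      linarith
    intro x hx
    have := hm (Set.mem_Ici.2 le_rfl) (Set.mem_Ici.2 hx) hx
    simpa using this
  linarith [h w hw]

lemma exp_le_quadratic {w : ℝ} (hw : |w| ≤ 1) : exp w ≤ 1 + w + w ^ 2 := by
  have h := abs_exp_sub_one_sub_id_le hw
  linarith [le_abs_self (exp w - 1 - w)]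

/-- Multiplicative Chernoff bound, lower tail. -/
lemma measureReal_sum_le_lower {K m₀ ε : ℝ} (hK : 0 < K) (hε : 0 ≤ ε) (hε' : ε ≤ 2)
    (hX : ∀ v ∈ s, Measurable (X v)) (hX0 : ∀ v ∈ s, ∀ ω, 0 ≤ X v ω) (hXK : ∀ v ∈ s, ∀ ω, X v ω ≤ K)
    (hB : ∀ v ∈ s, DependsOn (X v) (B v)) (hd : (s : Set κ).PairwiseDisjoint B)
    (hm : m₀ ≤ ∑ v ∈ s, ∫ ω, X v ω ∂Pr ν) : (Pr ν).real {ω | ∑ v ∈ s, X v ω ≤ (1 - ε) * m₀}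
      ≤ exp (-(ε ^ 2 * m₀ / (2 * K))) := by
  have hXb : ∀ v ∈ s, BddMeas (X v) := fun v hv => ⟨hX v hv, K, fun ω => by
    rw [abs_of_nonneg (hX0 v hv ω)]; exact hXK v hv ω⟩
  -- The tilt `ε / K` replaces the optimal logarithmic one. Since `ε ≤ 2`, the coefficient `ε - ε² /
  -- 2` is nonnegative, so a lower bound `m₀` on the mean is enough.
  have key := measureReal_le_exp_sum ν (s := s) (X := fun v ω => -(ε / K) * X v ω) (B := B)
    (c := fun v => -((ε - ε ^ 2 / 2) / K) * ∫ ω, X v ω ∂Pr ν)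
    (r := -(ε / K) * ((1 - ε) * m₀)) (E := {ω | ∑ v ∈ s, X v ω ≤ (1 - ε) * m₀})
    (fun v hv => (hXb v hv).const_mul _) (fun v hv x y hxy => by simp only [hB v hv hxy]) hd ?_ ?_
  · refine key.trans (exp_le_exp.2 ?_)
    rw [← mul_sum]
    have h1 : 0 ≤ (ε - ε ^ 2 / 2) / K := by
      apply div_nonneg _ hK.le; nlinarith
    have h2 := mul_le_mul_of_nonneg_left hm h1
    have h3 : -((ε - ε ^ 2 / 2) / K) * m₀ - -(ε / K) * ((1 - ε) * m₀)
        = -(ε ^ 2 * m₀ / (2 * K)) := by field_simp; ring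
    linarith
  · intro v hv
    have h1 : ∀ ω, exp (-(ε / K) * X v ω) ≤ 1 + (-((ε - ε ^ 2 / 2) / K)) * X v ω := by
      intro ω
      have hz0 : 0 ≤ X v ω / K := div_nonneg (hX0 v hv ω) hK.le
      have hz1 : X v ω / K ≤ 1 := (div_le_one hK).2 (hXK v hv ω)
      have h := exp_neg_le_quadratic (mul_nonneg hε hz0)
      have e1 : -(ε / K) * X v ω = -(ε * (X v ω / K)) := by ring
      have e2 : (-((ε - ε ^ 2 / 2) / K)) * X v ω = -((ε - ε ^ 2 / 2) * (X v ω / K)) := by ring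
      rw [e1, e2]
      -- The square is linearised by `z² ≤ z` for `z = X / K` in `[0, 1]`.
      nlinarith [mul_nonneg (sq_nonneg ε) (mul_nonneg hz0 (sub_nonneg.2 hz1))]
    calc ∫ ω, exp (-(ε / K) * X v ω) ∂Pr ν ≤ ∫ ω, (1 + (-((ε - ε ^ 2 / 2) / K)) * X v ω) ∂Pr ν :=
          integral_mono (((hXb v hv).const_mul _).exp.integrable _)
            (((BddMeas.const 1).add ((hXb v hv).const_mul _)).integrable _) h1
      _ = 1 + (-((ε - ε ^ 2 / 2) / K)) * ∫ ω, X v ω ∂Pr ν := by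
          rw [integral_add (integrable_const _) (((hXb v hv).const_mul _).integrable _),
            integral_const_mul]; simp
      _ ≤ _ := by
          have := add_one_le_exp (-((ε - ε ^ 2 / 2) / K) * ∫ ω, X v ω ∂Pr ν)
          linarith
  · intro ω hω
    simp only [Set.mem_ofPred_eq] at hω
    rw [← mul_sum]
    have : 0 ≤ ε / K := by positivity
    nlinarith

/-- Multiplicative Chernoff bound, upper tail. -/
lemma measureReal_sum_ge_upper {m₀ ε : ℝ} (hε : 0 ≤ ε) (hε' : ε ≤ 2)
    (hX : ∀ v ∈ s, Measurable (X v)) (hX0 : ∀ v ∈ s, ∀ ω, 0 ≤ X v ω) (hX1 : ∀ v ∈ s, ∀ ω, X v ω ≤ 1)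
    (hB : ∀ v ∈ s, DependsOn (X v) (B v)) (hd : (s : Set κ).PairwiseDisjoint B)
    (hm : ∑ v ∈ s, ∫ ω, X v ω ∂Pr ν ≤ m₀) : (Pr ν).real {ω | (1 + ε) * m₀ ≤ ∑ v ∈ s, X v ω}
      ≤ exp (-(ε ^ 2 * m₀ / 4)) := by
  have hXb : ∀ v ∈ s, BddMeas (X v) := fun v hv => ⟨hX v hv, 1, fun ω => by
    rw [abs_of_nonneg (hX0 v hv ω)]; exact hX1 v hv ω⟩
  -- With tilt `ε / 2` the exponent stays at most `1`, where `exp w ≤ 1 + w + w²` applies.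
  have key := measureReal_le_exp_sum ν (s := s) (X := fun v ω => (ε / 2) * X v ω) (B := B)
    (c := fun v => (ε / 2 + ε ^ 2 / 4) * ∫ ω, X v ω ∂Pr ν)
    (r := (ε / 2) * ((1 + ε) * m₀)) (E := {ω | (1 + ε) * m₀ ≤ ∑ v ∈ s, X v ω})
    (fun v hv => (hXb v hv).const_mul _) (fun v hv x y hxy => by simp only [hB v hv hxy]) hd ?_ ?_
  · refine key.trans (exp_le_exp.2 ?_)
    rw [← mul_sum]
    nlinarith
  · intro v hv
    have h1 : ∀ ω, exp ((ε / 2) * X v ω) ≤ 1 + (ε / 2 + ε ^ 2 / 4) * X v ω := by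
      intro ω
      have hz0 := hX0 v hv ω
      have hz1 := hX1 v hv ω
      have h := exp_le_quadratic (w := (ε / 2) * X v ω)
        (by rw [abs_of_nonneg (by positivity)]; nlinarith)
      nlinarith [mul_nonneg (sq_nonneg ε) (mul_nonneg hz0 (sub_nonneg.2 hz1))]
    calc ∫ ω, exp ((ε / 2) * X v ω) ∂Pr ν ≤ ∫ ω, (1 + (ε / 2 + ε ^ 2 / 4) * X v ω) ∂Pr ν :=
          integral_mono (((hXb v hv).const_mul _).exp.integrable _)
            (((BddMeas.const 1).add ((hXb v hv).const_mul _)).integrable _) h1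
      _ = 1 + (ε / 2 + ε ^ 2 / 4) * ∫ ω, X v ω ∂Pr ν := by
          rw [integral_add (integrable_const _) (((hXb v hv).const_mul _).integrable _),
            integral_const_mul]; simp
      _ ≤ _ := by
          have := add_one_le_exp ((ε / 2 + ε ^ 2 / 4) * ∫ ω, X v ω ∂Pr ν)
          linarith
  · intro ω hω
    rw [← mul_sum]
    exact mul_le_mul_of_nonneg_left hω (by positivity)

/-- Moment generating function bound from mean zero and a second moment. -/
lemma integral_exp_le_of_second_moment {α : Type*} [MeasurableSpace α] {P : Measure α} [IsProbabilityMeasure P]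
    {f : α → ℝ} (hf : BddMeas f) (h0 : ∫ ω, f ω ∂P = 0) {c w : ℝ}
    (hc : ∀ ω, exp (f ω) ≤ 1 + f ω + c * f ω ^ 2) (hw : c * ∫ ω, f ω ^ 2 ∂P ≤ w) :
    ∫ ω, exp (f ω) ∂P ≤ exp w := by
  calc ∫ ω, exp (f ω) ∂P ≤ ∫ ω, (1 + f ω + c * f ω ^ 2) ∂P := integral_mono (hf.exp.integrable _)
          ((((BddMeas.const 1).add hf).add ((hf.pow 2).const_mul c)).integrable _) hc
    _ = 1 + c * ∫ ω, f ω ^ 2 ∂P := by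
        rw [integral_add (((BddMeas.const 1).add hf).integrable _)
          (((hf.pow 2).const_mul c).integrable _), integral_add (integrable_const _)
          (hf.integrable _), integral_const_mul, h0]; simp
    _ ≤ w + 1 := by linarith
    _ ≤ _ := add_one_le_exp w

/-- Bernstein's inequality with a free parameter `t`. -/
lemma measureReal_abs_sum_ge {b γ₂ t r : ℝ} (ht : 0 ≤ t) (htb : t * b ≤ 1)
    (hX : ∀ v ∈ s, Measurable (X v)) (hXb : ∀ v ∈ s, ∀ ω, |X v ω| ≤ b)
    (h0 : ∀ v ∈ s, ∫ ω, X v ω ∂Pr ν = 0) (h2 : ∀ v ∈ s, ∫ ω, X v ω ^ 2 ∂Pr ν ≤ γ₂)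
    (hB : ∀ v ∈ s, DependsOn (X v) (B v)) (hd : (s : Set κ).PairwiseDisjoint B) :
    (Pr ν).real {ω | r ≤ |∑ v ∈ s, X v ω|} ≤ 2 * exp (t ^ 2 * γ₂ * #s - t * r) := by
  have hb : ∀ v ∈ s, BddMeas (X v) := fun v hv => ⟨hX v hv, b, hXb v hv⟩
  have key : ∀ c : ℝ, (c = t ∨ c = -t) → (Pr ν).real {ω | t * r ≤ c * ∑ v ∈ s, X v ω}
        ≤ exp (t ^ 2 * γ₂ * #s - t * r) := by
    intro c hc
    have hc2 : c ^ 2 = t ^ 2 := by rcases hc with rfl | rfl <;> ring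
    have hca : |c| = t := by rcases hc with rfl | rfl <;> simp [abs_of_nonneg ht]
    have := measureReal_le_exp_sum ν (s := s) (X := fun v ω => c * X v ω) (B := B)
      (c := fun _ => t ^ 2 * γ₂) (r := t * r) (E := {ω | t * r ≤ c * ∑ v ∈ s, X v ω})
      (fun v hv => (hb v hv).const_mul _) (fun v hv x y hxy => by simp only [hB v hv hxy]) hd ?_ ?_
    · simpa [mul_comm] using this
    · intro v hv
      refine integral_exp_le_of_second_moment ((hb v hv).const_mul c) (c := 1)
        (by rw [integral_const_mul, h0 v hv, mul_zero]) (fun ω => ?_) ?_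
      · rw [one_mul]
        refine exp_le_quadratic ?_
        rw [abs_mul, hca]
        exact (mul_le_mul_of_nonneg_left (hXb v hv ω) ht).trans htb
      · simp only [mul_pow, integral_const_mul, one_mul, hc2]
        exact mul_le_mul_of_nonneg_left (h2 v hv) (sq_nonneg t)
    · intro ω hω
      simpa [mul_sum] using hω
  have hsub : {ω | r ≤ |∑ v ∈ s, X v ω|} ⊆ {ω | t * r ≤ t * ∑ v ∈ s, X v ω}
      ∪ {ω | t * r ≤ -t * ∑ v ∈ s, X v ω} := by
    intro ω hω
    simp only [Set.mem_ofPred_eq, Set.mem_union] at hω ⊢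
    rcases abs_cases (∑ v ∈ s, X v ω) with ⟨h, _⟩ | ⟨h, _⟩
    · left; rw [h] at hω; exact mul_le_mul_of_nonneg_left hω ht
    · right; rw [h] at hω; nlinarith
  calc _ ≤ _ := measureReal_mono hsub
    _ ≤ _ := measureReal_union_le _ _
    _ ≤ _ := by linarith [key t (Or.inl rfl), key (-t) (Or.inr rfl)]

/-- Hoeffding's inequality for functions of disjoint blocks. -/
lemma measureReal_abs_sum_sub_ge {R r : ℝ} (hR : 0 < R) (hr : 0 ≤ r) (lo : κ → ℝ)
    (hs : s.Nonempty) (hX : ∀ v ∈ s, Measurable (X v))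
    (hXb : ∀ v ∈ s, ∀ ω, X v ω ∈ Set.Icc (lo v) (lo v + R))
    (hB : ∀ v ∈ s, DependsOn (X v) (B v)) (hd : (s : Set κ).PairwiseDisjoint B) :
    (Pr ν).real {ω | r ≤ |∑ v ∈ s, (X v ω - ∫ ω', X v ω' ∂Pr ν)|}
      ≤ 2 * exp (-(2 * r ^ 2 / (#s * R ^ 2))) := by
  have hb : ∀ v ∈ s, BddMeas (X v) := fun v hv => ⟨hX v hv, max |lo v| |lo v + R|, fun ω =>
    abs_le_max_abs_abs (hXb v hv ω).1 (hXb v hv ω).2⟩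
  have hcard : (0 : ℝ) < #s := by exact_mod_cast hs.card_pos
  -- This value minimises `#s R² t² / 8 - t r`.
  set t : ℝ := 4 * r / (#s * R ^ 2) with ht
  have ht0 : 0 ≤ t := by positivity
  have key : ∀ c : ℝ, (c = t ∨ c = -t) →
      (Pr ν).real {ω | t * r ≤ c * ∑ v ∈ s, (X v ω - ∫ ω', X v ω' ∂Pr ν)}
        ≤ exp (-(2 * r ^ 2 / (#s * R ^ 2))) := by
    intro c hc
    have hc2 : c ^ 2 = t ^ 2 := by rcases hc with rfl | rfl <;> ring
    have := measureReal_le_exp_sum ν (s := s)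
      (X := fun v ω => c * (X v ω - ∫ ω', X v ω' ∂Pr ν)) (B := B)
      (c := fun _ => R ^ 2 * t ^ 2 / 8) (r := t * r)
      (E := {ω | t * r ≤ c * ∑ v ∈ s, (X v ω - ∫ ω', X v ω' ∂Pr ν)})
      (fun v hv => ((hb v hv).sub (.const _)).const_mul _)
      (fun v hv x y hxy => by simp only [hB v hv hxy]) hd ?_ ?_
    · refine this.trans (exp_le_exp.2 (le_of_eq ?_))
      rw [sum_const, nsmul_eq_mul, ht]
      field_simp
      ring
    · intro v hv
      have h := (hasSubgaussianMGF_of_mem_Icc (μ := Pr ν) (hX v hv).aemeasurable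
        (ae_of_all _ (hXb v hv))).mgf_le c
      refine h.trans (exp_le_exp.2 (le_of_eq ?_))
      rw [hc2]
      simp [abs_of_pos hR]
      ring
    · intro ω hω
      rw [← mul_sum]
      exact hω
  have hsub : {ω | r ≤ |∑ v ∈ s, (X v ω - ∫ ω', X v ω' ∂Pr ν)|} ⊆
      {ω | t * r ≤ t * ∑ v ∈ s, (X v ω - ∫ ω', X v ω' ∂Pr ν)}
      ∪ {ω | t * r ≤ -t * ∑ v ∈ s, (X v ω - ∫ ω', X v ω' ∂Pr ν)} := by
    intro ω hω
    simp only [Set.mem_ofPred_eq, Set.mem_union] at hω ⊢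
    rcases abs_cases (∑ v ∈ s, (X v ω - ∫ ω', X v ω' ∂Pr ν)) with ⟨h, _⟩ | ⟨h, _⟩
    · left; rw [h] at hω; exact mul_le_mul_of_nonneg_left hω ht0
    · right; rw [h] at hω; nlinarith
  calc _ ≤ _ := measureReal_mono hsub
    _ ≤ _ := measureReal_union_le _ _
    _ ≤ _ := by linarith [key t (Or.inl rfl), key (-t) (Or.inr rfl)]

end Blocks

/-! ### Centred sums of squares when one coordinate is resampled. -/

section Flux

variable {ι Y : Type*}

variable (b : Y → ℝ) (c : ι → ℝ) (κ : ℝ)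

/-- Centred sum of squares of the values `c v - b (ω v)`, `v ∈ s`. -/
noncomputable def centredSq (s : Finset ι) (ω : ι → Y) : ℝ :=
  ∑ v ∈ s, (c v - b (ω v)) ^ 2 - (∑ v ∈ s, (c v - b (ω v))) ^ 2 / #s

open scoped Classical in
/-- Change of `(c v - b (ω v)) ^ 2` when coordinate `v` is resampled, cut off where the two
values nearly cancel. -/
noncomputable def jump (v : ι) (p : (ι → Y) × (ι → Y)) : ℝ :=
  if κ ≤ |2 * c v - b (p.1 v) - b (p.2 v)| then
    (b (p.1 v) - b (p.2 v)) * (2 * c v - b (p.1 v) - b (p.2 v)) else 0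

variable {b c κ}

lemma jump_swap (v : ι) (p : (ι → Y) × (ι → Y)) : jump b c κ v p.swap = -jump b c κ v p := by
  simp only [jump, Prod.fst_swap, Prod.snd_swap]
  grind

/-- With the invariance of the product law under exchange, this antisymmetry makes the configuration
and its resampled version an exchangeable pair. It allows positive parts of jumps to be traded for
negative parts. -/
lemma jump_exchange (v : ι) (p : (ι → Y) × (ι → Y)) :
    jump b c κ v (mix {v} p.2 p.1, mix {v} p.1 p.2) = -jump b c κ v p := by
  rw [← jump_swap]
  simp [jump, mix]

/-- Without the centring the change would be the uncut jump. The correction is the sum of the two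
sample means, and the cut-off `κ` in `jump` is there to make it a small fraction of the jump when
both means are small. -/
lemma centredSq_mix {s : Finset ι} {v : ι} (hv : v ∈ s) (x y : ι → Y) :
    centredSq b c s (mix {v} y x) - centredSq b c s x
      = (b (x v) - b (y v)) * (2 * c v - b (x v) - b (y v)
        - (∑ w ∈ s, (c w - b (x w)) + ∑ w ∈ s, (c w - b (mix {v} y x w))) / #s) := by
  classical
  have h0 : ∀ w ∈ s.erase v, mix {v} y x w = x w := fun w hw =>
    mix_of_notMem (by simpa using (ne_of_mem_erase hw)) _ _
  have h1 : mix {v} y x v = y v := mix_of_mem (by simp) _ _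
  have e1 : ∑ w ∈ s, (c w - b (mix {v} y x w))
      = ∑ w ∈ s, (c w - b (x w)) + (b (x v) - b (y v)) := by
    rw [← add_sum_erase _ _ hv, ← add_sum_erase s (fun w => c w - b (x w)) hv, h1,
      sum_congr rfl (fun w hw => by rw [h0 w hw])]
    ring
  have e2 : ∑ w ∈ s, (c w - b (mix {v} y x w)) ^ 2 = ∑ w ∈ s, (c w - b (x w)) ^ 2
        + (b (x v) - b (y v)) * (2 * c v - b (x v) - b (y v)) := by
    rw [← add_sum_erase _ _ hv, ← add_sum_erase s (fun w => (c w - b (x w)) ^ 2) hv,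
      h1, sum_congr rfl (fun w hw => by rw [h0 w hw])]
    ring
  unfold centredSq
  rw [e1, e2]
  ring

variable [MeasurableSpace Y]

lemma measurable_jump (hb : Measurable b) (v : ι) : Measurable (jump b c κ v) := by
  classical
  unfold jump
  have h : Measurable fun p : (ι → Y) × (ι → Y) => 2 * c v - b (p.1 v) - b (p.2 v) := by
    fun_prop
  refine Measurable.ite (measurableSet_le measurable_const h.abs) ?_ measurable_const
  fun_prop

lemma measurable_centredSq (hb : Measurable b) (s : Finset ι) : Measurable (centredSq b c s) := by
  unfold centredSq
  fun_prop

variable [Fintype ι] (ν : ι → Measure Y) [∀ i, IsProbabilityMeasure (ν i)]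

/-- Exchanging the coordinates in `A` between two independent copies preserves the law. -/
lemma measurePreserving_exchange (A : Set ι) :
    MeasurePreserving (fun p : (ι → Y) × (ι → Y) => (mix A p.2 p.1, mix A p.1 p.2))
      ((Pr ν).prod (Pr ν)) ((Pr ν).prod (Pr ν)) := by
  classical
  have e := measurePreserving_arrowProdEquivProdArrow Y Y ι ν ν
  let f : ι → Y × Y → Y × Y := fun i => if i ∈ A then Prod.swap else id
  have hf : ∀ i, MeasurePreserving (f i) ((ν i).prod (ν i)) ((ν i).prod (ν i)) := by
    intro i
    by_cases h : i ∈ A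
    · simp only [f, h, if_true]; exact Measure.measurePreserving_swap
    · simp only [f, h, if_false]; exact MeasurePreserving.id _
  have h := (e.comp (measurePreserving_pi _ _ hf)).comp (e.symm _)
  convert h using 1
  funext p
  refine Prod.ext ?_ ?_ <;> funext i <;> by_cases hi : i ∈ A <;>
    simp [mix, hi, f, MeasurableEquiv.arrowProdEquivProdArrow, Equiv.arrowProdEquivProdArrow]

lemma integral_exchange {H : (ι → Y) × (ι → Y) → ℝ} (hH : Measurable H) (A : Set ι) :
    ∫ p, H p ∂((Pr ν).prod (Pr ν))
      = ∫ p, H (mix A p.2 p.1, mix A p.1 p.2) ∂((Pr ν).prod (Pr ν)) := by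
  have h := measurePreserving_exchange ν A
  conv_lhs => rw [← h.map_eq]
  rw [integral_map h.measurable.aemeasurable]
  rw [h.map_eq]; exact hH.aestronglyMeasurable

/-- Replacing the coordinates in `A` by an independent copy preserves the law. -/
lemma integral_comp_mix {G : (ι → Y) → ℝ} (hG : Measurable G) (A : Set ι) :
    ∫ p : (ι → Y) × (ι → Y), G (mix A p.2 p.1) ∂((Pr ν).prod (Pr ν)) = ∫ ω, G ω ∂Pr ν := by
  have h := integral_exchange ν (H := fun p => G p.1) (hG.comp measurable_fst) A
  simp only at h
  rw [← h, integral_fun_fst]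
  simp

/-- Half the total second moment of the jumps. -/
noncomputable def jumpVar (b : Y → ℝ) (c : ι → ℝ) (κ : ℝ) (s : Finset ι) : ℝ :=
  ∑ v ∈ s, (∫ p, jump b c κ v p ^ 2 ∂((Pr ν).prod (Pr ν))) / 2

/-- The cubic remainder is at most `(2 / 9) |x|³`, and `(2 / 9) (1 / 6) = 1 / 27 ≤ 1 / 25`, which is
the excess of `27 / 50` over `1 / 2`. -/
lemma exp_le_of_abs_le {x : ℝ} (hx : |x| ≤ 1 / 6) : exp x ≤ 1 + x + 27 / 50 * x ^ 2 := by
  have h := exp_bound (x := x) (by linarith) (n := 3) (by norm_num)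
  have h3 : |x| ^ 3 = |x| * x ^ 2 := by rw [← sq_abs x]; ring
  simp only [sum_range_succ, sum_range_zero, Nat.factorial, h3] at h
  norm_num at h
  have := (abs_le.1 h).2
  nlinarith [sq_nonneg x]

/-- A nonincreasing 1-Lipschitz ramp. -/
noncomputable def ramp (τ h J x : ℝ) : ℝ := max 0 (min (τ + h - x) (h + J))

lemma ramp_nonneg (τ h J x : ℝ) : 0 ≤ ramp τ h J x := le_max_left _ _

lemma ramp_le {τ h J : ℝ} (hh : 0 ≤ h + J) (x : ℝ) : ramp τ h J x ≤ h + J :=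
  max_le hh (min_le_right _ _)

lemma ramp_eq_zero {τ h J x : ℝ} (hx : τ + h ≤ x) : ramp τ h J x = 0 :=
  max_eq_left ((min_le_left _ _).trans (by linarith))

lemma ramp_anti (τ h J : ℝ) {x y : ℝ} (hxy : x ≤ y) : ramp τ h J y ≤ ramp τ h J x :=
  max_le_max le_rfl (min_le_min (by linarith) le_rfl)

/-- The ramp keeps slope `-1` down to `τ - J`, below the window, so a drop of size at most `J`
starting in the window is fully registered. This is why the plateau has height `h + J`. -/
lemma ramp_sub_ge {τ h J x y d : ℝ} (h1 : τ < y) (h2 : y ≤ τ + h) (hd : d ≤ y - x)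
    (hd' : d ≤ J) : d ≤ ramp τ h J x - ramp τ h J y := by
  have e1 : ramp τ h J y ≤ τ + h - y := max_le (by linarith) (min_le_left _ _)
  have e2 : min (τ + h - x) (h + J) ≤ ramp τ h J x := le_max_right _ _
  grind

lemma measurable_ramp (τ h J : ℝ) : Measurable (ramp τ h J) := by
  unfold ramp; fun_prop

/-- Conditional mean of a jump given the original configuration. -/
noncomputable def jumpMean (b : Y → ℝ) (c : ι → ℝ) (κ : ℝ) (v : ι) (ω : ι → Y) : ℝ :=
  ∫ ω', jump b c κ v (ω, ω') ∂Pr ν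

/-- Conditional second moment of the negative part of a jump. -/
noncomputable def negJumpSq (b : Y → ℝ) (c : ι → ℝ) (κ : ℝ) (v : ι) (ω : ι → Y) : ℝ :=
  ∫ ω', (max (-jump b c κ v (ω, ω')) 0) ^ 2 ∂Pr ν

section Moments

variable {s : Finset ι} {J : ℝ} (hb : Measurable b)
  (hJ : ∀ v ∈ s, ∀ p : (ι → Y) × (ι → Y), |jump b c κ v p| ≤ J)

include hJ in
lemma abs_jumpMean_le {v : ι} (hv : v ∈ s) (ω : ι → Y) : |jumpMean ν b c κ v ω| ≤ J := by
  have := norm_integral_le_of_norm_le_const (μ := Pr ν)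
    (f := fun ω' => jump b c κ v (ω, ω')) (C := J) (ae_of_all _ fun ω' => hJ v hv _)
  simpa [jumpMean] using this

include hb hJ

lemma bddMeas_jump {v : ι} (hv : v ∈ s) : BddMeas (jump b c κ v) :=
  ⟨measurable_jump hb v, J, hJ v hv⟩

lemma bddMeas_negJump {v : ι} (hv : v ∈ s) :
    BddMeas (fun p : (ι → Y) × (ι → Y) => max (-jump b c κ v p) 0) :=
  (bddMeas_jump hb hJ hv).neg.max (.const 0)

lemma bddMeas_jumpMean {v : ι} (hv : v ∈ s) : BddMeas (jumpMean ν b c κ v) := by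
  have h : BddMeas (fun p : (ι → Y) × (ι → Y) => jump b c κ v p.swap) :=
    (bddMeas_jump hb hJ hv).comp measurable_swap
  exact h.integral_left (Pr ν)

lemma bddMeas_negJumpSq {v : ι} (hv : v ∈ s) : BddMeas (negJumpSq ν b c κ v) := by
  have h : BddMeas (fun p : (ι → Y) × (ι → Y) => (max (-jump b c κ v p.swap) 0) ^ 2) :=
    ((bddMeas_negJump hb hJ hv).comp measurable_swap).pow 2
  exact h.integral_left (Pr ν)

lemma integral_jumpMean {v : ι} (hv : v ∈ s) : ∫ ω, jumpMean ν b c κ v ω ∂Pr ν = 0 := by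
  have hj := (bddMeas_jump hb hJ hv).integrable ((Pr ν).prod (Pr ν))
  have h1 : ∫ ω, jumpMean ν b c κ v ω ∂Pr ν = ∫ p, jump b c κ v p ∂((Pr ν).prod (Pr ν)) :=
    (integral_prod _ hj).symm
  have h2 : ∫ p, jump b c κ v p ∂((Pr ν).prod (Pr ν))
      = ∫ p : (ι → Y) × (ι → Y), jump b c κ v p.swap ∂((Pr ν).prod (Pr ν)) :=
    (integral_prod_swap _).symm
  simp only [jump_swap, integral_neg] at h2
  linarith

/-- Swapping the two copies exchanges the positive and the negative part of the jump, so each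
carries half of the second moment. -/
lemma integral_negJumpSq {v : ι} (hv : v ∈ s) : ∫ ω, negJumpSq ν b c κ v ω ∂Pr ν
      = (∫ p, jump b c κ v p ^ 2 ∂((Pr ν).prod (Pr ν))) / 2 := by
  have hn := (bddMeas_negJump hb hJ hv).pow 2
  have hn' := hn.comp (measurable_swap (α := ι → Y) (β := ι → Y))
  have h1 : ∫ ω, negJumpSq ν b c κ v ω ∂Pr ν
      = ∫ p, (max (-jump b c κ v p) 0) ^ 2 ∂((Pr ν).prod (Pr ν)) :=
    (integral_prod _ (hn.integrable _)).symm
  have h2 : ∫ p, (max (-jump b c κ v p) 0) ^ 2 ∂((Pr ν).prod (Pr ν))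
      = ∫ p : (ι → Y) × (ι → Y), (max (-jump b c κ v p.swap) 0) ^ 2 ∂((Pr ν).prod (Pr ν)) :=
    (integral_prod_swap (fun p => (max (-jump b c κ v p) 0) ^ 2)).symm
  have h3 : ∫ p, jump b c κ v p ^ 2 ∂((Pr ν).prod (Pr ν))
      = ∫ p, (max (-jump b c κ v p) 0) ^ 2 ∂((Pr ν).prod (Pr ν))
      + ∫ p : (ι → Y) × (ι → Y), (max (-jump b c κ v p.swap) 0) ^ 2 ∂((Pr ν).prod (Pr ν)) := by
    rw [← integral_add (hn.integrable _) (hn'.integrable _)]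
    congr 1
    funext p
    rw [jump_swap]
    all_goals grind
  rw [h1, h3, ← h2]; ring

/-- By antisymmetry the projection of the jump onto sums of functions of one copy is `φ p.1 - φ
p.2`, with `φ` the conditional mean. Its second moment is `2 ∫ φ²`, and subtracting it from the jump
leaves a nonnegative second moment. -/
lemma integral_jumpMean_sq_le {v : ι} (hv : v ∈ s) : ∫ ω, jumpMean ν b c κ v ω ^ 2 ∂Pr ν
      ≤ (∫ p, jump b c κ v p ^ 2 ∂((Pr ν).prod (Pr ν))) / 2 := by
  have hj := bddMeas_jump hb hJ hv
  have hm := bddMeas_jumpMean ν hb hJ hv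
  set φ := jumpMean ν b c κ v with hφ
  have hm1 : BddMeas (fun p : (ι → Y) × (ι → Y) => φ p.1) := hm.comp measurable_fst
  have hm2 : BddMeas (fun p : (ι → Y) × (ι → Y) => φ p.2) := hm.comp measurable_snd
  set PP := (Pr ν).prod (Pr ν) with hPP
  have a1 : ∫ p, jump b c κ v p * φ p.1 ∂PP = ∫ ω, φ ω ^ 2 ∂Pr ν := by
    rw [hPP, integral_prod _ ((hj.mul hm1).integrable _)]
    congr 1
    funext ω
    simp only [integral_mul_const]
    rw [sq]; rfl
  have a2 : ∫ p, jump b c κ v p * φ p.2 ∂PP = - ∫ ω, φ ω ^ 2 ∂Pr ν := by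
    have := (integral_prod_swap (μ := Pr ν) (ν := Pr ν) (fun p => jump b c κ v p * φ p.2)).symm
    rw [hPP, this]
    simp only [jump_swap, Prod.snd_swap, neg_mul, integral_neg]
    rw [← hPP, a1]
  have a3 : ∫ p : (ι → Y) × (ι → Y), φ p.1 * φ p.2 ∂PP = 0 := by
    rw [hPP, integral_prod_mul (f := φ) (g := φ), hφ, integral_jumpMean ν hb hJ hv, zero_mul]
  have a4 : ∫ p : (ι → Y) × (ι → Y), φ p.1 ^ 2 ∂PP = ∫ ω, φ ω ^ 2 ∂Pr ν := by
    rw [hPP, integral_fun_fst (fun ω => φ ω ^ 2)]; simp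
  have a5 : ∫ p : (ι → Y) × (ι → Y), φ p.2 ^ 2 ∂PP = ∫ ω, φ ω ^ 2 ∂Pr ν := by
    rw [hPP, integral_fun_snd (fun ω => φ ω ^ 2)]; simp
  have h0 : 0 ≤ ∫ p, (jump b c κ v p - φ p.1 + φ p.2) ^ 2 ∂PP :=
    integral_nonneg fun p => sq_nonneg _
  have e : ∀ p : (ι → Y) × (ι → Y), (jump b c κ v p - φ p.1 + φ p.2) ^ 2
      = jump b c κ v p ^ 2 + (φ p.1 ^ 2 + (φ p.2 ^ 2 + ((-2) * (jump b c κ v p * φ p.1)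
        + (2 * (jump b c κ v p * φ p.2) + (-2) * (φ p.1 * φ p.2))))) := fun p => by ring
  simp only [e] at h0
  have i0 := hj.pow 2
  have i1 := hm1.pow 2
  have i2 := hm2.pow 2
  have i3 := (hj.mul hm1).const_mul (-2)
  have i4 := (hj.mul hm2).const_mul 2
  have i5 := (hm1.mul hm2).const_mul (-2)
  rw [i0.integral_add (i1.add (i2.add (i3.add (i4.add i5)))), i1.integral_add
    (i2.add (i3.add (i4.add i5))), i2.integral_add (i3.add (i4.add i5)),
    i3.integral_add (i4.add i5), i4.integral_add i5, integral_const_mul, integral_const_mul,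
    integral_const_mul, a1, a2, a3, a4, a5] at h0
  linarith

end Moments

end Flux

/-! ### Anti-concentration of the centred sum of squares in its lower tail. -/

section Window

variable {ι Y : Type*} [MeasurableSpace Y] [Fintype ι] (ν : ι → Measure Y)
  [∀ i, IsProbabilityMeasure (ν i)] {b : Y → ℝ} {c : ι → ℝ} {κ : ℝ} {s : Finset ι} {J : ℝ}

/-- The conditional mean of the jump at `v` is a function of coordinate `v` alone, so the moment
generating function factorises. Each factor is controlled by a vanishing mean and half the second
moment of the jump. -/
lemma integral_exp_sum_jumpMean_le (hb : Measurable b)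
    (hJ : ∀ v ∈ s, ∀ p : (ι → Y) × (ι → Y), |jump b c κ v p| ≤ J) {lam : ℝ} (hlam : 0 < lam)
    (hlJ : lam * J ≤ 1 / 6) : ∫ ω, exp (∑ v ∈ s, lam * jumpMean ν b c κ v ω) ∂Pr ν
      ≤ exp (27 / 50 * lam ^ 2 * jumpVar ν b c κ s) := by
  rw [integral_exp_sum ν (B := fun v => {v})
    (fun v hv => (bddMeas_jumpMean ν hb hJ hv).const_mul lam) ?_ ?_]
  · rw [jumpVar, mul_sum, exp_sum]
    refine prod_le_prod (fun v _ => integral_nonneg fun ω => (exp_pos _).le) fun v hv => ?_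
    refine integral_exp_le_of_second_moment ((bddMeas_jumpMean ν hb hJ hv).const_mul lam)
      (c := 27 / 50) ?_ (fun ω => exp_le_of_abs_le ?_) ?_
    · rw [integral_const_mul, integral_jumpMean ν hb hJ hv, mul_zero]
    · rw [abs_mul, abs_of_pos hlam]
      exact (mul_le_mul_of_nonneg_left (abs_jumpMean_le ν hJ hv ω) hlam.le).trans hlJ
    · simp only [mul_pow, integral_const_mul]
      rw [← mul_assoc]
      exact mul_le_mul_of_nonneg_left (integral_jumpMean_sq_le ν hb hJ hv) (by positivity)
  · intro v _ x y hxy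
    simp only [jumpMean, jump, hxy v rfl]
  · intro v _ w _ hvw
    simpa using hvw

/-- A sum of the jumps, integrated against a ramp of the centred sum of squares, is at least the
mass of the window where the ramp is steep. -/
lemma sum_jump_ramp_ge (hb : Measurable b)
    (hJ : ∀ v ∈ s, ∀ p : (ι → Y) × (ι → Y), |jump b c κ v p| ≤ J) {τ h ρ δ : ℝ}
    (hh : 0 ≤ h) (hJ0 : 0 ≤ J) (hρ0 : 0 ≤ ρ) (hρ1 : ρ ≤ 1)
    (hbad : (Pr ν).real {ω | ρ * κ / 2 < |(∑ w ∈ s, (c w - b (ω w))) / #s|} ≤ δ) :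
    (1 - ρ) * (∫ ω, (∑ v ∈ s, negJumpSq ν b c κ v ω) *
        Set.indicator {ω | τ < centredSq b c s ω ∧ centredSq b c s ω ≤ τ + h} 1 ω ∂Pr ν)
      - #s * (J * (h + 2 * J) * (2 * δ))
      ≤ ∫ ω, (∑ v ∈ s, jumpMean ν b c κ v ω) * ramp τ h J (centredSq b c s ω) ∂Pr ν := by
  classical
  set PP := (Pr ν).prod (Pr ν) with hPP
  set Fq := centredSq b c s with hFq
  have hFm : Measurable Fq := measurable_centredSq hb s
  set W := {ω | τ < Fq ω ∧ Fq ω ≤ τ + h} with hW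
  have hWm : MeasurableSet W := (measurableSet_lt measurable_const hFm).inter
    (measurableSet_le hFm measurable_const)
  set T := {ω : ι → Y | ρ * κ / 2 < |(∑ w ∈ s, (c w - b (ω w))) / #s|} with hT
  have hTm : MeasurableSet T := by
    have : Measurable fun ω : ι → Y => (∑ w ∈ s, (c w - b (ω w))) / #s := by fun_prop
    exact measurableSet_lt measurable_const this.abs
  have hWb : BddMeas (Set.indicator W (1 : (ι → Y) → ℝ)) :=
    ⟨measurable_one.indicator hWm, 1, fun ω => by by_cases h : ω ∈ W <;> simp [h]⟩
  have hTb : BddMeas (Set.indicator T (1 : (ι → Y) → ℝ)) :=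
    ⟨measurable_one.indicator hTm, 1, fun ω => by by_cases h : ω ∈ T <;> simp [h]⟩
  have hRb : BddMeas (fun ω => ramp τ h J (Fq ω)) :=
    ⟨(measurable_ramp τ h J).comp hFm, h + J, fun ω => by
      rw [abs_of_nonneg (ramp_nonneg _ _ _ _)]; exact ramp_le (by linarith) _⟩
  simp only [sum_mul]
  rw [integral_finsetSum _ fun v hv =>
      ((bddMeas_negJumpSq ν hb hJ hv).mul hWb).integrable _,
    integral_finsetSum _ fun v hv => ((bddMeas_jumpMean ν hb hJ hv).mul hRb).integrable _,
    ← nsmul_eq_mul, ← sum_const, mul_sum, ← sum_sub_distrib]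
  refine sum_le_sum fun v hv => ?_
  have hj := bddMeas_jump hb hJ hv
  have hn := bddMeas_negJump hb hJ hv
  have hp : BddMeas (fun p : (ι → Y) × (ι → Y) => max (jump b c κ v p) 0) := by fun_prop
  have hmm : Measurable (fun p : (ι → Y) × (ι → Y) => mix {v} p.2 p.1) :=
    (measurable_mix {v}).comp measurable_swap
  have hR1 := hRb.comp (measurable_fst (α := ι → Y) (β := ι → Y))
  have hRm := hRb.comp hmm
  have hW1 := hWb.comp (measurable_fst (α := ι → Y) (β := ι → Y))
  have hT1 := hTb.comp (measurable_fst (α := ι → Y) (β := ι → Y))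
  have hTm' := hTb.comp hmm
  have e1 : ∫ ω, jumpMean ν b c κ v ω * ramp τ h J (Fq ω) ∂Pr ν
      = ∫ p, jump b c κ v p * ramp τ h J (Fq p.1) ∂PP := by
    rw [hPP, integral_prod _ ((hj.mul hR1).integrable _)]
    simp only [integral_mul_const]; rfl
  have e2 : ∫ ω, negJumpSq ν b c κ v ω * Set.indicator W 1 ω ∂Pr ν
      = ∫ p : (ι → Y) × (ι → Y), (max (-jump b c κ v p) 0) ^ 2 * Set.indicator W 1 p.1 ∂PP := by
    rw [hPP, integral_prod _ (((hn.pow 2).mul hW1).integrable _)]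
    simp only [integral_mul_const]; rfl
  -- Exchanging coordinate `v` turns the positive part at the original configuration into the
  -- negative part seen from the resampled one.
  have e3 : ∫ p : (ι → Y) × (ι → Y), max (jump b c κ v p) 0 * ramp τ h J (Fq p.1) ∂PP
      = ∫ p : (ι → Y) × (ι → Y), max (-jump b c κ v p) 0 * ramp τ h J (Fq (mix {v} p.2 p.1))
        ∂PP := by
    rw [hPP, integral_exchange ν (hp.mul hR1).meas {v}]
    simp only [jump_exchange]
  -- Hence only downward jumps remain, each multiplied by the increment of the ramp that it causes.
  have e4 : ∫ p, jump b c κ v p * ramp τ h J (Fq p.1) ∂PP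
      = ∫ p : (ι → Y) × (ι → Y), max (-jump b c κ v p) 0 *
        (ramp τ h J (Fq (mix {v} p.2 p.1)) - ramp τ h J (Fq p.1)) ∂PP := by
    have : ∀ p : (ι → Y) × (ι → Y), jump b c κ v p * ramp τ h J (Fq p.1)
        = max (jump b c κ v p) 0 * ramp τ h J (Fq p.1)
          - max (-jump b c κ v p) 0 * ramp τ h J (Fq p.1) := by
      all_goals grind
    simp only [this, mul_sub]
    rw [(hp.mul hR1).integral_sub (hn.mul hR1), e3, (hn.mul hRm).integral_sub (hn.mul hR1)]
  have hTreal : ∫ ω, Set.indicator T (1 : (ι → Y) → ℝ) ω ∂Pr ν ≤ δ := by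
    rw [integral_indicator_one hTm]; exact hbad
  have e5 : ∫ p : (ι → Y) × (ι → Y), (Set.indicator T (1 : (ι → Y) → ℝ) p.1
      + Set.indicator T (1 : (ι → Y) → ℝ) (mix {v} p.2 p.1)) ∂PP ≤ 2 * δ := by
    rw [hT1.integral_add hTm', hPP, integral_comp_mix ν hTb.meas {v},
      integral_fun_fst (fun ω => Set.indicator T (1 : (ι → Y) → ℝ) ω)]
    simp only [probReal_univ, one_smul]
    linarith
  rw [e1, e4, e2]
  have hfin := (((hn.pow 2).mul hW1).const_mul (1 - ρ)).sub
    ((hT1.add hTm').const_mul (J * (h + 2 * J)))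
  have hmono := hfin.integral_mono (hn.mul (hRm.sub hR1)) PP ?_
  · rw [(((hn.pow 2).mul hW1).const_mul (1 - ρ)).integral_sub
      ((hT1.add hTm').const_mul (J * (h + 2 * J))), integral_const_mul, integral_const_mul] at hmono
    have := mul_le_mul_of_nonneg_left e5 (show 0 ≤ J * (h + 2 * J) by positivity)
    linarith
  · rintro ⟨x, y⟩
    simp only
    have hmx := centredSq_mix (b := b) (c := c) hv x y
    rw [← hFq] at hmx
    set a := jump b c κ v (x, y) with ha
    have haJ : |a| ≤ J := hJ v hv _
    have hi0 : ∀ (A : Set (ι → Y)) (z : ι → Y), 0 ≤ Set.indicator A (1 : (ι → Y) → ℝ) z :=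
      fun A z => Set.indicator_nonneg (by simp) z
    have hi1 : ∀ (A : Set (ι → Y)) (z : ι → Y), Set.indicator A (1 : (ι → Y) → ℝ) z ≤ 1 :=
      fun A z => by by_cases hz : z ∈ A <;> simp [hz]
    have hJJ : 0 ≤ J * (h + 2 * J) := by positivity
    rcases le_or_gt 0 a with h0 | h0
    · rw [max_eq_right (by linarith)]
      have := mul_nonneg hJJ (add_nonneg (hi0 T x) (hi0 T (mix {v} y x)))
      linarith
    have hm : max (-a) 0 = -a := max_eq_left (by linarith)
    have haJ' : -a ≤ J := by rw [abs_of_neg h0] at haJ; exact haJ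
    rw [hm]
    have hR := ramp_nonneg τ h J (Fq (mix {v} y x))
    have hR' := ramp_le (τ := τ) (h := h) (J := J) (by linarith) (Fq x)
    by_cases hgood : x ∉ T ∧ mix {v} y x ∉ T
    · rw [Set.indicator_of_notMem hgood.1, Set.indicator_of_notMem hgood.2]
      simp only [add_zero, mul_zero, sub_zero]
      have g1 : |(∑ w ∈ s, (c w - b (x w))) / #s| ≤ ρ * κ / 2 := not_lt.1 hgood.1
      have g2 : |(∑ w ∈ s, (c w - b (mix {v} y x w))) / #s| ≤ ρ * κ / 2 := not_lt.1 hgood.2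
      set m := (∑ w ∈ s, (c w - b (x w)) + ∑ w ∈ s, (c w - b (mix {v} y x w))) / #s with hm'
      have hmle : |m| ≤ ρ * κ := by
        rw [hm', add_div]
        refine (abs_add_le _ _).trans ?_
        linarith
      set r := 2 * c v - b (x v) - b (y v) with hr
      have hcut : κ ≤ |r| := by
        by_contra hcon
        have : a = 0 := by rw [ha, jump, if_neg]; exact hcon
        linarith
      have haeq : a = (b (x v) - b (y v)) * r := by
        rw [ha, jump, if_pos]; exact hcut
      -- A nonzero jump has `κ ≤ |r|`. When both sample means are at most `ρ κ / 2`, the centring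
      -- correction is at most the fraction `ρ` of the jump, so the actual change has the sign of
      -- the jump and at least `1 - ρ` times its size.
      have hmr : |m| ≤ ρ * |r| := hmle.trans (mul_le_mul_of_nonneg_left hcut hρ0)
      have hd : (1 - ρ) * (-a) ≤ Fq x - Fq (mix {v} y x) := by
        have e : Fq x - Fq (mix {v} y x) = -a + (b (x v) - b (y v)) * m := by
          rw [haeq]; linarith
        have hb' : |(b (x v) - b (y v)) * m| ≤ ρ * (-a) := by
          rw [← abs_of_neg h0, haeq, abs_mul, abs_mul]
          nlinarith [abs_nonneg (b (x v) - b (y v))]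
        have := (abs_le.1 hb').1
        rw [e]; linarith
      have hdn : 0 ≤ (1 - ρ) * (-a) := mul_nonneg (by linarith) (by linarith)
      by_cases hw : x ∈ W
      · rw [Set.indicator_of_mem hw]
        have := ramp_sub_ge (J := J) hw.1 hw.2 hd (by nlinarith)
        have k := mul_le_mul_of_nonneg_left this (show 0 ≤ -a by linarith)
        simp only [Pi.one_apply, mul_one]
        linarith
      · rw [Set.indicator_of_notMem hw]
        have := ramp_anti τ h J (show Fq (mix {v} y x) ≤ Fq x by linarith)
        simp only [mul_zero]
        exact mul_nonneg (by linarith) (by linarith)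
    -- When one of the two sample means is large, the loss is at most `J²` from the left side and `J
    -- (h + J)` from the right, which makes `J (h + 2 J)`.
    · have h1 : 1 ≤ Set.indicator T (1 : (ι → Y) → ℝ) x
          + Set.indicator T (1 : (ι → Y) → ℝ) (mix {v} y x) := by
        by_cases hx : x ∈ T
        · rw [Set.indicator_of_mem hx]; simp only [Pi.one_apply]; linarith [hi0 T (mix {v} y x)]
        · have hy : mix {v} y x ∈ T := by
            by_contra hy; exact hgood ⟨hx, hy⟩
          rw [Set.indicator_of_mem hy]; simp only [Pi.one_apply]; linarith [hi0 T x]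
      have h2 := mul_le_mul_of_nonneg_left h1 hJJ
      have h3 : (1 - ρ) * ((-a) ^ 2 * Set.indicator W 1 x) ≤ J * J := by
        have h5 : 0 ≤ (-a) ^ 2 * Set.indicator W 1 x := mul_nonneg (sq_nonneg _) (hi0 W x)
        have h6 : (-a) ^ 2 * Set.indicator W 1 x ≤ (-a) ^ 2 :=
          mul_le_of_le_one_right (sq_nonneg _) (hi1 W x)
        have h7 : (-a) ^ 2 ≤ J * J := by
          rw [sq]; exact mul_self_le_mul_self (by linarith) haJ'
        have h8 := mul_nonneg hρ0 h5
        linarith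
      have h4 : -(J * (h + J)) ≤ -a * (ramp τ h J (Fq (mix {v} y x)) - ramp τ h J (Fq x)) := by
        have k1 : -(h + J) ≤ ramp τ h J (Fq (mix {v} y x)) - ramp τ h J (Fq x) := by linarith
        have k2 := mul_le_mul_of_nonneg_left k1 (show 0 ≤ -a by linarith)
        have k3 := mul_le_mul_of_nonneg_right haJ' (show 0 ≤ h + J by linarith)
        linarith
      linarith

/-- Anti-concentration in the lower tail: the mass of a window just below a level is small
compared with the mass of everything below that level. -/
lemma window_bound (hb : Measurable b)
    (hJ : ∀ v ∈ s, ∀ p : (ι → Y) × (ι → Y), |jump b c κ v p| ≤ J) {τ h ρ δ lam L : ℝ}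
    (hh : 0 ≤ h) (hJ0 : 0 < J) (hρ0 : 0 ≤ ρ) (hρ1 : ρ ≤ 1)
    (hbad : (Pr ν).real {ω | ρ * κ / 2 < |(∑ w ∈ s, (c w - b (ω w))) / #s|} ≤ δ)
    (hlam : 0 < lam) (hlJ : lam * J ≤ 1 / 6) (hL : lam ^ 2 * jumpVar ν b c κ s = 2 * L) :
    (1 - ρ) * (5 / 6 * jumpVar ν b c κ s *
        ((Pr ν).real {ω | τ < centredSq b c s ω ∧ centredSq b c s ω ≤ τ + h} - exp (-L)))
      ≤ (h + J) * (26 / 25 * lam * jumpVar ν b c κ s *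
          (Pr ν).real {ω | centredSq b c s ω ≤ τ + h} + exp (-L) / lam)
        + #s * (J * (h + 2 * J) * (2 * δ)) := by
  classical
  set V := jumpVar ν b c κ s with hV
  set Fq := centredSq b c s with hFq
  have hFm : Measurable Fq := measurable_centredSq hb s
  set W := {ω | τ < Fq ω ∧ Fq ω ≤ τ + h} with hW
  have hWm : MeasurableSet W := (measurableSet_lt measurable_const hFm).inter
    (measurableSet_le hFm measurable_const)
  set D := {ω | Fq ω ≤ τ + h} with hD
  have hDm : MeasurableSet D := measurableSet_le hFm measurable_const
  have hV0 : 0 ≤ V := sum_nonneg fun v _ => by positivity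
  have hib : ∀ {A : Set (ι → Y)}, MeasurableSet A → BddMeas (Set.indicator A (1 : (ι → Y) → ℝ)) :=
    fun {A} hA => ⟨measurable_one.indicator hA, 1, fun ω => by by_cases h : ω ∈ A <;> simp [h]⟩
  have hi0 : ∀ (A : Set (ι → Y)) (z : ι → Y), 0 ≤ Set.indicator A (1 : (ι → Y) → ℝ) z :=
    fun A z => Set.indicator_nonneg (by simp) z
  have hi1 : ∀ (A : Set (ι → Y)) (z : ι → Y), Set.indicator A (1 : (ι → Y) → ℝ) z ≤ 1 :=
    fun A z => by by_cases hz : z ∈ A <;> simp [hz]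
  -- lower bound on the quadratic variation
  set Q := fun ω => ∑ v ∈ s, negJumpSq ν b c κ v ω with hQ
  have hQb : BddMeas Q := BddMeas.sum s fun v hv => bddMeas_negJumpSq ν hb hJ hv
  set E := {ω | Q ω ≤ (1 - 1 / 6) * V} with hE
  have hEm : MeasurableSet E := measurableSet_le hQb.meas measurable_const
  have hEp : (Pr ν).real E ≤ exp (-L) := by
    have := measureReal_sum_le_lower ν (s := s) (X := fun v => negJumpSq ν b c κ v)
      (B := fun v => {v}) (K := J ^ 2) (m₀ := V) (ε := 1 / 6) (by positivity) (by norm_num)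
      (by norm_num) (fun v hv => (bddMeas_negJumpSq ν hb hJ hv).meas)
      (fun v _ ω => integral_nonneg fun _ => sq_nonneg _) ?_ ?_ ?_ ?_
    · refine this.trans (exp_le_exp.2 ?_)
      -- Chernoff with `ε = 1 / 6` has exponent `V / (72 J²)`, and `λ J ≤ 1 / 6` makes this at least
      -- `λ² V / 2 = L`. Both exceptional events thus have the same cost `exp (-L)`.
      have h1 : lam ^ 2 * J ^ 2 ≤ 1 / 36 := by
        rw [← mul_pow]
        calc (lam * J) ^ 2 ≤ (1 / 6) ^ 2 := by
              apply pow_le_pow_left₀ (by positivity) hlJ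
          _ = 1 / 36 := by norm_num
      have h2 : L ≤ (1 / 6) ^ 2 * V / (2 * J ^ 2) := by
        rw [le_div_iff₀ (by positivity)]
        nlinarith
      linarith
    · intro v hv ω
      have := norm_integral_le_of_norm_le_const (μ := Pr ν)
        (f := fun ω' => (max (-jump b c κ v (ω, ω')) 0) ^ 2) (C := J ^ 2) (ae_of_all _ fun ω' => ?_)
      · simp only [probReal_univ, mul_one] at this
        exact (le_abs_self _).trans this
      · rw [norm_of_nonneg (sq_nonneg _)]
        refine pow_le_pow_left₀ (le_max_right _ _) (max_le ?_ hJ0.le) 2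
        exact (neg_le_abs _).trans (hJ v hv _)
    · intro v _ x y hxy
      simp only [negJumpSq, jump, hxy v rfl]
    · intro v _ w _ hvw
      simpa using hvw
    · rw [hV, jumpVar]
      exact le_of_eq (sum_congr rfl fun v hv => (integral_negJumpSq ν hb hJ hv).symm)
  have hQW : 5 / 6 * V * ((Pr ν).real W - exp (-L)) ≤ ∫ ω, Q ω * Set.indicator W 1 ω ∂Pr ν := by
    have hpt : ∀ ω, 5 / 6 * V * (Set.indicator W (1 : (ι → Y) → ℝ) ω
        - Set.indicator E (1 : (ι → Y) → ℝ) ω) ≤ Q ω * Set.indicator W 1 ω := by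
      intro ω
      have hQ0 : 0 ≤ Q ω := sum_nonneg fun v _ => integral_nonneg fun _ => sq_nonneg _
      by_cases he : ω ∈ E
      · rw [Set.indicator_of_mem he]
        have h1 := hi0 W ω
        have h2 := hi1 W ω
        have h3 : 5 / 6 * V * (Set.indicator W (1 : (ι → Y) → ℝ) ω - 1) ≤ 0 :=
          mul_nonpos_of_nonneg_of_nonpos (by positivity) (by linarith)
        have h4 := mul_nonneg hQ0 h1
        simp only [Pi.one_apply] at *
        linarith
      · rw [Set.indicator_of_notMem he, sub_zero]
        have : (1 - 1 / 6) * V < Q ω := not_le.1 he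
        exact mul_le_mul_of_nonneg_right (by linarith) (hi0 W ω)
    have := (((hib hWm).sub (hib hEm)).const_mul (5 / 6 * V)).integral_mono (hQb.mul (hib hWm))
      (Pr ν) hpt
    rw [integral_const_mul, (hib hWm).integral_sub (hib hEm), integral_indicator_one hWm,
      integral_indicator_one hEm] at this
    nlinarith
  -- upper bound on the drift
  set Z := fun ω => ∑ v ∈ s, jumpMean ν b c κ v ω with hZ
  have hZb : BddMeas Z := BddMeas.sum s fun v hv => bddMeas_jumpMean ν hb hJ hv
  have hRb : BddMeas (fun ω => ramp τ h J (Fq ω)) :=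
    ⟨(measurable_ramp τ h J).comp hFm, h + J, fun ω => by
      rw [abs_of_nonneg (ramp_nonneg _ _ _ _)]; exact ramp_le (by linarith) _⟩
  have hdrift : ∫ ω, Z ω * ramp τ h J (Fq ω) ∂Pr ν
      ≤ (h + J) * (26 / 25 * lam * V * (Pr ν).real D + exp (-L) / lam) := by
    -- Here `26 / 25 = 27 / 50 + 1 / 2`: the tilted tail above `z` is then at most `exp (-λ² V / 2)
    -- = exp (-L)`.
    set z := 26 / 25 * lam * V with hz
    have hz0 : 0 ≤ z := by positivity
    have hEx : BddMeas (fun ω => exp (lam * (Z ω - z))) := by fun_prop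
    have hpt : ∀ ω, Z ω * ramp τ h J (Fq ω) ≤ (h + J) * (z * Set.indicator D 1 ω
        + exp (lam * (Z ω - z)) / lam) := by
      intro ω
      have hr0 := ramp_nonneg τ h J (Fq ω)
      have hr1 := ramp_le (τ := τ) (h := h) (J := J) (by linarith) (Fq ω)
      -- The excess over `z` is charged to an exponential moment, and the part up to `z` is paid
      -- only where the ramp is nonzero.
      have hex : Z ω - z ≤ exp (lam * (Z ω - z)) / lam := by
        rw [le_div_iff₀ hlam]
        linarith [add_one_le_exp (lam * (Z ω - z))]
      have hex0 : 0 ≤ exp (lam * (Z ω - z)) / lam := by positivity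
      have hrD : ramp τ h J (Fq ω) ≤ (h + J) * Set.indicator D 1 ω := by
        by_cases hd : ω ∈ D
        · rw [Set.indicator_of_mem hd]; simpa using hr1
        · rw [Set.indicator_of_notMem hd, ramp_eq_zero (not_le.1 hd).le, mul_zero]
      nlinarith
    have := (hZb.mul hRb).integral_mono ((((hib hDm).const_mul z).add
      (hEx.div_const lam)).const_mul (h + J)) (Pr ν) hpt
    refine this.trans ?_
    rw [integral_const_mul, ((hib hDm).const_mul z).integral_add (hEx.div_const lam),
      integral_const_mul, integral_indicator_one hDm, integral_div]
    refine mul_le_mul_of_nonneg_left ?_ (by linarith)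
    have hm : ∫ ω, exp (lam * (Z ω - z)) ∂Pr ν ≤ exp (-L) := by
      have e : ∀ ω, exp (lam * (Z ω - z))
          = exp (∑ v ∈ s, lam * jumpMean ν b c κ v ω) * exp (-(lam * z)) := by
        intro ω
        rw [← exp_add, ← mul_sum]
        congr 1
        simp only [hZ]
        ring
      simp only [e, integral_mul_const]
      refine (mul_le_mul_of_nonneg_right (integral_exp_sum_jumpMean_le ν hb hJ hlam hlJ)
        (exp_pos _).le).trans ?_
      rw [← exp_add]
      refine exp_le_exp.2 ?_
      rw [hz, ← hV]
      nlinarith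
    gcongr
  have hge := sum_jump_ramp_ge ν (τ := τ) (h := h) hb hJ hh hJ0.le hρ0 hρ1 hbad
  nlinarith

end Window

/-! ### Combinatorics of selecting the `k` smallest scores. -/

section Selection

variable {n : ℕ}

/-- Lexicographic comparison by a score and a priority. -/
def Precedes (σ : Fin n → ℝ) (τ : Equiv.Perm (Fin n)) (a b : Fin n) : Prop :=
  σ a < σ b ∨ (σ a = σ b ∧ τ a < τ b)

open scoped Classical in
/-- The `k` elements of `C` that come first. -/
noncomputable def firstK (C : Finset (Fin n)) (σ : Fin n → ℝ) (τ : Equiv.Perm (Fin n)) (k : ℕ) :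
    Finset (Fin n) := C.filter fun j => #(C.filter fun j' => Precedes σ τ j' j) < k

variable {σ : Fin n → ℝ} {τ : Equiv.Perm (Fin n)}

lemma Precedes.irrefl (a : Fin n) : ¬ Precedes σ τ a a := by
  simp [Precedes]

lemma Precedes.trans {a b c : Fin n} (h1 : Precedes σ τ a b) (h2 : Precedes σ τ b c) :
    Precedes σ τ a c := by
  rcases h1 with h1 | ⟨h1, h1'⟩ <;> rcases h2 with h2 | ⟨h2, h2'⟩
  · exact Or.inl (h1.trans h2)
  · exact Or.inl (h2 ▸ h1)
  · exact Or.inl (h1 ▸ h2)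
  · exact Or.inr ⟨h1.trans h2, h1'.trans h2'⟩

lemma Precedes.total {a b : Fin n} (h : a ≠ b) : Precedes σ τ a b ∨ Precedes σ τ b a := by
  rcases lt_trichotomy (σ a) (σ b) with h1 | h1 | h1
  · exact Or.inl (Or.inl h1)
  · rcases lt_trichotomy (τ a) (τ b) with h2 | h2 | h2
    · exact Or.inl (Or.inr ⟨h1, h2⟩)
    · exact absurd (τ.injective h2) h
    · exact Or.inr (Or.inr ⟨h1.symm, h2⟩)
  · exact Or.inr (Or.inl h1)

lemma Precedes.le {a b : Fin n} (h : Precedes σ τ a b) : σ a ≤ σ b := by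
  rcases h with h | h
  · exact h.le
  · exact h.1.le

lemma Precedes.not_symm {a b : Fin n} (h : Precedes σ τ a b) : ¬ Precedes σ τ b a :=
  fun h' => Precedes.irrefl a (h.trans h')

lemma firstK_subset (C : Finset (Fin n)) (σ : Fin n → ℝ) (τ : Equiv.Perm (Fin n)) (k : ℕ) :
    firstK C σ τ k ⊆ C := filter_subset _ _

/-- A nonempty set has a last element. -/
lemma exists_last {C : Finset (Fin n)} (hC : C.Nonempty) :
    ∃ j ∈ C, ∀ j' ∈ C, j' ≠ j → Precedes σ τ j' j := by
  classical
  induction C using Finset.induction_on with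
  | empty => simp at hC
  | insert a C ha ih =>
    rcases C.eq_empty_or_nonempty with rfl | hne
    · exact ⟨a, by simp, by simp⟩
    obtain ⟨j, hj, hlast⟩ := ih hne
    have haj : a ≠ j := fun h => ha (h ▸ hj)
    rcases Precedes.total (σ := σ) (τ := τ) haj with h | h
    · refine ⟨j, by simp [hj], fun j' hj' hne' => ?_⟩
      rcases mem_insert.1 hj' with rfl | hj'
      · exact h
      · exact hlast j' hj' hne'
    · refine ⟨a, by simp, fun j' hj' hne' => ?_⟩
      rcases mem_insert.1 hj' with rfl | hj'
      · exact absurd rfl hne'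
      · by_cases hjj : j' = j
        · exact hjj ▸ h
        · exact (hlast j' hj' hjj).trans h

lemma card_firstK_le (C : Finset (Fin n)) (σ : Fin n → ℝ) (τ : Equiv.Perm (Fin n)) (k : ℕ) :
    #(firstK C σ τ k) ≤ k := by
  classical
  rcases (firstK C σ τ k).eq_empty_or_nonempty with h | h
  · simp [h]
  obtain ⟨j, hj, hlast⟩ := exists_last (σ := σ) (τ := τ) h
  have hk := (mem_filter.1 hj).2
  have : (firstK C σ τ k).erase j ⊆ C.filter fun j' => Precedes σ τ j' j := by
    intro j' hj'
    rw [mem_erase] at hj'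
    exact mem_filter.2 ⟨firstK_subset _ _ _ _ hj'.2, hlast j' hj'.2 hj'.1⟩
  have := card_le_card this
  rw [card_erase_of_mem hj] at this
  omega

lemma firstK_mono_precedes {C : Finset (Fin n)} {k : ℕ} {a b : Fin n} (ha : a ∈ C)
    (hb : b ∈ firstK C σ τ k) (hab : Precedes σ τ a b) : a ∈ firstK C σ τ k := by
  classical
  refine mem_filter.2 ⟨ha, lt_of_le_of_lt (card_le_card ?_) (mem_filter.1 hb).2⟩
  intro j hj
  rw [mem_filter] at hj ⊢
  exact ⟨hj.1, hj.2.trans hab⟩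

/-- If fewer than `k` elements were selected, the first element left out would have only selected
predecessors, hence fewer than `k` of them, and would be selected. -/
lemma card_firstK {C : Finset (Fin n)} {k : ℕ} (hk : k ≤ #C) : #(firstK C σ τ k) = k := by
  classical
  refine le_antisymm (card_firstK_le _ _ _ _) ?_
  by_contra hlt
  push Not at hlt
  have hne : (C \ firstK C σ τ k).Nonempty := by
    rw [← card_pos, card_sdiff_of_subset (firstK_subset _ _ _ _)]
    omega
  obtain ⟨j, hj, hfirst⟩ : ∃ j ∈ C \ firstK C σ τ k, ∀ j' ∈ C \ firstK C σ τ k,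
      ¬ Precedes σ τ j' j := by
    -- A first element is a last element for the negated score and the reversed priority.
    obtain ⟨j, hj, hl⟩ := exists_last (σ := fun x => -σ x) (τ := τ.trans Fin.revPerm) hne
    refine ⟨j, hj, fun j' hj' hp => ?_⟩
    by_cases h : j' = j
    · exact Precedes.irrefl _ (h ▸ hp)
    have := hl j' hj' h
    simp only [Precedes, neg_lt_neg_iff, neg_inj, Equiv.trans_apply, Fin.revPerm_apply,
      Fin.rev_lt_rev] at this
    refine hp.not_symm ?_
    rcases this with h | h
    · exact Or.inl h
    · exact Or.inr ⟨h.1.symm, h.2⟩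
  rw [Finset.mem_sdiff] at hj
  apply hj.2
  refine mem_filter.2 ⟨hj.1, lt_of_le_of_lt (card_le_card ?_) hlt⟩
  grind

lemma mem_firstK_erase {C : Finset (Fin n)} {k : ℕ} {j : Fin n} : j ∈ firstK C σ τ k ↔
      j ∈ C ∧ #((C.erase j).filter fun j' => σ j' < σ j ∨ (σ j' = σ j ∧ τ j' < τ j)) < k := by
  classical
  have : (C.erase j).filter (fun j' => σ j' < σ j ∨ (σ j' = σ j ∧ τ j' < τ j))
      = C.filter (fun j' => Precedes σ τ j' j) := by
    ext j'
    rw [mem_filter, mem_filter, mem_erase]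
    constructor
    · rintro ⟨⟨_, h⟩, h'⟩; exact ⟨h, h'⟩
    · rintro ⟨h, h'⟩
      refine ⟨⟨?_, h⟩, h'⟩
      rintro rfl
      exact Precedes.irrefl (σ := σ) (τ := τ) _ h'
  rw [this]
  unfold firstK
  rw [mem_filter]

/-- When `j` is selected, the others are the first `k - 1` elements of the rest. -/
lemma firstK_erase {C : Finset (Fin n)} {k : ℕ} {j : Fin n} (hj : j ∈ firstK C σ τ k) :
    (firstK C σ τ k).erase j = firstK (C.erase j) σ τ (k - 1) := by
  classical
  have hjC := firstK_subset _ _ _ _ hj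
  have hjk := (mem_filter.1 hj).2
  ext a
  simp only [mem_erase, firstK, mem_filter]
  by_cases haj : a = j
  · simp [haj]
  simp only [haj, ne_eq, not_false_eq_true, true_and]
  refine and_congr_right fun haC => ?_
  rcases Precedes.total (σ := σ) (τ := τ) haj with h | h
  · -- `a` comes before `j`
    have e : (C.erase j).filter (fun j' => Precedes σ τ j' a)
        = C.filter (fun j' => Precedes σ τ j' a) := by
      ext x
      simp only [mem_filter, mem_erase]
      exact ⟨fun hx => ⟨hx.1.2, hx.2⟩, fun hx => ⟨⟨fun hxj => (hxj ▸ hx.2).not_symm h, hx.1⟩, hx.2⟩⟩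
    rw [e]
    have hlt : #(C.filter fun j' => Precedes σ τ j' a)
        < #(C.filter fun j' => Precedes σ τ j' j) := by
      refine card_lt_card ⟨fun x hx => ?_, fun hsub => ?_⟩
      · rw [mem_filter] at hx ⊢
        exact ⟨hx.1, hx.2.trans h⟩
      · exact Precedes.irrefl a (mem_filter.1 (hsub (mem_filter.2 ⟨haC, h⟩))).2
    omega
  · have e : C.filter (fun j' => Precedes σ τ j' a)
        = insert j ((C.erase j).filter (fun j' => Precedes σ τ j' a)) := by
      all_goals grind
    rw [e, card_insert_of_notMem (by simp)]
    omega

/-- The selected elements have the smallest total score. -/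
lemma sum_firstK_le {C T : Finset (Fin n)} {k : ℕ} (hT : T ⊆ C) (hTk : #T = k) :
    ∑ j ∈ firstK C σ τ k, σ j ≤ ∑ j ∈ T, σ j := by
  classical
  have hS : #(firstK C σ τ k) = k := card_firstK (hTk ▸ card_le_card hT)
  set S := firstK C σ τ k with hSd
  have h1 : ∑ j ∈ S, σ j = ∑ j ∈ S \ T, σ j + ∑ j ∈ S ∩ T, σ j := by
    rw [add_comm]; exact (sum_inter_add_sum_sdiff S T σ).symm
  have h2 : ∑ j ∈ T, σ j = ∑ j ∈ T \ S, σ j + ∑ j ∈ S ∩ T, σ j := by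
    rw [inter_comm, add_comm]; exact (sum_inter_add_sum_sdiff T S σ).symm
  have hc : #(S \ T) = #(T \ S) := by
    grind
  rw [h1, h2]
  gcongr ?_ + _
  rcases (S \ T).eq_empty_or_nonempty with he | hne
  · rw [he] at hc ⊢
    rw [card_empty] at hc
    rw [card_eq_zero.1 hc.symm]
  obtain ⟨j, hj, hlast⟩ := exists_last (σ := σ) (τ := τ) hne
  have hup : ∀ a ∈ S \ T, σ a ≤ σ j := fun a ha => by
    by_cases h : a = j
    · rw [h]
    · exact (hlast a ha h).le
  have hlo : ∀ a ∈ T \ S, σ j ≤ σ a := fun a ha => by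
    rw [Finset.mem_sdiff] at ha hj
    have hne : a ≠ j := fun h => ha.2 (h ▸ hj.1)
    rcases Precedes.total (σ := σ) (τ := τ) hne with h | h
    · exact absurd (firstK_mono_precedes (hT ha.1) hj.1 h) ha.2
    · exact h.le
  calc ∑ a ∈ S \ T, σ a ≤ #(S \ T) • σ j := sum_le_card_nsmul _ _ _ hup
    _ = #(T \ S) • σ j := by rw [hc]
    _ ≤ _ := card_nsmul_le_sum _ _ _ hlo

/-- An element of maximal score in the filtered set has all its other members among its rivals. Ties
count against an element, so no priority enters. Integrated, this bounds a sum of near-selection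
probabilities by `k`. -/
lemma card_filter_few_le (C : Finset (Fin n)) (σ : Fin n → ℝ) (k : ℕ) :
    #(C.filter fun j => #((C.erase j).filter fun j' => σ j' ≤ σ j) < k) ≤ k := by
  classical
  set U := C.filter fun j => #((C.erase j).filter fun j' => σ j' ≤ σ j) < k with hU
  rcases U.eq_empty_or_nonempty with h | h
  · simp [h]
  obtain ⟨a, ha, hmax⟩ := exists_max_image U σ h
  have hsub : U.erase a ⊆ (C.erase a).filter fun j' => σ j' ≤ σ a := by
    grind
  have := card_le_card hsub
  grind

lemma colNearest_eq_firstK {m : ℕ} (Z : Fin m → Fin n → ℝ) (o : Fin m → Fin n → Bool) (β : ℝ)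
    (k : ℕ) (τ : Equiv.Perm (Fin n)) (u : Fin m) (i : Fin n) :
    colNearest Z o β k τ u i = firstK (colBase o β u i) (colVar Z o i) τ k := by
  unfold colNearest firstK RankedBefore Precedes
  rfl

end Selection

/-! ### Mass of a window relative to the lower tail. -/

section WindowRatio

variable {ι Y : Type*} [MeasurableSpace Y] [Fintype ι] (ν : ι → Measure Y)
  [∀ i, IsProbabilityMeasure (ν i)] {b : Y → ℝ} {c : ι → ℝ} {κ : ℝ} {s : Finset ι} {J : ℝ}

/-- `window_bound` solved for the mass of the window. -/
lemma window_ratio (hb : Measurable b)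
    (hJ : ∀ v ∈ s, ∀ p : (ι → Y) × (ι → Y), |jump b c κ v p| ≤ J) {h ρ δ lam₀ L V₀ : ℝ}
    (hh : 0 ≤ h) (hJ0 : 0 < J) (hρ0 : 0 ≤ ρ) (hρ1 : ρ < 1)
    (hbad : (Pr ν).real {ω | ρ * κ / 2 < |(∑ w ∈ s, (c w - b (ω w))) / #s|} ≤ δ)
    (hL0 : 0 < L) (hlam : 0 < lam₀) (hlJ : lam₀ * J ≤ 1 / 6) (hV₀ : 0 < V₀)
    (hV : V₀ ≤ jumpVar ν b c κ s) (hL : lam₀ ^ 2 * V₀ = 2 * L) (τ : ℝ) :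
    (Pr ν).real {ω | τ < centredSq b c s ω ∧ centredSq b c s ω ≤ τ + h}
      ≤ (156 / 125 * (h + J) * lam₀ / (1 - ρ)) * (Pr ν).real {ω | centredSq b c s ω ≤ τ + h}
        + (exp (-L) * (1 + (156 / 125 * (h + J) * lam₀ / (1 - ρ)) / (2 * L))
          + 12 / 5 * #s * (J * (h + 2 * J)) * δ / ((1 - ρ) * V₀)) := by
  set V := jumpVar ν b c κ s with hVd
  have hVpos : 0 < V := hV₀.trans_le hV
  -- The tilt is adapted to the actual variance `V ≥ V₀`, so that `λ ≤ λ₀` and the cost stays `exp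
  -- (-L)`. The constant `156 / 125` below is `(26 / 25) / (5 / 6)`.
  set lam := sqrt (2 * L / V) with hlamd
  have hl2 : lam ^ 2 * V = 2 * L := by
    rw [hlamd, sq_sqrt (by positivity)]; field_simp
  have hlpos : 0 < lam := sqrt_pos.2 (by positivity)
  have hle : lam ≤ lam₀ := by
    rw [hlamd, sqrt_le_iff]
    refine ⟨hlam.le, ?_⟩
    rw [div_le_iff₀ hVpos, ← hL]
    exact mul_le_mul_of_nonneg_left hV (sq_nonneg _)
  have key := window_bound ν (τ := τ) (h := h) (L := L) hb hJ hh hJ0 hρ0 hρ1.le hbad hlpos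
    ((mul_le_mul_of_nonneg_right hle hJ0.le).trans hlJ) hl2
  rw [← hVd] at key
  set q := (Pr ν).real {ω | centredSq b c s ω ≤ τ + h} with hq
  set w := (Pr ν).real {ω | τ < centredSq b c s ω ∧ centredSq b c s ω ≤ τ + h} with hw
  have hq0 : 0 ≤ q := measureReal_nonneg
  have hδ0 : 0 ≤ δ := measureReal_nonneg.trans hbad
  have h1ρ : 0 < 1 - ρ := by linarith
  have hE := exp_pos (-L)
  set K := (1 - ρ) * (5 / 6 * V) with hK
  have hKpos : 0 < K := by positivity
  have e1 : w ≤ exp (-L) + ((h + J) * (26 / 25 * lam * V * q + exp (-L) / lam)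
        + #s * (J * (h + 2 * J) * (2 * δ))) / K := by
    rw [← sub_le_iff_le_add', le_div_iff₀ hKpos, hK]
    linarith
  have e2 : (h + J) * (26 / 25 * lam * V * q) / K = (156 / 125 * (h + J) * lam / (1 - ρ)) * q := by
    rw [hK]; field_simp; ring
  have e3 : (h + J) * (exp (-L) / lam) / K
      ≤ exp (-L) * ((156 / 125 * (h + J) * lam / (1 - ρ)) / (2 * L)) := by
    have : (h + J) * (exp (-L) / lam) / K
        = exp (-L) * ((6 / 5 * (h + J) * lam / (1 - ρ)) / (2 * L)) := by
      rw [← hl2, hK]; field_simp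
    rw [this]
    have : 6 / 5 * (h + J) * lam ≤ 156 / 125 * (h + J) * lam := by
      have : 0 ≤ (h + J) * lam := by positivity
      linarith
    gcongr
  have e4 : #s * (J * (h + 2 * J) * (2 * δ)) / K
      ≤ 12 / 5 * #s * (J * (h + 2 * J)) * δ / ((1 - ρ) * V₀) := by
    have : #s * (J * (h + 2 * J) * (2 * δ)) / K
        = 12 / 5 * #s * (J * (h + 2 * J)) * δ / ((1 - ρ) * V) := by
      rw [hK]; field_simp; ring
    rw [this]
    gcongr
  have hmono : 156 / 125 * (h + J) * lam / (1 - ρ) ≤ 156 / 125 * (h + J) * lam₀ / (1 - ρ) := by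
    gcongr
  have e5 := mul_le_mul_of_nonneg_right hmono hq0
  have e6 : exp (-L) * ((156 / 125 * (h + J) * lam / (1 - ρ)) / (2 * L))
      ≤ exp (-L) * ((156 / 125 * (h + J) * lam₀ / (1 - ρ)) / (2 * L)) := by
    gcongr
  grind

end WindowRatio

/-! ### Windows below arbitrary lower sets. -/

section DownClosed

variable {α : Type*} [MeasurableSpace α] {P : Measure α} [IsProbabilityMeasure P]

/-- Passing from windows below a closed half-line to windows below any lower set. -/
lemma window_of_isLowerSet {F : α → ℝ} (hF : Measurable F) {h θ t : ℝ} (hθ : 0 ≤ θ) (ht : 0 ≤ t)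
    (hw : ∀ τ, P.real {x | τ < F x ∧ F x ≤ τ + h} ≤ θ * P.real {x | F x ≤ τ + h} + t)
    {U : Set ℝ} (hU : IsLowerSet U) :
    P.real {x | F x ∈ U ∧ F x + h ∉ U} ≤ θ * P.real {x | F x ∈ U} + t := by
  rcases U.eq_empty_or_nonempty with rfl | hne
  · simpa using ht
  by_cases hbd : BddAbove U
  swap
  · have hall : ∀ x, x ∈ U := fun x => by
      rw [not_bddAbove_iff] at hbd
      obtain ⟨y, hy, hxy⟩ := hbd x
      exact hU hxy.le hy
    simp only [hall, not_true_eq_false, and_false, Set.ofPred_false, measureReal_empty]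
    positivity
  set T := sSup U with hT
  have hle : ∀ x ∈ U, x ≤ T := fun x hx => le_csSup hbd hx
  have hlt : ∀ x < T, x ∈ U := fun x hx => by
    obtain ⟨y, hy, hxy⟩ := exists_lt_of_lt_csSup hne hx
    exact hU hxy.le hy
  by_cases hTU : T ∈ U
  · have e : ∀ x, x ∈ U ↔ x ≤ T := fun x => ⟨hle x, fun hx => hU hx hTU⟩
    have h1 := hw (T - h)
    grind
  -- An open half-line is exhausted by closed ones, whose endpoints lose mass at most `ε`. No
  -- continuity of the law is required.
  · have e : ∀ x, x ∈ U ↔ x < T := fun x =>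
      ⟨fun hx => lt_of_le_of_ne (hle x hx) (fun h => hTU (h ▸ hx)), hlt x⟩
    simp only [e]
    have htend : Tendsto (fun N : ℕ => P.real {x | F x ≤ T - 1 / ((N : ℝ) + 1)}) atTop
        (𝓝 (P.real {x | F x < T})) := by
      have hmono : Monotone fun N : ℕ => {x | F x ≤ T - 1 / ((N : ℝ) + 1)} := by
        intro a b hab x hx
        have hx' : F x ≤ T - 1 / ((a : ℝ) + 1) := hx
        have : 1 / ((b : ℝ) + 1) ≤ 1 / ((a : ℝ) + 1) := by
          apply one_div_le_one_div_of_le (by positivity)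
          have : (a : ℝ) ≤ b := by exact_mod_cast hab
          linarith
        exact (show F x ≤ T - 1 / ((b : ℝ) + 1) by linarith)
      have hun : {x | F x < T} = ⋃ N : ℕ, {x | F x ≤ T - 1 / ((N : ℝ) + 1)} := by
        ext x
        simp only [Set.mem_iUnion]
        constructor
        · intro hx
          have hx' : F x < T := hx
          obtain ⟨N, hN⟩ := exists_nat_one_div_lt (sub_pos.2 hx')
          exact ⟨N, (show F x ≤ T - 1 / ((N : ℝ) + 1) by linarith)⟩
        · rintro ⟨N, hN⟩
          have hN' : F x ≤ T - 1 / ((N : ℝ) + 1) := hN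
          have : (0 : ℝ) < 1 / ((N : ℝ) + 1) := by positivity
          exact (show F x < T by linarith)
      rw [hun]
      have := tendsto_measure_iUnion_atTop (μ := P) hmono
      exact (ENNReal.tendsto_toReal (measure_ne_top _ _)).comp this
    refine le_of_forall_pos_le_add fun ε hε => ?_
    obtain ⟨N, hN⟩ := ((tendsto_order.1 htend).1 (P.real {x | F x < T} - ε) (by linarith)).exists
    set T' := T - 1 / ((N : ℝ) + 1) with hT'
    have hT'T : T' < T := by rw [hT']; have : (0 : ℝ) < 1 / ((N : ℝ) + 1) := by positivity
                             linarith
    have hdiff : P.real {x | T' < F x ∧ F x < T} ≤ ε := by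
      have : {x | T' < F x ∧ F x < T} = {x | F x < T} \ {x | F x ≤ T'} := by
        ext x
        grind
      rw [this, measureReal_sdiff (s₁ := {x | F x < T}) (s₂ := {x | F x ≤ T'})
        (show {x | F x ≤ T'} ⊆ {x | F x < T} from fun x hx => lt_of_le_of_lt hx hT'T)
        (measurableSet_le hF measurable_const)]
      linarith
    have h1 := hw (T' - h)
    simp only [sub_add_cancel] at h1
    have h2 : P.real {x | F x ≤ T'} ≤ P.real {x | F x < T} :=
      measureReal_mono fun x hx => lt_of_le_of_lt hx hT'T
    calc P.real {x | F x < T ∧ ¬ F x + h < T}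
        ≤ P.real ({x | T' - h < F x ∧ F x ≤ T'} ∪ {x | T' < F x ∧ F x < T}) := by
          refine measureReal_mono ?_
          all_goals grind
      _ ≤ P.real {x | T' - h < F x ∧ F x ≤ T'} + P.real {x | T' < F x ∧ F x < T} :=
          measureReal_union_le _ _
      _ ≤ _ := by nlinarith

end DownClosed

/-! ### Integrals of single coordinates; the abstract column model. -/

section Coordinates

variable {ι Y : Type*} [MeasurableSpace Y] [Fintype ι] (ν : ι → Measure Y)
  [∀ i, IsProbabilityMeasure (ν i)]

lemma integral_coord {g : Y → ℝ} (hg : Measurable g) (s : ι) :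
    ∫ ω, g (ω s) ∂Pr ν = ∫ y, g y ∂(ν s) := by
  rw [← (measurePreserving_eval ν s).map_eq]
  exact (integral_map (measurable_pi_apply s).aemeasurable
    (hg.stronglyMeasurable.aestronglyMeasurable)).symm

lemma BddMeas.coord {g : Y → ℝ} (hg : BddMeas g) (s : ι) :
    BddMeas (fun ω : ι → Y => g (ω s)) := hg.comp (measurable_pi_apply s)

lemma dependsOn_coord {β : Type*} (g : Y → β) (s : ι) :
    DependsOn (fun ω : ι → Y => g (ω s)) {s} := fun _ _ h => congrArg g (h s rfl)

lemma integral_mul_coord {g h : Y → ℝ} (hg : BddMeas g) (hh : BddMeas h) {s t : ι} (hst : s ≠ t) :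
    ∫ ω, g (ω s) * h (ω t) ∂Pr ν = (∫ y, g y ∂(ν s)) * ∫ y, h y ∂(ν t) := by
  rw [integral_mul_of_dependsOn ν (hg.coord s) (hh.coord t) (dependsOn_coord g s)
    (dependsOn_coord h t) (by simpa using hst), integral_coord ν hg.meas, integral_coord ν hh.meas]

end Coordinates

/-- Row feature source. -/
abbrev rowSrc {m n : ℕ} (v : Fin m) : Source m n := .inl (.inl v)

/-- Noise source. -/
abbrev noiseSrc {m n : ℕ} (v : Fin m) (j : Fin n) : Source m n := .inr (.inl (v, j))

/-- A column `i` compared with the other columns: `H j` is the centred difference of columns `i`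
and `j` as a function of the row feature, with variance `sg j`, and `b` reads off the noise. -/
structure ColumnModel {m n : ℕ} {Y : Type*} [MeasurableSpace Y] (ν : Source m n → Measure Y)
    (H : Fin n → Y → ℝ) (b : Y → ℝ) (mu sg : Fin n → ℝ) (b₁ b₂ γ : ℝ) : Prop where
  meas_diff : ∀ j, Measurable (H j)
  meas_noise : Measurable b
  diff_bound : ∀ j y, |H j y + mu j| ≤ b₁
  noise_bound : ∀ y, |b y| ≤ b₂
  diff_mean : ∀ v j, ∫ y, H j y ∂(ν (rowSrc v)) = 0
  diff_var : ∀ v j, ∫ y, H j y ^ 2 ∂(ν (rowSrc v)) = sg j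
  noise_mean : ∀ v j, ∫ y, b y ∂(ν (noiseSrc v j)) = 0
  noise_var : ∀ v j, ∫ y, b y ^ 2 ∂(ν (noiseSrc v j)) = γ ^ 2
  row_nonempty : Nonempty (Fin m)
  bound_pos : 0 < b₁ + 2 * b₂

/-! ### Residuals of a pair of columns. -/

section Residuals

variable {m n : ℕ} {Y : Type*} (H : Fin n → Y → ℝ) (b : Y → ℝ) (i : Fin n)

/-- Centred noisy difference of columns `i` and `j` in row `v`. -/
def resid (j : Fin n) (v : Fin m) (ω : Source m n → Y) : ℝ :=
  H j (ω (rowSrc v)) + b (ω (noiseSrc v i)) - b (ω (noiseSrc v j))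

/-- Mean of the residuals over a set of rows. -/
noncomputable def residMean (j : Fin n) (R : Finset (Fin m)) (ω : Source m n → Y) : ℝ :=
  (∑ v ∈ R, resid H b i j v ω) / #R

/-- Centred sum of squares of the residuals over a set of rows. -/
noncomputable def residSq (j : Fin n) (R : Finset (Fin m)) (ω : Source m n → Y) : ℝ :=
  ∑ v ∈ R, resid H b i j v ω ^ 2 - (∑ v ∈ R, resid H b i j v ω) ^ 2 / #R

/-- Sources read by the residual of column `j` in row `v`. -/
def residBlock {m n : ℕ} (i j : Fin n) (v : Fin m) : Set (Source m n) :=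
  {rowSrc v, noiseSrc v i, noiseSrc v j}

lemma dependsOn_resid (j : Fin n) (v : Fin m) : DependsOn (resid H b i j v) (residBlock i j v) := by
  intro x y h
  simp only [resid]
  rw [h (rowSrc v) (by simp [residBlock]), h (noiseSrc v i) (by simp [residBlock]),
    h (noiseSrc v j) (by simp [residBlock])]

lemma residBlock_disjoint (j : Fin n) (s : Set (Fin m)) : s.PairwiseDisjoint (residBlock i j) := by
  intro v _ w _ hvw
  simp only [Function.onFun, residBlock]
  simp [Set.disjoint_left, hvw]

lemma residSq_nonneg (j : Fin n) (R : Finset (Fin m)) (ω : Source m n → Y) :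
    0 ≤ residSq H b i j R ω := by
  unfold residSq
  rcases R.eq_empty_or_nonempty with rfl | hR
  · simp
  have hc : (0 : ℝ) < #R := by exact_mod_cast hR.card_pos
  rw [sub_nonneg, div_le_iff₀ hc, mul_comm]
  exact sq_sum_le_card_mul_sum_sq

end Residuals

/-! ### Measurability of the selection. -/

section SelectionMeasurable

variable {n : ℕ} {Ω : Type*} [MeasurableSpace Ω]

lemma measurableSet_mem_firstK (C : Finset (Fin n)) {σ : Fin n → Ω → ℝ}
    (hσ : ∀ j ∈ C, Measurable (σ j)) (τ : Equiv.Perm (Fin n)) (k : ℕ) (j : Fin n) :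
    MeasurableSet {ω | j ∈ firstK C (fun j => σ j ω) τ k} := by
  classical
  by_cases hj : j ∈ C
  swap
  · have : {ω | j ∈ firstK C (fun j => σ j ω) τ k} = ∅ := by
      ext ω
      exact ⟨fun h => (hj (firstK_subset _ _ _ _ h)).elim, fun h => h.elim⟩
    rw [this]; exact MeasurableSet.empty
  have e : {ω | j ∈ firstK C (fun j => σ j ω) τ k}
      = {ω | (∑ j' ∈ C, if Precedes (fun j => σ j ω) τ j' j then 1 else 0) < k} := by
    ext ω
    simp [firstK, hj]
  rw [e]
  refine measurableSet_lt (measurable_sum _ fun j' hj' => ?_) measurable_const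
  refine Measurable.ite ?_ measurable_const measurable_const
  exact (measurableSet_lt (hσ j' hj') (hσ j hj)).union
    ((measurableSet_eq_fun (hσ j' hj') (hσ j hj)).inter (MeasurableSet.const _))

lemma BddMeas.sum_firstK {C : Finset (Fin n)} {σ : Fin n → Ω → ℝ} {g : Fin n → Ω → ℝ}
    (hσ : ∀ j ∈ C, Measurable (σ j)) (hg : ∀ j ∈ C, BddMeas (g j)) (τ : Equiv.Perm (Fin n))
    (k : ℕ) : BddMeas (fun ω => ∑ j ∈ firstK C (fun j => σ j ω) τ k, g j ω) := by
  classical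
  have e : (fun ω => ∑ j ∈ firstK C (fun j => σ j ω) τ k, g j ω)
      = fun ω => ∑ j ∈ C, if j ∈ firstK C (fun j => σ j ω) τ k then g j ω else 0 := by
    ext ω
    rw [← sum_filter]
    refine sum_congr ?_ fun _ _ => rfl
    ext j
    simp only [mem_filter]
    exact ⟨fun h => ⟨firstK_subset _ _ _ _ h, h⟩, fun h => h.2⟩
  rw [e]
  refine BddMeas.sum C fun j hj => ?_
  convert BddMeas.ite (measurableSet_mem_firstK C hσ τ k j) (hg j hj) (.const 0)

/-- A selected element with score above `K` would be preceded by all of `T`, that is by at least `k`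
candidates. -/
lemma le_of_mem_firstK {C T : Finset (Fin n)} {σ : Fin n → ℝ} {τ : Equiv.Perm (Fin n)} {k : ℕ}
    {K : ℝ} (hT : T ⊆ C) (hTk : k ≤ #T) (hK : ∀ j ∈ T, σ j ≤ K) {j : Fin n}
    (hj : j ∈ firstK C σ τ k) : σ j ≤ K := by
  classical
  by_contra h
  have hsub : T ⊆ C.filter fun j' => Precedes σ τ j' j := fun j' hj' =>
    mem_filter.2 ⟨hT hj', Or.inl ((hK j' hj').trans_lt (not_le.1 h))⟩
  have := card_le_card hsub
  have h2 := (mem_filter.1 hj).2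
  linarith

end SelectionMeasurable

/-! ### Error of a neighbour and removal of the row `u`. -/

section NeighbourError

variable {m n : ℕ} {Y : Type*} (H : Fin n → Y → ℝ) (b : Y → ℝ) (i : Fin n) (u : Fin m)

/-- Sources of the row `u`. -/
def rowBlock {m n : ℕ} (u : Fin m) : Set (Source m n) := {s | s = rowSrc u ∨ ∃ j, s = noiseSrc u j}

/-- Contribution of the neighbour `j` to the error in row `u`. -/
noncomputable def nbrTerm (j : Fin n) (R : Finset (Fin m)) (ω : Source m n → Y) : ℝ :=
  residMean H b i j R ω - H j (ω (rowSrc u)) + b (ω (noiseSrc u j))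

/-- Sample variance of the residuals of column `j`. -/
noncomputable def nbrScore (R : Fin n → Finset (Fin m)) (ω : Source m n → Y) (j : Fin n) : ℝ :=
  residSq H b i j (R j) ω / (#(R j) - 1)

/-- Error of the nearest neighbour estimate in row `u`. -/
noncomputable def nbrErr (C : Finset (Fin n)) (R : Fin n → Finset (Fin m))
    (τ : Equiv.Perm (Fin n)) (k : ℕ) (ω : Source m n → Y) : ℝ :=
  (∑ j ∈ firstK C (nbrScore H b i R ω) τ k, nbrTerm H b i u j (R j) ω) / k

/-- Deviation of the residual of row `u` from the mean over other rows. -/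
noncomputable def residDev (j : Fin n) (R : Finset (Fin m)) (ω : Source m n → Y) : ℝ :=
  resid H b i j u ω - residMean H b i j R ω

/-- The first two sample moments of the residuals of column `j` are close to their means. -/
def goodCol (sg : Fin n → ℝ) (γ α : ℝ) (j : Fin n) (R : Finset (Fin m)) (ω : Source m n → Y) :
    Prop :=
  |residMean H b i j R ω| ≤ α / 2 ∧
    |(∑ v ∈ R, resid H b i j v ω ^ 2) / #R - (sg j + 2 * γ ^ 2)| ≤ 3 * α / 4

variable {H b i u}

lemma resid_disjoint_rowBlock {j : Fin n} {v : Fin m} (hv : v ≠ u) :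
    Disjoint (rowBlock u) (residBlock i j v) := by
  rw [Set.disjoint_left]
  rintro s (rfl | ⟨j', rfl⟩) <;> simp [residBlock, Ne.symm hv]

lemma resid_mix_rowBlock {j : Fin n} {v : Fin m} (hv : v ≠ u) (x y : Source m n → Y) :
    resid H b i j v (mix (rowBlock u) x y) = resid H b i j v y :=
  (dependsOn_resid H b i j v).apply_mix_compl (resid_disjoint_rowBlock hv) x y

lemma residMean_mix_rowBlock {j : Fin n} {R : Finset (Fin m)} (hu : u ∉ R) (x y : Source m n → Y) :
    residMean H b i j R (mix (rowBlock u) x y) = residMean H b i j R y := by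
  unfold residMean
  rw [sum_congr rfl fun v hv =>
    resid_mix_rowBlock (H := H) (b := b) (i := i) (j := j) (ne_of_mem_of_not_mem hv hu) x y]

lemma residSq_mix_rowBlock {j : Fin n} {R : Finset (Fin m)} (hu : u ∉ R) (x y : Source m n → Y) :
    residSq H b i j R (mix (rowBlock u) x y) = residSq H b i j R y := by
  unfold residSq
  have h : ∀ v ∈ R, resid H b i j v (mix (rowBlock u) x y) = resid H b i j v y :=
    fun v hv => resid_mix_rowBlock (ne_of_mem_of_not_mem hv hu) x y
  rw [sum_congr rfl h, sum_congr rfl fun v hv => by rw [h v hv]]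

/-- On the good event the sample second moment is close to the variance. -/
lemma goodCol.residSq_bounds {sg : Fin n → ℝ} {γ α : ℝ} {j : Fin n} {R : Finset (Fin m)}
    {ω : Source m n → Y} (h : goodCol H b i sg γ α j R ω) (hR : R.Nonempty) :
    residSq H b i j R ω / #R ≤ sg j + 2 * γ ^ 2 + 3 * α / 4 ∧
      sg j + 2 * γ ^ 2 - 3 * α / 4 - α ^ 2 / 4 ≤ residSq H b i j R ω / #R := by
  have hc : (0 : ℝ) < #R := by exact_mod_cast hR.card_pos
  have e : residSq H b i j R ω / #R
      = (∑ v ∈ R, resid H b i j v ω ^ 2) / #R - residMean H b i j R ω ^ 2 := by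
    unfold residSq residMean
    field_simp
  have h1 := abs_le.1 h.2
  have h2 : residMean H b i j R ω ^ 2 ≤ (α / 2) ^ 2 := sq_le_sq' (abs_le.1 h.1).1 (abs_le.1 h.1).2
  rw [e]
  constructor <;> nlinarith [sq_nonneg (residMean H b i j R ω)]

/-- Leave-one-out form of the mean: it isolates row `u`, whose noise is correlated with the
selection, from the other rows. -/
lemma residMean_erase {j : Fin n} {R : Finset (Fin m)} (hu : u ∈ R) (hR : 2 ≤ #R)
    (ω : Source m n → Y) : residMean H b i j R ω = resid H b i j u ω
      - residDev H b i u j (R.erase u) ω * (((#R : ℝ) - 1) / #R) := by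
  have hc : (#R : ℝ) - 1 ≠ 0 := by
    have : (2 : ℝ) ≤ #R := by exact_mod_cast hR
    linarith
  have hc' : (#R : ℝ) ≠ 0 := by
    positivity
  have he : (#(R.erase u) : ℝ) = #R - 1 := by
    rw [card_erase_of_mem hu, Nat.cast_sub (by omega)]; simp
  unfold residDev residMean
  rw [he, ← add_sum_erase R (fun v => resid H b i j v ω) hu]
  field_simp
  ring

/-- Adding one observation to a sample raises the centred sum of squares by a multiple of its
squared deviation from the old mean. Row `u` can therefore only increase a score. -/
lemma residSq_erase {j : Fin n} {R : Finset (Fin m)} (hu : u ∈ R) (hR : 2 ≤ #R)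
    (ω : Source m n → Y) : residSq H b i j R ω = residSq H b i j (R.erase u) ω
      + residDev H b i u j (R.erase u) ω ^ 2 * (((#R : ℝ) - 1) / #R) := by
  have hc : (#R : ℝ) - 1 ≠ 0 := by
    have : (2 : ℝ) ≤ #R := by exact_mod_cast hR
    linarith
  have hc' : (#R : ℝ) ≠ 0 := by
    positivity
  have he : (#(R.erase u) : ℝ) = #R - 1 := by
    rw [card_erase_of_mem hu, Nat.cast_sub (by omega)]; simp
  unfold residDev residSq residMean
  rw [he, ← add_sum_erase R (fun v => resid H b i j v ω) hu,
    ← add_sum_erase R (fun v => resid H b i j v ω ^ 2) hu]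
  field_simp
  ring

lemma nbrScore_erase {R : Fin n → Finset (Fin m)} {j : Fin n} (hu : u ∈ R j)
    (hR : 2 ≤ #(R j)) (ω : Source m n → Y) :
    nbrScore H b i R ω j = residSq H b i j ((R j).erase u) ω / (#(R j) - 1)
      + residDev H b i u j ((R j).erase u) ω ^ 2 / #(R j) := by
  have hc : (#(R j) : ℝ) - 1 ≠ 0 := by
    have : (2 : ℝ) ≤ #(R j) := by exact_mod_cast hR
    linarith
  have hc' : (#(R j) : ℝ) ≠ 0 := by
    positivity
  unfold nbrScore
  rw [residSq_erase hu hR]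
  field_simp

/-- The noise of `(u, j)` and the signal difference in row `u` are absorbed in the deviation, and
only the noise of the target entry is left over. The deviation in the error is the one penalised by
the score. -/
lemma nbrTerm_erase {R : Finset (Fin m)} {j : Fin n} (hu : u ∈ R)
    (hR : 2 ≤ #R) (ω : Source m n → Y) : nbrTerm H b i u j R ω = b (ω (noiseSrc u i))
      - residDev H b i u j (R.erase u) ω * (((#R : ℝ) - 1) / #R) := by
  unfold nbrTerm
  rw [residMean_erase hu hR]
  simp only [resid]
  ring

/-- No selected score exceeds the scores of all of `T`. Passing from variance to score and back
costs `3 α / 4` twice and the squared sample mean `α² / 4` once; `κ` allows for scores that differ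
slightly from the centred second moment. -/
lemma sg_le_of_mem_firstK {sg : Fin n → ℝ} {γ : ℝ} {j : Fin n} {C T : Finset (Fin n)} {R : Fin n → Finset (Fin m)} {σ : Fin n → ℝ}
    {τ : Equiv.Perm (Fin n)} {k : ℕ} {ζ α κ : ℝ} {ω : Source m n → Y}
    (hR : ∀ j ∈ C, (R j).Nonempty) (hT : T ⊆ C) (hTk : k ≤ #T) (hζ : ∀ j ∈ T, sg j ≤ ζ)
    (hg : ∀ j ∈ C, goodCol H b i sg γ α j (R j) ω)
    (hlo : ∀ j ∈ C, residSq H b i j (R j) ω / #(R j) ≤ σ j)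
    (hup : ∀ j ∈ C, σ j ≤ residSq H b i j (R j) ω / #(R j) + κ)
    (hj : j ∈ firstK C σ τ k) : sg j ≤ ζ + 3 * α / 2 + α ^ 2 / 4 + κ := by
  have hjC := firstK_subset _ _ _ _ hj
  have h1 : σ j ≤ ζ + 2 * γ ^ 2 + 3 * α / 4 + κ := by
    refine le_of_mem_firstK hT hTk (fun j' hj' => ?_) hj
    have := ((hg j' (hT hj')).residSq_bounds (hR j' (hT hj'))).1
    linarith [hup j' (hT hj'), hζ j' hj']
  have h2 := ((hg j hjC).residSq_bounds (hR j hjC)).2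
  linarith [hlo j hjC]

end NeighbourError

lemma firstK_congr {n : ℕ} {C : Finset (Fin n)} {σ σ' : Fin n → ℝ} {τ : Equiv.Perm (Fin n)}
    {k : ℕ} (h : ∀ j ∈ C, σ j = σ' j) : firstK C σ τ k = firstK C σ' τ k := by
  classical
  unfold firstK
  refine filter_congr fun j hj => ?_
  have : ∀ j' ∈ C, Precedes σ τ j' j ↔ Precedes σ' τ j' j := fun j' hj' => by
    unfold Precedes; rw [h j hj, h j' hj']
  rw [filter_congr this]

/-! ### Conditioning on a good event. -/

section GoodEvent

variable {ι Y : Type*} [MeasurableSpace Y] [Fintype ι] (ν : ι → Measure Y)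
  [∀ i, IsProbabilityMeasure (ν i)]

open scoped Classical in
/-- Bounding an expectation by conditioning on the coordinates outside `A`, away from an
exceptional event that does not depend on `A`. -/
lemma integral_le_of_good {f : (ι → Y) → ℝ} (hf : BddMeas f) {K L p : ℝ} (hK : 0 ≤ K)
    (hL : 0 ≤ L) (hfL : ∀ ω, f ω ≤ L) (A : Set ι) {κ : Type*} (C : Finset κ)
    {g : κ → (ι → Y) → Prop} (hgm : ∀ j ∈ C, MeasurableSet {ω | g j ω})
    (hp : ∀ j ∈ C, (Pr ν).real {ω | ¬ g j ω} ≤ p)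
    (h : ∀ b, (∀ j ∈ C, g j b) → ∫ a, f (mix A a b) ∂Pr ν ≤ K) :
    ∫ ω, f ω ∂Pr ν ≤ K + L * (p * #C) := by
  set I : κ → (ι → Y) → ℝ := fun j ω => if g j ω then 0 else 1 with hI
  have hIb : ∀ j ∈ C, BddMeas (I j) := fun j hj => BddMeas.ite (hgm j hj) (.const 0) (.const 1)
  have hII : ∀ j ∈ C, ∫ ω, I j ω ∂Pr ν ≤ p := by
    intro j hj
    have : I j = Set.indicator {ω | g j ω}ᶜ 1 := by
      ext ω
      by_cases h : g j ω <;> simp [hI, h]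
    rw [this, integral_indicator_one (hgm j hj).compl]
    exact hp j hj
  have h0 : ∀ b, ∫ a, f (mix A a b) ∂Pr ν ≤ K + L * ∑ j ∈ C, I j b := by
    intro b
    have hIn : ∀ j, 0 ≤ I j b := fun j => by simp only [hI]; split_ifs <;> norm_num
    by_cases hb : ∀ j ∈ C, g j b
    · have := sum_nonneg (s := C) fun j _ => hIn j
      have := h b hb
      nlinarith
    · push Not at hb
      obtain ⟨j, hj, hjb⟩ := hb
      have h1 : 1 ≤ ∑ j ∈ C, I j b := by
        refine le_trans (le_of_eq ?_) (single_le_sum (fun j _ => hIn j) hj)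
        simp [hI, hjb]
      have h2 : ∫ a, f (mix A a b) ∂Pr ν ≤ ∫ _, L ∂Pr ν :=
        BddMeas.integral_mono (hf.comp (measurable_mix_left A b)) (.const _) _ fun a => hfL _
      simp only [integral_const, probReal_univ, one_smul] at h2
      nlinarith
  rw [integral_eq_integral_mix ν hf A]
  have hS : BddMeas (fun ω => ∑ j ∈ C, I j ω) := BddMeas.sum C hIb
  refine (BddMeas.integral_mono (hf.integral_mix_left ν A) (by fun_prop) _ h0).trans ?_
  rw [BddMeas.integral_add, integral_const_mul,
    integral_finsetSum _ fun j hj => (hIb j hj).integrable _]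
  simp only [integral_const, probReal_univ, one_smul]
  have : ∑ j ∈ C, ∫ ω, I j ω ∂Pr ν ≤ p * #C := by
    refine (sum_le_card_nsmul C _ p hII).trans (le_of_eq ?_)
    rw [nsmul_eq_mul, mul_comm]
  nlinarith

end GoodEvent

/-! ### Freezing everything except the noise of one column. -/

section ColumnSignal

variable {m n : ℕ} {Y : Type*} (H : Fin n → Y → ℝ) (b : Y → ℝ) (i j : Fin n)

/-- The part of the residual of column `j` in row `v` that does not involve column `j`'s noise. -/
def colSignal (v : Fin m) (ω : Source m n → Y) : ℝ := H j (ω (rowSrc v)) + b (ω (noiseSrc v i))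

lemma noiseSrc_injective (m n : ℕ) (j : Fin n) :
    Function.Injective fun v : Fin m => noiseSrc v j := fun v w h => by simpa using h

/-- Noise sources of column `j` in the rows `R`. -/
def noiseCol (j : Fin n) (R : Finset (Fin m)) : Finset (Source m n) := R.image fun v => noiseSrc v j

/-- The column signal as a function on sources, supported on the noise sources. -/
def signalOnNoise (ω : Source m n → Y) : Source m n → ℝ
  | .inr (.inl (v, _)) => colSignal H b i j v ω
  | _ => 0

variable {H b i j}

lemma mem_noiseCol {R : Finset (Fin m)} {s : Source m n} :
    s ∈ noiseCol j R ↔ ∃ v ∈ R, noiseSrc v j = s := by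
  simp [noiseCol]

lemma card_noiseCol {R : Finset (Fin m)} : #(noiseCol j R) = #R :=
  card_image_of_injective _ (noiseSrc_injective m n j)

lemma sum_noiseCol {R : Finset (Fin m)} (g : Source m n → ℝ) :
    ∑ w ∈ noiseCol j R, g w = ∑ v ∈ R, g (noiseSrc v j) :=
  sum_image fun _ _ _ _ h => noiseSrc_injective m n j h

lemma colSignal_mix {R : Finset (Fin m)} (hij : i ≠ j) (v : Fin m) (a ω : Source m n → Y) :
    colSignal H b i j v (mix (noiseCol j R : Set (Source m n)) a ω) = colSignal H b i j v ω := by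
  unfold colSignal
  rw [mix_of_notMem (by simp [mem_noiseCol]), mix_of_notMem (by simp [mem_noiseCol, hij.symm])]

lemma resid_mix_noiseCol {R : Finset (Fin m)} (hij : i ≠ j) {v : Fin m} (hv : v ∈ R)
    (a ω : Source m n → Y) : resid H b i j v (mix (noiseCol j R : Set (Source m n)) a ω)
      = signalOnNoise H b i j ω (noiseSrc v j) - b (a (noiseSrc v j)) := by
  have h := colSignal_mix (H := H) (b := b) (R := R) hij v a ω
  unfold colSignal at h
  unfold resid
  rw [h, mix_of_mem (by exact mem_coe.2 (mem_noiseCol.2 ⟨v, hv, rfl⟩))]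
  rfl

/-- The link to the window estimate: once signals and the noise of column `i` are fixed, the sample
variance of column `j` is a centred sum of squares in independent noise variables. -/
lemma residSq_mix_noiseCol {R : Finset (Fin m)} (hij : i ≠ j) (a ω : Source m n → Y) :
    residSq H b i j R (mix (noiseCol j R : Set (Source m n)) a ω)
      = centredSq b (signalOnNoise H b i j ω) (noiseCol j R) a := by
  unfold residSq centredSq
  have h := fun v hv => resid_mix_noiseCol (H := H) (b := b) (R := R) hij (v := v) hv a ω
  rw [card_noiseCol, sum_noiseCol, sum_noiseCol, sum_congr rfl h,
    sum_congr rfl fun v hv => by rw [h v hv]]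

lemma residMean_mix_noiseCol {R : Finset (Fin m)} (hij : i ≠ j) (a ω : Source m n → Y) :
    residMean H b i j R (mix (noiseCol j R : Set (Source m n)) a ω)
      = (∑ w ∈ noiseCol j R, (signalOnNoise H b i j ω w - b (a w))) / #(noiseCol j R) := by
  unfold residMean
  rw [card_noiseCol, sum_noiseCol, sum_congr rfl fun v hv =>
    resid_mix_noiseCol (H := H) (b := b) (R := R) hij (v := v) hv a ω]

end ColumnSignal

/-! ### Variance produced by resampling one noise variable. -/

section NoiseMoments

variable {Y : Type*} [MeasurableSpace Y]

/-- Half the second moment of `(X - X') (2 c - X - X')` for independent copies `X`, `X'` of the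
noise with law given by `P`. -/
noncomputable def pairVar (P : Measure Y) (b : Y → ℝ) (c : ℝ) : ℝ :=
  (∫ y, ∫ y', ((b y - b y') * (2 * c - b y - b y')) ^ 2 ∂P ∂P) / 2

lemma integral_quartic {P : Measure Y} [IsProbabilityMeasure P] {b : Y → ℝ} (hb : BddMeas b)
    (c₀ c₁ c₂ c₃ c₄ : ℝ) : ∫ y, (c₀ + c₁ * b y + c₂ * b y ^ 2 + c₃ * b y ^ 3 + c₄ * b y ^ 4) ∂P
      = c₀ + c₁ * (∫ y, b y ∂P) + c₂ * (∫ y, b y ^ 2 ∂P) + c₃ * (∫ y, b y ^ 3 ∂P)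
        + c₄ * ∫ y, b y ^ 4 ∂P := by
  have h0 : BddMeas fun _ : Y => c₀ := .const _
  have h1 := h0.add (hb.const_mul c₁)
  have h2 := h1.add ((hb.pow 2).const_mul c₂)
  have h3 := h2.add ((hb.pow 3).const_mul c₃)
  rw [BddMeas.integral_add, BddMeas.integral_add, BddMeas.integral_add, BddMeas.integral_add]
  simp [integral_const_mul]

/-- The unknown third moment enters only linearly in `c`, so it disappears once `c` is averaged over
a centred signal. -/
lemma pairVar_eq {P : Measure Y} [IsProbabilityMeasure P] {b : Y → ℝ} (hb : BddMeas b)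
    (h0 : ∫ y, b y ∂P = 0) (c : ℝ) :
    pairVar P b c = 4 * (∫ y, b y ^ 2 ∂P) * c ^ 2 - 4 * (∫ y, b y ^ 3 ∂P) * c
      + (∫ y, b y ^ 4 ∂P - (∫ y, b y ^ 2 ∂P) ^ 2) := by
  set m₂ := ∫ y, b y ^ 2 ∂P
  set m₃ := ∫ y, b y ^ 3 ∂P
  set m₄ := ∫ y, b y ^ 4 ∂P
  have inner : ∀ y, ∫ y', ((b y - b y') * (2 * c - b y - b y')) ^ 2 ∂P
      = (4 * c ^ 2 * m₂ - 4 * c * m₃ + m₄) + (4 * c * m₂) * b y + (4 * c ^ 2 - 2 * m₂) * b y ^ 2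
        + (-4 * c) * b y ^ 3 + 1 * b y ^ 4 := by
    intro y
    have e : ∀ y', ((b y - b y') * (2 * c - b y - b y')) ^ 2
        = (4 * c ^ 2 * b y ^ 2 - 4 * c * b y ^ 3 + b y ^ 4)
          + (-8 * c ^ 2 * b y + 4 * c * b y ^ 2) * b y'
          + (4 * c ^ 2 + 4 * c * b y - 2 * b y ^ 2) * b y' ^ 2
          + (-4 * c) * b y' ^ 3 + 1 * b y' ^ 4 := fun y' => by ring
    simp only [e]
    rw [integral_quartic hb, h0]
    ring
  unfold pairVar
  simp only [inner]
  rw [integral_quartic hb, h0]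
  ring

lemma integral_pow_four_ge {P : Measure Y} [IsProbabilityMeasure P] {b : Y → ℝ}
    (hb : BddMeas b) : (∫ y, b y ^ 2 ∂P) ^ 2 ≤ ∫ y, b y ^ 4 ∂P := by
  set m₂ := ∫ y, b y ^ 2 ∂P with hm
  have h : 0 ≤ ∫ y, (m₂ ^ 2 + 0 * b y + (-2 * m₂) * b y ^ 2 + 0 * b y ^ 3 + 1 * b y ^ 4) ∂P :=
    integral_nonneg fun y => by
      have : m₂ ^ 2 + 0 * b y + (-2 * m₂) * b y ^ 2 + 0 * b y ^ 3 + 1 * b y ^ 4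
        = (b y ^ 2 - m₂) ^ 2 := by ring
      simp only [Pi.zero_apply]; rw [this]; positivity
  rw [integral_quartic hb, ← hm] at h
  nlinarith

lemma pairVar_nonneg (P : Measure Y) (b : Y → ℝ) (c : ℝ) : 0 ≤ pairVar P b c :=
  div_nonneg (integral_nonneg fun y => integral_nonneg fun y' => sq_nonneg _) (by norm_num)

lemma pairVar_le {P : Measure Y} [IsProbabilityMeasure P] {b : Y → ℝ} {c J : ℝ}
    (hJ : ∀ y y', |(b y - b y') * (2 * c - b y - b y')| ≤ J) : pairVar P b c ≤ J ^ 2 / 2 := by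
  have h1 : ∀ y, ∫ y', ((b y - b y') * (2 * c - b y - b y')) ^ 2 ∂P ≤ J ^ 2 := fun y => by
    have := norm_integral_le_of_norm_le_const (μ := P)
      (f := fun y' => ((b y - b y') * (2 * c - b y - b y')) ^ 2) (C := J ^ 2)
      (ae_of_all _ fun y' => by
        rw [norm_eq_abs, abs_pow]
        exact pow_le_pow_left₀ (abs_nonneg _) (hJ y y') 2)
    simpa using (le_abs_self _).trans this
  have := norm_integral_le_of_norm_le_const (μ := P)
    (f := fun y => ∫ y', ((b y - b y') * (2 * c - b y - b y')) ^ 2 ∂P) (C := J ^ 2)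
    (ae_of_all _ fun y => by
      rw [norm_eq_abs, abs_of_nonneg (integral_nonneg fun _ => sq_nonneg _)]
      exact h1 y)
  have h2 := (le_abs_self _).trans this
  simp only [probReal_univ, mul_one] at h2
  unfold pairVar
  linarith

/-- The cut-off in the jumps costs at most `κ ^ 2` times the noise variance. -/
lemma pairVar_sub_le_jump {ι : Type*} [Fintype ι] (ν : ι → Measure Y)
    [∀ i, IsProbabilityMeasure (ν i)] {b : Y → ℝ} (hb : BddMeas b) {c : ι → ℝ} (κ : ℝ) (w : ι)
    (h0 : ∫ y, b y ∂(ν w) = 0) : pairVar (ν w) b (c w) - κ ^ 2 * ∫ y, b y ^ 2 ∂(ν w)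
      ≤ (∫ p, jump b c κ w p ^ 2 ∂((Pr ν).prod (Pr ν))) / 2 := by
  have hb1 : BddMeas fun p : (ι → Y) × (ι → Y) => b (p.1 w) :=
    hb.comp ((measurable_pi_apply w).comp measurable_fst)
  have hb2 : BddMeas fun p : (ι → Y) × (ι → Y) => b (p.2 w) :=
    hb.comp ((measurable_pi_apply w).comp measurable_snd)
  have hd := hb1.sub hb2
  have hr := (((BddMeas.const (2 * c w)).sub hb1).sub hb2)
  have hjb : BddMeas (jump b c κ w) := by
    unfold jump
    exact BddMeas.ite (measurableSet_le measurable_const hr.abs.meas) (hd.mul hr) (.const 0)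
  have hpt : ∀ p : (ι → Y) × (ι → Y),
      ((b (p.1 w) - b (p.2 w)) * (2 * c w - b (p.1 w) - b (p.2 w))) ^ 2
        - κ ^ 2 * (b (p.1 w) - b (p.2 w)) ^ 2 ≤ jump b c κ w p ^ 2 := by
    intro p
    unfold jump
    split_ifs with h
    · nlinarith [mul_nonneg (sq_nonneg κ) (sq_nonneg (b (p.1 w) - b (p.2 w)))]
    · have h1 := abs_lt.1 (not_le.1 h)
      have : (2 * c w - b (p.1 w) - b (p.2 w)) ^ 2 ≤ κ ^ 2 := sq_le_sq' h1.1.le h1.2.le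
      nlinarith
  have h := BddMeas.integral_mono (by fun_prop) (hjb.pow 2) ((Pr ν).prod (Pr ν)) hpt
  rw [BddMeas.integral_sub, integral_const_mul, integral_prod _ (((hd.mul hr).pow 2).integrable _),
    integral_prod _ ((hd.pow 2).integrable _)] at h
  have e1 : ∫ x : ι → Y, ∫ y : ι → Y, ((b (x w) - b (y w)) * (2 * c w - b (x w) - b (y w))) ^ 2
      ∂Pr ν ∂Pr ν = 2 * pairVar (ν w) b (c w) := by
    have hq : ∀ z : ℝ, BddMeas fun y' => ((z - b y') * (2 * c w - z - b y')) ^ 2 := fun _ => by fun_prop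
    have : ∀ x : ι → Y, ∫ y : ι → Y, ((b (x w) - b (y w)) * (2 * c w - b (x w) - b (y w))) ^ 2 ∂Pr ν
        = ∫ y', ((b (x w) - b y') * (2 * c w - b (x w) - b y')) ^ 2 ∂(ν w) := fun x =>
      integral_coord ν (hq (b (x w))).meas w
    simp only [this]
    have hm : Measurable fun y => ∫ y', ((b y - b y') * (2 * c w - b y - b y')) ^ 2 ∂(ν w) := by
      have hb1' : BddMeas fun p : Y × Y => b p.1 := hb.comp measurable_fst
      have hb2' : BddMeas fun p : Y × Y => b p.2 := hb.comp measurable_snd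
      have := (((hb1'.sub hb2').mul (((BddMeas.const (2 * c w)).sub hb1').sub hb2')).pow 2).meas
      exact (this.stronglyMeasurable.integral_prod_right' (ν := ν w)).measurable
    rw [integral_coord ν (g := fun y =>
      ∫ y', ((b y - b y') * (2 * c w - b y - b y')) ^ 2 ∂(ν w)) hm]
    unfold pairVar
    ring
  have e2 : ∫ x : ι → Y, ∫ y : ι → Y, (b (x w) - b (y w)) ^ 2
      ∂Pr ν ∂Pr ν = 2 * ∫ y, b y ^ 2 ∂(ν w) := by
    have e : ∀ z t : ℝ, (z - t) ^ 2 = z ^ 2 + (-2 * z) * t + 1 * t ^ 2 + 0 * t ^ 3 + 0 * t ^ 4 :=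
      fun z t => by ring
    have i1 : ∀ x : ι → Y, ∫ y : ι → Y, (b (x w) - b (y w)) ^ 2 ∂Pr ν
        = (∫ y, b y ^ 2 ∂(ν w)) + 0 * b (x w) + 1 * b (x w) ^ 2 + 0 * b (x w) ^ 3
          + 0 * b (x w) ^ 4 := fun x => by
      rw [integral_coord ν (g := fun y' => (b (x w) - b y') ^ 2)
        (((BddMeas.const (b (x w))).sub hb).pow 2).meas]
      simp only [e]
      rw [integral_quartic hb, h0]
      ring
    simp only [i1]
    have hpoly : BddMeas fun y => (∫ y, b y ^ 2 ∂(ν w)) + 0 * b y + 1 * b y ^ 2 + 0 * b y ^ 3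
          + 0 * b y ^ 4 := by fun_prop
    rw [integral_coord ν (g := fun y => (∫ y, b y ^ 2 ∂(ν w)) + 0 * b y + 1 * b y ^ 2
      + 0 * b y ^ 3 + 0 * b y ^ 4) hpoly.meas, integral_quartic hb, h0]
    ring
  simp only at h e1 e2
  rw [e1, e2] at h
  linarith

end NoiseMoments

section Regular

variable {m n : ℕ} {Y : Type*} [MeasurableSpace Y]

/-- The signal of column `j` is centred and spread out enough for the noise of column `j` to
smooth its sample variance. -/
def regularCol (ν : Source m n → Measure Y) (H : Fin n → Y → ℝ) (b : Y → ℝ) (i : Fin n)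
    (c₀ V : ℝ) (j : Fin n) (R : Finset (Fin m)) (ω : Source m n → Y) : Prop :=
  |(∑ v ∈ R, colSignal H b i j v ω) / #R| ≤ c₀ ∧
    V ≤ ∑ v ∈ R, pairVar (ν (noiseSrc v j)) b (colSignal H b i j v ω)

end Regular

/-! ### Indicators of propositions. -/

section Ind

open scoped Classical in
/-- Indicator of a proposition. -/
noncomputable def ind (p : Prop) : ℝ := if p then 1 else 0

lemma ind_of {p : Prop} (h : p) : ind p = 1 := if_pos h

lemma ind_of_not {p : Prop} (h : ¬p) : ind p = 0 := if_neg h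

lemma ind_nonneg (p : Prop) : 0 ≤ ind p := by
  by_cases h : p
  · rw [ind_of h]; norm_num
  · rw [ind_of_not h]

lemma ind_le_one (p : Prop) : ind p ≤ 1 := by
  by_cases h : p
  · rw [ind_of h]
  · rw [ind_of_not h]; norm_num

lemma ind_mono {p q : Prop} (h : p → q) : ind p ≤ ind q := by
  by_cases hp : p
  · rw [ind_of hp, ind_of (h hp)]
  · rw [ind_of_not hp]; exact ind_nonneg q

lemma ind_le_add {p q r : Prop} (h : p → q ∨ r) : ind p ≤ ind q + ind r := by
  by_cases hp : p
  · rcases h hp with h | h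
    · rw [ind_of hp, ind_of h]; linarith [ind_nonneg r]
    · rw [ind_of hp, ind_of h]; linarith [ind_nonneg q]
  · rw [ind_of_not hp]; exact add_nonneg (ind_nonneg q) (ind_nonneg r)

lemma ind_and (p q : Prop) : ind (p ∧ q) = ind p * ind q := by
  by_cases hp : p <;> by_cases hq : q <;> simp [ind, hp, hq]

variable {α : Type*} [MeasurableSpace α]

lemma BddMeas.ind {p : α → Prop} (hp : MeasurableSet {x | p x}) : BddMeas fun x => ind (p x) :=
  BddMeas.ite hp (.const 1) (.const 0)

lemma integral_ind {p : α → Prop} (hp : MeasurableSet {x | p x}) (P : Measure α) :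
    ∫ x, ind (p x) ∂P = P.real {x | p x} := by
  have : (fun x => ind (p x)) = Set.indicator {x | p x} 1 := by
    ext x
    by_cases h : p x <;> simp [ind, h]
  rw [this, integral_indicator_one hp]

end Ind

lemma integral_mul_of_mix {ι Y : Type*} [MeasurableSpace Y] [Fintype ι] (ν : ι → Measure Y)
    [∀ i, IsProbabilityMeasure (ν i)] {f g : (ι → Y) → ℝ} {A : Set ι} (hf : BddMeas f)
    (hg : BddMeas g) (hfA : ∀ a b, f (mix A a b) = f a) (hgA : ∀ a b, g (mix A a b) = g b) :
    ∫ ω, f ω * g ω ∂Pr ν = (∫ ω, f ω ∂Pr ν) * ∫ ω, g ω ∂Pr ν := by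
  rw [integral_eq_integral_mix ν (hf.mul hg) A]
  simp only [hfA, hgA, integral_mul_const, integral_const_mul]

/-! ### How the selection depends on the noise of one column. -/

section Smooth

variable {m n : ℕ} {Y : Type*} {H : Fin n → Y → ℝ} {b : Y → ℝ} {i j : Fin n} {u : Fin m}

/-- Noise sources of column `j`. -/
def colBlock {m n : ℕ} (j : Fin n) : Set (Source m n) := {s | ∃ v, s = noiseSrc v j}

lemma noiseCol_subset_colBlock (R : Finset (Fin m)) :
    (noiseCol j R : Set (Source m n)) ⊆ colBlock j := by
  intro s hs
  obtain ⟨v, _, rfl⟩ := mem_noiseCol.1 (mem_coe.1 hs)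
  exact ⟨v, rfl⟩

lemma mix_colBlock_noise {A : Set (Source m n)} (hA : A ⊆ colBlock j) {j' : Fin n}
    (hj : j ≠ j') (v : Fin m) (a ω : Source m n → Y) :
    mix A a ω (noiseSrc v j') = ω (noiseSrc v j') :=
  mix_of_notMem (fun h => by obtain ⟨w, hw⟩ := hA h; simp at hw; exact hj hw.2.symm) _ _

lemma mix_colBlock_row {A : Set (Source m n)} (hA : A ⊆ colBlock j) (v : Fin m)
    (a ω : Source m n → Y) : mix A a ω (rowSrc v) = ω (rowSrc v) :=
  mix_of_notMem (fun h => by obtain ⟨w, hw⟩ := hA h; simp at hw) _ _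

lemma resid_mix_colBlock {A : Set (Source m n)} (hA : A ⊆ colBlock j) (hij : i ≠ j)
    {j' : Fin n} (hj : j ≠ j') (v : Fin m) (a ω : Source m n → Y) :
    resid H b i j' v (mix A a ω) = resid H b i j' v ω := by
  unfold resid
  rw [mix_colBlock_noise hA hj, mix_colBlock_noise hA hij.symm, mix_colBlock_row hA]

lemma residSq_mix_colBlock {A : Set (Source m n)} (hA : A ⊆ colBlock j) (hij : i ≠ j)
    {j' : Fin n} (hj : j ≠ j') (R : Finset (Fin m)) (a ω : Source m n → Y) :
    residSq H b i j' R (mix A a ω) = residSq H b i j' R ω := by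
  unfold residSq
  simp only [resid_mix_colBlock hA hij hj]

lemma residMean_mix_colBlock {A : Set (Source m n)} (hA : A ⊆ colBlock j) (hij : i ≠ j)
    {j' : Fin n} (hj : j ≠ j') (R : Finset (Fin m)) (a ω : Source m n → Y) :
    residMean H b i j' R (mix A a ω) = residMean H b i j' R ω := by
  unfold residMean
  simp only [resid_mix_colBlock hA hij hj]

lemma resid_mix_colBlock_self {R : Finset (Fin m)} {v : Fin m} (hv : v ∈ R)
    (hij : i ≠ j) (a ω : Source m n → Y) : resid H b i j v (mix (colBlock j) a ω)
      = resid H b i j v (mix (noiseCol j R : Set (Source m n)) a ω) := by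
  unfold resid
  rw [mix_colBlock_noise subset_rfl hij.symm, mix_colBlock_row subset_rfl,
    mix_colBlock_noise (noiseCol_subset_colBlock R) hij.symm,
    mix_colBlock_row (noiseCol_subset_colBlock R), mix_of_mem (by exact ⟨v, rfl⟩),
    mix_of_mem (by exact mem_coe.2 (mem_noiseCol.2 ⟨v, hv, rfl⟩))]

lemma residSq_mix_colBlock_self {R : Finset (Fin m)} (hij : i ≠ j) (a ω : Source m n → Y) :
    residSq H b i j R (mix (colBlock j) a ω)
      = residSq H b i j R (mix (noiseCol j R : Set (Source m n)) a ω) := by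
  unfold residSq
  have h := fun v hv => resid_mix_colBlock_self (H := H) (b := b) (R := R) (v := v) hv hij a ω
  rw [sum_congr rfl h, sum_congr rfl fun v hv => by rw [h v hv]]

lemma residMean_mix_colBlock_self {R : Finset (Fin m)} (hij : i ≠ j) (a ω : Source m n → Y) :
    residMean H b i j R (mix (colBlock j) a ω)
      = residMean H b i j R (mix (noiseCol j R : Set (Source m n)) a ω) := by
  unfold residMean
  have h := fun v hv => resid_mix_colBlock_self (H := H) (b := b) (R := R) (v := v) hv hij a ω
  rw [sum_congr rfl h]

variable (H b i u) in
/-- Score of column `j`, split into the part from the rows `R j` and the part from row `u`. -/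
noncomputable def splitScore (R : Fin n → Finset (Fin m)) (ω : Source m n → Y) (j : Fin n) : ℝ :=
  residSq H b i j (R j) ω / #(R j) + residDev H b i u j (R j) ω ^ 2 / (#(R j) + 1)

/-- Scores at most `x` would select column `j`, with scores `σ` of the other columns. -/
def selectSet (C : Finset (Fin n)) (σ : Fin n → ℝ) (τ : Equiv.Perm (Fin n)) (k : ℕ) (j : Fin n) :
    Set ℝ := {x | #((C.erase j).filter fun j' => σ j' < x ∨ (σ j' = x ∧ τ j' < τ j)) < k}

/-- A smaller value has fewer candidates before it. Selection is thus a threshold condition on a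
column's own score, to which the window estimate for lower sets applies. -/
lemma isLowerSet_selectSet (C : Finset (Fin n)) (σ : Fin n → ℝ) (τ : Equiv.Perm (Fin n)) (k : ℕ)
    (j : Fin n) : IsLowerSet (selectSet C σ τ k j) := by
  intro x y hyx hx
  refine lt_of_le_of_lt (card_le_card fun j' hj' => ?_) hx
  all_goals grind

lemma mem_firstK_iff_selectSet {C : Finset (Fin n)} {σ : Fin n → ℝ} {τ : Equiv.Perm (Fin n)}
    {k : ℕ} : j ∈ firstK C σ τ k ↔ j ∈ C ∧ σ j ∈ selectSet C σ τ k j := by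
  rw [mem_firstK_erase]; rfl

/-- Score values below which fewer than `k` other columns have score plus margin `κ`. -/
def marginSet (C : Finset (Fin n)) (σ κ : Fin n → ℝ) (k : ℕ) (j : Fin n) : Set ℝ :=
  {x | #((C.erase j).filter fun j' => σ j' + κ j' < x) < k}

lemma isLowerSet_marginSet (C : Finset (Fin n)) (σ κ : Fin n → ℝ) (k : ℕ) (j : Fin n) :
    IsLowerSet (marginSet C σ κ k j) := by
  intro x y hyx hx
  refine lt_of_le_of_lt (card_le_card fun j' hj' => ?_) hx
  grind

lemma isLowerSet_div {U : Set ℝ} (hU : IsLowerSet U) {N : ℝ} (hN : 0 ≤ N) :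
    IsLowerSet {x : ℝ | x / N ∈ U} := fun x y hyx hx => by
  exact hU (div_le_div_of_nonneg_right hyx hN) hx

/-- The columns `C`, with rows `R j` other than `u`, whose sample variances are smoothed by their
own noise: away from an event of probability `pb`, the law of the centred sum of squares of column
`j` given everything except the noise of column `j` has, up to `t`, a small mass ratio `θ` between
windows of length `h` and half-lines, and the sample mean is at most `ε₁` up to probability `δ`. -/
structure SmoothColumns [MeasurableSpace Y] (ν : Source m n → Measure Y) (H : Fin n → Y → ℝ)
    (b : Y → ℝ) (i : Fin n) (u : Fin m) (C : Finset (Fin n)) (R : Fin n → Finset (Fin m))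
    (g : Fin n → (Source m n → Y) → Prop) (b₁ b₂ ε₁ h θ t δ pb : ℝ) : Prop where
  notMem : i ∉ C
  row : ∀ j ∈ C, u ∉ R j
  nonempty : ∀ j ∈ C, (R j).Nonempty
  meas : ∀ j ∈ C, MeasurableSet {ω | g j ω}
  inv_row : ∀ j ∈ C, ∀ a ω, g j (mix (rowBlock u) a ω) ↔ g j ω
  inv_col : ∀ j ∈ C, ∀ A ⊆ colBlock j, ∀ a ω, g j (mix A a ω) ↔ g j ω
  tail : ∀ j ∈ C, (Pr ν).real {ω | ¬ g j ω} ≤ pb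
  window : ∀ j ∈ C, ∀ ω, g j ω → ∀ U : Set ℝ, IsLowerSet U → (Pr ν).real
      {a | residSq H b i j (R j) (mix (noiseCol j (R j) : Set (Source m n)) a ω) ∈ U ∧
        residSq H b i j (R j) (mix (noiseCol j (R j) : Set (Source m n)) a ω) + h ∉ U}
    ≤ θ * (Pr ν).real
      {a | residSq H b i j (R j) (mix (noiseCol j (R j) : Set (Source m n)) a ω) ∈ U} + t
  dev : ∀ j ∈ C, ∀ ω, g j ω → (Pr ν).real {a | ε₁ < |residMean H b i j (R j)
        (mix (noiseCol j (R j) : Set (Source m n)) a ω)|} ≤ δ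
  theta_nonneg : 0 ≤ θ
  theta_lt_one : θ < 1
  t_nonneg : 0 ≤ t
  delta_nonneg : 0 ≤ δ
  gap : ∀ j ∈ C, ∀ j' ∈ C, (2 * (b₁ + b₂) + ε₁) ^ 2 * #(R j) < h * (#(R j') + 1)

lemma splitScore_mix_colBlock {A : Set (Source m n)} (hA : A ⊆ colBlock j) (hij : i ≠ j)
    {j' : Fin n} (hj : j ≠ j') (a ω : Source m n → Y) :
    splitScore H b i u R (mix A a ω) j' = splitScore H b i u R ω j' := by
  unfold splitScore residDev
  rw [residSq_mix_colBlock hA hij hj, resid_mix_colBlock hA hij hj, residMean_mix_colBlock hA hij hj]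

/-- The threshold for column `j` is made of the scores of the other columns, and these read the
noise of column `i` and of their own column but not that of column `j`. -/
lemma selectSet_mix_colBlock {A : Set (Source m n)} (hA : A ⊆ colBlock j) (hij : i ≠ j)
    (τ : Equiv.Perm (Fin n)) (k : ℕ) (a ω : Source m n → Y) :
    selectSet C (splitScore H b i u R (mix A a ω)) τ k j
      = selectSet C (splitScore H b i u R ω) τ k j := by
  ext x
  have : (C.erase j).filter (fun j' => splitScore H b i u R (mix A a ω) j' < x ∨
        (splitScore H b i u R (mix A a ω) j' = x ∧ τ j' < τ j))
      = (C.erase j).filter (fun j' => splitScore H b i u R ω j' < x ∨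
        (splitScore H b i u R ω j' = x ∧ τ j' < τ j)) := by
    refine filter_congr fun j' hj' => ?_
    rw [splitScore_mix_colBlock hA hij (ne_of_mem_erase hj').symm]
  unfold selectSet
  grind

lemma nbrScore_eq_splitScore {R : Fin n → Finset (Fin m)} (hu : u ∈ R j) (hR : 2 ≤ #(R j))
    (ω : Source m n → Y) :
    nbrScore H b i R ω j = splitScore H b i u (fun j => (R j).erase u) ω j := by
  have he : (#((R j).erase u) : ℝ) = #(R j) - 1 := by
    rw [card_erase_of_mem hu, Nat.cast_sub (by omega)]; simp
  rw [nbrScore_erase hu hR]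
  simp only [splitScore]
  rw [he, sub_add_cancel]

end Smooth

lemma measurableSet_card_filter_lt {κ Ω : Type*} [MeasurableSpace Ω] (s : Finset κ)
    {p : κ → Ω → Prop} (hp : ∀ j ∈ s, MeasurableSet {ω | p j ω}) (k : ℕ)
    [∀ ω, DecidablePred fun j => p j ω] : MeasurableSet {ω | #(s.filter fun j => p j ω) < k} := by
  classical
  have e : {ω | #(s.filter fun j => p j ω) < k} = {ω | (∑ j ∈ s, if p j ω then 1 else 0) < k} := by
    ext ω
    simp
  rw [e]
  refine measurableSet_lt (measurable_sum _ fun j hj => ?_) measurable_const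
  exact Measurable.ite (hp j hj) measurable_const measurable_const

/-- Correlation by sandwiching: `e` is uncorrelated with `w₁`, and `w - w₁` lies between `0` and
`w₃`, whose correlation with the positive and negative parts of `e` factorises. A centred `e` has
positive and negative parts of mean `∫ |e| / 2 ≤ |γ| / 2`, whence the constant. -/
lemma abs_integral_mul_le {α : Type*} [MeasurableSpace α] {P : Measure α}
    [IsProbabilityMeasure P] {e w w₁ w₃ : α → ℝ} (he : BddMeas e) (hw : BddMeas w)
    (hw₁ : BddMeas w₁) (hw₃ : BddMeas w₃) {c γ : ℝ} (hγ : ∫ x, e x ^ 2 ∂P = γ ^ 2)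
    (he0 : ∫ x, e x ∂P = 0) (h1 : ∀ x, w₁ x ≤ w x) (h3 : ∀ x, w x ≤ w₁ x + w₃ x) (hc : 0 ≤ c)
    (hi1 : ∫ x, e x * w₁ x ∂P = 0)
    (hi3 : ∫ x, Max.max (e x) 0 * w₃ x ∂P = (∫ x, Max.max (e x) 0 ∂P) * c)
    (hi3' : ∫ x, Max.max (-e x) 0 * w₃ x ∂P = (∫ x, Max.max (-e x) 0 ∂P) * c) :
    |∫ x, e x * w x ∂P| ≤ |γ| / 2 * c := by
  have hp : BddMeas fun x => Max.max (e x) 0 := he.max (.const 0)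
  have hn : BddMeas fun x => Max.max (-e x) 0 := he.neg.max (.const 0)
  have ed : ∀ x, e x * (w x - w₁ x) = e x * w x - e x * w₁ x := fun x => by ring
  have hd : ∫ x, e x * (w x - w₁ x) ∂P = ∫ x, e x * w x ∂P := by
    simp only [ed]
    rw [BddMeas.integral_sub, hi1, sub_zero]
  have habs : ∫ x, |e x| ∂P ≤ |γ| := by
    have h := BddMeas.integral_mono (G := fun x => 2 * |γ| * |e x|) (H := fun x => e x ^ 2 + γ ^ 2)
      (he.abs.const_mul _) ((he.pow 2).add (.const _)) P fun x => by
        nlinarith [sq_nonneg (|e x| - |γ|), sq_abs (e x), sq_abs γ]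
    rw [integral_const_mul, BddMeas.integral_add, hγ] at h
    simp only [integral_const, probReal_univ, one_smul] at h
    rcases (abs_nonneg γ).eq_or_lt with h0 | h0
    · have hγ0 : γ = 0 := abs_eq_zero.1 h0.symm
      rw [hγ0, zero_pow two_ne_zero] at hγ
      have := (integral_eq_zero_iff_of_nonneg (fun x => sq_nonneg (e x))
        ((he.pow 2).integrable P)).1 hγ
      rw [← h0]
      refine le_of_eq ((integral_congr_ae ?_).trans (integral_zero _ _))
      filter_upwards [this] with x hx
      have : e x ^ 2 = 0 := hx
      simpa using this
    · have : 2 * |γ| * ∫ x, |e x| ∂P ≤ 2 * |γ| * |γ| := by nlinarith [sq_abs γ]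
      exact le_of_mul_le_mul_left this (by positivity)
  have e1 : ∀ x, Max.max (e x) 0 = |e x| / 2 + e x / 2 := fun x => by
    rcases le_total 0 (e x) with h | h
    · rw [max_eq_left h, abs_of_nonneg h]; ring
    · rw [max_eq_right h, abs_of_nonpos h]; ring
  have e2 : ∀ x, Max.max (-e x) 0 = |e x| / 2 - e x / 2 := fun x => by
    rcases le_total 0 (e x) with h | h
    · rw [max_eq_right (by linarith), abs_of_nonneg h]; ring
    · rw [max_eq_left (by linarith), abs_of_nonpos h]; ring
  have ip : ∫ x, Max.max (e x) 0 ∂P ≤ |γ| / 2 := by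
    simp only [e1]
    rw [BddMeas.integral_add, integral_div, integral_div, he0]
    linarith
  have im : ∫ x, Max.max (-e x) 0 ∂P ≤ |γ| / 2 := by
    simp only [e2]
    rw [BddMeas.integral_sub, integral_div, integral_div, he0]
    linarith
  have hew : BddMeas fun x => e x * (w x - w₁ x) := by fun_prop
  have up := BddMeas.integral_mono hew (hp.mul hw₃) P fun x => by
    have ha := h1 x; have hb := h3 x
    have hc1 := le_max_left (e x) 0; have hc2 := le_max_right (e x) 0
    nlinarith
  have lo := BddMeas.integral_mono hew.neg (hn.mul hw₃) P fun x => by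
    have ha := h1 x; have hb := h3 x
    have hc1 := le_max_left (-e x) 0; have hc2 := le_max_right (-e x) 0
    nlinarith
  rw [integral_neg] at lo
  rw [hd, hi3] at up
  rw [hd, hi3'] at lo
  exact abs_le.2 ⟨by nlinarith, by nlinarith⟩

lemma dependsOn_comp_mix {ι Y β : Type*} (G : (ι → Y) → β) (A : Set ι) (ω : ι → Y) :
    DependsOn (fun a => G (mix A a ω)) A := by
  intro x y h
  refine congrArg G (funext fun s => ?_)
  by_cases hs : s ∈ A
  · rw [mix_of_mem hs, mix_of_mem hs, h s hs]
  · rw [mix_of_notMem hs, mix_of_notMem hs]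

/-! ### The selected sum and its leave-one-column-out part. -/

section

variable {m n : ℕ} {Y : Type*} (H : Fin n → Y → ℝ) (b : Y → ℝ) (i : Fin n) (u : Fin m)
  (C C' : Finset (Fin n)) (R : Fin n → Finset (Fin m)) (τ : Equiv.Perm (Fin n)) (k : ℕ) (ε₁ : ℝ)

/-- Column `j` is selected and all sample means are small. -/
def smallSelected (j : Fin n) (ω : Source m n → Y) : Prop :=
  j ∈ firstK C (splitScore H b i u R ω) τ k ∧ ∀ j' ∈ C, |residMean H b i j' (R j') ω| ≤ ε₁

/-- Fewer than `k` other columns have a sample variance at most that of column `j`. -/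
def fewBelow (j : Fin n) (ω : Source m n → Y) : Prop := #((C.erase j).filter fun j' =>
    residSq H b i j' (R j') ω / #(R j') ≤ residSq H b i j (R j) ω / #(R j)) < k

/-- Contribution of the noise and of the signal of column `j` in row `u`, for `j` in `C'`. -/
noncomputable def rowTerm (j : Fin n) (ω : Source m n → Y) : ℝ :=
  ind (j ∈ C') * (b (ω (noiseSrc u j)) - H j (ω (rowSrc u)))

/-- Sum of the row terms of the selected columns, when all sample means are small. -/
noncomputable def selectedSum (ω : Source m n → Y) : ℝ :=
  ∑ j ∈ C', ind (smallSelected H b i u C R τ k ε₁ j ω) * (b (ω (noiseSrc u j)) - H j (ω (rowSrc u)))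

/-- The part of the selected sum, given that column `j` is selected, that does not involve the
noise of column `j`. -/
noncomputable def selectedRest (j : Fin n) (ω : Source m n → Y) : ℝ :=
  ind (∀ j' ∈ C.erase j, |residMean H b i j' (R j') ω| ≤ ε₁) *
    ((∑ j' ∈ firstK (C.erase j) (splitScore H b i u R ω) τ (k - 1), rowTerm H b u C' j' ω)
      - H j (ω (rowSrc u)))

variable {H b i u C C' R τ k ε₁}

lemma selectedSum_eq {ω : Source m n → Y} (hC : C' ⊆ C)
    (hD : ∀ j ∈ C, |residMean H b i j (R j) ω| ≤ ε₁) : selectedSum H b i u C C' R τ k ε₁ ω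
      = ∑ j ∈ firstK C (splitScore H b i u R ω) τ k, rowTerm H b u C' j ω := by
  classical
  set S := firstK C (splitScore H b i u R ω) τ k with hS
  set x : Fin n → ℝ := fun j => b (ω (noiseSrc u j)) - H j (ω (rowSrc u)) with hx
  have e1 : selectedSum H b i u C C' R τ k ε₁ ω = ∑ j ∈ C, if j ∈ S ∧ j ∈ C' then x j else 0 := by
    rw [← sum_subset hC fun j _ hj => if_neg fun h => hj h.2]
    refine sum_congr rfl fun j hj => ?_
    by_cases hjS : j ∈ S
    · rw [ind_of (show smallSelected H b i u C R τ k ε₁ j ω from ⟨hjS, hD⟩), if_pos ⟨hjS, hj⟩,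
        one_mul]
    · rw [ind_of_not (fun h : smallSelected H b i u C R τ k ε₁ j ω => hjS h.1),
        if_neg fun h => hjS h.1, zero_mul]
  have e2 : ∑ j ∈ S, rowTerm H b u C' j ω = ∑ j ∈ C, if j ∈ S ∧ j ∈ C' then x j else 0 := by
    rw [← sum_subset (firstK_subset C _ τ k) fun j _ hj => if_neg fun h => hj h.1]
    refine sum_congr rfl fun j hj => ?_
    by_cases hjC : j ∈ C'
    · rw [if_pos ⟨hj, hjC⟩, rowTerm, ind_of hjC, one_mul]
    · rw [if_neg fun h => hjC h.2, rowTerm, ind_of_not hjC, zero_mul]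
  rw [e1, e2]

/-- Given that `j` is selected, the other selected columns are the first `k - 1` of the rest. Their
identity does not depend on the score of `j`. -/
lemma selectedRest_eq {j : Fin n} {ω : Source m n → Y} (hC : C' ⊆ C) (hj : j ∈ C')
    (h : smallSelected H b i u C R τ k ε₁ j ω) : selectedRest H b i u C C' R τ k ε₁ j ω
      = selectedSum H b i u C C' R τ k ε₁ ω - b (ω (noiseSrc u j)) := by
  rw [selectedSum_eq hC h.2, selectedRest, ind_of fun j' hj' => h.2 j' (mem_of_mem_erase hj'),
    ← firstK_erase h.1, ← add_sum_erase _ _ h.1, rowTerm, ind_of hj]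
  ring

/-- This invariance is the reason for the leave-one-out definition: conditionally on everything
except the noise of column `j`, the rest is a constant factor. -/
lemma selectedRest_mix_colBlock (hi : i ∉ C) {j : Fin n} (hj : j ∈ C) (a ω : Source m n → Y) :
    selectedRest H b i u C C' R τ k ε₁ j (mix (colBlock j) a ω)
      = selectedRest H b i u C C' R τ k ε₁ j ω := by
  have hij : i ≠ j := fun e => hi (e ▸ hj)
  unfold selectedRest
  have h1 : (∀ j' ∈ C.erase j, |residMean H b i j' (R j') (mix (colBlock j) a ω)| ≤ ε₁) ↔
      ∀ j' ∈ C.erase j, |residMean H b i j' (R j') ω| ≤ ε₁ := forall₂_congr fun j' hj' => by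
      rw [residMean_mix_colBlock subset_rfl hij (ne_of_mem_erase hj').symm]
  have h2 : firstK (C.erase j) (splitScore H b i u R (mix (colBlock j) a ω)) τ (k - 1)
      = firstK (C.erase j) (splitScore H b i u R ω) τ (k - 1) := firstK_congr fun j' hj' =>
      splitScore_mix_colBlock subset_rfl hij (ne_of_mem_erase hj').symm a ω
  rw [h1, h2, mix_colBlock_row subset_rfl]
  congr 2
  refine sum_congr rfl fun j' hj' => ?_
  unfold rowTerm
  rw [mix_colBlock_noise subset_rfl
    (ne_of_mem_erase (firstK_subset _ _ _ _ hj')).symm, mix_colBlock_row subset_rfl]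

end

/-! ### Normalized inequalities in the large-noise regime. -/

lemma le_log_of_exp_pow_le {x l : ℝ} (k n : ℕ) (h : 2.7182818286 ^ k ≤ x ^ n := by norm_num)
    (hx : 0 < x := by norm_num) (hn : 0 < n := by norm_num) (hl : l * n ≤ k := by norm_num) :
    l ≤ log x := by
  have hn' : (0 : ℝ) < n := by exact_mod_cast hn
  refine ((le_div_iff₀ hn').2 hl).trans ?_
  rw [div_le_iff₀ hn', mul_comm, ← log_pow, le_log_iff_exp_le (by positivity)]
  -- A rational upper bound for `e` turns the bound `k / n ≤ log x` into a comparison of rational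
  -- powers.
  have : exp (k : ℝ) = exp 1 ^ k := by rw [← exp_nat_mul, mul_one]
  rw [this]
  exact (pow_le_pow_left₀ (exp_pos 1).le exp_one_lt_d9.le k).trans h

lemma mul_log_div_le {X a b : ℝ} (ha : 0 < a) (hab : a ≤ b) (hX : 0 < X) :
    a * log (X / a) ≤ a * log (X / b) + (b - a) := by
  have hb : 0 < b := ha.trans_le hab
  have e : log (X / a) = log (X / b) + log (b / a) := by
    rw [← log_mul (by positivity) (by positivity)]
    congr 1
    field_simp
  have h1 := log_le_sub_one_of_pos (show 0 < b / a by positivity)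
  have h2 : a * (b / a - 1) = b - a := by field_simp
  nlinarith

/-- The derivative of `a log (X / a)` is `log (X / a) - 1`, nonnegative while `X / a ≥ e`. -/
lemma mul_log_div_mono {X a b : ℝ} (ha : 0 < a) (hab : a ≤ b) (hX : 0 < X)
    (h : 1 ≤ log (X / b)) : a * log (X / a) ≤ b * log (X / b) := by
  have := mul_log_div_le ha hab hX
  nlinarith

/-- Normalized form of the main part of the error bound. -/
noncomputable def normBound (x α Y : ℝ) : ℝ := 2 * Y * log (2 * x / Y) + α * (Y + 1) ^ 2 + 2

/-- Normalized parameters for which neither the comparison with the optimal neighbours nor the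
crude form of that comparison yields the error bound. -/
structure LargeNoise (x B α r g s d : ℝ) : Prop where
  α_pos : 0 < α
  α_le : α ≤ 0.0435
  x_pos : 0 < x
  B_eq : B = α * x
  x_ge : 92 * B ^ 3 * (2 * B ^ 2 + 1) ≤ x
  r_le : r ≤ 1.16
  r_le' : (r - 1) * (x - 0.605) ≤ 1.461
  s_nonneg : 0 ≤ s
  d_nonneg : 0 ≤ d
  d_le : d ≤ g
  total_le : s + 2 + d ≤ 2 * x
  cap : normBound x α (s + 2 + d) < 1.5 * r * x * B + 0.375 * r * α
  compare : normBound x α (s + 2 + d)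
    < (29 / 12 + 58 / 17 * r) * g + 29 / 17 * r * (s + 1.5 + α / 2)

namespace LargeNoise

variable {x B α r g s d q y t : ℝ} (h : LargeNoise x B α r g s d)

include h

lemma B_pos : 0 < B := by
  rw [h.B_eq]; exact mul_pos h.α_pos h.x_pos

lemma B_le {B₁ x₁ : ℝ} (hx : x ≤ x₁) (hB₁ : 0 ≤ B₁ := by norm_num)
    (hx₁ : x₁ ≤ 92 * B₁ ^ 3 * (2 * B₁ ^ 2 + 1) := by norm_num) : B ≤ B₁ := by
  by_contra hc
  push Not at hc
  have h1 := h.x_ge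
  have h2 : 92 * B₁ ^ 3 * (2 * B₁ ^ 2 + 1) < 92 * B ^ 3 * (2 * B ^ 2 + 1) := by gcongr
  linarith

lemma x_gt {B₀ : ℝ} (hB₀ : 0 ≤ B₀) (hB : B₀ ≤ B) : 92 * B₀ ^ 3 * (2 * B₀ ^ 2 + 1) ≤ x := by
  have := h.B_pos
  refine le_trans ?_ h.x_ge
  gcongr

lemma log_nonneg : 0 ≤ log (2 * x / (s + 2 + d)) := by
  have := h.s_nonneg; have := h.d_nonneg
  refine Real.log_nonneg ?_
  rw [le_div_iff₀ (by linarith)]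
  linarith [h.total_le]

lemma sq_le (Y : ℝ) : α * Y ^ 2 = 4 * (Y / (2 * x)) ^ 2 * (x * B) := by
  have := h.x_pos
  rw [h.B_eq]; field_simp; ring

/-- Write `f` for the ratio of the left side to `2 x`. The quadratic part of the bound is `4 f² x
B`, whereas `cap` allows about `1.5 · 1.16 x B = 1.74 x B`, and `4 · 0.661² > 1.74`. -/
lemma frac_lt : s + 2 + d < 0.661 * (2 * x) := by
  by_contra hc
  push Not at hc
  have hx := h.x_pos
  have h1 := h.cap
  unfold normBound at h1
  have h2 := h.log_nonneg
  have hs := h.s_nonneg; have hd := h.d_nonneg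
  set Y := s + 2 + d with hY
  have hY0 : 0 < Y := by linarith
  have e := h.sq_le Y
  have h3 : 0.661 ≤ Y / (2 * x) := by rw [le_div_iff₀ (by positivity)]; linarith
  have h4 : (0.661 : ℝ) ^ 2 ≤ (Y / (2 * x)) ^ 2 := by gcongr
  have hB := h.B_pos
  have hxB : 0 < x * B := by positivity
  have h5 : 0 ≤ 2 * Y * log (2 * x / Y) := by positivity
  have hr := h.r_le
  have hα := h.α_pos
  nlinarith

lemma log_ge_of_le {f c : ℝ} (hf : s + 2 + d ≤ f * (2 * x)) (hc : c ≤ log (1 / f))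
    (hf0 : 0 < f := by norm_num) : c ≤ log (2 * x / (s + 2 + d)) := by
  have hs := h.s_nonneg; have hd := h.d_nonneg
  refine hc.trans (log_le_log (by positivity) ?_)
  rw [div_le_div_iff₀ hf0 (by linarith)]
  linarith

lemma r_le_of {x₀ r₁ : ℝ} (hx : x₀ ≤ x) (hx0 : 0.605 < x₀ := by norm_num)
    (hr : 1.461 ≤ (r₁ - 1) * (x₀ - 0.605) := by norm_num) : r ≤ r₁ := by
  by_contra hc
  push Not at hc
  have h1 := h.r_le'
  have h3 : 0 < r₁ - 1 := by
    by_contra h4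
    push Not at h4
    nlinarith
  nlinarith

/-- As `1 / 0.3678 ≥ e`, the logarithmic term is increasing on this range, so it is at least its
value at the smallest argument `2`. -/
lemma cap_of_small (hf : s + 2 + d ≤ 0.3678 * (2 * x)) : 4 * log x + 2 < 1.5 * r * x * B := by
  have hx := h.x_pos
  have h1 := h.cap
  unfold normBound at h1
  have hs := h.s_nonneg
  have hd := h.d_nonneg
  have hα := h.α_pos
  have hr := h.r_le
  have hl : 1 ≤ log (2 * x / (s + 2 + d)) := h.log_ge_of_le hf (le_log_of_exp_pow_le 1 1)
  have h2 := mul_log_div_mono (X := 2 * x) two_pos (show 2 ≤ s + 2 + d by linarith)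
    (by positivity) hl
  rw [show 2 * x / 2 = x by ring] at h2
  have h7 : 0.375 * r * α ≤ 1 * α := by gcongr; linarith
  have h8 : 1 * α ≤ α * (s + 2 + d + 1) ^ 2 := by
    rw [one_mul]
    exact le_mul_of_one_le_right hα.le (by nlinarith)
  linarith

/-- Monotone endpoint test for an interval of `x`: the smallest logarithm is compared with the
largest values of `r`, `x` and `B`. -/
lemma not_range (hf : s + 2 + d ≤ 0.3678 * (2 * x)) {x₀ x₁ r₁ B₁ l : ℝ} (h0 : x₀ ≤ x)
    (h1 : x ≤ x₁) (hr : r ≤ r₁) (hB : B ≤ B₁) (hl : l ≤ log x₀) (hx0 : 0 < x₀ := by norm_num)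
    (hfin : 1.5 * r₁ * x₁ * B₁ ≤ 4 * l + 2 := by norm_num) : False := by
  have h2 := h.cap_of_small hf
  have h3 := log_le_log hx0 h0
  have hB0 := h.B_pos
  have hx := h.x_pos
  by_cases hr0 : 0 ≤ r
  · have hx1 : 0 ≤ x₁ := hx.le.trans h1
    have hr1 : 0 ≤ r₁ := hr0.trans hr
    have : 1.5 * r * x * B ≤ 1.5 * r₁ * x₁ * B₁ := by gcongr
    linarith
  · push Not at hr0
    have h5 : 1.5 * r * x * B ≤ 0 := by
      have : 0 < 1.5 * x * B := by positivity
      nlinarith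
    have h6 : 0 ≤ log x := Real.log_nonneg (by linarith [h.total_le, h.s_nonneg, h.d_nonneg])
    linarith

/-- With `f = (s + 2 + d) / (2 x)` in `(0.3678, 0.661)` one has `f log (1 / f) ≥ f (1 - f) ≥ 0.224`.
For `x ≤ 16` the bound `B ≤ 0.48983` is too small for `cap` to hold. -/
lemma sixteen_lt_of_large (hf : 0.3678 * (2 * x) < s + 2 + d) : 16 < x := by
  by_contra hc
  push Not at hc
  have hx := h.x_pos
  have hB := h.B_pos
  have hs := h.s_nonneg
  have hd := h.d_nonneg
  have h1 := h.cap
  unfold normBound at h1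
  have hlt := h.frac_lt
  have hBs : B ≤ 0.48983 := h.B_le hc
  have hr := h.r_le
  have hα := h.α_pos
  have e := h.sq_le (s + 2 + d)
  set Y := s + 2 + d with hY
  have hY2 : 2 ≤ Y := by linarith
  have h2 : 1 - Y / (2 * x) ≤ log (2 * x / Y) := by
    have := one_sub_inv_le_log_of_pos (x := 2 * x / Y) (by positivity)
    rwa [inv_div] at this
  set f := Y / (2 * x) with hfd
  have hYf : Y = f * (2 * x) := by rw [hfd]; field_simp
  have hf1 : 0.3678 < f := by rw [hfd, lt_div_iff₀ (by positivity)]; exact hf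
  have hf2 : f < 0.661 := by rw [hfd, div_lt_iff₀ (by positivity)]; exact hlt
  have h7 : 0.375 * r * α ≤ 1 * α := by gcongr; linarith
  have h10 : 1 * α ≤ α * (2 * Y + 1) := by rw [one_mul]; nlinarith
  have h11 : 1.5 * r * x * B ≤ 1.74 * (x * B) := by
    have : 0 < x * B := by positivity
    nlinarith
  have h12 : 2 * Y * (1 - f) ≤ 2 * Y * log (2 * x / Y) := by gcongr
  have h13 : 2 * Y * (1 - f) = 4 * x * (f * (1 - f)) := by rw [hYf]; ring
  have h14 : 0.224 ≤ f * (1 - f) := by nlinarith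
  have h15 : 0.5408 * (x * B) ≤ 4 * f ^ 2 * (x * B) := by
    have : 0 < x * B := by positivity
    have : 0.1352 ≤ f ^ 2 := by nlinarith
    nlinarith
  have h16 : x * B ≤ x * 0.48983 := by gcongr
  have h17 : 4 * x * 0.224 ≤ 4 * x * (f * (1 - f)) := by gcongr
  linarith

/-- Small `x` forces small `B` through `x_ge`, and then `1.5 r x B` stays below `4 log x + 2`. The
range is cut finely enough for endpoint values of `r`, `x` and `B` to decide each piece. -/
lemma x_ge_sixteen : 16 ≤ x := by
  by_contra hc
  push Not at hc
  have hx := h.x_pos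
  have hf : s + 2 + d ≤ 0.3678 * (2 * x) := by
    by_contra hf
    push Not at hf
    linarith [h.sixteen_lt_of_large hf]
  have hx1 : 1 ≤ x := by have := h.total_le; have := h.s_nonneg; have := h.d_nonneg; linarith
  have hBx : B ≤ 0.0435 * x := by
    rw [h.B_eq]; exact mul_le_mul_of_nonneg_right h.α_le hx.le
  rcases le_or_gt x 5 with h5 | h5
  · exact h.not_range hf (hx0 := one_pos) hx1 h5 h.r_le (by linarith : B ≤ 0.2175) (l := 0)
      (by simp)
  rcases le_or_gt x 8 with h8 | h8
  · exact h.not_range hf h5.le h8 h.r_le (h.B_le (B₁ := 0.4034) h8)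
      (le_log_of_exp_pow_le (l := 3 / 2) 3 2)
  rcases le_or_gt x 12 with h12 | h12
  · exact h.not_range hf h8.le h12 h.r_le (h.B_le (B₁ := 0.4524) h12)
      (le_log_of_exp_pow_le (l := 2 / 1) 2 1)
  rcases le_or_gt x 14 with h14 | h14
  · exact h.not_range hf h12.le h14 (h.r_le_of (r₁ := 1.1283) h12.le) (h.B_le (B₁ := 0.4722) h14)
      (le_log_of_exp_pow_le (l := 49 / 20) 49 20)
  rcases le_or_gt x 15 with h15 | h15
  · exact h.not_range hf h14.le h15 (h.r_le_of (r₁ := 1.1091) h14.le) (h.B_le (B₁ := 0.4813) h15)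
      (le_log_of_exp_pow_le (l := 26 / 10) 26 10)
  rcases le_or_gt x 15.5 with h16 | h16
  · exact h.not_range hf h15.le h16 (h.r_le_of (r₁ := 1.1015) h15.le) (h.B_le (B₁ := 0.4856) h16)
      (le_log_of_exp_pow_le (l := 27 / 10) 27 10)
  · exact h.not_range hf h16.le hc.le (h.r_le_of (r₁ := 1.0982) h16.le)
      (h.B_le (B₁ := 0.48983) hc.le) (le_log_of_exp_pow_le (l := 137 / 50) 137 50)

end LargeNoise

lemma le_log_one_div {y l : ℝ} (k n : ℕ) (h : 2.7182818286 ^ k * y ^ n ≤ 1 := by norm_num)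
    (hy : 0 < y := by norm_num) (hn : 0 < n := by norm_num) (hl : l * n ≤ k := by norm_num) :
    l ≤ log (1 / y) := by
  refine le_log_of_exp_pow_le k n ?_ (by positivity) hn hl
  rwa [div_pow, one_pow, le_div_iff₀ (by positivity)]

/-- Normalized form of the error bound obtained from smoothing with density parameter `θ`. -/
noncomputable def smoothBound (g s d θ : ℝ) : ℝ :=
  17 / 16 * (3 / 2 * (1 / (1 - θ)) * (s + 1.53 + (1 + θ / (1 - θ) / 2) * d)
    + 9 / 8 * (g * (θ / (1 - θ)) ^ 2)) + 0.2

lemma smoothBound_le {g s d θ θ₁ w ψ : ℝ} (hs : 0 ≤ s) (hd : 0 ≤ d) (hg : 0 ≤ g) (hθ : 0 ≤ θ)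
    (hθ₁ : θ ≤ θ₁) (h1 : θ₁ < 1) (hw : θ * g ≤ w) (hψ : 1 ≤ ψ * (1 - θ₁)) :
    smoothBound g s d θ ≤ 17 / 16 * (3 / 2 * ψ * (s + 1.53 + (1 + θ₁ * ψ / 2) * d)
      + 9 / 8 * (w * (θ₁ * ψ ^ 2))) + 0.2 := by
  have h2 : 1 / (1 - θ) ≤ ψ := by
    rw [div_le_iff₀ (by linarith)]
    nlinarith
  have h3 : 0 ≤ 1 / (1 - θ) := by apply div_nonneg <;> linarith
  have hψ0 : 0 ≤ ψ := h3.trans h2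
  have h4 : θ / (1 - θ) = θ * (1 / (1 - θ)) := by ring
  have h5 : θ / (1 - θ) ≤ θ₁ * ψ := by rw [h4]; gcongr; linarith
  have h6 : 0 ≤ θ / (1 - θ) := by rw [h4]; positivity
  have h7 : g * (θ / (1 - θ)) ^ 2 ≤ w * (θ₁ * ψ ^ 2) := by
    have e : g * (θ / (1 - θ)) ^ 2 = (θ * g) * (θ * (1 / (1 - θ)) ^ 2) := by rw [h4]; ring
    rw [e]
    have : 0 ≤ θ₁ := by linarith
    gcongr
    exact (mul_nonneg hθ hg).trans hw
  unfold smoothBound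
  gcongr

namespace LargeNoise

variable {x B α r g s d q y t : ℝ} (h : LargeNoise x B α r g s d)

include h

lemma r_le_near_one : r ≤ 1.095 := h.r_le_of h.x_ge_sixteen

lemma normBound_ge {f₀ l b : ℝ} (hf₀ : 0 ≤ f₀)
    (hf : f₀ * (2 * x) ≤ s + 2 + d) (hl : l ≤ log (2 * x / (s + 2 + d))) (hb : b ≤ B) :
    (2 * l + 2 * f₀ * b) * (s + 2 + d) + 2 ≤ normBound x α (s + 2 + d) := by
  have hs := h.s_nonneg
  have hd := h.d_nonneg
  have hα := h.α_pos
  have hB := h.B_eq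
  unfold normBound
  set Y := s + 2 + d
  have hY : 0 < Y := by positivity
  have h1 : 2 * l * Y ≤ 2 * Y * log (2 * x / Y) := by nlinarith
  have h2 : 2 * f₀ * b * Y ≤ α * Y ^ 2 :=
    calc 2 * f₀ * b * Y ≤ 2 * f₀ * B * Y := by gcongr
      _ = α * (f₀ * (2 * x)) * Y := by rw [hB]; ring
      _ ≤ α * Y * Y := by gcongr
      _ = α * Y ^ 2 := by ring
  nlinarith

/-- Divided by `4 x`, `cap` reads `f₀ l + f₀² B < 0.4107 B`, where `0.4107` rounds up `1.5 · 1.095 /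
4`. A bound that is a fixed fraction of the trivial one is therefore possible only for large `B`. -/
lemma le_B_of_frac {f₀ f₁ l b : ℝ} (hf : f₀ * (2 * x) ≤ s + 2 + d)
    (hf' : s + 2 + d ≤ f₁ * (2 * x)) (hl : l ≤ log (1 / f₁)) (hf₀ : 0 ≤ f₀ := by norm_num)
    (hf₁ : 0 < f₁ := by norm_num) (hl0 : 0 ≤ l := by norm_num) (hb0 : 0 ≤ b := by norm_num)
    (hb : b * (0.4107 - f₀ ^ 2) ≤ f₀ * l := by norm_num) : b ≤ B := by
  by_contra hc
  push Not at hc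
  have hl' := h.log_ge_of_le hf' (hf0 := hf₁) hl
  have h1 := h.cap
  have h2 := h.r_le_near_one
  have hs := h.s_nonneg
  have hd := h.d_nonneg
  have hx := h.x_pos
  have hB := h.B_pos
  have hα := h.α_pos
  have e := h.B_eq
  unfold normBound at h1
  set Y := s + 2 + d
  have hY : 0 < Y := by positivity
  have h3 : 4 * x * (f₀ * l) ≤ 2 * Y * log (2 * x / Y) :=
    calc 4 * x * (f₀ * l) = 2 * (f₀ * (2 * x)) * l := by ring
      _ ≤ 2 * Y * log (2 * x / Y) := by gcongr
  have h4 : 4 * x * (f₀ ^ 2 * B) ≤ α * Y ^ 2 :=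
    calc 4 * x * (f₀ ^ 2 * B) = α * (f₀ * (2 * x)) ^ 2 := by rw [e]; ring
      _ ≤ α * Y ^ 2 := by gcongr
  have h5 : α * (Y + 1) ^ 2 = α * Y ^ 2 + α * (2 * Y + 1) := by ring
  have h6 : 1 * α ≤ α * (2 * Y + 1) := by rw [one_mul]; nlinarith
  have h7 : 0.375 * r * α ≤ 1 * α := by gcongr; linarith
  have h8 : 1.5 * r * x * B ≤ 1.6425 * (x * B) := by
    have : 0 < x * B := by positivity
    nlinarith
  have h9 : 4 * x * (f₀ * l + f₀ ^ 2 * B) < 4 * x * (0.410625 * B) := by linarith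
  have h10 := lt_of_mul_lt_mul_left h9 (by positivity)
  have h11 : 0 < 0.4107 - f₀ ^ 2 := by
    by_contra h12
    push Not at h12
    have := mul_nonneg hf₀ hl0
    nlinarith
  nlinarith

/-- For `r ≤ 1.095` the coefficients in `compare` are at most `6.1526` for `g` and `1.868` for `s`.
If the target grows faster than `1.868 s`, the comparison bound can fail only because of large noise
`g`. -/
lemma noise_ge {c Y₀ : ℝ} (hc : c * (s + 2 + d) + 2 ≤ normBound x α (s + 2 + d)) (hc' : 1.868 ≤ c)
    (hY : Y₀ ≤ s + 2 + d) : (c - 1.868) * Y₀ + 2.893 ≤ 6.1526 * g := by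
  have h1 := h.compare
  have h2 := h.r_le_near_one
  have hs := h.s_nonneg
  have hd := h.d_nonneg
  have hg : 0 ≤ g := hd.trans h.d_le
  have hα := h.α_le
  have hα0 := h.α_pos
  nlinarith

/-- The main estimates when the error bound is a fixed fraction of the trivial one. -/
lemma of_frac_range {f₀ f₁ l b c X : ℝ} (hf : f₀ * (2 * x) ≤ s + 2 + d)
    (hf' : s + 2 + d ≤ f₁ * (2 * x)) (hl : l ≤ log (1 / f₁)) (hf₀ : 0 ≤ f₀ := by norm_num)
    (hf₁ : 0 < f₁ := by norm_num) (hl0 : 0 ≤ l := by norm_num) (hb0 : 0 ≤ b := by norm_num)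
    (hb : b * (0.4107 - f₀ ^ 2) ≤ f₀ * l := by norm_num)
    (hc : c ≤ 2 * l + 2 * f₀ * b := by norm_num) (hc' : 1.868 ≤ c := by norm_num)
    (hX : X ≤ 92 * b ^ 3 * (2 * b ^ 2 + 1) := by norm_num) :
    c * (s + 2 + d) + 2 ≤ normBound x α (s + 2 + d) ∧
      (c - 1.868) * (f₀ * (2 * X)) + 2.893 ≤ 6.1526 * g := by
  have h1 := h.le_B_of_frac (hf₀ := hf₀) (hf₁ := hf₁) hf hf' (hl0 := hl0) hl (hb0 := hb0) (hb := hb)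
  have h2 := h.normBound_ge hf₀ hf (h.log_ge_of_le hf' (hf0 := hf₁) hl) h1
  have h3 := h.x_gt hb0 h1
  have hs := h.s_nonneg
  have hd := h.d_nonneg
  have h4 : c * (s + 2 + d) + 2 ≤ normBound x α (s + 2 + d) := by
    refine le_trans ?_ h2
    gcongr
  refine ⟨h4, h.noise_ge h4 hc' (le_trans ?_ hf)⟩
  have : X ≤ x := hX.trans h3
  gcongr

/-- A large fraction forces large `B`, hence very large `x` through `x_ge`, hence a large target,
and failure of the comparison then needs much noise. The cases trade the logarithmic slope against
the quadratic one. -/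
lemma of_large_frac (hf : 0.17 * (2 * x) ≤ s + 2 + d) :
    (2.7032 * (s + 2 + d) + 2 ≤ normBound x α (s + 2 + d) ∧ 5.2 ≤ g) ∨
    (2.4792 * (s + 2 + d) + 2 ≤ normBound x α (s + 2 + d) ∧ 6 ≤ g) := by
  rcases le_total (s + 2 + d) (0.21 * (2 * x)) with h1 | h1
  · have := h.of_frac_range (b := 0.69) (l := 1.56) (X := 58.9) (c := 3.354) hf h1
      (le_log_one_div 39 25)
    grind
  rcases le_total (s + 2 + d) (0.28 * (2 * x)) with h2 | h2
  · have := h.of_frac_range (b := 0.727) (l := 1.27) (X := 72) (c := 2.845) h1 h2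
      (le_log_one_div 127 100)
    grind
  right
  rcases le_total (s + 2 + d) (0.34 * (2 * x)) with h3 | h3
  · have := h.of_frac_range (b := 0.9) (l := 1.07) (X := 174) (c := 2.6) h2 h3
      (le_log_one_div 107 100)
    grind
  rcases le_total (s + 2 + d) (0.40 * (2 * x)) with h4 | h4
  · have := h.of_frac_range (b := 1.04) (l := 0.91) (X := 300) (c := 2.525) h3 h4
      (le_log_one_div 91 100)
    grind
  rcases le_total (s + 2 + d) (0.45 * (2 * x)) with h5 | h5
  · have := h.of_frac_range (b := 1.26) (l := 0.79) (X := 300) (c := 2.58) h4 h5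
      (le_log_one_div 79 100)
    grind
  rcases le_total (s + 2 + d) (0.53 * (2 * x)) with h6 | h6
  · have := h.of_frac_range (b := 1.36) (l := 0.63) (X := 300) (c := 2.484) h5 h6
      (le_log_one_div 63 100)
    grind
  · have := h.of_frac_range (b := 1.67) (l := 0.41) (X := 300) (c := 2.58) h6 h.frac_lt.le
      (le_log_one_div 41 100)
    have hs := h.s_nonneg
    have hd := h.d_nonneg
    exact ⟨by linarith [this.1], by linarith [this.2]⟩

/-- Here `B ≤ 0.637`, so beyond the stated fraction the logarithmic term alone is nearly `1.5 r x
B`, and the quadratic one pushes the sum above it. -/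
lemma frac_lt_of_x_lt (hx : x < 43) : s + 2 + d ≤ 0.121 * (2 * x) := by
  by_contra hf
  push Not at hf
  have hB : B ≤ 0.637 := h.B_le hx.le
  have h1 := h.cap
  have h2 := h.r_le_near_one
  have hs := h.s_nonneg
  have hd := h.d_nonneg
  have hx0 := h.x_pos
  have hB0 := h.B_pos
  have hα := h.α_pos
  have e := h.B_eq
  have hlt := h.frac_lt
  have hlt' := h.log_ge_of_le hlt.le (c := 0.41) (le_log_one_div 41 100)
  rcases le_total (s + 2 + d) (0.3678 * (2 * x)) with h3 | h3
  · have hl : 1 ≤ log (2 * x / (s + 2 + d)) := h.log_ge_of_le h3 (le_log_of_exp_pow_le 1 1)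
    have h4 := mul_log_div_mono (X := 2 * x) (by positivity) hf.le (by positivity) hl
    have h5 : (211 : ℝ) / 100 ≤ log (1 / 0.121) := le_log_one_div 211 100
    have e1 : 2 * x / (0.121 * (2 * x)) = 1 / 0.121 := by field_simp
    rw [e1] at h4
    unfold normBound at h1
    set Y := s + 2 + d
    have h6 : 0.121 * (2 * x) * (211 / 100) ≤ Y * log (2 * x / Y) := le_trans (by gcongr) h4
    have h7 : 4 * x * (0.121 ^ 2 * B) ≤ α * Y ^ 2 :=
      calc 4 * x * (0.121 ^ 2 * B) = α * (0.121 * (2 * x)) ^ 2 := by rw [e]; ring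
        _ ≤ α * Y ^ 2 := by gcongr
    have h8 : α * (Y + 1) ^ 2 = α * Y ^ 2 + α * (2 * Y + 1) := by ring
    have hY : 2 ≤ Y := by simp only [Y]; linarith
    have h9 : 1 * α ≤ α * (2 * Y + 1) := by rw [one_mul]; nlinarith
    have h10 : 0.375 * r * α ≤ 1 * α := by gcongr; linarith
    have h11 : 1.5 * r * x * B ≤ 1.6425 * (x * B) := by
      have : 0 < x * B := by positivity
      nlinarith
    have h12 : 4 * x * (0.121 * 2.11 + 0.121 ^ 2 * B) < 4 * x * (0.410625 * B) := by linarith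
    have h13 := lt_of_mul_lt_mul_left h12 (by positivity)
    norm_num at h13
    linarith
  · rcases le_total (s + 2 + d) (0.5 * (2 * x)) with h4 | h4
    · have := h.le_B_of_frac (b := 0.68) (l := 0.69) h3 h4 (le_log_one_div 69 100)
      linarith
    · have := h.le_B_of_frac (b := 0.68) (l := 0.41) h4 hlt.le (le_log_one_div 41 100)
      linarith

/-- A lower bound for the noise level when the error bound is a small fraction of the trivial
one. -/
lemma noise_ge_log (hf : s + 2 + d ≤ 0.144 * (2 * x)) {x₀ l : ℝ} (hx : x₀ ≤ x) (hl : l ≤ log x₀)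
    (hx₀ : 0 < x₀ := by norm_num) : 4 * l - 0.843 ≤ 6.1526 * g := by
  have hs := h.s_nonneg
  have hd := h.d_nonneg
  have hx0 := h.x_pos
  have h1 : (1.934 : ℝ) ≤ log (2 * x / (s + 2 + d)) := h.log_ge_of_le hf (le_log_one_div 89 46)
  have h2 := mul_log_div_le (X := 2 * x) two_pos (show 2 ≤ s + 2 + d by linarith) (by positivity)
  rw [show 2 * x / 2 = x by ring] at h2
  have h3 := h.normBound_ge le_rfl (by linarith) le_rfl (le_refl B)
  have h4 := h.noise_ge (c := 2 * log (2 * x / (s + 2 + d))) (by linarith) (by linarith) le_rfl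
  have h5 := log_le_log hx₀ hx
  nlinarith

lemma sq_parameter_le {q B₁ q₁ : ℝ} (hq : q ^ 2 * (2 * B ^ 2 + 1) = 2 * B ^ 2) (hB : B ≤ B₁)
    (hq₁ : 0 ≤ q₁ := by norm_num) (h1 : 2 * B₁ ^ 2 ≤ q₁ ^ 2 * (2 * B₁ ^ 2 + 1) := by norm_num) : q ≤ q₁ := by
  by_contra hc
  push Not at hc
  have hB0 := h.B_pos
  have h2 : q₁ ^ 2 < q ^ 2 := by gcongr
  have h3 : B ^ 2 ≤ B₁ ^ 2 := by gcongr
  have h4 : 0 < 1 - q ^ 2 := by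
    by_contra h5
    push Not at h5
    nlinarith [sq_nonneg B]
  nlinarith

lemma parameter_le_one  (hq : q ^ 2 * (2 * B ^ 2 + 1) = 2 * B ^ 2) : q ≤ 1 :=
  h.sq_parameter_le hq le_rfl (hq₁ := zero_le_one) (h1 := (by linarith))

lemma smoothBound_le_of_le {w ψ θ₁ c : ℝ} (hq : 0 < q) (hg : 1.5 * q ≤ θ₁ * g)
    (hc : c * (s + 2 + d) + 2 ≤ normBound x α (s + 2 + d)) (hw : q ≤ w)
    (hθ₁ : 0 < θ₁ := by norm_num) (hθ1 : θ₁ < 1 := by norm_num)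
    (hψ : 1 ≤ ψ * (1 - θ₁) := by norm_num)
    (h1 : 17 / 16 * (3 / 2 * ψ * (1 + θ₁ * ψ / 2)) ≤ c := by norm_num)
    (h2 : 17 / 16 * (3 / 2 * ψ * 1.53 + 9 / 8 * (1.5 * w * (θ₁ * ψ ^ 2))) + 0.2 ≤ 2 * c + 2 := by norm_num)
    : smoothBound g s d (1.5 * q / g) ≤ normBound x α (s + 2 + d) := by
  have hs := h.s_nonneg
  have hd := h.d_nonneg
  have hg0 : 0 < g := by
    by_contra h3
    push Not at h3
    nlinarith
  have hψ0 : 0 < ψ := by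
    by_contra h3
    push Not at h3
    nlinarith
  have h3 : 1.5 * q / g ≤ θ₁ := by rw [div_le_iff₀ hg0]; exact hg
  have h4 : 1.5 * q / g * g ≤ 1.5 * w := by rw [div_mul_cancel₀ _ hg0.ne']; linarith
  refine (smoothBound_le hs hd hg0.le (by positivity) h3 hθ1 h4 hψ).trans ?_
  have h5 : 17 / 16 * (3 / 2 * ψ) ≤ c := by
    nlinarith
  nlinarith

lemma smoothBound_le_of_small_frac {w c : ℝ} (hq : 0 < q) (hg : 2.885 * q ≤ g) (hw : q ≤ w)
    (hc : c * (s + 2 + d) + 2 ≤ normBound x α (s + 2 + d)) (hc₁ : 4 ≤ c := by norm_num)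
    (hc₂ : c ≤ 5 := by norm_num)
    (hcw : w * (3.75 * (5.1193 - c) + 4.047) + 3.281 ≤ 2 * c := by norm_num)
    (hw1 : w ≤ 1 := by norm_num) : smoothBound g s d (1.5 * q / g) ≤ normBound x α (s + 2 + d) := by
  have hs := h.s_nonneg
  have hd := h.d_nonneg
  -- For small `d` the crude `θ ≤ 0.52` is affordable. For large `d` the inequality `d ≤ g` gives `g
  -- ≥ 3.75 q`, hence `θ ≤ 0.4`.
  rcases le_total d (3.75 * q) with h1 | h1
  · have hg0 : 0 < g := by linarith
    have h3 : 1.5 * q / g ≤ 0.52 := by rw [div_le_iff₀ hg0]; linarith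
    have h4 : 1.5 * q / g * g ≤ 1.5 * q := by rw [div_mul_cancel₀ _ hg0.ne']
    refine (smoothBound_le hs hd hg0.le (by positivity) h3 (by norm_num) h4
      (ψ := 2.08334) (by norm_num)).trans ?_
    nlinarith
  · exact h.smoothBound_le_of_le hq (θ₁ := 0.4) (ψ := 1.66667) (by linarith [h.d_le]) hc hw
      (h1 := by norm_num; linarith) (h2 := by norm_num; linarith)

lemma noise_ge_of_x_ge (hx : 43 ≤ x)
    (hf : 0.099 * (2 * x) ≤ s + 2 + d) (hf' : s + 2 + d ≤ 0.17 * (2 * x)) :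
    3.542 * (s + 2 + d) + 2 ≤ normBound x α (s + 2 + d) ∧ 2.785 ≤ g ∧ (80 ≤ x → 4.7 ≤ g) := by
  have hl : (1.771 : ℝ) ≤ log (2 * x / (s + 2 + d)) := h.log_ge_of_le hf' (le_log_one_div 62 35)
  have h1 := h.normBound_ge le_rfl (by linarith [h.s_nonneg, h.d_nonneg]) hl (le_refl B)
  have h2 : 3.542 * (s + 2 + d) + 2 ≤ normBound x α (s + 2 + d) := by linarith
  refine ⟨h2, ?_, fun h3 => ?_⟩
  · have := h.noise_ge h2 (by norm_num) (Y₀ := 8.514) (by linarith)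
    linarith
  · have := h.noise_ge h2 (by norm_num) (Y₀ := 15.84) (by linarith)
    linarith

lemma mul_parameter_le_of_small_frac
    (hf : s + 2 + d ≤ 0.121 * (2 * x)) (hq : q ^ 2 * (2 * B ^ 2 + 1) = 2 * B ^ 2) :
    2.885 * q ≤ g ∧ (43 ≤ x → 2.3 ≤ g) := by
  have hf' : s + 2 + d ≤ 0.144 * (2 * x) := hf.trans (by have := h.x_pos; gcongr; norm_num)
  have h43 : 43 ≤ x → 2.3 ≤ g := fun h43 => by
    have := h.noise_ge_log hf' h43 (le_log_of_exp_pow_le (l := 3.76) 94 25)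
    linarith
  refine ⟨?_, h43⟩
  have h16 := h.x_ge_sixteen
  rcases le_total x 16.9 with h1 | h1
  · have h2 := h.sq_parameter_le hq (h.B_le (B₁ := 0.4975) h1) (q₁ := 0.5755)
    have h3 := h.noise_ge_log hf' h16 (le_log_of_exp_pow_le (l := 2.7721) 219 79)
    linarith
  rcases le_total x 19 with h19 | h19
  · have h2 := h.sq_parameter_le hq (h.B_le (B₁ := 0.5135) h19) (q₁ := 0.5877)
    have h3 := h.noise_ge_log hf' h1 (le_log_of_exp_pow_le (l := 2.825) 113 40)
    linarith
  rcases le_total x 24 with h24 | h24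
  · have h2 := h.sq_parameter_le hq (h.B_le (B₁ := 0.5467) h24) (q₁ := 0.6118)
    have h3 := h.noise_ge_log hf' h19 (le_log_of_exp_pow_le (l := 2.94) 147 50)
    linarith
  rcases le_total x 32 with h32 | h32
  · have h2 := h.sq_parameter_le hq (h.B_le (B₁ := 0.59) h32) (q₁ := 0.641)
    have h3 := h.noise_ge_log hf' h24 (le_log_of_exp_pow_le (l := 3.16) 79 25)
    linarith
  rcases le_total x 43 with h4 | h4
  · have h2 := h.sq_parameter_le hq (h.B_le (B₁ := 0.637) h4) (q₁ := 0.6694)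
    have h3 := h.noise_ge_log hf' h32 (le_log_of_exp_pow_le (l := 3.44) 86 25)
    linarith
  rcases le_total x 99 with h99 | h99
  · have h2 := h.sq_parameter_le hq (h.B_le (B₁ := 0.785) h99) (q₁ := 0.7431)
    linarith [h43 h4]
  rcases le_total x 226 with h226 | h226
  · have h2 := h.sq_parameter_le hq (h.B_le (B₁ := 0.955) h226) (q₁ := 0.8038)
    have h3 := h.noise_ge_log hf' h99 (le_log_of_exp_pow_le (l := 4.5) 9 2)
    linarith
  · have h2 := h.parameter_le_one hq
    have h3 := h.noise_ge_log hf' h226 (le_log_of_exp_pow_le (l := 5) 5 1)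
    linarith

/-- The noise is large enough for smoothing, and smoothing yields the error bound. -/
lemma smoothBound_le_normBound (hq0 : 0 < q) (hq : q ^ 2 * (2 * B ^ 2 + 1) = 2 * B ^ 2) :
    2.885 * q ≤ g ∧ (43 ≤ x → 2.3 ≤ g) ∧
      smoothBound g s d (1.5 * q / g) ≤ normBound x α (s + 2 + d) := by
  have hq1 := h.parameter_le_one hq
  have hs := h.s_nonneg
  have hd := h.d_nonneg
  rcases lt_or_ge x 43 with hx | hx
  · have hf := h.frac_lt_of_x_lt hx
    obtain ⟨h1, h2⟩ := h.mul_parameter_le_of_small_frac hf hq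
    refine ⟨h1, h2, ?_⟩
    have hl : (4.22 / 2 : ℝ) ≤ log (2 * x / (s + 2 + d)) := h.log_ge_of_le hf
      (le_log_one_div 211 100)
    have h3 := h.normBound_ge le_rfl (by linarith) hl (le_refl B)
    exact h.smoothBound_le_of_small_frac (c := 4.22) (w := 0.6694) hq0 h1
      (h.sq_parameter_le hq (h.B_le (B₁ := 0.637) hx.le)) (by linarith)
  rcases le_total (s + 2 + d) (0.099 * (2 * x)) with hf | hf
  · obtain ⟨h1, h2⟩ := h.mul_parameter_le_of_small_frac
      (hf.trans (by have := h.x_pos; gcongr; norm_num)) hq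
    refine ⟨h1, h2, ?_⟩
    have hl : (4.62 / 2 : ℝ) ≤ log (2 * x / (s + 2 + d)) := h.log_ge_of_le hf
      (le_log_one_div 231 100)
    have h3 := h.normBound_ge le_rfl (by linarith) hl (le_refl B)
    exact h.smoothBound_le_of_small_frac (c := 4.62) (w := 1) hq0 h1 hq1 (by linarith)
  rcases le_total (s + 2 + d) (0.17 * (2 * x)) with hf' | hf'
  · obtain ⟨h1, h2, h3⟩ := h.noise_ge_of_x_ge hx hf hf'
    have h4 : 3.75 * q ≤ g := by
      rcases le_total x 80 with h5 | h5
      · have := h.sq_parameter_le hq (h.B_le (B₁ := 0.745) h5) (q₁ := 0.7255)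
        linarith
      · linarith [h3 h5]
    refine ⟨by linarith, fun _ => by linarith, ?_⟩
    exact h.smoothBound_le_of_le hq0 (θ₁ := 0.4) (ψ := 1.66667) (by linarith) h1 hq1
  rcases h.of_large_frac hf' with ⟨h1, h2⟩ | ⟨h1, h2⟩
  · refine ⟨by linarith, fun _ => by linarith, ?_⟩
    exact h.smoothBound_le_of_le hq0 (θ₁ := 0.28847) (ψ := 1.40543) (by linarith) h1 hq1
  · refine ⟨by linarith, fun _ => by linarith, ?_⟩
    exact h.smoothBound_le_of_le hq0 (θ₁ := 0.25) (ψ := 1.333334) (by linarith) (c := 2.4792) h1 hq1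

/-- For `r = 1` and `x = ∞` the left side is `(1 - t)² + 2 t (1 - t) = 1 - t²`. The term `2.6 / x`
absorbs the corrections from `r ≤ 1 + 1.5185 / x` and from `0.465 / x`. -/
lemma spread_le (ht0 : 0 ≤ t) (ht : t ≤ 1 / 2) :
    r * (1 - t + 0.465 / x) ^ 2 + 2 * t * (1 - t) ≤ (1 - t) * (1 + t + 2.6 / x) := by
  have hx := h.x_ge_sixteen
  have hx0 := h.x_pos
  have h1 : r * (1 - t + 0.465 / x) ^ 2 = r * (1 - t) ^ 2
      + r * (0.93 * (1 - t) + 0.216225 / x) / x := by field_simp; ring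
  have h2 : r ≤ 1 + 1.5185 / x := by
    have h3 := h.r_le'
    rw [← sub_le_iff_le_add', le_div_iff₀ hx0]
    by_contra h4
    push Not at h4
    nlinarith
  have h3 : r * (0.93 * (1 - t) + 0.216225 / x) ≤ 1.05 * (1 - t) := by
    have h4 : 0.216225 / x ≤ 0.0136 := by rw [div_le_iff₀ hx0]; linarith
    have h5 : 0 ≤ 0.93 * (1 - t) + 0.216225 / x := by
      have : 0 ≤ 0.216225 / x := by positivity
      linarith
    calc r * (0.93 * (1 - t) + 0.216225 / x) ≤ 1.095 * (0.93 * (1 - t) + 0.216225 / x) := by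
          gcongr; exact h.r_le_near_one
      _ ≤ 1.05 * (1 - t) := by linarith
  have h4 : r * (1 - t) ^ 2 ≤ (1 + 1.5185 / x) * (1 - t) ^ 2 := by gcongr
  have h5 : r * (0.93 * (1 - t) + 0.216225 / x) / x ≤ 1.05 * (1 - t) / x := by gcongr
  have h6 : 1.5185 / x * (1 - t) ^ 2 ≤ 1.5185 / x * (1 - t) := by
    gcongr
    nlinarith
  have h7 : 1.05 * (1 - t) / x = 1.05 / x * (1 - t) := by ring
  have h8 : 2.6 / x * (1 - t) = 1.5185 / x * (1 - t) + 1.05 / x * (1 - t)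
      + 0.0315 / x * (1 - t) := by ring
  have h9 : 0 ≤ 0.0315 / x * (1 - t) := by
    apply mul_nonneg (by positivity); linarith
  nlinarith

/-- Much noise implies a large share `t ≥ y = |γ| / B` of the noise bound, which lowers the spread
because `1 - t²` decreases. The numbers `1.2715` and `19.56` come from multiplying `3.6` and `55.36`
by `0.3532`. -/
lemma spread_sq_le_of_range {x₀ g₀ y₀ A b X : ℝ} (hy : 0 ≤ y) (hyt : y ≤ t) (ht : t ≤ 1 / 2)
    (hyg : y ^ 2 * (x * B) = g) (hx₀ : x₀ ≤ x) (hg₀ : g₀ ≤ g) (hA : α ≤ A) (hX : x * B ≤ X)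
    (hx0 : 0 < x₀ := by norm_num) (hg0 : 0 < g₀ := by norm_num) (hy0 : 0 ≤ y₀ := by norm_num)
    (hy₀ : y₀ ^ 2 * X ≤ g₀ := by norm_num) (hb : 2.6 ≤ b * x₀ := by norm_num)
    (hfin : ((1 - y₀) * (1 + y₀ + b)) ^ 2 + 19.56 * (A / g₀) ≤ 1.2715 := by norm_num) :
    (r * (1 - t + 0.465 / x) ^ 2 + 2 * t * (1 - t)) ^ 2 ≤ 0.3532 * (3.6 - 55.36 * (α / g)) := by
  have hx := h.x_pos
  have hB := h.B_pos
  have hα := h.α_pos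
  have h1 : y₀ ≤ y := by
    by_contra hc
    push Not at hc
    have h2 : y ^ 2 < y₀ ^ 2 := by gcongr
    have h3 : y ^ 2 * (x * B) < y₀ ^ 2 * (x * B) := by gcongr
    nlinarith
  have h2 := h.spread_le (hy.trans hyt) ht
  have h3 : 2.6 / x ≤ b := by
    have hb0 : 0 ≤ b := by
      by_contra hc
      push Not at hc
      nlinarith
    rw [div_le_iff₀ hx]
    exact hb.trans (by gcongr)
  have hb0 : 0 ≤ b := le_trans (by positivity) h3
  have h4 : (1 - t) * (1 + t + 2.6 / x) ≤ (1 - y₀) * (1 + y₀ + b) := by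
    nlinarith
  have h5 : 0 ≤ α / g := div_nonneg hα.le (hg0.le.trans hg₀)
  have h6 : α / g ≤ A / g₀ := by
    have : 0 ≤ A := hα.le.trans hA
    gcongr
  by_cases hr : 0 ≤ r
  · have h7 : 0 ≤ 2 * t * (1 - t) := by
      apply mul_nonneg <;> linarith
    have h8 : (r * (1 - t + 0.465 / x) ^ 2 + 2 * t * (1 - t)) ^ 2
        ≤ ((1 - y₀) * (1 + y₀ + b)) ^ 2 := by
      have : 0 ≤ r * (1 - t + 0.465 / x) ^ 2 := by positivity
      exact pow_le_pow_left₀ (by linarith) (h2.trans h4) 2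
    linarith
  · exfalso
    push Not at hr
    have h7 := h.cap
    have h8 := h.log_nonneg
    have hs := h.s_nonneg
    have hd := h.d_nonneg
    unfold normBound at h7
    have : 0 ≤ 2 * (s + 2 + d) * log (2 * x / (s + 2 + d)) := by positivity
    have : 0 ≤ α * (s + 2 + d + 1) ^ 2 := by positivity
    have : 0 < x * B := by positivity
    nlinarith

lemma α_le_of_range {x₀ B₁ A : ℝ} (hx : x₀ ≤ x) (hB : B ≤ B₁) (hx₀ : 0 < x₀ := by norm_num)
    (hA : B₁ ≤ A * x₀ := by norm_num) : α ≤ A := by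
  have hx0 := h.x_pos
  have hα := h.α_pos
  have h1 : α * x₀ ≤ A * x₀ := by
    calc α * x₀ ≤ α * x := by gcongr
      _ = B := h.B_eq.symm
      _ ≤ _ := hB.trans hA
  exact le_of_mul_le_mul_right h1 hx₀

lemma α_lt_of_x_ge (hx : 226 ≤ x) : α ≤ 0.0109 := by
  have hB := h.B_pos
  rcases le_total B 0.71 with h1 | h1
  · exact h.α_le_of_range hx h1
  · have h2 := h.x_ge
    have h3 : 92 * B ≤ x := by
      refine le_trans ?_ h2
      have : 92 * B * 1 ≤ 92 * B * (B ^ 2 * (2 * B ^ 2 + 1)) := by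
        gcongr
        have : (0.71 : ℝ) ^ 2 ≤ B ^ 2 := by gcongr
        nlinarith
      linarith
    have h4 := h.B_eq
    nlinarith

lemma spread_sq_le (hy : 0 ≤ y) (hyt : y ≤ t) (ht : t ≤ 1 / 2)
    (hyg : y ^ 2 * (x * B) = g) (hg : 43 ≤ x → 2.3 ≤ g) :
    (r * (1 - t + 0.465 / x) ^ 2 + 2 * t * (1 - t)) ^ 2 ≤ 0.3532 * (3.6 - 55.36 * (α / g)) := by
  have h16 := h.x_ge_sixteen
  have hB := h.B_pos
  rcases lt_or_ge x 43 with hx | hx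
  · have hf' : s + 2 + d ≤ 0.144 * (2 * x) :=
      (h.frac_lt_of_x_lt hx).trans (by have := h.x_pos; gcongr; norm_num)
    rcases le_total x 19 with h19 | h19
    · have h2 := h.B_le (B₁ := 0.5135) h19
      have h3 := h.noise_ge_log hf' h16 (le_log_of_exp_pow_le (l := 2.76) 69 25)
      exact h.spread_sq_le_of_range hy hyt ht hyg h16 (g₀ := 1.657) (by linarith)
        (h.α_le_of_range (A := 0.0321) h16 h2) (X := 19 * 0.5135)
        (by gcongr) (y₀ := 0.412) (b := 0.1625)
    rcases le_total x 24 with h24 | h24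
    · have h2 := h.B_le (B₁ := 0.5467) h24
      have h3 := h.noise_ge_log hf' h19 (le_log_of_exp_pow_le (l := 2.94) 147 50)
      exact h.spread_sq_le_of_range hy hyt ht hyg h19 (g₀ := 1.774) (by linarith)
        (h.α_le_of_range (A := 0.0288) h19 h2) (X := 24 * 0.5467)
        (by gcongr) (y₀ := 0.367) (b := 0.137)
    rcases le_total x 32 with h32 | h32
    · have h2 := h.B_le (B₁ := 0.59) h32
      have h3 := h.noise_ge_log hf' h24 (le_log_of_exp_pow_le (l := 3.16) 79 25)
      exact h.spread_sq_le_of_range hy hyt ht hyg h24 (g₀ := 1.917) (by linarith)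
        (h.α_le_of_range (A := 0.0246) h24 h2) (X := 32 * 0.59)
        (by gcongr) (y₀ := 0.318) (b := 0.1084)
    · have h2 := h.B_le (B₁ := 0.637) hx.le
      have h3 := h.noise_ge_log hf' h32 (le_log_of_exp_pow_le (l := 3.44) 86 25)
      exact h.spread_sq_le_of_range hy hyt ht hyg h32 (g₀ := 2.099) (by linarith)
        (h.α_le_of_range (A := 0.02) h32 h2) (X := 43 * 0.637)
        (by gcongr) (y₀ := 0.276) (b := 0.08125)
  have hg' := hg hx
  rcases le_total x 99 with h99 | h99
  · have h2 := h.B_le (B₁ := 0.785) h99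
    exact h.spread_sq_le_of_range hy hyt ht hyg hx hg'
      (h.α_le_of_range (A := 0.0183) hx h2) (X := 99 * 0.785) (by gcongr) (y₀ := 0.17) (b := 0.0605)
  rcases le_total x 226 with h226 | h226
  · have h2 := h.B_le (B₁ := 0.955) h226
    exact h.spread_sq_le_of_range hy hyt ht hyg h99 hg'
      (h.α_le_of_range (A := 0.0097) h99 h2) le_rfl (y₀ := 0) (hy0 := le_rfl) (b := 0.0263)
  · exact h.spread_sq_le_of_range hy hyt ht hyg h226 hg' (h.α_lt_of_x_ge h226) le_rfl (y₀ := 0)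
      (hy0 := le_rfl) (b := 0.0116)

lemma α_le_mul_parameter
    (hq0 : 0 < q) (hq : q ^ 2 * (2 * B ^ 2 + 1) = 2 * B ^ 2) : α ≤ 0.0194 * (2.885 * q) := by
  have hB := h.B_pos
  have hx := h.x_ge_sixteen
  have hα := h.α_pos
  refine le_of_sq_le_sq ?_ (by positivity)
  have h1 : (2 * B ^ 2 + 1) ≤ 0.006265 * x ^ 2 := by
    rcases le_total B 0.549 with h2 | h2
    · nlinarith
    · have h3 : 15.2 * (2 * B ^ 2 + 1) ≤ x := by
        refine le_trans ?_ h.x_ge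
        gcongr
        have : (0.549 : ℝ) ^ 3 ≤ B ^ 3 := by gcongr
        linarith
      nlinarith
  have h2 : α ^ 2 * (2 * B ^ 2 + 1) ≤ (0.0194 * (2.885 * q)) ^ 2 * (2 * B ^ 2 + 1) := by
    have e : (0.0194 * (2.885 * q)) ^ 2 * (2 * B ^ 2 + 1)
        = (0.0194 * 2.885) ^ 2 * (q ^ 2 * (2 * B ^ 2 + 1)) := by ring
    rw [e, hq]
    calc α ^ 2 * (2 * B ^ 2 + 1) ≤ α ^ 2 * (0.006265 * x ^ 2) := by gcongr
      _ = 0.006265 * B ^ 2 := by rw [h.B_eq]; ring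
      _ ≤ _ := by nlinarith [sq_nonneg B]
  exact le_of_mul_le_mul_right h2 (by positivity)

end LargeNoise

/-! ### Tail exponents and errors in terms of the accuracy `α`. -/

/-- Relations between the bound `B` on the noisy differences, the accuracy `α`, the rate `c` of
the tail bounds and the ratio `r` between the numbers of rows of two columns. -/
structure Scale (B α c r : ℝ) : Prop where
  α_pos : 0 < α
  B_pos : 0 < B
  c_le : c ≤ 1 / 2
  c_mul_le : c * (8 * B ^ 2 * (2 * B ^ 2 + 1)) ≤ 1
  α_le_c : 11.5 * α ≤ c
  r_le : r ≤ 1.16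
  r_le' : (r - 1) * (B / α - 0.605) ≤ 1.461

namespace Scale

variable {B α c r N b : ℝ} (h : Scale B α c r)

include h

lemma c_pos : 0 < c := by linarith [h.α_pos, h.α_le_c]

lemma α_le : α ≤ 0.0435 := by linarith [h.α_le_c, h.c_le]

lemma c_sq_le : c * B ^ 2 ≤ 0.0916 := by
  by_contra hc
  push Not at hc
  have h1 : 0.0916 < 1 / 2 * B ^ 2 := hc.trans_le (by gcongr; exact h.c_le)
  have h2 := h.c_mul_le
  nlinarith

lemma c_quartic_le : 16 * (c * B ^ 4) ≤ 1 := by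
  have h1 : 0 ≤ c * B ^ 2 := by have := h.c_pos; positivity
  have h2 := h.c_mul_le
  linarith

lemma α_quartic_le : 184 * (α * B ^ 4) ≤ 1 := by
  have h1 : 11.5 * α * B ^ 4 ≤ c * B ^ 4 := by gcongr; exact h.α_le_c
  have := h.c_quartic_le
  linarith

lemma α_cube_le : α ^ 3 ≤ 0.0001 := by
  have := h.α_pos
  calc α ^ 3 ≤ 0.0435 ^ 3 := by gcongr; exact h.α_le
    _ ≤ 0.0001 := by norm_num

lemma card_pos (hN : 0.9999 ≤ α ^ 3 * N) : 0 < N := by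
  by_contra hc
  push Not at hc
  have : 0 < α ^ 3 := pow_pos h.α_pos 3
  nlinarith

lemma sq_mul_le : B ^ 2 * α ^ 2 ≤ 0.0007 := by
  have h0 := h.α_pos
  have h1 := h.α_quartic_le
  have h2 := h.α_cube_le
  have h3 : (B ^ 2 * α ^ 2) ^ 2 ≤ 0.0007 ^ 2 := by
    have e : (B ^ 2 * α ^ 2) ^ 2 = (α * B ^ 4) * α ^ 3 := by ring
    rw [e]
    have h4 : α * B ^ 4 ≤ 1 / 184 := by linarith
    have h5 : α ^ 3 ≤ 0.0435 ^ 3 := by gcongr; exact h.α_le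
    calc (α * B ^ 4) * α ^ 3 ≤ 1 / 184 * 0.0435 ^ 3 := by gcongr
      _ ≤ _ := by norm_num
  exact le_of_sq_le_sq h3 (by norm_num)

/-- With `N` of size `α⁻³` the Hoeffding exponent is at least a multiple of `1 / (α B²)`. The slack
`0.9999` leaves room for deleting the row `u`, as `α³ ≤ 0.0001`. -/
lemma exp_mean_le (hN : 0.9999 ≤ α ^ 3 * N) :
    exp (-(N * (α / 2) ^ 2 / (2 * B ^ 2))) ≤ exp (-c / α) := by
  have h0 := h.α_pos
  have h1 := h.B_pos
  rw [exp_le_exp, neg_div, neg_le_neg_iff, div_le_div_iff₀ h0 (by positivity)]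
  have h2 : 8 * (c * B ^ 2) ≤ 0.9999 := by have := h.c_sq_le; linarith
  nlinarith

lemma exp_sq_le (hN : 0.9999 ≤ α ^ 3 * N) :
    exp (-(N * (3 * α / 4) ^ 2 / (8 * B ^ 4))) ≤ exp (-c / α) := by
  have h0 := h.α_pos
  have h1 := h.B_pos
  rw [exp_le_exp, neg_div, neg_le_neg_iff, div_le_div_iff₀ h0 (by positivity)]
  have h2 := h.c_quartic_le
  nlinarith

lemma card_ge (hN : 1 ≤ α ^ 3 * N) : 10000 ≤ N := by
  have h1 := h.α_cube_le
  have h2 := h.card_pos (N := N) (by linarith)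
  nlinarith

lemma mul_sq_le : B * α ^ 2 ≤ 0.00116 := by
  have h0 := h.α_pos
  have hα := h.α_le
  have hsq := h.sq_mul_le
  nlinarith

/-- Largest contribution of the row `u` to a score: a bounded squared deviation divided by at least
`α⁻³` rows is negligible against `α`. -/
lemma score_error_le (hb : 0 ≤ b) (hbB : b ≤ B) (hN : 1 ≤ α ^ 3 * N) :
    (2 * b + α / 2) ^ 2 / N ≤ 0.015 * α := by
  have h0 := h.α_pos
  have hα := h.α_le
  have hsq := h.sq_mul_le
  rw [div_le_iff₀ (by linarith [h.card_ge hN])]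
  have h9 : (2 * b + α / 2) ^ 2 ≤ 8 * B ^ 2 + α ^ 2 / 2 := by
    have : b ^ 2 ≤ B ^ 2 := by gcongr
    nlinarith [sq_nonneg (2 * b - α / 2)]
  have h12 : 0 < α ^ 2 := by positivity
  refine h9.trans (le_of_mul_le_mul_right ?_ h12)
  have h13 : α ^ 2 ≤ 0.0435 ^ 2 := by gcongr
  nlinarith

/-- Bias of one neighbour term: the leave-one-out mean, at most `α / 2`, plus the share of the row
`u` in the full mean. -/
lemma mean_error_le (hbB : b ≤ B) (hN : 1 ≤ α ^ 3 * N) :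
    α / 2 + (2 * b + α / 2) / N ≤ 0.503 * α := by
  have h0 := h.α_pos
  have hsq := h.mul_sq_le
  have h3 := h.α_cube_le
  have h9 : (2 * b + α / 2) / N ≤ 0.003 * α := by
    rw [div_le_iff₀ (by linarith [h.card_ge hN])]
    nlinarith
  linarith

end Scale

/-! ### The main part of the bound and numerical exponentials. -/

/-- Main part of the error bound. -/
noncomputable def mainBound (B α F : ℝ) : ℝ := 2 * F * log (2 * B / F) + (F + α) ^ 2 + 2 * α

/-- If `t = 2 log (M / F)` satisfies `t + F < 1`, then `F (exp t - 1) ≤ (1 - t) (exp t - 1) ≤ t`,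
because `exp t (1 - t) ≤ 1`. Hence `M² = F² exp t ≤ F² + F t`. -/
lemma le_two_mul_log_add_sq_or {F M : ℝ} (hF : 0 < F) (hFM : F ≤ M) :
    F ≤ 2 * F * log (M / F) + F ^ 2 ∨ M ^ 2 ≤ 2 * F * log (M / F) + F ^ 2 := by
  rcases le_or_gt 1 (2 * log (M / F) + F) with h | h
  · left
    nlinarith
  right
  have hM : 0 < M := hF.trans_le hFM
  have h0 : 0 ≤ log (M / F) := log_nonneg (by rwa [one_le_div hF])
  set t := 2 * log (M / F) with ht
  have e : M ^ 2 = F ^ 2 * exp t := by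
    have : exp t = (M / F) ^ 2 := by
      rw [ht, two_mul, exp_add, exp_log (by positivity)]; ring
    rw [this]; field_simp
  have h1 : exp t * (1 - t) ≤ 1 := by
    have h2 := one_sub_le_exp_neg t
    calc exp t * (1 - t) ≤ exp t * exp (-t) := by gcongr
      _ = 1 := by rw [← exp_add]; simp
  have h3 : 1 ≤ exp t := one_le_exp (by positivity)
  have h4 : F * (exp t - 1) ≤ t := by
    nlinarith
  rw [e]
  nlinarith

lemma mainBound_eq {B α x Y : ℝ} (hB : B = α * x) :
    mainBound B α (α * Y) = α * normBound x α Y := by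
  unfold mainBound normBound
  grind

/-- Rational certificate for upper bounds on `exp (-t)`: `exp t ≥ e ^ n (1 + (t - n))` and `e ≥
2.718`. -/
lemma exp_neg_le {t K : ℝ} (n : ℕ) (hK : 0 ≤ K)
    (h : 1 ≤ K * ((2.718 : ℝ) ^ n * (1 + (t - n)))) : exp (-t) ≤ K := by
  have h1 : (2.718 : ℝ) ^ n * (1 + (t - n)) ≤ exp t := by
    have e : exp t = exp 1 ^ n * exp (t - n) := by
      rw [← exp_nat_mul, mul_one, ← exp_add]; congr 1; ring
    have h2 : (2.718 : ℝ) ^ n ≤ exp 1 ^ n := by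
      gcongr
      linarith [exp_one_gt_d9]
    have h3 : 1 + (t - n) ≤ exp (t - n) := by linarith [add_one_le_exp (t - n)]
    rw [e]
    by_cases h4 : 0 ≤ 1 + (t - n)
    · gcongr
    · push Not at h4
      have : (2.718 : ℝ) ^ n * (1 + (t - n)) ≤ 0 :=
        mul_nonpos_of_nonneg_of_nonpos (by positivity) h4.le
      exact this.trans (by positivity)
  rw [exp_neg, inv_le_comm₀ (exp_pos t)]
  · refine le_trans ?_ h1
    rw [inv_le_iff_one_le_mul₀']
    · exact h
    · exact lt_of_le_of_ne hK (fun e => by rw [← e] at h; norm_num at h)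
  · exact lt_of_le_of_ne hK (fun e => by rw [← e] at h; norm_num at h)

/-! ### Choice of parameters for smoothing by the noise. -/

/-- Relations between the parameters used for smoothing by noise of standard deviation `γ`. -/
structure SmoothScale (B α c r γ b₂ q g : ℝ) : Prop where
  scale : Scale B α c r
  r_nonneg : 0 ≤ r
  g_eq : γ ^ 2 = α * g
  γ_le : γ ^ 2 ≤ b₂ ^ 2
  b₂_nonneg : 0 ≤ b₂
  b₂_le : 2 * b₂ ≤ B
  q_pos : 0 < q
  q_eq : q ^ 2 * (2 * B ^ 2 + 1) = 2 * B ^ 2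
  q_le : 2.885 * q ≤ g
  α_le_g : α ≤ 0.0194 * g
  spread : (r * (1 - b₂ / B + 0.465 / (B / α)) ^ 2 + 2 * (b₂ / B) * (1 - b₂ / B)) ^ 2
    ≤ 0.3532 * (3.6 - 55.36 * (α / g))

namespace SmoothScale

variable {B α c r γ b₂ q g N lam : ℝ} (h : SmoothScale B α c r γ b₂ q g)

/-- Ratio between the lower bound on the smoothing variance and `γ ^ 4` times the number of
rows. -/
noncomputable def varRatio (α g : ℝ) : ℝ := 3.6 - 55.3536 * (α / g)

include h

lemma g_pos : 0 < g := by
  linarith [h.q_pos, h.q_le]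

lemma γ_ne : γ ≠ 0 := by
  rintro rfl
  have h1 := h.g_eq
  have := mul_pos h.scale.α_pos h.g_pos
  linarith

lemma γ_fourth : γ ^ 4 = α ^ 2 * g ^ 2 := by
  have : γ ^ 4 = (γ ^ 2) ^ 2 := by ring
  rw [this, h.g_eq]; ring

lemma γ_fourth_pos : 0 < γ ^ 4 := by
  rw [h.γ_fourth]
  have := h.scale.α_pos
  have := h.g_pos
  positivity

lemma le_varRatio : 2.526 ≤ varRatio α g := by
  have h1 : α / g ≤ 0.0194 := by rw [div_le_iff₀ h.g_pos]; exact h.α_le_g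
  unfold varRatio
  linarith

lemma c_quartic_le : 16 * (c * B ^ 4) ≤ q ^ 2 := by
  have h1 := h.scale.c_mul_le
  have h2 := h.q_eq
  nlinarith

/-- Since `γ ^ 4 = α² g²` and `N` is of size `α⁻³`, all powers of `α` cancel, and `16 c B⁴ ≤ q²`
leaves a bound on `λ` of order `q / (B² g)`. The constant is `2.3 / 0.9999`, rounded up. -/
lemma lam_sq_le (hN : 0.9999 ≤ α ^ 3 * N)
    (hlam : lam ^ 2 * (varRatio α g * γ ^ 4 * N) = 2 * (1.15 * c / α)) :
    lam ^ 2 * (16 * B ^ 4 * g ^ 2) * varRatio α g ≤ 2.3003 * q ^ 2 := by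
  have hα := h.scale.α_pos
  have h1 := h.c_quartic_le
  have hv := h.le_varRatio
  rw [h.γ_fourth] at hlam
  have h2 : lam ^ 2 * varRatio α g * g ^ 2 * (α ^ 3 * N) = 2.3 * c := by
    grind
  have h3 : lam ^ 2 * varRatio α g * g ^ 2 * 0.9999 ≤ 2.3 * c := by
    rw [← h2]
    gcongr
  have hB := h.scale.B_pos
  have h4 := mul_le_mul_of_nonneg_left h3 (show 0 ≤ 16 * B ^ 4 by positivity)
  nlinarith [sq_nonneg q]

lemma jump_le : 8 * b₂ * (B - b₂) ≤ 2 * B ^ 2 := by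
  nlinarith [sq_nonneg (B - 2 * b₂)]

lemma jump_nonneg : 0 ≤ 8 * b₂ * (B - b₂) := by
  have := h.b₂_nonneg
  have := h.b₂_le
  apply mul_nonneg (by positivity); linarith

lemma lam_mul_jump_le (hN : 0.9999 ≤ α ^ 3 * N)
    (hlam : lam ^ 2 * (varRatio α g * γ ^ 4 * N) = 2 * (1.15 * c / α)) (hl : 0 ≤ lam) :
    lam * (8 * b₂ * (B - b₂)) ≤ 1 / 6 := by
  have h1 := h.lam_sq_le hN hlam
  have hg := h.g_pos
  have hB := h.scale.B_pos
  have hq := h.q_pos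
  have h2 : lam * (8 * b₂ * (B - b₂)) ≤ lam * (2 * B ^ 2) := mul_le_mul_of_nonneg_left h.jump_le hl
  refine h2.trans (le_of_sq_le_sq ?_ (by norm_num))
  have h3 : (2.885 * q) ^ 2 ≤ g ^ 2 := by gcongr; exact h.q_le
  have h4 : lam ^ 2 * (16 * B ^ 4 * g ^ 2) * 2.526 ≤ 2.3003 * q ^ 2 :=
    le_trans (by gcongr; exact h.le_varRatio) h1
  nlinarith

/-- Window length plus maximal jump, the height of the ramp, in units of `4 B²`; the last factor is
the quantity bounded by `spread`. -/
lemma gap_add_jump : r * (2 * (B - b₂) + 0.93 * α) ^ 2 + 8 * b₂ * (B - b₂) = 4 * B ^ 2 *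
      (r * (1 - b₂ / B + 0.465 / (B / α)) ^ 2 + 2 * (b₂ / B) * (1 - b₂ / B)) := by
  have hB := h.scale.B_pos
  have hα := h.scale.α_pos
  field_simp
  ring

/-- The left side is the window ratio for `ρ = 1 / 4`. After squaring, the constants `1.664² ·
0.3532 · 2.3003` stay below `1.5²`. -/
lemma density_le (hN : 0.9999 ≤ α ^ 3 * N)
    (hlam : lam ^ 2 * (varRatio α g * γ ^ 4 * N) = 2 * (1.15 * c / α)) :
    156 / 125 * (r * (2 * (B - b₂) + 0.93 * α) ^ 2 + 8 * b₂ * (B - b₂)) * lam / (1 - 1 / 4)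
      ≤ 1.5 * q / g := by
  have h1 := h.lam_sq_le hN hlam
  have hg := h.g_pos
  have hB := h.scale.B_pos
  have hα := h.scale.α_pos
  have hq := h.q_pos
  have h2 := h.spread
  rw [h.gap_add_jump]
  set sp := r * (1 - b₂ / B + 0.465 / (B / α)) ^ 2 + 2 * (b₂ / B) * (1 - b₂ / B)
  have h3 : sp ^ 2 ≤ 0.3532 * varRatio α g := by
    have : 0 ≤ α / g := by positivity
    unfold varRatio
    linarith
  rw [le_div_iff₀ hg]
  refine le_of_sq_le_sq ?_ (by positivity)
  have e : (156 / 125 * (4 * B ^ 2 * sp) * lam / (1 - 1 / 4) * g) ^ 2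
      = 1.664 ^ 2 * (sp ^ 2 * (lam ^ 2 * (16 * B ^ 4 * g ^ 2))) := by ring
  rw [e]
  have h4 : sp ^ 2 * (lam ^ 2 * (16 * B ^ 4 * g ^ 2))
      ≤ 0.3532 * varRatio α g * (lam ^ 2 * (16 * B ^ 4 * g ^ 2)) := by gcongr
  nlinarith [sq_nonneg q]

lemma gap_add_jump_le : r * (2 * (B - b₂) + 0.93 * α) ^ 2 + 8 * b₂ * (B - b₂) ≤ 4.52 * B ^ 2 := by
  have h2 := h.spread
  have hB := h.scale.B_pos
  rw [h.gap_add_jump]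
  set sp := r * (1 - b₂ / B + 0.465 / (B / α)) ^ 2 + 2 * (b₂ / B) * (1 - b₂ / B)
  have h3 : 0 ≤ α / g := div_nonneg h.scale.α_pos.le h.g_pos.le
  have h4 : sp ≤ 1.13 := le_of_sq_le_sq (by linarith) (by norm_num)
  nlinarith [sq_nonneg B]

omit h in
-- One unit of the exponent is kept as `exp (-c / α)`; the surplus `ρ - 1` becomes a numerical
-- factor because `c / α ≥ 11.5`.
lemma exp_split {ρ K : ℝ} (h : Scale B α c r) (hρ : 1 ≤ ρ)
    (hK : exp (-((ρ - 1) * 11.5)) ≤ K) : exp (-(ρ * (c / α))) ≤ K * exp (-c / α) := by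
  have hα := h.α_pos
  have h1 : 11.5 ≤ c / α := by rw [le_div_iff₀ hα]; exact h.α_le_c
  have e : -(ρ * (c / α)) = -((ρ - 1) * (c / α)) + -c / α := by ring
  rw [e, exp_add]
  gcongr
  refine le_trans (exp_le_exp.2 ?_) hK
  nlinarith

lemma irregular_le (hN : 0.9999 ≤ α ^ 3 * N) : 2 * exp (-(N * (α / 2) ^ 2 / (2 * (B - b₂) ^ 2)))
        + exp (-(4 * 0.1 ^ 2 * γ ^ 4 * N / (8 * b₂ * (B - b₂)) ^ 2)) ≤ 0.061 * exp (-c / α) := by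
  have hα := h.scale.α_pos
  have hB := h.scale.B_pos
  have hb := h.b₂_nonneg
  have hb' := h.b₂_le
  have hc := h.scale.c_pos
  have hg := h.g_pos
  have hq := h.q_pos
  have hb0 : 0 < b₂ := by
    refine lt_of_le_of_ne hb fun e => ?_
    have h1 := h.γ_le
    have h2 := mul_pos hα hg
    rw [← e, h.g_eq] at h1
    norm_num at h1
    linarith
  have h1 : exp (-(N * (α / 2) ^ 2 / (2 * (B - b₂) ^ 2))) ≤ 0.0162 * exp (-c / α) := by
    refine le_trans (exp_le_exp.2 (neg_le_neg ?_)) (exp_split h.scale (ρ := 1.36)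
      (by norm_num) (exp_neg_le 4 (by norm_num) (by norm_num)))
    have hBb : 0 < B - b₂ := by linarith
    rw [mul_div, div_le_div_iff₀ hα (by positivity)]
    have h2 : c * (B - b₂) ^ 2 ≤ c * B ^ 2 := by gcongr; linarith
    have h3 := h.scale.c_sq_le
    nlinarith
  have h2 : exp (-(4 * 0.1 ^ 2 * γ ^ 4 * N / (8 * b₂ * (B - b₂)) ^ 2)) ≤ 0.0278 * exp (-c / α) := by
    refine le_trans (exp_le_exp.2 (neg_le_neg ?_)) (exp_split h.scale (ρ := 1.33)
      (by norm_num) (exp_neg_le 3 (by norm_num) (by norm_num)))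
    have hJ := h.jump_le
    have hJ0 : 0 < 8 * b₂ * (B - b₂) := by
      apply mul_pos (by positivity); linarith
    rw [mul_div, div_le_div_iff₀ hα (by positivity), h.γ_fourth]
    have h3 : (8 * b₂ * (B - b₂)) ^ 2 ≤ (2 * B ^ 2) ^ 2 := by gcongr
    have h4 := h.c_quartic_le
    have h5 : (2.885 * q) ^ 2 ≤ g ^ 2 := by gcongr; exact h.q_le
    nlinarith
  linarith [exp_pos (-c / α)]

/-- Tail of the mean of the noise of a column. -/
lemma noise_exponent_le (hN : 0.9999 ≤ α ^ 3 * N) : 0.48 * (B ^ 2 / γ ^ 2) * (c / α)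
      ≤ N * (0.43 * α / (2 * γ ^ 2 + 0.43 * α * b₂) * (0.43 * α)
        - (0.43 * α / (2 * γ ^ 2 + 0.43 * α * b₂)) ^ 2 * γ ^ 2) := by
  have hα := h.scale.α_pos
  have hB := h.scale.B_pos
  have hb := h.b₂_nonneg
  have hb' := h.b₂_le
  have hc := h.scale.c_pos
  have hg := h.g_pos
  have hq := h.q_pos
  have hγ : 0 < γ ^ 2 := by rw [h.g_eq]; positivity
  have hNp := h.scale.card_pos hN
  set G := γ ^ 2 with hG
  set p := 0.43 * α * b₂ with hp
  have hp0 : 0 ≤ p := by positivity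
  have h1 : (0.43 * α) ^ 2 / (4 * G + 2 * p) ≤ 0.43 * α / (2 * G + p) * (0.43 * α)
      - (0.43 * α / (2 * G + p)) ^ 2 * G := by
    have e : 0.43 * α / (2 * G + p) * (0.43 * α) - (0.43 * α / (2 * G + p)) ^ 2 * G
        = (0.43 * α) ^ 2 * (G + p) / (2 * G + p) ^ 2 := by field_simp; ring
    rw [e, div_le_div_iff₀ (by positivity) (by positivity), mul_assoc]
    gcongr
    nlinarith
  refine le_trans ?_ (mul_le_mul_of_nonneg_left h1 hNp.le)
  have e : 0.48 * (B ^ 2 / G) * (c / α) = 0.48 * B ^ 2 * c / (G * α) := by field_simp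
  rw [e, mul_div, div_le_div_iff₀ (by positivity) (by positivity)]
  have h2 : c * B ^ 2 ≤ 0.0916 := h.scale.c_sq_le
  have h3 : c * B ^ 3 ≤ 0.08 * q := by
    refine le_of_sq_le_sq ?_ (by positivity)
    have e : (c * B ^ 3) ^ 2 = (c * B ^ 4) * (c * B ^ 2) := by ring
    rw [e]
    have h4 : c * B ^ 4 ≤ q ^ 2 / 16 := by have := h.c_quartic_le; linarith
    calc c * B ^ 4 * (c * B ^ 2) ≤ q ^ 2 / 16 * 0.0916 := by gcongr
      _ ≤ (0.08 * q) ^ 2 := by nlinarith [sq_nonneg q]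
  have h5 : c * B ^ 2 * (2 * p) ≤ 0.0121 * G := by
    have h6 : c * B ^ 2 * (2 * b₂) ≤ c * B ^ 3 := by
      calc c * B ^ 2 * (2 * b₂) ≤ c * B ^ 2 * B := by gcongr
        _ = _ := by ring
    have h7 : c * B ^ 2 * (2 * p) = 0.43 * α * (c * B ^ 2 * (2 * b₂)) := by rw [hp]; ring
    rw [h7, hG, h.g_eq]
    have h8 : c * B ^ 2 * (2 * b₂) ≤ 0.028 * g := by linarith [h.q_le]
    nlinarith
  nlinarith

omit h in
lemma exp_quadratic {w : ℝ} (hw : 4 ≤ w) : exp (-((0.48 * w - 1) * 11.5)) ≤ 1 / (1650 * w ^ 2) := by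
  have h1 : exp (-(2.76 * w - 5.75)) ≤ 1 / (40.7 * w) := by
    refine exp_neg_le 5 (by positivity) ?_
    rw [one_div, inv_mul_eq_div, le_div_iff₀ (by positivity)]
    norm_num
    linarith
  have e : exp (-((0.48 * w - 1) * 11.5)) = exp (-(2.76 * w - 5.75)) ^ 2 := by
    rw [← exp_nat_mul]; congr 1; push_cast; ring
  rw [e]
  calc _ ≤ (1 / (40.7 * w)) ^ 2 := by gcongr
    _ ≤ _ := by
      rw [div_pow, one_pow, mul_pow]
      gcongr
      norm_num

/-- The prefactor `γ ^ 4 / B ^ 4` is wanted because this probability is later divided by a variance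
of order `γ ^ 4 N`. It is extracted from an exponent proportional to `B² / γ²`. -/
lemma noise_tail_le (hN : 0.9999 ≤ α ^ 3 * N) :
    2 * exp (-(N * (0.43 * α / (2 * γ ^ 2 + 0.43 * α * b₂) * (0.43 * α)
        - (0.43 * α / (2 * γ ^ 2 + 0.43 * α * b₂)) ^ 2 * γ ^ 2)))
      ≤ γ ^ 4 / (825 * B ^ 4) * exp (-c / α) := by
  have hB := h.scale.B_pos
  have hγ : 0 < γ ^ 2 := by
    rw [h.g_eq]; exact mul_pos h.scale.α_pos h.g_pos
  have h1 : 4 ≤ B ^ 2 / γ ^ 2 := by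
    rw [le_div_iff₀ hγ]
    have := h.γ_le
    have := h.b₂_le
    have := h.b₂_nonneg
    nlinarith
  have h2 := exp_split h.scale (ρ := 0.48 * (B ^ 2 / γ ^ 2)) (by linarith) (exp_quadratic h1)
  have h3 := (exp_le_exp.2 (neg_le_neg (h.noise_exponent_le hN))).trans h2
  have e : γ ^ 4 / (825 * B ^ 4) * exp (-c / α)
      = 2 * (1 / (1650 * (B ^ 2 / γ ^ 2) ^ 2) * exp (-c / α)) := by
    have := h.γ_ne
    field_simp
    norm_num
  rw [e]
  linarith

/-- The additive term of the window ratio. Its first part is small because `L = 1.15 c / α` exceeds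
`c / α`; in the second, `N`, `γ ^ 4` and `B ^ 4` cancel. -/
lemma remainder_le (hN : 0.9999 ≤ α ^ 3 * N) :
    exp (-(1.15 * c / α)) * (1 + 1.5 * q / g / (2 * (1.15 * c / α)))
      + 12 / 5 * N * (8 * b₂ * (B - b₂) * (r * (2 * (B - b₂) + 0.93 * α) ^ 2
          + 2 * (8 * b₂ * (B - b₂)))) * (γ ^ 4 / (825 * B ^ 4) * exp (-c / α))
        / ((1 - 1 / 4) * (varRatio α g * γ ^ 4 * N)) ≤ 0.24 * exp (-c / α) := by
  have hα := h.scale.α_pos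
  have hB := h.scale.B_pos
  have hg := h.g_pos
  have hq := h.q_pos
  have hNp := h.scale.card_pos hN
  have hγ := h.γ_fourth_pos
  have hv := h.le_varRatio
  have hc1 : 11.5 ≤ c / α := by rw [le_div_iff₀ hα]; exact h.scale.α_le_c
  have h1 : exp (-(1.15 * c / α)) ≤ 0.2134 * exp (-c / α) := by
    have := exp_split h.scale (ρ := 1.15) (by norm_num)
      (exp_neg_le 1 (K := 0.2134) (by norm_num) (by norm_num))
    rwa [← mul_div_assoc] at this
  have h2 : 1 + 1.5 * q / g / (2 * (1.15 * c / α)) ≤ 1.02 := by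
    have h3 : 1.5 * q / g ≤ 0.52 := by rw [div_le_iff₀ hg]; linarith [h.q_le]
    have h4 : 26 ≤ 2 * (1.15 * c / α) := by rw [mul_div_assoc]; linarith
    have h5 : 1.5 * q / g / (2 * (1.15 * c / α)) ≤ 0.02 := by
      rw [div_le_iff₀ (by linarith)]
      linarith
    linarith
  have h3 : exp (-(1.15 * c / α)) * (1 + 1.5 * q / g / (2 * (1.15 * c / α)))
      ≤ 0.2134 * exp (-c / α) * 1.02 := by
    have : 0 ≤ 1 + 1.5 * q / g / (2 * (1.15 * c / α)) := by
      have := h.scale.c_pos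
      positivity
    gcongr
  have hJ := h.jump_le
  have hJ0 := h.jump_nonneg
  have hG := h.gap_add_jump_le
  have hr := h.r_nonneg
  set J := 8 * b₂ * (B - b₂)
  set K := r * (2 * (B - b₂) + 0.93 * α) ^ 2
  have hK : 0 ≤ K := by positivity
  have h4 : J * (K + 2 * J) ≤ 13.04 * B ^ 4 :=
    calc J * (K + 2 * J) ≤ 2 * B ^ 2 * (6.52 * B ^ 2) := by
          gcongr
          linarith
      _ = 13.04 * B ^ 4 := by ring
  have h5 : 12 / 5 * N * (J * (K + 2 * J)) * (γ ^ 4 / (825 * B ^ 4) * exp (-c / α))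
        / ((1 - 1 / 4) * (varRatio α g * γ ^ 4 * N)) ≤ 0.0202 * exp (-c / α) := by
    have e : 12 / 5 * N * (J * (K + 2 * J)) * (γ ^ 4 / (825 * B ^ 4) * exp (-c / α))
        / ((1 - 1 / 4) * (varRatio α g * γ ^ 4 * N))
        = 3.2 * (J * (K + 2 * J)) / (825 * B ^ 4 * varRatio α g) * exp (-c / α) := by
      have : varRatio α g ≠ 0 := by linarith
      have := h.γ_ne
      field_simp
      ring
    rw [e]
    gcongr
    rw [div_le_iff₀ (by positivity)]
    have : 825 * B ^ 4 * 2.526 ≤ 825 * B ^ 4 * varRatio α g := by gcongr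
    nlinarith [pow_pos hB 4]
  nlinarith [exp_pos (-c / α)]

end SmoothScale

/-- Collects the leading term and the remainders of the bound obtained by smoothing. -/
lemma smooth_total_le {k z G ψ ρ Cc e δ b₁ b₂ γ M W S₀ : ℝ} (hk : 1 ≤ k) (hz : 0 ≤ z)
    (hG : 0 ≤ G) (hψ : 1 ≤ ψ) (hρ0 : 0 ≤ ρ) (hρ : ρ ≤ 1.0834) (hCc : 0 ≤ Cc) (he : 0 ≤ e)
    (hδ : δ ≤ 0.0001 * e) (hb₁ : 0 ≤ b₁) (hb₂ : 0 ≤ b₂) (hγ : |γ| ≤ b₂) (hM : M = 2 * (b₁ + 2 * b₂))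
    (hS₀ : 0 ≤ S₀) (hW : 17 / 16 * (3 / 2 * ψ * (z + (1 + ρ / 2) * (G / k)) + 9 / 8 * (G * ρ ^ 2))
      + S₀ ≤ W) (hWM : W ≤ 0.4125 * M ^ 2) : 17 / 16 * ((3 / 2 * (k * z + G * (1 + ρ / 2)) *
          (ψ * (k + Cc * (0.24 * e)) + Cc * (0.061 * e)) + 9 / 8 * (k ^ 2 * (G * ρ ^ 2))
        + 3 / 2 * (Cc * (k * (2 * b₁ + b₂) *
          (|γ| / 2 * (ρ * (0.24 * e + δ) + 0.24 * e) + b₂ * (0.061 * e))))) / k ^ 2) + S₀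
      ≤ W + M ^ 2 * (1 / 4 * e * Cc) := by
  have hk0 : 0 < k := by linarith
  set A := z + (1 + ρ / 2) * (G / k) with hA
  have hA0 : 0 ≤ A := by positivity
  set D := |γ| / 2 * (ρ * (0.24 * e + δ) + 0.24 * e) + b₂ * (0.061 * e) with hD
  have hX : (3 / 2 * (k * z + G * (1 + ρ / 2)) * (ψ * (k + Cc * (0.24 * e)) + Cc * (0.061 * e))
        + 9 / 8 * (k ^ 2 * (G * ρ ^ 2)) + 3 / 2 * (Cc * (k * (2 * b₁ + b₂) * D))) / k ^ 2
      = 3 / 2 * ψ * A + 9 / 8 * (G * ρ ^ 2) + 3 / 2 * A * (ψ * 0.24 + 0.061) * (Cc * e) * (1 / k)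
        + 3 / 2 * (Cc * ((2 * b₁ + b₂) * D)) * (1 / k) := by
    rw [hA]; field_simp; ring
  rw [hX]
  have hk1 : 1 / k ≤ 1 := by rw [div_le_one hk0]; exact hk
  have hk2 : 0 ≤ 1 / k := by positivity
  have hDle : D ≤ b₂ * (0.3112 * e) := by
    have h1 : ρ * (0.24 * e + δ) + 0.24 * e ≤ 1.0834 * (0.2401 * e) + 0.24 * e := by
      gcongr ?_ + _
      calc ρ * (0.24 * e + δ) ≤ ρ * (0.2401 * e) := by gcongr; linarith
        _ ≤ _ := by gcongr
    have h2 : |γ| / 2 * (ρ * (0.24 * e + δ) + 0.24 * e)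
        ≤ b₂ / 2 * (1.0834 * (0.2401 * e) + 0.24 * e) := by
      calc _ ≤ |γ| / 2 * (1.0834 * (0.2401 * e) + 0.24 * e) := by gcongr
        _ ≤ _ := by gcongr
    have h3 : 0 ≤ b₂ * e := by positivity
    rw [hD]
    linarith
  have hP : (2 * b₁ + b₂) * D ≤ M ^ 2 / 12 * (0.3112 * e) := by
    have h1 : (2 * b₁ + b₂) * b₂ ≤ M ^ 2 / 12 := by
      rw [hM]; nlinarith [sq_nonneg (b₁ - b₂)]
    calc (2 * b₁ + b₂) * D ≤ (2 * b₁ + b₂) * (b₂ * (0.3112 * e)) := by gcongr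
      _ = (2 * b₁ + b₂) * b₂ * (0.3112 * e) := by ring
      _ ≤ _ := by gcongr
  have hT3 : 3 / 2 * (Cc * ((2 * b₁ + b₂) * D)) * (1 / k)
      ≤ 3 / 2 * (Cc * (M ^ 2 / 12 * (0.3112 * e))) := by
    calc _ ≤ 3 / 2 * (Cc * (M ^ 2 / 12 * (0.3112 * e))) * (1 / k) := by gcongr
      _ ≤ 3 / 2 * (Cc * (M ^ 2 / 12 * (0.3112 * e))) * 1 := by gcongr
      _ = _ := mul_one _
  have hT1 : 3 / 2 * A * (ψ * 0.24 + 0.061) * (Cc * e) * (1 / k)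
      ≤ 3 / 2 * ψ * A * 0.301 * (Cc * e) := by
    calc _ ≤ 3 / 2 * A * (ψ * 0.24 + 0.061) * (Cc * e) * 1 := by gcongr
      _ ≤ 3 / 2 * A * (ψ * 0.301) * (Cc * e) * 1 := by gcongr; linarith
      _ = _ := by ring
  -- The product of the leading term with the tail is charged to `M²` times the tail, which is
  -- possible because the target is itself below a fraction of `M²`.
  have hAW : 17 / 16 * (3 / 2 * ψ * A) ≤ 0.4125 * M ^ 2 := by
    have : 0 ≤ 9 / 8 * (G * ρ ^ 2) := by positivity
    linarith
  have hE : 0 ≤ Cc * e := by positivity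
  have h1 : 17 / 16 * (3 / 2 * ψ * A * 0.301 * (Cc * e)) ≤ 0.4125 * M ^ 2 * (0.301 * (Cc * e)) := by
    calc _ = 17 / 16 * (3 / 2 * ψ * A) * (0.301 * (Cc * e)) := by ring
      _ ≤ _ := by gcongr
  have h2 : 0 ≤ M ^ 2 * (Cc * e) := by positivity
  grind

namespace LargeNoise

variable {B α r G ζ K θ : ℝ} (h : LargeNoise (B / α) B α r (G / α) (ζ / α) (K / α))

include h

lemma mul_normBound_eq :
    α * normBound (B / α) α (ζ / α + 2 + K / α) = mainBound B α (ζ + 2 * α + K) := by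
  have hα := h.α_pos
  have hs := h.s_nonneg
  have hd := h.d_nonneg
  rw [← mainBound_eq (B := B) (by field_simp)]
  congr 1
  field_simp

/-- A restatement of `cap` with `r ≤ 1.095` and `α ≤ B / 16`: when the crude bound fails, the target
is a definite fraction below the trivial bound. -/
lemma mainBound_le : mainBound B α (ζ + 2 * α + K) ≤ 0.4125 * (2 * B) ^ 2 := by
  have hα := h.α_pos
  rw [← h.mul_normBound_eq]
  have h5 : α ≤ B / 16 := by
    have := h.x_ge_sixteen
    rw [le_div_iff₀ hα] at this
    linarith
  have h6 : α ^ 2 ≤ (B / 16) ^ 2 := by gcongr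
  have h7 := h.r_le_near_one
  have h8 := mul_lt_mul_of_pos_left h.cap hα
  have e : α * (1.5 * r * (B / α) * B + 0.375 * r * α)
      = r * (1.5 * B ^ 2 + 0.375 * α ^ 2) := by field_simp
  nlinarith

lemma smooth_le_mainBound
    (hsm : smoothBound (G / α) (ζ / α) (K / α) θ ≤ normBound (B / α) α (ζ / α + 2 + K / α))
    (hθ : θ < 1) : 17 / 16 * (3 / 2 * (1 / (1 - θ)) * (ζ + 3 * α / 2 + α ^ 2 / 4 + 0.015 * α
        + (1 + θ / (1 - θ) / 2) * K) + 9 / 8 * (G * (θ / (1 - θ)) ^ 2)) + 17 * (0.503 * α) ^ 2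
      ≤ mainBound B α (ζ + 2 * α + K) := by
  have hα := h.α_pos
  have hα' := h.α_le
  rw [← h.mul_normBound_eq]
  refine le_trans ?_ (mul_le_mul_of_nonneg_left hsm hα.le)
  have e : α * smoothBound (G / α) (ζ / α) (K / α) θ
      = 17 / 16 * (3 / 2 * (1 / (1 - θ)) * (ζ + 1.53 * α + (1 + θ / (1 - θ) / 2) * K)
        + 9 / 8 * (G * (θ / (1 - θ)) ^ 2)) + 0.2 * α := by
    have e1 : G / α * α = G := by field_simp
    have e2 : ζ / α * α = ζ := by field_simp
    have e3 : K / α * α = K := by field_simp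
    unfold smoothBound
    grind
  rw [e]
  have h5 : 17 * (0.503 * α) ^ 2 ≤ 0.2 * α := by nlinarith
  have h6 : ζ + 3 * α / 2 + α ^ 2 / 4 + 0.015 * α ≤ ζ + 1.53 * α := by nlinarith
  have : 0 ≤ 1 / (1 - θ) := by apply div_nonneg <;> linarith
  gcongr

end LargeNoise

/-! ### Probabilistic estimates for a fixed pattern and fixed columns. -/

namespace ColumnModel

variable {m n : ℕ} {Y : Type*} [MeasurableSpace Y] {ν : Source m n → Measure Y}
  [∀ s, IsProbabilityMeasure (ν s)] {H : Fin n → Y → ℝ} {b : Y → ℝ} {mu sg : Fin n → ℝ}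
  {b₁ b₂ γ : ℝ} {i j : Fin n} {u : Fin m} {C C' T : Finset (Fin n)} {R : Fin n → Finset (Fin m)}
  {g : Fin n → (Source m n → Y) → Prop} {ε₁ h θ t δ pb ζ α κ c r : ℝ}
  {τ : Equiv.Perm (Fin n)} {k : ℕ} (M : ColumnModel ν H b mu sg b₁ b₂ γ)

include M

lemma bddMeas_noise : BddMeas b := ⟨M.meas_noise, b₂, M.noise_bound⟩

lemma b₂_nonneg : 0 ≤ b₂ := by
  obtain ⟨v⟩ := M.row_nonempty
  have hne : Nonempty Y := (ν (rowSrc v)).nonempty_of_neZero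
  obtain ⟨y⟩ := hne
  exact (abs_nonneg _).trans (M.noise_bound y)

lemma b₁_nonneg (j : Fin n) : 0 ≤ b₁ := by
  obtain ⟨v⟩ := M.row_nonempty
  have hne : Nonempty Y := (ν (rowSrc v)).nonempty_of_neZero
  obtain ⟨y⟩ := hne
  exact (abs_nonneg _).trans (M.diff_bound j y)

lemma bddMeas_diff_add (j : Fin n) : BddMeas (fun y => H j y + mu j) :=
  ⟨(M.meas_diff j).add_const _, b₁, M.diff_bound j⟩

lemma bddMeas_diff (j : Fin n) : BddMeas (H j) := by
  simpa using (M.bddMeas_diff_add j).sub (.const (mu j))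

lemma abs_mu_le (j : Fin n) : |mu j| ≤ b₁ := by
  obtain ⟨v⟩ := M.row_nonempty
  have h := norm_integral_le_of_norm_le_const (μ := ν (rowSrc v))
    (f := fun y => H j y + mu j) (C := b₁) (ae_of_all _ fun y => M.diff_bound j y)
  rw [BddMeas.integral_add (M.bddMeas_diff j) (.const _), M.diff_mean] at h
  simpa using h

lemma abs_diff_le (j : Fin n) (y : Y) :
    |H j y| ≤ 2 * b₁ := by
  have h1 := abs_le.1 (M.diff_bound j y)
  have h2 := abs_le.1 (M.abs_mu_le j)
  exact abs_le.2 ⟨by linarith, by linarith⟩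

lemma sg_le (j : Fin n) : sg j ≤ b₁ ^ 2 := by
  obtain ⟨v⟩ := M.row_nonempty
  have e : ∀ y, (H j y + mu j) ^ 2 = H j y ^ 2 + (2 * mu j * H j y + mu j ^ 2) := fun y => by ring
  have h : ∫ y, (H j y + mu j) ^ 2 ∂(ν (rowSrc v)) ≤ ∫ _, b₁ ^ 2 ∂(ν (rowSrc v)) :=
    BddMeas.integral_mono ((M.bddMeas_diff_add j).pow 2) (.const _) _ fun y =>
      sq_le_sq' (abs_le.1 (M.diff_bound j y)).1 (abs_le.1 (M.diff_bound j y)).2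
  simp only [e] at h
  rw [BddMeas.integral_add ((M.bddMeas_diff j).pow 2)
      (((M.bddMeas_diff j).const_mul _).add (.const _)),
    BddMeas.integral_add ((M.bddMeas_diff j).const_mul _) (.const _), integral_const_mul,
    M.diff_mean, M.diff_var] at h
  simp only [integral_const, probReal_univ, one_smul, mul_zero, zero_add] at h
  linarith [sq_nonneg (mu j)]

lemma sg_nonneg (j : Fin n) : 0 ≤ sg j := by
  obtain ⟨v⟩ := M.row_nonempty
  rw [← M.diff_var v j]
  exact integral_nonneg fun y => sq_nonneg _

lemma gamma_sq_le (j : Fin n) : γ ^ 2 ≤ b₂ ^ 2 := by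
  obtain ⟨v⟩ := M.row_nonempty
  rw [← M.noise_var v j]
  have := BddMeas.integral_mono (M.bddMeas_noise.pow 2) (.const (b₂ ^ 2))
    (ν (noiseSrc v j)) fun y =>
      sq_le_sq' (abs_le.1 (M.noise_bound y)).1 (abs_le.1 (M.noise_bound y)).2
  simpa using this

lemma bddMeas_resid (v : Fin m) : BddMeas (resid H b i j v) :=
  ((M.bddMeas_diff j).coord _ |>.add (M.bddMeas_noise.coord _)).sub (M.bddMeas_noise.coord _)

lemma bddMeas_residMean (R : Finset (Fin m)) : BddMeas (residMean H b i j R) :=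
  (BddMeas.sum R fun v _ => M.bddMeas_resid v).div_const _

lemma bddMeas_residSq (R : Finset (Fin m)) : BddMeas (residSq H b i j R) :=
  (BddMeas.sum R fun v _ => (M.bddMeas_resid v).pow 2).sub
    (((BddMeas.sum R fun v _ => M.bddMeas_resid v).pow 2).div_const _)

lemma abs_resid_le (v : Fin m) (ω : Source m n → Y) :
    |resid H b i j v ω| ≤ 2 * (b₁ + b₂) := by
  have h1 := abs_le.1 (M.abs_diff_le j (ω (rowSrc v)))
  have h2 := abs_le.1 (M.noise_bound (ω (noiseSrc v i)))
  have h3 := abs_le.1 (M.noise_bound (ω (noiseSrc v j)))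
  exact abs_le.2 ⟨by simp only [resid]; linarith, by simp only [resid]; linarith⟩

lemma integral_resid (v : Fin m) : ∫ ω, resid H b i j v ω ∂Pr ν = 0 := by
  simp only [resid]
  rw [BddMeas.integral_sub (((M.bddMeas_diff j).coord _).add (M.bddMeas_noise.coord _))
      (M.bddMeas_noise.coord _),
    BddMeas.integral_add ((M.bddMeas_diff j).coord _) (M.bddMeas_noise.coord _),
    integral_coord ν (M.meas_diff j), integral_coord ν M.meas_noise,
    integral_coord ν M.meas_noise, M.diff_mean, M.noise_mean, M.noise_mean]
  simp

lemma integral_resid_sq (hij : i ≠ j) (v : Fin m) :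
    ∫ ω, resid H b i j v ω ^ 2 ∂Pr ν = sg j + 2 * γ ^ 2 := by
  have hb := M.bddMeas_noise
  have hH := M.bddMeas_diff j
  have e : ∀ ω : Source m n → Y, resid H b i j v ω ^ 2
      = H j (ω (rowSrc v)) ^ 2 + (b (ω (noiseSrc v i)) ^ 2 + (b (ω (noiseSrc v j)) ^ 2
        + (2 * (H j (ω (rowSrc v)) * b (ω (noiseSrc v i)))
        + (-2 * (H j (ω (rowSrc v)) * b (ω (noiseSrc v j)))
        + -2 * (b (ω (noiseSrc v i)) * b (ω (noiseSrc v j))))))) := by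
    intro ω; simp only [resid]; ring
  have h1 := (hH.coord (rowSrc v)).mul (hb.coord (noiseSrc v i))
  have h2 := (hH.coord (rowSrc v)).mul (hb.coord (noiseSrc v j))
  have h3 := (hb.coord (noiseSrc v i)).mul (hb.coord (noiseSrc v j))
  have g5 := (h2.const_mul (-2)).add (h3.const_mul (-2))
  have g4 := (h1.const_mul 2).add g5
  have g3 := ((hb.pow 2).coord (noiseSrc v j)).add g4
  have g2 := ((hb.pow 2).coord (noiseSrc v i)).add g3
  simp only [e]
  rw [BddMeas.integral_add ((hH.pow 2).coord (rowSrc v)) g2,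
    BddMeas.integral_add ((hb.pow 2).coord (noiseSrc v i)) g3,
    BddMeas.integral_add ((hb.pow 2).coord (noiseSrc v j)) g4, BddMeas.integral_add,
    BddMeas.integral_add, integral_const_mul, integral_const_mul, integral_const_mul,
    integral_mul_coord ν hH hb (by simp), integral_mul_coord ν hH hb (by simp),
    integral_mul_coord ν hb hb (by simpa using hij),
    integral_coord ν (g := fun y => H j y ^ 2) ((M.meas_diff j).pow_const 2),
    integral_coord ν (g := fun y => b y ^ 2) (M.meas_noise.pow_const 2),
    integral_coord ν (g := fun y => b y ^ 2) (M.meas_noise.pow_const 2),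
    M.diff_var, M.noise_var, M.noise_var, M.diff_mean, M.noise_mean, M.noise_mean]
  ring

lemma residMean_tail {R : Finset (Fin m)} (hR : R.Nonempty) (hr : 0 ≤ r) :
    (Pr ν).real {ω | r ≤ |residMean H b i j R ω|}
      ≤ 2 * exp (-(#R * r ^ 2 / (2 * (b₁ + 2 * b₂) ^ 2))) := by
  have hc : (0 : ℝ) < #R := by exact_mod_cast hR.card_pos
  have hB := M.bound_pos
  have key := measureReal_abs_sum_sub_ge ν (s := R) (X := resid H b i j)
    (B := residBlock i j) (R := 2 * (b₁ + 2 * b₂)) (r := #R * r) (by linarith)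
    -- Before centring by `mu j` the noisy difference lies between `-(b₁ + 2 b₂)` and `b₁ + 2 b₂`,
    -- so the range is twice that bound wherever the mean is.
    (by positivity) (fun _ => -(b₁ + 2 * b₂) - mu j) hR (fun v _ => (M.bddMeas_resid v).meas)
    (fun v _ ω => by
      have h1 := abs_le.1 (M.diff_bound j (ω (rowSrc v)))
      have h2 := abs_le.1 (M.noise_bound (ω (noiseSrc v i)))
      have h3 := abs_le.1 (M.noise_bound (ω (noiseSrc v j)))
      constructor <;> simp only [resid] <;> linarith)
    (fun v _ => dependsOn_resid H b i j v) (residBlock_disjoint i j _)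
  simp only [M.integral_resid, sub_zero] at key
  refine le_trans (measureReal_mono fun ω hω => ?_) (key.trans (le_of_eq ?_))
  · have hω' : r ≤ |residMean H b i j R ω| := hω
    rw [residMean, abs_div, abs_of_pos hc, le_div_iff₀ hc] at hω'
    grind
  · congr 2
    field_simp

lemma residSq_tail (hij : i ≠ j) {R : Finset (Fin m)} (hR : R.Nonempty) (hr : 0 ≤ r) :
    (Pr ν).real {ω | r ≤ |(∑ v ∈ R, resid H b i j v ω ^ 2) / #R - (sg j + 2 * γ ^ 2)|}
      ≤ 2 * exp (-(#R * r ^ 2 / (8 * (b₁ + 2 * b₂) ^ 4))) := by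
  have hc : (0 : ℝ) < #R := by exact_mod_cast hR.card_pos
  have hB := M.bound_pos
  have hb₂ := M.b₂_nonneg
  have key := measureReal_abs_sum_sub_ge ν (s := R) (X := fun v ω => resid H b i j v ω ^ 2)
    (B := residBlock i j) (R := 4 * (b₁ + 2 * b₂) ^ 2) (r := #R * r) (by positivity)
    (by positivity) (fun _ => 0) hR (fun v _ => ((M.bddMeas_resid v).pow 2).meas) (fun v _ ω => by
      have h1 := abs_le.1 (M.abs_resid_le (i := i) (j := j) v ω)
      refine ⟨sq_nonneg _, ?_⟩
      nlinarith)
    (fun v _ x y hxy => by simp only [dependsOn_resid H b i j v hxy]) (residBlock_disjoint i j _)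
  simp only [M.integral_resid_sq hij] at key
  refine le_trans (measureReal_mono fun ω hω => ?_) (key.trans (le_of_eq ?_))
  · have hω' : r ≤ |(∑ v ∈ R, resid H b i j v ω ^ 2) / #R - (sg j + 2 * γ ^ 2)| := hω
    have e : (∑ v ∈ R, resid H b i j v ω ^ 2) / #R - (sg j + 2 * γ ^ 2)
        = (∑ v ∈ R, (resid H b i j v ω ^ 2 - (sg j + 2 * γ ^ 2))) / #R := by
      rw [sum_sub_distrib, sum_const, nsmul_eq_mul]
      field_simp
    rw [e, abs_div, abs_of_pos hc, le_div_iff₀ hc] at hω'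
    grind
  · congr 2
    field_simp
    ring

lemma bddMeas_nbrTerm (R : Finset (Fin m)) : BddMeas (nbrTerm H b i u j R) :=
  ((M.bddMeas_residMean R).sub ((M.bddMeas_diff j).coord _)).add (M.bddMeas_noise.coord _)

lemma bddMeas_nbrScore (R : Fin n → Finset (Fin m)) : BddMeas (fun ω => nbrScore H b i R ω j) :=
  (M.bddMeas_residSq (R j)).div_const _

lemma bddMeas_residDev (R : Finset (Fin m)) : BddMeas (residDev H b i u j R) :=
  (M.bddMeas_resid u).sub (M.bddMeas_residMean R)

lemma bddMeas_nbrErr (C : Finset (Fin n))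
    (R : Fin n → Finset (Fin m)) (τ : Equiv.Perm (Fin n)) (k : ℕ) :
    BddMeas (nbrErr H b i u C R τ k) :=
  (BddMeas.sum_firstK (fun j _ => (M.bddMeas_nbrScore (i := i) (j := j) R).meas)
    (fun _ _ => M.bddMeas_nbrTerm _) τ k).div_const _

lemma abs_nbrTerm_le {R : Finset (Fin m)}
    (hR : R.Nonempty) (ω : Source m n → Y) : |nbrTerm H b i u j R ω| ≤ 2 * (b₁ + 2 * b₂) := by
  have hc : (0 : ℝ) < #R := by exact_mod_cast hR.card_pos
  have hb₂ := M.b₂_nonneg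
  have e : nbrTerm H b i u j R ω = (∑ v ∈ R, (resid H b i j v ω + mu j)) / #R
      - (H j (ω (rowSrc u)) + mu j) + b (ω (noiseSrc u j)) := by
    rw [sum_add_distrib, sum_const, nsmul_eq_mul]
    unfold nbrTerm residMean
    field_simp
    ring
  have h1 : |(∑ v ∈ R, (resid H b i j v ω + mu j)) / #R| ≤ b₁ + 2 * b₂ := by
    rw [abs_div, abs_of_pos hc, div_le_iff₀ hc]
    refine (abs_sum_le_sum_abs _ _).trans ?_
    refine (sum_le_card_nsmul R _ (b₁ + 2 * b₂) fun v _ => ?_).trans (le_of_eq ?_)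
    · have h1 := abs_le.1 (M.diff_bound j (ω (rowSrc v)))
      have h2 := abs_le.1 (M.noise_bound (ω (noiseSrc v i)))
      have h3 := abs_le.1 (M.noise_bound (ω (noiseSrc v j)))
      refine abs_le.2 ⟨?_, ?_⟩ <;> simp only [resid] <;> linarith
    · rw [nsmul_eq_mul]; ring
  have h1 := abs_le.1 h1
  have h2 := abs_le.1 (M.diff_bound j (ω (rowSrc u)))
  have h3 := abs_le.1 (M.noise_bound (ω (noiseSrc u j)))
  rw [e]
  exact abs_le.2 ⟨by linarith, by linarith⟩

lemma abs_nbrErr_le (hR : ∀ j ∈ C, (R j).Nonempty) (τ : Equiv.Perm (Fin n))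
    (hk : 0 < k) (ω : Source m n → Y) : |nbrErr H b i u C R τ k ω| ≤ 2 * (b₁ + 2 * b₂) := by
  have hk' : (0 : ℝ) < k := by exact_mod_cast hk
  have hB := M.bound_pos
  unfold nbrErr
  rw [abs_div, abs_of_pos hk', div_le_iff₀ hk']
  refine (abs_sum_le_sum_abs _ _).trans ?_
  refine (sum_le_card_nsmul _ _ (2 * (b₁ + 2 * b₂)) fun j hj =>
    M.abs_nbrTerm_le (hR j (firstK_subset _ _ _ _ hj)) ω).trans ?_
  rw [nsmul_eq_mul, mul_comm]
  have : (#(firstK C (nbrScore H b i R ω) τ k) : ℝ) ≤ k := by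
    exact_mod_cast card_firstK_le _ _ _ _
  gcongr

lemma measurableSet_goodCol
    (R : Finset (Fin m)) : MeasurableSet {ω | goodCol H b i sg γ α j R ω} := by
  refine MeasurableSet.inter (measurableSet_le (M.bddMeas_residMean R).abs.meas measurable_const)
    (measurableSet_le (BddMeas.meas ?_) measurable_const)
  exact (((BddMeas.sum R fun v _ => (M.bddMeas_resid v).pow 2).div_const _).sub (.const _)).abs

lemma goodCol_tail (hij : i ≠ j) {R : Finset (Fin m)} (hR : R.Nonempty) {e : ℝ} (hα : 0 ≤ α)
    (h1 : exp (-(#R * (α / 2) ^ 2 / (2 * (b₁ + 2 * b₂) ^ 2))) ≤ e)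
    (h2 : exp (-(#R * (3 * α / 4) ^ 2 / (8 * (b₁ + 2 * b₂) ^ 4))) ≤ e) :
    (Pr ν).real {ω | ¬ goodCol H b i sg γ α j R ω} ≤ 4 * e := by
  have hsub : {ω | ¬ goodCol H b i sg γ α j R ω} ⊆ {ω | α / 2 ≤ |residMean H b i j R ω|} ∪
      {ω | 3 * α / 4 ≤ |(∑ v ∈ R, resid H b i j v ω ^ 2) / #R - (sg j + 2 * γ ^ 2)|} := by
    intro ω hω
    by_contra hc
    simp only [Set.mem_union, Set.mem_ofPred_eq, not_or, not_le] at hc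
    exact hω ⟨hc.1.le, hc.2.le⟩
  refine (measureReal_mono hsub).trans ((measureReal_union_le _ _).trans ?_)
  have k1 := M.residMean_tail (i := i) (j := j) hR (r := α / 2) (by positivity)
  have k2 := M.residSq_tail hij hR (r := 3 * α / 4) (by positivity)
  linarith

lemma integral_sum_noise_sq (S : Finset (Fin n)) :
    ∫ ω, (∑ j ∈ S, b (ω (noiseSrc u j))) ^ 2 ∂Pr ν = #S * γ ^ 2 := by
  classical
  have hb := M.bddMeas_noise
  have hs : ∀ T : Finset (Fin n), BddMeas fun ω : Source m n → Y =>
      ∑ j ∈ T, b (ω (noiseSrc u j)) := fun T => BddMeas.sum T fun j _ => hb.coord _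
  induction S using Finset.induction_on with
  | empty => simp
  | insert a S ha ih =>
    have e : ∀ ω : Source m n → Y, (∑ j ∈ insert a S, b (ω (noiseSrc u j))) ^ 2
        = b (ω (noiseSrc u a)) ^ 2 + ((∑ j ∈ S, b (ω (noiseSrc u j))) ^ 2
          + 2 * ∑ j ∈ S, b (ω (noiseSrc u a)) * b (ω (noiseSrc u j))) := by
      intro ω; rw [sum_insert ha, ← mul_sum]; ring
    have hx : ∀ j, BddMeas fun ω : Source m n → Y =>
        b (ω (noiseSrc u a)) * b (ω (noiseSrc u j)) := fun j =>
      (hb.coord _).mul (hb.coord _)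
    have h0 : ∑ j ∈ S, ∫ ω, b (ω (noiseSrc u a)) * b (ω (noiseSrc u j)) ∂Pr ν = 0 := by
      refine sum_eq_zero fun j hj => ?_
      have : a ≠ j := fun h => ha (h ▸ hj)
      rw [integral_mul_coord ν hb hb (by simpa using this), M.noise_mean, zero_mul]
    simp only [e]
    rw [BddMeas.integral_add ((hb.pow 2).coord (noiseSrc u a))
        (((hs S).pow 2).add ((BddMeas.sum S fun j _ => hx j).const_mul 2)),
      BddMeas.integral_add, ih,
      integral_const_mul, integral_finsetSum _ fun j _ => (hx j).integrable _, h0,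
      integral_coord ν (g := fun y => b y ^ 2) (M.meas_noise.pow_const 2), M.noise_var,
      card_insert_of_notMem ha]
    push_cast; ring

/-- Second moment, over one row, of an average over a fixed set of neighbours. -/
lemma integral_avg_sq_le {S : Finset (Fin n)}
    (hk : 0 < k) (hS : #S = k) {d : Fin n → ℝ} {D z : ℝ} (hd : ∀ j ∈ S, |d j| ≤ D)
    (hz : ∀ j ∈ S, sg j ≤ z) :
    ∫ ω, ((∑ j ∈ S, (d j - H j (ω (rowSrc u)) + b (ω (noiseSrc u j)))) / k) ^ 2
      ∂Pr ν ≤ D ^ 2 + z + γ ^ 2 / k := by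
  have hk' : (0 : ℝ) < k := by exact_mod_cast hk
  have hb := M.bddMeas_noise
  have hHS : BddMeas fun y => ∑ j ∈ S, H j y := BddMeas.sum S fun j _ => M.bddMeas_diff j
  have hbS : BddMeas fun ω : Source m n → Y => ∑ j ∈ S, b (ω (noiseSrc u j)) :=
    BddMeas.sum S fun j _ => hb.coord _
  set c := ∑ j ∈ S, d j with hc
  have e : ∀ ω : Source m n → Y,
      ((∑ j ∈ S, (d j - H j (ω (rowSrc u)) + b (ω (noiseSrc u j)))) / k) ^ 2
      = (c / k) ^ 2 + ((∑ j ∈ S, H j (ω (rowSrc u))) ^ 2 / k ^ 2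
        + ((∑ j ∈ S, b (ω (noiseSrc u j))) ^ 2 / k ^ 2
        + (-(2 * c / k ^ 2) * (∑ j ∈ S, H j (ω (rowSrc u)))
        + ((2 * c / k ^ 2) * (∑ j ∈ S, b (ω (noiseSrc u j)))
        + (-2 / k ^ 2) * ((∑ j ∈ S, H j (ω (rowSrc u))) * ∑ j ∈ S, b (ω (noiseSrc u j))))))) := by
    intro ω
    rw [sum_add_distrib, sum_sub_distrib, ← hc]
    field_simp
    ring
  have hH1 := hHS.coord (rowSrc (n := n) u)
  have hx := hH1.mul hbS
  have g5 := (hbS.const_mul (2 * c / k ^ 2)).add (hx.const_mul (-2 / k ^ 2))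
  have g4 := (hH1.const_mul (-(2 * c / k ^ 2))).add g5
  have g3 := ((hbS.pow 2).div_const (k ^ 2)).add g4
  have g2 := ((hH1.pow 2).div_const (k ^ 2)).add g3
  have i1 : ∫ ω, ∑ j ∈ S, H j (ω (rowSrc u)) ∂Pr ν = 0 := by
    rw [integral_finsetSum _ fun j _ => ((M.bddMeas_diff j).coord _).integrable _]
    refine sum_eq_zero fun j _ => ?_
    rw [integral_coord ν (M.meas_diff j), M.diff_mean]
  have i2 : ∫ ω, ∑ j ∈ S, b (ω (noiseSrc u j)) ∂Pr ν = 0 := by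
    rw [integral_finsetSum _ fun j _ => (hb.coord _).integrable _]
    refine sum_eq_zero fun j _ => ?_
    rw [integral_coord ν M.meas_noise, M.noise_mean]
  have i3 : ∫ ω, (∑ j ∈ S, H j (ω (rowSrc u))) * ∑ j ∈ S, b (ω (noiseSrc u j)) ∂Pr ν = 0 := by
    rw [integral_mul_of_dependsOn ν hH1 hbS (A := {rowSrc u}) (B := {rowSrc u}ᶜ), i1, zero_mul]
    · intro x y h
      have := h (rowSrc u) rfl
      simp only [this]
    · intro x y h
      grind
    · exact disjoint_compl_right
  have i4 : ∫ ω, (∑ j ∈ S, H j (ω (rowSrc u))) ^ 2 ∂Pr ν ≤ k ^ 2 * z := by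
    have h1 : ∫ ω, (∑ j ∈ S, H j (ω (rowSrc u))) ^ 2 ∂Pr ν
        ≤ ∫ ω, k * ∑ j ∈ S, H j (ω (rowSrc u)) ^ 2 ∂Pr ν := by
      refine BddMeas.integral_mono (hH1.pow 2) ((BddMeas.sum S fun j _ =>
        ((M.bddMeas_diff j).pow 2).coord _).const_mul _) _ fun ω => ?_
      rw [← hS]; exact sq_sum_le_card_mul_sum_sq
    refine h1.trans ?_
    rw [integral_const_mul, integral_finsetSum _ fun j _ =>
      (((M.bddMeas_diff j).pow 2).coord (rowSrc u)).integrable _]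
    have h2 : ∑ j ∈ S, ∫ ω, H j (ω (rowSrc u)) ^ 2 ∂Pr ν ≤ k * z := by
      rw [← hS, ← nsmul_eq_mul]
      refine sum_le_card_nsmul _ _ _ fun j hj => ?_
      rw [integral_coord ν (g := fun y => H j y ^ 2) ((M.meas_diff j).pow_const 2), M.diff_var]
      exact hz j hj
    nlinarith
  have hc2 : (c / k) ^ 2 ≤ D ^ 2 := by
    have : |c / k| ≤ D := by
      rw [abs_div, abs_of_pos hk', div_le_iff₀ hk', mul_comm]
      refine (abs_sum_le_sum_abs _ _).trans ?_
      refine (sum_le_card_nsmul _ _ D hd).trans (le_of_eq ?_)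
      rw [nsmul_eq_mul, hS]
    exact sq_le_sq' (abs_le.1 this).1 (abs_le.1 this).2
  simp only [e]
  rw [BddMeas.integral_add, BddMeas.integral_add, BddMeas.integral_add, BddMeas.integral_add,
    BddMeas.integral_add,
    integral_const_mul, integral_const_mul, integral_const_mul, i1, i2, i3, integral_div,
    integral_div, M.integral_sum_noise_sq, hS]
  simp only [integral_const, probReal_univ, one_smul, mul_zero, add_zero]
  have h3 : (∫ ω, (∑ j ∈ S, H j (ω (rowSrc u))) ^ 2 ∂Pr ν) / (k : ℝ) ^ 2 ≤ z := by
    rw [div_le_iff₀ (by positivity)]; linarith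
  have h4 : (k : ℝ) * γ ^ 2 / k ^ 2 = γ ^ 2 / k := by field_simp
  rw [h4]
  linarith

/-- Mean squared error at an unobserved entry. -/
lemma integral_nbrErr_sq_le_of_notMem (hR : ∀ j ∈ C, 2 ≤ #(R j))
    (hu : ∀ j ∈ C, u ∉ R j) (τ : Equiv.Perm (Fin n)) (hk : 0 < k) (hT : T ⊆ C)
    (hTk : k ≤ #T) {e : ℝ} (hα : 0 ≤ α) (hκ0 : 0 ≤ κ) (hζ0 : 0 ≤ ζ) (hζ : ∀ j ∈ T, sg j ≤ ζ)
    (hκ : ∀ j ∈ C, (sg j + 2 * γ ^ 2 + 3 * α / 4) / (#(R j) - 1) ≤ κ)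
    (he : ∀ j ∈ C, (Pr ν).real {ω | ¬ goodCol H b i sg γ α j (R j) ω} ≤ 4 * e) :
    ∫ ω, nbrErr H b i u C R τ k ω ^ 2 ∂Pr ν
      ≤ (ζ + 3 * α / 2 + α ^ 2 / 4 + κ) + γ ^ 2 / k + α ^ 2 / 4
        + (2 * (b₁ + 2 * b₂)) ^ 2 * (4 * e * #C) := by
  have hRn : ∀ j ∈ C, (R j).Nonempty := fun j hj => card_pos.1 (by have := hR j hj; omega)
  refine integral_le_of_good ν ((M.bddMeas_nbrErr C R τ k).pow 2) (by positivity) (sq_nonneg _)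
    (fun ω => ?_) (rowBlock u) C (g := fun j => goodCol H b i sg γ α j (R j))
    (fun j _ => M.measurableSet_goodCol _) he fun ω hω => ?_
  · have := abs_le.1 (M.abs_nbrErr_le (i := i) (u := u) hRn τ hk ω)
    exact sq_le_sq' this.1 this.2
  set S := firstK C (nbrScore H b i R ω) τ k with hS
  -- Row `u` belongs to no overlap, so the selection is frozen while row `u` is averaged over; a
  -- fixed average remains.
  have hSmix : ∀ a, firstK C (nbrScore H b i R (mix (rowBlock u) a ω)) τ k = S := by
    intro a
    have : ∀ j ∈ C, nbrScore H b i R (mix (rowBlock u) a ω) j = nbrScore H b i R ω j :=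
      fun j hj => by unfold nbrScore; rw [residSq_mix_rowBlock (hu j hj)]
    exact firstK_congr this
  have hScard : #S = k := card_firstK (hTk.trans (card_le_card hT))
  have key := M.integral_avg_sq_le (u := u) hk hScard (d := fun j => residMean H b i j (R j) ω)
    (D := α / 2) (z := ζ + 3 * α / 2 + α ^ 2 / 4 + κ)
    (fun j hj => (hω j (firstK_subset _ _ _ _ hj)).1) (fun j hj => ?_)
  · refine le_trans (le_of_eq ?_) (key.trans (by nlinarith))
    refine integral_congr_ae (ae_of_all _ fun a => ?_)
    simp only [nbrErr, hSmix a]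
    congr 2
    refine sum_congr rfl fun j hj => ?_
    have hjC := firstK_subset _ _ _ _ hj
    unfold nbrTerm
    rw [residMean_mix_rowBlock (hu j hjC), mix_of_mem (by exact Or.inl rfl),
      mix_of_mem (by exact Or.inr ⟨j, rfl⟩)]
  · refine sg_le_of_mem_firstK hRn hT hTk hζ hω (fun j hj => ?_) (fun j hj => ?_) hj
    · have h2 : (2 : ℝ) ≤ #(R j) := by exact_mod_cast hR j hj
      unfold nbrScore
      exact div_le_div_of_nonneg_left (residSq_nonneg _ _ _ _ _ _) (by linarith) (by linarith)
    · have h2 : (2 : ℝ) ≤ #(R j) := by exact_mod_cast hR j hj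
      have h3 := ((hω j hj).residSq_bounds (hRn j hj)).1
      -- Effect of the divisor `N - 1` instead of `N`, absorbed in `κ`.
      have h4 : nbrScore H b i R ω j = residSq H b i j (R j) ω / #(R j)
          + residSq H b i j (R j) ω / #(R j) / (#(R j) - 1) := by
        unfold nbrScore
        grind
      rw [h4]
      have : residSq H b i j (R j) ω / #(R j) / (#(R j) - 1) ≤ κ := by
        refine le_trans ?_ (hκ j hj)
        gcongr
        linarith
      linarith

/-- Second moment, over one row, of the deviation from a fixed number. -/
lemma integral_resid_sub_sq (hij : i ≠ j) (d : ℝ) :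
    ∫ ω, (resid H b i j u ω - d) ^ 2 ∂Pr ν = sg j + 2 * γ ^ 2 + d ^ 2 := by
  have e : ∀ ω : Source m n → Y, (resid H b i j u ω - d) ^ 2
      = resid H b i j u ω ^ 2 + ((-2 * d) * resid H b i j u ω + d ^ 2) := fun ω => by ring
  have hr := M.bddMeas_resid (i := i) (j := j) u
  simp only [e]
  rw [BddMeas.integral_add, BddMeas.integral_add, integral_const_mul, M.integral_resid,
    M.integral_resid_sq hij]
  simp

/-- Mean squared error at an observed entry, from the optimality of the selected columns. -/
lemma integral_nbrErr_sq_le_of_mem (hR : ∀ j ∈ C, 2 ≤ #(R j))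
    (hi : i ∉ C) (hu : ∀ j ∈ C, u ∈ R j) (τ : Equiv.Perm (Fin n)) (hk : 0 < k)
    (hT : T ⊆ C) (hTk : k ≤ #T) {e z w : ℝ} (hw : 0 < w) (hr : 0 ≤ r)
    (hrR : ∀ j ∈ C, ∀ j' ∈ C, (#(R j) : ℝ) ≤ r * #(R j')) (hζ : ∀ j ∈ T, sg j ≤ ζ) (hz0 : 0 ≤ z)
    (hz : ∀ j ∈ C, sg j ≤ ζ + 3 * α / 2 + α ^ 2 / 4 → sg j ≤ z) (he : ∀ j ∈ C,
      (Pr ν).real {ω | ¬ goodCol H b i sg γ α j ((R j).erase u) ω} ≤ 4 * e) :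
    ∫ ω, nbrErr H b i u C R τ k ω ^ 2 ∂Pr ν
      ≤ (1 + w) * γ ^ 2 + (1 + 1 / w) * (r * (z + 2 * γ ^ 2 + α ^ 2 / 4))
        + (2 * (b₁ + 2 * b₂)) ^ 2 * (4 * e * #C) := by
  have hk' : (0 : ℝ) < k := by exact_mod_cast hk
  have hRn : ∀ j ∈ C, (R j).Nonempty := fun j hj => card_pos.1 (by have := hR j hj; omega)
  have hRe : ∀ j ∈ C, ((R j).erase u).Nonempty := fun j hj =>
    card_pos.1 (by rw [card_erase_of_mem (hu j hj)]; have := hR j hj; omega)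
  have hkC : k ≤ #C := hTk.trans (card_le_card hT)
  refine integral_le_of_good ν ((M.bddMeas_nbrErr C R τ k).pow 2) (by positivity) (sq_nonneg _)
    (fun ω => ?_) (rowBlock u) C (g := fun j => goodCol H b i sg γ α j ((R j).erase u))
    (fun j _ => M.measurableSet_goodCol _) he fun ω hω => ?_
  · have := abs_le.1 (M.abs_nbrErr_le (i := i) (u := u) hRn τ hk ω)
    exact sq_le_sq' this.1 this.2
  set σ : Fin n → ℝ := fun j => residSq H b i j ((R j).erase u) ω / (#(R j) - 1) with hσ
  set S' := firstK C σ τ k with hS'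
  have hS'C : S' ⊆ C := firstK_subset _ _ _ _
  have hS'card : #S' = k := card_firstK hkC
  set x : Fin n → (Source m n → Y) → ℝ := fun j a =>
    resid H b i j u a - residMean H b i j ((R j).erase u) ω with hx
  have hxdev : ∀ a, ∀ j, residDev H b i u j ((R j).erase u) (mix (rowBlock u) a ω) = x j a := by
    intro a j
    simp only [hx, residDev]
    rw [residMean_mix_rowBlock (notMem_erase _ _)]
    congr 1
    simp only [resid]
    rw [mix_of_mem (by exact Or.inl rfl), mix_of_mem (by exact Or.inr ⟨i, rfl⟩),
      mix_of_mem (by exact Or.inr ⟨j, rfl⟩)]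
  have hxb : ∀ j, BddMeas (x j) := fun j => (M.bddMeas_resid u).sub (.const _)
  have hpt : ∀ a, nbrErr H b i u C R τ k (mix (rowBlock u) a ω) ^ 2
      ≤ (1 + w) * b (a (noiseSrc u i)) ^ 2 + ((1 + 1 / w) * r / k) * ∑ j ∈ S', x j a ^ 2 := by
    intro a
    set ω' := mix (rowBlock u) a ω with hω'
    set S := firstK C (nbrScore H b i R ω') τ k with hS
    have hSC : S ⊆ C := firstK_subset _ _ _ _
    have hScard : #S = k := card_firstK hkC
    have hsc : ∀ j ∈ C, nbrScore H b i R ω' j = σ j + x j a ^ 2 / #(R j) := by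
      intro j hj
      rw [nbrScore_erase (hu j hj) (hR j hj), hxdev, residSq_mix_rowBlock (notMem_erase _ _)]
    -- `S` minimises the total full score and `S'` the total leave-one-out part; the difference of
    -- the two relations is this inequality. `S'` does not depend on row `u`, so the right side can
    -- be averaged over that row.
    have hopt : ∑ j ∈ S, x j a ^ 2 / #(R j) ≤ ∑ j ∈ S', x j a ^ 2 / #(R j) := by
      have h1 : ∑ j ∈ S, nbrScore H b i R ω' j ≤ ∑ j ∈ S', nbrScore H b i R ω' j :=
        sum_firstK_le hS'C hS'card
      have h2 : ∑ j ∈ S', σ j ≤ ∑ j ∈ S, σ j := sum_firstK_le hSC hScard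
      rw [sum_congr rfl fun j hj => hsc j (hSC hj),
        sum_congr rfl fun j hj => hsc j (hS'C hj), sum_add_distrib, sum_add_distrib] at h1
      linarith
    have hcomp : ∑ j ∈ S, x j a ^ 2 ≤ r * ∑ j ∈ S', x j a ^ 2 := by
      have hSne : S.Nonempty := card_pos.1 (by omega)
      obtain ⟨j₀, hj₀, hmax⟩ := exists_max_image S (fun j => (#(R j) : ℝ)) hSne
      have hN : (0 : ℝ) < #(R j₀) := by
        exact_mod_cast (hRn j₀ (hSC hj₀)).card_pos
      have h1 : ∑ j ∈ S, x j a ^ 2 ≤ #(R j₀) * ∑ j ∈ S, x j a ^ 2 / #(R j) := by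
        rw [mul_sum]
        refine sum_le_sum fun j hj => ?_
        have hNj : (0 : ℝ) < #(R j) := by exact_mod_cast (hRn j (hSC hj)).card_pos
        rw [mul_div_assoc', le_div_iff₀ hNj, mul_comm]
        exact mul_le_mul_of_nonneg_right (hmax j hj) (sq_nonneg _)
      have h2 : #(R j₀) * ∑ j ∈ S', x j a ^ 2 / #(R j) ≤ r * ∑ j ∈ S', x j a ^ 2 := by
        rw [mul_sum, mul_sum]
        refine sum_le_sum fun j hj => ?_
        have hNj : (0 : ℝ) < #(R j) := by exact_mod_cast (hRn j (hS'C hj)).card_pos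
        rw [mul_div_assoc', div_le_iff₀ hNj]
        nlinarith [hrR j₀ (hSC hj₀) j (hS'C hj), sq_nonneg (x j a)]
      have := mul_le_mul_of_nonneg_left hopt hN.le
      linarith
    set t := (∑ j ∈ S, x j a * (((#(R j) : ℝ) - 1) / #(R j))) / k with ht
    have herr : nbrErr H b i u C R τ k ω' = b (a (noiseSrc u i)) - t := by
      have h1 : ∀ j ∈ S, nbrTerm H b i u j (R j) ω' = b (a (noiseSrc u i))
          - x j a * (((#(R j) : ℝ) - 1) / #(R j)) := by
        intro j hj
        rw [nbrTerm_erase (hu j (hSC hj)) (hR j (hSC hj)), hxdev, hω',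
          mix_of_mem (by exact Or.inr ⟨i, rfl⟩)]
      unfold nbrErr
      rw [← hS, sum_congr rfl h1, sum_sub_distrib, sum_const, hScard, nsmul_eq_mul, ht]
      field_simp
    have ht2 : t ^ 2 ≤ (∑ j ∈ S, x j a ^ 2) / k := by
      rw [ht, div_pow, div_le_div_iff₀ (by positivity) hk']
      have h1 : (∑ j ∈ S, x j a * (((#(R j) : ℝ) - 1) / #(R j))) ^ 2 ≤ k * ∑ j ∈ S, x j a ^ 2 := by
        refine (sq_sum_le_card_mul_sum_sq (s := S)).trans ?_
        rw [hScard]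
        refine mul_le_mul_of_nonneg_left (sum_le_sum fun j hj => ?_) hk'.le
        have hNj : (2 : ℝ) ≤ #(R j) := by exact_mod_cast hR j (hSC hj)
        rw [mul_pow]
        have h1 : (((#(R j) : ℝ) - 1) / #(R j)) ≤ 1 := by
          rw [div_le_one (by linarith)]; linarith
        have h0 : 0 ≤ (((#(R j) : ℝ) - 1) / #(R j)) := div_nonneg (by linarith) (by linarith)
        nlinarith [sq_nonneg (x j a), mul_le_one₀ h1 h0 h1]
      nlinarith
    have hyoung : (b (a (noiseSrc u i)) - t) ^ 2
        ≤ (1 + w) * b (a (noiseSrc u i)) ^ 2 + (1 + 1 / w) * t ^ 2 := by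
      have : 0 ≤ (w * b (a (noiseSrc u i)) + t) ^ 2 / w := by positivity
      have e : (w * b (a (noiseSrc u i)) + t) ^ 2 / w
          = (1 + w) * b (a (noiseSrc u i)) ^ 2 + (1 + 1 / w) * t ^ 2
            - (b (a (noiseSrc u i)) - t) ^ 2 := by
        field_simp; ring
      linarith
    rw [herr]
    refine hyoung.trans ?_
    have h3 : t ^ 2 ≤ r / k * ∑ j ∈ S', x j a ^ 2 := by
      refine ht2.trans ?_
      rw [div_mul_eq_mul_div]
      gcongr
    have h4 : (1 + 1 / w) * t ^ 2 ≤ (1 + 1 / w) * (r / k * ∑ j ∈ S', x j a ^ 2) := by gcongr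
    grind
  have hsum : BddMeas fun a => ∑ j ∈ S', x j a ^ 2 := by fun_prop
  refine (BddMeas.integral_mono (((M.bddMeas_nbrErr C R τ k).pow 2).comp
    (measurable_mix_left _ _)) ((((M.bddMeas_noise.pow 2).coord (noiseSrc u i)).const_mul
      (1 + w)).add (hsum.const_mul ((1 + 1 / w) * r / k))) _ hpt).trans ?_
  rw [BddMeas.integral_add (((M.bddMeas_noise.pow 2).coord (noiseSrc u i)).const_mul (1 + w))
      (hsum.const_mul _), integral_const_mul, integral_const_mul,
    integral_coord ν (g := fun y => b y ^ 2) (M.meas_noise.pow_const 2), M.noise_var,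
    integral_finsetSum _ fun j _ => ((hxb j).pow 2).integrable _]
  have hbound : ∑ j ∈ S', ∫ a, x j a ^ 2 ∂Pr ν ≤ k * (z + 2 * γ ^ 2 + α ^ 2 / 4) := by
    rw [← hS'card, ← nsmul_eq_mul]
    refine sum_le_card_nsmul _ _ _ fun j hj => ?_
    have hjC := hS'C hj
    have hij : i ≠ j := fun h => hi (h ▸ hjC)
    simp only [hx]
    rw [M.integral_resid_sub_sq hij]
    have h1 := abs_le.1 (hω j hjC).1
    have h2 : sg j ≤ z := by
      refine hz j hjC ?_
      have := sg_le_of_mem_firstK (R := fun j => (R j).erase u) (κ := 0) hRe hT hTk hζ hω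
        (fun j hj => ?_) (fun j hj => ?_) hj
      · linarith
      all_goals
        have : (#((R j).erase u) : ℝ) = #(R j) - 1 := by
          rw [card_erase_of_mem (hu j hj), Nat.cast_sub (by have := hR j hj; omega)]
          simp
        simp only [hσ, this]
        linarith
    nlinarith
  have h1 : (1 + 1 / w) * r / k * ∑ j ∈ S', ∫ a, x j a ^ 2 ∂Pr ν
      ≤ (1 + 1 / w) * r / k * (k * (z + 2 * γ ^ 2 + α ^ 2 / 4)) := by gcongr
  have h2 : (1 + 1 / w) * r / k * (k * (z + 2 * γ ^ 2 + α ^ 2 / 4))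
      = (1 + 1 / w) * (r * (z + 2 * γ ^ 2 + α ^ 2 / 4)) := by field_simp
  linarith

lemma b₂_pos (hγ : γ ≠ 0) (j : Fin n) : 0 < b₂ := by
  have h1 := M.gamma_sq_le j
  have h2 : 0 < γ ^ 2 := by positivity
  have h3 := M.b₂_nonneg
  all_goals nlinarith

lemma bddMeas_colSignal (v : Fin m) : BddMeas (colSignal H b i j v) :=
  ((M.bddMeas_diff j).coord _).add (M.bddMeas_noise.coord _)

lemma integral_colSignal (v : Fin m) : ∫ ω, colSignal H b i j v ω ∂Pr ν = 0 := by
  simp only [colSignal]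
  rw [BddMeas.integral_add ((M.bddMeas_diff j).coord _) (M.bddMeas_noise.coord _),
    integral_coord ν (M.meas_diff j), integral_coord ν M.meas_noise, M.diff_mean, M.noise_mean]
  simp

lemma integral_colSignal_sq (v : Fin m) : ∫ ω, colSignal H b i j v ω ^ 2 ∂Pr ν = sg j + γ ^ 2 := by
  have hb := M.bddMeas_noise
  have hH := M.bddMeas_diff j
  have e : ∀ ω : Source m n → Y, colSignal H b i j v ω ^ 2
      = H j (ω (rowSrc v)) ^ 2 + (b (ω (noiseSrc v i)) ^ 2
        + 2 * (H j (ω (rowSrc v)) * b (ω (noiseSrc v i)))) := by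
    intro ω; simp only [colSignal]; ring
  have h1 := (hH.coord (rowSrc v)).mul (hb.coord (noiseSrc v i))
  simp only [e]
  rw [BddMeas.integral_add ((hH.pow 2).coord (rowSrc v))
      (((hb.pow 2).coord (noiseSrc v i)).add (h1.const_mul 2)),
    BddMeas.integral_add ((hb.pow 2).coord (noiseSrc v i)) (h1.const_mul 2),
    integral_const_mul, integral_mul_coord ν hH hb (by simp),
    integral_coord ν (g := fun y => H j y ^ 2) ((M.meas_diff j).pow_const 2),
    integral_coord ν (g := fun y => b y ^ 2) (M.meas_noise.pow_const 2),
    M.diff_var, M.noise_var, M.diff_mean]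
  ring

lemma pairVar_noise (v : Fin m) (c : ℝ) : pairVar (ν (noiseSrc v j)) b c
      = 4 * γ ^ 2 * c ^ 2 - 4 * (∫ y, b y ^ 3 ∂(ν (noiseSrc v j))) * c
        + (∫ y, b y ^ 4 ∂(ν (noiseSrc v j)) - (γ ^ 2) ^ 2) := by
  rw [pairVar_eq M.bddMeas_noise (M.noise_mean v j), M.noise_var]

lemma bddMeas_pairVar (v : Fin m) :
    BddMeas fun ω => pairVar (ν (noiseSrc v j)) b (colSignal H b i j v ω) := by
  simp only [M.pairVar_noise]
  exact ((((M.bddMeas_colSignal v).pow 2).const_mul _).sub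
    ((M.bddMeas_colSignal v).const_mul _)).add (.const _)

/-- The third-moment term averages to zero, the fourth moment is at least `γ ^ 4`, and the noise of
column `i` in the signal contributes `4 γ² · γ²`. No variance of the signal itself is needed. -/
lemma integral_pairVar_ge (v : Fin m) :
    4 * γ ^ 4 ≤ ∫ ω, pairVar (ν (noiseSrc v j)) b (colSignal H b i j v ω) ∂Pr ν := by
  simp only [M.pairVar_noise]
  have hc := M.bddMeas_colSignal (i := i) (j := j) v
  rw [BddMeas.integral_add, BddMeas.integral_sub, integral_const_mul,
    integral_const_mul, M.integral_colSignal, M.integral_colSignal_sq]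
  have h := integral_pow_four_ge (P := ν (noiseSrc v j)) M.bddMeas_noise
  rw [M.noise_var] at h
  simp only [integral_const, probReal_univ, one_smul]
  nlinarith [mul_nonneg (sq_nonneg γ) (M.sg_nonneg j)]

lemma abs_two_mul_sub_le (v : Fin m) (ω : Source m n → Y) (y y' : Y) :
    |(b y - b y') * (2 * colSignal H b i j v ω - b y - b y')| ≤ 8 * b₂ * (b₁ + b₂) := by
  have h1 := abs_le.1 (M.noise_bound y)
  have h2 := abs_le.1 (M.noise_bound y')
  have h3 := abs_le.1 (M.abs_diff_le j (ω (rowSrc v)))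
  have h4 := abs_le.1 (M.noise_bound (ω (noiseSrc v i)))
  have e1 : |b y - b y'| ≤ 2 * b₂ := abs_le.2 ⟨by linarith, by linarith⟩
  have e2 : |2 * colSignal H b i j v ω - b y - b y'| ≤ 4 * (b₁ + b₂) := by
    unfold colSignal
    exact abs_le.2 ⟨by linarith, by linarith⟩
  rw [abs_mul]
  calc _ ≤ 2 * b₂ * (4 * (b₁ + b₂)) := mul_le_mul e1 e2 (abs_nonneg _) (by linarith [M.b₂_nonneg])
    _ = _ := by ring

lemma regularCol_tail (hγ : γ ≠ 0)
    {R : Finset (Fin m)} (hR : R.Nonempty) {c₀ ε : ℝ} (hc₀ : 0 ≤ c₀) (hε : 0 ≤ ε) (hε2 : ε ≤ 2) :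
    (Pr ν).real {ω | ¬ regularCol ν H b i c₀ ((1 - ε) * (4 * γ ^ 4 * #R)) j R ω}
      ≤ 2 * exp (-(#R * c₀ ^ 2 / (2 * (b₁ + b₂) ^ 2)))
        + exp (-(4 * ε ^ 2 * γ ^ 4 * #R / (8 * b₂ * (b₁ + b₂)) ^ 2)) := by
  have hc : (0 : ℝ) < #R := by exact_mod_cast hR.card_pos
  have hb₂ := M.b₂_pos hγ j
  have hb₁ := M.b₁_nonneg j
  have hbb : 0 < b₁ + b₂ := by linarith
  set blk : Fin m → Set (Source m n) := fun v => {rowSrc v, noiseSrc v i} with hblk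
  have hdep : ∀ v, DependsOn (colSignal H b i j v) (blk v) := by
    intro v x y h
    simp only [colSignal]
    grind
  have hdis : ∀ s : Set (Fin m), s.PairwiseDisjoint blk := by
    intro s v _ w _ hvw
    grind
  have k1 := measureReal_abs_sum_sub_ge ν (s := R) (X := colSignal H b i j)
    (B := blk) (R := 2 * (b₁ + b₂)) (r := #R * c₀) (by linarith)
    (by positivity) (fun _ => -(b₁ + b₂) - mu j) hR (fun v _ => (M.bddMeas_colSignal v).meas)
    (fun v _ ω => by
      have h1 := abs_le.1 (M.diff_bound j (ω (rowSrc v)))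
      have h2 := abs_le.1 (M.noise_bound (ω (noiseSrc v i)))
      constructor <;> simp only [colSignal] <;> linarith)
    (fun v _ => hdep v) (hdis _)
  simp only [M.integral_colSignal, sub_zero] at k1
  have e1 : -(2 * (#R * c₀) ^ 2 / (#R * (2 * (b₁ + b₂)) ^ 2))
      = -(#R * c₀ ^ 2 / (2 * (b₁ + b₂) ^ 2)) := by
    field_simp
  rw [e1] at k1
  have k2 := measureReal_sum_le_lower ν (s := R) (B := blk)
    (X := fun v ω => pairVar (ν (noiseSrc v j)) b (colSignal H b i j v ω))
    (K := (8 * b₂ * (b₁ + b₂)) ^ 2 / 2) (m₀ := 4 * γ ^ 4 * #R) (ε := ε) (by positivity) hε hε2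
    (fun v _ => (M.bddMeas_pairVar v).meas) (fun v _ ω => pairVar_nonneg _ _ _)
    (fun v _ ω => pairVar_le fun y y' => M.abs_two_mul_sub_le v ω y y')
    (fun v _ x y h => by simp only [hdep v h]) (hdis _) (by
      have := card_nsmul_le_sum R (fun v => ∫ ω, pairVar (ν (noiseSrc v j)) b
        (colSignal H b i j v ω) ∂Pr ν) (4 * γ ^ 4) fun v _ => M.integral_pairVar_ge v
      rw [nsmul_eq_mul] at this
      linarith)
  have e2 : -(ε ^ 2 * (4 * γ ^ 4 * #R) / (2 * ((8 * b₂ * (b₁ + b₂)) ^ 2 / 2)))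
      = -(4 * ε ^ 2 * γ ^ 4 * #R / (8 * b₂ * (b₁ + b₂)) ^ 2) := by
    field_simp
  rw [e2] at k2
  refine le_trans (measureReal_mono ?_) ((measureReal_union_le _ _).trans (add_le_add k1 k2))
  intro ω hω
  by_contra hcon
  simp only [Set.mem_union, Set.mem_ofPred_eq, not_or, not_le] at hcon
  refine hω ⟨?_, hcon.2.le⟩
  rw [abs_div, abs_of_pos hc, div_le_iff₀ hc]
  linarith [hcon.1]

lemma measurableSet_regularCol {c₀ V : ℝ}
    (R : Finset (Fin m)) : MeasurableSet {ω | regularCol ν H b i c₀ V j R ω} := MeasurableSet.inter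
    (measurableSet_le ((BddMeas.sum R fun v _ => M.bddMeas_colSignal v).div_const _).abs.meas
      measurable_const)
    (measurableSet_le measurable_const (BddMeas.sum R fun v _ => M.bddMeas_pairVar v).meas)

/-- Given the signals, the noise of column `j` rarely moves its mean by `b₀`. -/
lemma noiseCol_mean_tail {R : Finset (Fin m)}
    (hR : R.Nonempty) {b₀ : ℝ} (ht : 0 ≤ t) (htb : t * b₂ ≤ 1) :
    (Pr ν).real {a | b₀ ≤ |(∑ v ∈ R, b (a (noiseSrc v j))) / #R|}
      ≤ 2 * exp (-(#R * (t * b₀ - t ^ 2 * γ ^ 2))) := by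
  have hc : (0 : ℝ) < #R := by exact_mod_cast hR.card_pos
  have key := measureReal_abs_sum_ge ν (s := R) (X := fun v a => b (a (noiseSrc v j)))
    (B := fun v => {noiseSrc v j}) (b := b₂) (γ₂ := γ ^ 2) (t := t) (r := #R * b₀) ht htb
    (fun v _ => (M.bddMeas_noise.coord _).meas) (fun v _ a => M.noise_bound _)
    (fun v _ => by rw [integral_coord ν M.meas_noise, M.noise_mean]) (fun v _ => by
      rw [integral_coord ν (g := fun y => b y ^ 2) (M.meas_noise.pow_const 2), M.noise_var])
    (fun v _ => dependsOn_coord b _)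
    (fun v _ w _ hvw => by simpa [Function.onFun] using hvw)
  refine le_trans (measureReal_mono fun a ha => ?_) (key.trans (le_of_eq ?_))
  · have ha' : b₀ ≤ |(∑ v ∈ R, b (a (noiseSrc v j))) / #R| := ha
    rw [abs_div, abs_of_pos hc, le_div_iff₀ hc] at ha'
    grind
  · congr 2; ring

lemma residMean_mix_tail (hij : i ≠ j)
    {R : Finset (Fin m)} (hR : R.Nonempty) {c₀ V b₀ : ℝ} (ht : 0 ≤ t) (htb : t * b₂ ≤ 1)
    {ω : Source m n → Y} (hω : regularCol ν H b i c₀ V j R ω) : (Pr ν).real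
        {a | c₀ + b₀ < |residMean H b i j R (mix (noiseCol j R : Set (Source m n)) a ω)|}
      ≤ 2 * exp (-(#R * (t * b₀ - t ^ 2 * γ ^ 2))) := by
  refine le_trans (measureReal_mono fun a ha => ?_) (M.noiseCol_mean_tail (j := j) hR ht htb)
  have ha' : c₀ + b₀ < |residMean H b i j R (mix (noiseCol j R : Set (Source m n)) a ω)| := ha
  have hc : (0 : ℝ) < #R := by exact_mod_cast hR.card_pos
  rw [residMean_mix_noiseCol hij, card_noiseCol, sum_noiseCol, sum_sub_distrib, sub_div] at ha'
  have h1 := hω.1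
  have h2 := abs_sub (((∑ v ∈ R, colSignal H b i j v ω) / #R))
    ((∑ v ∈ R, b (a (noiseSrc v j))) / #R)
  have e : (∑ v ∈ R, signalOnNoise H b i j ω (noiseSrc v j)) = ∑ v ∈ R, colSignal H b i j v ω := rfl
  grind

/-- Smoothness of the law of the centred sum of squares of column `j`, given the signals. -/
lemma window_residSq (hij : i ≠ j) (hγ : γ ≠ 0)
    {R : Finset (Fin m)} (hR : R.Nonempty) {c₀ V b₀ ρ lam₀ L V₀ : ℝ} (ht : 0 ≤ t)
    (htb : t * b₂ ≤ 1) {ω : Source m n → Y} (hω : regularCol ν H b i c₀ V j R ω)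
    (hh : 0 ≤ h) (hρ0 : 0 ≤ ρ) (hρ1 : ρ < 1) (hκ : c₀ + b₀ ≤ ρ * κ / 2)
    (hδ : 2 * exp (-(#R * (t * b₀ - t ^ 2 * γ ^ 2))) ≤ δ)
    (hL0 : 0 < L) (hlam : 0 < lam₀) (hlJ : lam₀ * (8 * b₂ * (b₁ + b₂)) ≤ 1 / 6) (hV₀ : 0 < V₀)
    (hV : V₀ ≤ V - #R * (κ ^ 2 * γ ^ 2)) (hL : lam₀ ^ 2 * V₀ = 2 * L)
    {U : Set ℝ} (hU : IsLowerSet U) : (Pr ν).real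
        {a | residSq H b i j R (mix (noiseCol j R : Set (Source m n)) a ω) ∈ U ∧
          residSq H b i j R (mix (noiseCol j R : Set (Source m n)) a ω) + h ∉ U}
      ≤ (156 / 125 * (h + 8 * b₂ * (b₁ + b₂)) * lam₀ / (1 - ρ)) * (Pr ν).real
        {a | residSq H b i j R (mix (noiseCol j R : Set (Source m n)) a ω) ∈ U}
        + (exp (-L) * (1 + (156 / 125 * (h + 8 * b₂ * (b₁ + b₂)) * lam₀ / (1 - ρ)) / (2 * L))
          + 12 / 5 * #R * (8 * b₂ * (b₁ + b₂) * (h + 2 * (8 * b₂ * (b₁ + b₂)))) * δ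
            / ((1 - ρ) * V₀)) := by
  have hb₂ := M.b₂_pos hγ j
  have hb₁ := M.b₁_nonneg j
  have hJ0 : 0 < 8 * b₂ * (b₁ + b₂) := by positivity
  have hδ0 : 0 ≤ δ := le_trans (by positivity) hδ
  simp only [residSq_mix_noiseCol hij]
  have hpv : ∀ w ∈ noiseCol j R, ∀ y y', |(b y - b y') *
      (2 * signalOnNoise H b i j ω w - b y - b y')| ≤ 8 * b₂ * (b₁ + b₂) := by
    intro w hw y y'
    obtain ⟨v, hv, rfl⟩ := mem_noiseCol.1 hw
    exact M.abs_two_mul_sub_le v ω y y'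
  have hw := window_ratio ν (b := b) (c := signalOnNoise H b i j ω) (κ := κ)
    (s := noiseCol j R) (J := 8 * b₂ * (b₁ + b₂)) M.meas_noise (fun w hw p => by
      unfold jump
      split_ifs
      · exact hpv w hw _ _
      · simpa using hJ0.le)
    (h := h) (ρ := ρ) (δ := δ) hh hJ0 hρ0 hρ1
    (by
      refine le_trans (measureReal_mono fun a ha => ?_)
        ((M.residMean_mix_tail hij hR (b₀ := b₀) ht htb hω).trans hδ)
      have ha' : ρ * κ / 2 < |(∑ w ∈ noiseCol j R, (signalOnNoise H b i j ω w - b (a w)))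
        / #(noiseCol j R)| := ha
      rw [← residMean_mix_noiseCol hij] at ha'
      exact lt_of_le_of_lt hκ ha')
    hL0 hlam hlJ hV₀ ?_ hL
  · rw [card_noiseCol] at hw
    have hθ : 0 ≤ 156 / 125 * (h + 8 * b₂ * (b₁ + b₂)) * lam₀ / (1 - ρ) := by
      have : 0 < 1 - ρ := by linarith
      positivity
    refine window_of_isLowerSet (measurable_centredSq M.meas_noise _) hθ ?_ hw hU
    have : 0 < 1 - ρ := by linarith
    positivity
  · refine hV.trans ?_
    unfold jumpVar
    rw [sum_noiseCol]
    have h1 : ∀ v ∈ R, pairVar (ν (noiseSrc v j)) b (colSignal H b i j v ω) - κ ^ 2 * γ ^ 2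
        ≤ (∫ p, jump b (signalOnNoise H b i j ω) κ (noiseSrc v j) p ^ 2
          ∂((Pr ν).prod (Pr ν))) / 2 := by
      intro v _
      have := pairVar_sub_le_jump ν M.bddMeas_noise (c := signalOnNoise H b i j ω) κ
        (noiseSrc v j) (M.noise_mean v j)
      rw [M.noise_var] at this
      exact this
    have h2 := sum_le_sum h1
    rw [sum_sub_distrib, sum_const, nsmul_eq_mul] at h2
    linarith [hω.2]

lemma residDev_sq_le {R : Finset (Fin m)} {ω : Source m n → Y} (hω : |residMean H b i j R ω| ≤ ε₁) :
    residDev H b i u j R ω ^ 2 ≤ (2 * (b₁ + b₂) + ε₁) ^ 2 := by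
  have h1 := abs_le.1 (M.abs_resid_le (i := i) (j := j) u ω)
  have h2 := abs_le.1 hω
  unfold residDev
  exact sq_le_sq' (by linarith) (by linarith)

lemma bddMeas_splitScore (j : Fin n) : BddMeas fun ω => splitScore H b i u R ω j :=
  ((M.bddMeas_residSq (R j)).div_const _).add (((M.bddMeas_residDev (R j)).pow 2).div_const _)

omit M in
lemma _root_.SmoothColumns.window_le (hS : SmoothColumns ν H b i u C R g b₁ b₂ ε₁ h θ t δ pb) (hj : j ∈ C)
    {ω : Source m n → Y} (hω : g j ω) {U : Set ℝ} (hU : IsLowerSet U) : (Pr ν).real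
      {a | residSq H b i j (R j) (mix (noiseCol j (R j) : Set (Source m n)) a ω) ∈ U}
    ≤ 1 / (1 - θ) * ((Pr ν).real
      {a | residSq H b i j (R j) (mix (noiseCol j (R j) : Set (Source m n)) a ω) + h ∈ U} + t) := by
  have hw := hS.window j hj ω hω U hU
  set F := fun a => residSq H b i j (R j) (mix (noiseCol j (R j) : Set (Source m n)) a ω)
  have h1 : (Pr ν).real {a | F a ∈ U} ≤ (Pr ν).real {a | F a + h ∈ U}
      + (Pr ν).real {a | F a ∈ U ∧ F a + h ∉ U} := by
    refine (measureReal_mono fun a ha => ?_).trans (measureReal_union_le _ _)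
    all_goals grind
  have h2 : 0 < 1 - θ := by linarith [hS.theta_lt_one]
  rw [one_div, inv_mul_eq_div, le_div_iff₀ h2]
  linarith

lemma measurableSet_smallMean (j : Fin n) : MeasurableSet {ω | |residMean H b i j (R j) ω| ≤ ε₁} :=
  measurableSet_le (M.bddMeas_residMean (R j)).abs.meas measurable_const

lemma measurableSet_selected (τ : Equiv.Perm (Fin n)) (k : ℕ) (j : Fin n) :
    MeasurableSet {ω | j ∈ firstK C (splitScore H b i u R ω) τ k} :=
  measurableSet_mem_firstK C (σ := fun j ω => splitScore H b i u R ω j)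
    (fun j _ => (M.bddMeas_splitScore (i := i) (u := u) (R := R) j).meas) τ k j

lemma measurableSet_smallSelected (τ : Equiv.Perm (Fin n)) (k : ℕ) (j : Fin n) :
    MeasurableSet {ω | smallSelected H b i u C R τ k ε₁ j ω} := by
  have : {ω | ∀ j' ∈ C, |residMean H b i j' (R j') ω| ≤ ε₁}
      = ⋂ j' ∈ C, {ω | |residMean H b i j' (R j') ω| ≤ ε₁} := by ext; simp
  have h2 : MeasurableSet {ω | ∀ j' ∈ C, |residMean H b i j' (R j') ω| ≤ ε₁} := by
    rw [this]
    exact measurableSet_biInter _ fun j' _ => M.measurableSet_smallMean j'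
  exact (M.measurableSet_selected τ k j).inter h2

lemma measurableSet_fewBelow (k : ℕ) (j : Fin n) : MeasurableSet {ω | fewBelow H b i C R k j ω} :=
  measurableSet_card_filter_lt _ (fun j' _ => measurableSet_le
    ((M.bddMeas_residSq (R j')).div_const _).meas ((M.bddMeas_residSq (R j)).div_const _).meas) k

lemma sum_fewBelow_le (k : ℕ) : ∑ j ∈ C, (Pr ν).real {ω | fewBelow H b i C R k j ω} ≤ k := by
  have h1 : ∀ j, BddMeas fun ω => ind (fewBelow H b i C R k j ω) := fun j =>
    BddMeas.ind (M.measurableSet_fewBelow k j)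
  have h2 : ∀ j ∈ C, (Pr ν).real {ω | fewBelow H b i C R k j ω}
      = ∫ ω, ind (fewBelow H b i C R k j ω) ∂Pr ν := fun j _ =>
    (integral_ind (M.measurableSet_fewBelow k j) _).symm
  rw [sum_congr rfl h2, ← integral_finsetSum _ fun j _ => (h1 j).integrable _]
  refine (BddMeas.integral_mono (by fun_prop) (.const (k : ℝ)) _ fun ω => ?_).trans (by simp)
  have := card_filter_few_le C (fun j => residSq H b i j (R j) ω / #(R j)) k
  refine le_trans (le_of_eq ?_) (Nat.cast_le.2 this)
  rw [card_filter, Nat.cast_sum]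
  refine sum_congr rfl fun j _ => ?_
  unfold fewBelow
  split_ifs with hc
  · rw [ind_of hc]; simp
  · rw [ind_of_not hc]; simp

/-- Replacing the row-`u` part of the other scores by its maximum and dropping that of column `j`
enlarges the selection event to one in which row `u` does not occur. -/
lemma residSq_mem_marginSet {ω : Source m n → Y} (hω : smallSelected H b i u C R τ k ε₁ j ω) :
    residSq H b i j (R j) ω / #(R j) ∈ marginSet C (fun j' => residSq H b i j' (R j') ω / #(R j'))
        (fun j' => (2 * (b₁ + b₂) + ε₁) ^ 2 / (#(R j') + 1)) k j := by
  obtain ⟨hS, hD⟩ := hω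
  obtain ⟨hjC, hsel⟩ := mem_firstK_iff_selectSet.1 hS
  refine lt_of_le_of_lt (card_le_card fun j' hj' => ?_) hsel
  rw [mem_filter] at hj' ⊢
  refine ⟨hj'.1, Or.inl ?_⟩
  have h1 : splitScore H b i u R ω j' ≤ residSq H b i j' (R j') ω / #(R j')
      + (2 * (b₁ + b₂) + ε₁) ^ 2 / (#(R j') + 1) := by
    unfold splitScore
    have := M.residDev_sq_le (u := u) (hD j' (mem_of_mem_erase hj'.1))
    gcongr
  have h2 : residSq H b i j (R j) ω / #(R j) ≤ splitScore H b i u R ω j := by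
    unfold splitScore
    have : 0 ≤ residDev H b i u j (R j) ω ^ 2 / (#(R j) + 1) := by positivity
    linarith
  exact (h1.trans_lt hj'.2).trans_le h2

lemma measurableSet_margin (κ : Fin n → ℝ) (k : ℕ) (j : Fin n) :
    MeasurableSet {ω | residSq H b i j (R j) ω / #(R j) ∈
      marginSet C (fun j' => residSq H b i j' (R j') ω / #(R j')) κ k j} :=
  measurableSet_card_filter_lt _ (fun j' _ => measurableSet_lt
    (((M.bddMeas_residSq (R j')).div_const _).add (.const _)).meas
    ((M.bddMeas_residSq (R j)).div_const _).meas) k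

/-- The gap condition makes each margin smaller than `h` divided by the number of rows of column
`j`. Shifting the sum of squares by `h` removes the margins and leaves `fewBelow`; the window
estimate pays for the shift with the factor `1 / (1 - θ)`. -/
lemma measureReal_margin_le
    (hS : SmoothColumns ν H b i u C R g b₁ b₂ ε₁ h θ t δ pb) (hj : j ∈ C) (k : ℕ) :
    ∫ ω, ind (g j ω) * ind (residSq H b i j (R j) ω / #(R j) ∈
      marginSet C (fun j' => residSq H b i j' (R j') ω / #(R j'))
        (fun j' => (2 * (b₁ + b₂) + ε₁) ^ 2 / (#(R j') + 1)) k j) ∂Pr ν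
      ≤ 1 / (1 - θ) * ((Pr ν).real {ω | fewBelow H b i C R k j ω} + t) := by
  have hij : i ≠ j := fun e => hS.notMem (e ▸ hj)
  have hN : (0 : ℝ) < #(R j) := by exact_mod_cast (hS.nonempty j hj).card_pos
  have hθ : 0 < 1 - θ := by linarith [hS.theta_lt_one]
  set A : Set (Source m n) := (noiseCol j (R j) : Set (Source m n)) with hA
  have hAc : A ⊆ colBlock j := noiseCol_subset_colBlock _
  set κ : Fin n → ℝ := fun j' => (2 * (b₁ + b₂) + ε₁) ^ 2 / (#(R j') + 1) with hκ
  set s : (Source m n → Y) → Fin n → ℝ := fun ω j' => residSq H b i j' (R j') ω / #(R j') with hs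
  have hfm := M.measurableSet_fewBelow (i := i) (C := C) (R := R) k j
  have hfI : BddMeas fun ω => ind (fewBelow H b i C R k j ω) := BddMeas.ind hfm
  have hf : BddMeas fun ω => ind (g j ω) * ind (s ω j ∈ marginSet C (s ω) κ k j) :=
    (BddMeas.ind (hS.meas j hj)).mul (BddMeas.ind (M.measurableSet_margin κ k j))
  have hmarg : ∀ a ω (x : ℝ), x ∈ marginSet C (s (mix A a ω)) κ k j ↔
      x ∈ marginSet C (s ω) κ k j := by
    intro a ω x
    have : (C.erase j).filter (fun j' => s (mix A a ω) j' + κ j' < x)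
        = (C.erase j).filter (fun j' => s ω j' + κ j' < x) := by
      refine filter_congr fun j' hj' => ?_
      simp only [hs]
      rw [residSq_mix_colBlock hAc hij (ne_of_mem_erase hj').symm]
    change #((C.erase j).filter (fun j' => s (mix A a ω) j' + κ j' < x)) < k ↔ _
    rw [this]; rfl
  rw [integral_eq_integral_mix ν hf A, ← integral_ind hfm, integral_eq_integral_mix ν hfI A]
  have hmono : ∀ ω, ∫ a, ind (g j (mix A a ω)) *
      ind (s (mix A a ω) j ∈ marginSet C (s (mix A a ω)) κ k j) ∂Pr ν
      ≤ 1 / (1 - θ) * ((∫ a, ind (fewBelow H b i C R k j (mix A a ω)) ∂Pr ν) + t) := by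
    intro ω
    have hfn : 0 ≤ ∫ a, ind (fewBelow H b i C R k j (mix A a ω)) ∂Pr ν :=
      integral_nonneg fun a => ind_nonneg _
    by_cases hg : g j ω
    swap
    · have : ∀ a, ind (g j (mix A a ω)) = 0 := fun a =>
        ind_of_not fun hc => hg ((hS.inv_col j hj A hAc a ω).1 hc)
      simp only [this, zero_mul, integral_zero]
      have := hS.t_nonneg
      positivity
    have hU : IsLowerSet {x : ℝ | x / #(R j) ∈ marginSet C (s ω) κ k j} :=
      isLowerSet_div (isLowerSet_marginSet _ _ _ _ _) hN.le
    have hw := hS.window_le hj hg hU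
    have hmF : Measurable fun a => residSq H b i j (R j) (mix A a ω) :=
      (M.bddMeas_residSq (R j)).meas.comp (measurable_mix_left A ω)
    have e1 : ∀ a, ind (g j (mix A a ω)) * ind (s (mix A a ω) j ∈ marginSet C (s (mix A a ω)) κ k j)
        = ind (residSq H b i j (R j) (mix A a ω) ∈
          {x : ℝ | x / #(R j) ∈ marginSet C (s ω) κ k j}) := by
      intro a
      rw [ind_of ((hS.inv_col j hj A hAc a ω).2 hg), one_mul]
      congr 1
      exact propext (hmarg a ω _)
    simp only [e1]
    have hUm : MeasurableSet {x : ℝ | x / #(R j) ∈ marginSet C (s ω) κ k j} :=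
      hU.ordConnected.measurableSet
    rw [integral_ind (hmF hUm)]
    refine hw.trans ?_
    refine mul_le_mul_of_nonneg_left ?_ (by positivity)
    have hfm' : MeasurableSet {a | fewBelow H b i C R k j (mix A a ω)} :=
      (measurable_mix_left A ω) hfm
    rw [integral_ind hfm']
    refine add_le_add (measureReal_mono fun a ha => ?_) le_rfl
    have ha' := (hmarg a ω _).2 ha
    refine lt_of_le_of_lt (card_le_card fun j' hj' => ?_) ha'
    rw [mem_filter] at hj' ⊢
    refine ⟨hj'.1, ?_⟩
    have hg' := hS.gap j hj j' (mem_of_mem_erase hj'.1)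
    have : κ j' < h / #(R j) := by
      rw [hκ, div_lt_div_iff₀ (by positivity) hN]
      exact hg'
    rw [add_div]
    exact add_lt_add_of_le_of_lt hj'.2 this
  refine (BddMeas.integral_mono (hf.integral_mix_left ν A)
    (((hfI.integral_mix_left ν A).add (.const t)).const_mul _) _ hmono).trans (le_of_eq ?_)
  rw [integral_const_mul, BddMeas.integral_add (hfI.integral_mix_left ν A) (.const t)]
  simp

/-- The selection event is dominated by one that does not involve row `u`, hence is independent of
`f`, and whose probability is known up to the factor `1 / (1 - θ)`. -/
lemma integral_mul_ind_smallSelected_le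
    (hS : SmoothColumns ν H b i u C R g b₁ b₂ ε₁ h θ t δ pb) (hj : j ∈ C)
    (τ : Equiv.Perm (Fin n)) (k : ℕ) {f : (Source m n → Y) → ℝ} (hf : BddMeas f)
    (hf0 : ∀ ω, 0 ≤ f ω) (hfu : DependsOn f (rowBlock u)) :
    ∫ ω, f ω * ind (smallSelected H b i u C R τ k ε₁ j ω) ∂Pr ν ≤ (∫ ω, f ω ∂Pr ν) *
        (1 / (1 - θ) * ((Pr ν).real {ω | fewBelow H b i C R k j ω} + t) + pb) := by
  set W : (Source m n → Y) → ℝ := fun ω => ind (g j ω) * ind (residSq H b i j (R j) ω / #(R j) ∈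
      marginSet C (fun j' => residSq H b i j' (R j') ω / #(R j'))
        (fun j' => (2 * (b₁ + b₂) + ε₁) ^ 2 / (#(R j') + 1)) k j) + ind (¬ g j ω) with hW
  have hgI : BddMeas fun ω => ind (g j ω) := BddMeas.ind (hS.meas j hj)
  have hgn : BddMeas fun ω => ind (¬ g j ω) := BddMeas.ind (hS.meas j hj).compl
  have hmI := BddMeas.ind (M.measurableSet_margin (i := i) (C := C) (R := R)
    (fun j' => (2 * (b₁ + b₂) + ε₁) ^ 2 / (#(R j') + 1)) k j)
  have hWb : BddMeas W := by fun_prop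
  have h1 : ∀ ω, f ω * ind (smallSelected H b i u C R τ k ε₁ j ω) ≤ f ω * W ω := by
    intro ω
    refine mul_le_mul_of_nonneg_left ?_ (hf0 ω)
    by_cases hg : g j ω
    · simp only [hW]
      rw [ind_of hg, one_mul]
      refine le_trans (ind_mono fun hω => residSq_mem_marginSet M hω) ?_
      linarith [ind_nonneg (¬ g j ω)]
    · simp only [hW]
      rw [ind_of_not hg, ind_of hg]
      linarith [ind_le_one (smallSelected H b i u C R τ k ε₁ j ω)]
  have hWmix : ∀ a ω, W (mix (rowBlock u) a ω) = W ω := by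
    intro a ω
    have hr : ∀ j' ∈ C, residSq H b i j' (R j') (mix (rowBlock u) a ω)
        = residSq H b i j' (R j') ω := fun j' hj' => residSq_mix_rowBlock (hS.row j' hj') a ω
    have hset : (C.erase j).filter (fun j' =>
          residSq H b i j' (R j') (mix (rowBlock u) a ω) / #(R j')
            + (2 * (b₁ + b₂) + ε₁) ^ 2 / (#(R j') + 1)
            < residSq H b i j (R j) (mix (rowBlock u) a ω) / #(R j))
        = (C.erase j).filter (fun j' => residSq H b i j' (R j') ω / #(R j')
            + (2 * (b₁ + b₂) + ε₁) ^ 2 / (#(R j') + 1) < residSq H b i j (R j) ω / #(R j)) := by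
      grind
    simp only [hW, hS.inv_row j hj a ω]
    congr 3
    exact congrArg (fun s : Finset (Fin n) => #s < k) hset
  refine (BddMeas.integral_mono (hf.mul (BddMeas.ind (M.measurableSet_smallSelected τ k j)))
    (hf.mul hWb) _ h1).trans ?_
  rw [integral_mul_of_mix ν hf hWb (A := rowBlock u) (fun a ω => hfu.apply_mix a ω) hWmix]
  refine mul_le_mul_of_nonneg_left ?_ (integral_nonneg hf0)
  rw [BddMeas.integral_add]
  refine add_le_add (M.measureReal_margin_le hS hj k) ?_
  have hgc : MeasurableSet {ω | ¬ g j ω} := (hS.meas j hj).compl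
  rw [integral_ind hgc]
  exact hS.tail j hj

/-- Conditionally on everything except the noise of column `j`, the noise of column `j` in row `u`
is almost uncorrelated with the selection of column `j`. -/
lemma abs_integral_noise_mix_le
    (hS : SmoothColumns ν H b i u C R g b₁ b₂ ε₁ h θ t δ pb) (hj : j ∈ C)
    (τ : Equiv.Perm (Fin n)) (k : ℕ) {ω : Source m n → Y} (hg : g j ω) :
    |∫ a, b (a (noiseSrc u j)) *
        ind (j ∈ firstK C (splitScore H b i u R (mix (colBlock j) a ω)) τ k ∧
          |residMean H b i j (R j) (mix (colBlock j) a ω)| ≤ ε₁) ∂Pr ν|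
      ≤ |γ| / 2 * (θ / (1 - θ) * (∫ a,
        ind (j ∈ firstK C (splitScore H b i u R (mix (colBlock j) a ω)) τ k ∧
          |residMean H b i j (R j) (mix (colBlock j) a ω)| ≤ ε₁) ∂Pr ν)
        + (θ / (1 - θ) * (t + δ) + t)) := by
  have hij : i ≠ j := fun e => hS.notMem (e ▸ hj)
  have hN : (0 : ℝ) < #(R j) := by exact_mod_cast (hS.nonempty j hj).card_pos
  have hθ : 0 < 1 - θ := by linarith [hS.theta_lt_one]
  have hθ0 := hS.theta_nonneg
  set B : Set (Source m n) := (noiseCol j (R j) : Set (Source m n)) with hB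
  set sel := selectSet C (splitScore H b i u R ω) τ k j with hsel
  set U : Set ℝ := {x : ℝ | x / #(R j) ∈ sel} with hUd
  have hsl : IsLowerSet sel := isLowerSet_selectSet _ _ _ _ _
  have hU : IsLowerSet U := isLowerSet_div hsl hN.le
  have hUm : MeasurableSet U := hU.ordConnected.measurableSet
  have hU2 : MeasurableSet {x : ℝ | x + h ∈ U} := (measurable_id.add_const h) hUm
  set F : (Source m n → Y) → ℝ := fun a => residSq H b i j (R j) (mix B a ω) with hF
  set D : (Source m n → Y) → ℝ := fun a => residMean H b i j (R j) (mix B a ω) with hD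
  have hFm : Measurable F := (M.bddMeas_residSq (R j)).meas.comp (measurable_mix_left B ω)
  have hDm : Measurable D := (M.bddMeas_residMean (R j)).meas.comp (measurable_mix_left B ω)
  have hDs : MeasurableSet {a | |D a| ≤ ε₁} := measurableSet_le hDm.abs measurable_const
  set w : (Source m n → Y) → ℝ := fun a =>
    ind (j ∈ firstK C (splitScore H b i u R (mix (colBlock j) a ω)) τ k ∧
      |residMean H b i j (R j) (mix (colBlock j) a ω)| ≤ ε₁) with hw
  -- `w₁` asks for selection even after the sum of squares grows by `h`, more than row `u` can add;
  -- `w₃` marks the window in between. Given `ω`, both depend only on the noise of column `j` in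
  -- rows other than `u`, hence not on that of `(u, j)`.
  set w₁ : (Source m n → Y) → ℝ := fun a => ind (F a + h ∈ U ∧ |D a| ≤ ε₁) with hw₁
  set w₃ : (Source m n → Y) → ℝ := fun a => ind (F a ∈ U ∧ F a + h ∉ U) with hw₃
  have hm1 : MeasurableSet {a | F a + h ∈ U ∧ |D a| ≤ ε₁} := (hFm hU2).inter hDs
  have hm3 : MeasurableSet {a | F a ∈ U ∧ F a + h ∉ U} := (hFm hUm).inter (hFm hU2).compl
  have hwb : BddMeas w := by
    have : MeasurableSet {a | j ∈ firstK C (splitScore H b i u R (mix (colBlock j) a ω)) τ k ∧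
        |residMean H b i j (R j) (mix (colBlock j) a ω)| ≤ ε₁} :=
      (measurable_mix_left (colBlock j) ω)
        ((M.measurableSet_selected τ k j).inter (M.measurableSet_smallMean j))
    exact BddMeas.ind this
  have hh0 : 0 ≤ h := by
    have := hS.gap j hj j hj
    nlinarith
  have hgap : (2 * (b₁ + b₂) + ε₁) ^ 2 / (#(R j) + 1) ≤ h / #(R j) := by
    rw [div_le_div_iff₀ (by positivity) hN]
    exact (hS.gap j hj j hj).le
  have hmem : ∀ a, (j ∈ firstK C (splitScore H b i u R (mix (colBlock j) a ω)) τ k ∧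
      |residMean H b i j (R j) (mix (colBlock j) a ω)| ≤ ε₁) ↔
      (F a / #(R j) + residDev H b i u j (R j) (mix (colBlock j) a ω) ^ 2
        / (#(R j) + 1) ∈ sel ∧ |D a| ≤ ε₁) := by
    intro a
    rw [mem_firstK_iff_selectSet, selectSet_mix_colBlock subset_rfl hij,
      residMean_mix_colBlock_self hij]
    have : splitScore H b i u R (mix (colBlock j) a ω) j = F a / #(R j)
        + residDev H b i u j (R j) (mix (colBlock j) a ω) ^ 2 / (#(R j) + 1) := by
      unfold splitScore
      rw [residSq_mix_colBlock_self hij]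
    rw [this]
    simp only [hj, true_and]
    rfl
  have h1 : ∀ a, w₁ a ≤ w a := by
    refine fun a => ind_mono fun hc => (hmem a).2 ⟨?_, hc.2⟩
    have hdev := M.residDev_sq_le (i := i) (j := j) (u := u) (R := R j)
      (ω := mix (colBlock j) a ω) (ε₁ := ε₁) (by
        rw [residMean_mix_colBlock_self hij]; exact hc.2)
    refine hsl ?_ hc.1
    rw [add_div]
    have : residDev H b i u j (R j) (mix (colBlock j) a ω) ^ 2 / (#(R j) + 1)
        ≤ (2 * (b₁ + b₂) + ε₁) ^ 2 / (#(R j) + 1) := by gcongr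
    linarith
  have h3 : ∀ a, w a ≤ w₁ a + w₃ a := by
    refine fun a => ind_le_add fun hc => ?_
    obtain ⟨hc1, hc2⟩ := (hmem a).1 hc
    have hFU : F a ∈ U := by
      refine hsl ?_ hc1
      have : 0 ≤ residDev H b i u j (R j) (mix (colBlock j) a ω) ^ 2 / (#(R j) + 1) := by
        positivity
      linarith
    all_goals grind
  have hb := M.bddMeas_noise
  have he : BddMeas fun a : Source m n → Y => b (a (noiseSrc u j)) := hb.coord _
  have hdisj : Disjoint ({noiseSrc u j} : Set (Source m n)) B := by
    rw [Set.disjoint_singleton_left]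
    intro hc
    obtain ⟨v, hv, hv2⟩ := mem_noiseCol.1 (mem_coe.1 hc)
    simp at hv2
    exact hS.row j hj (hv2 ▸ hv)
  have hdw1 : DependsOn w₁ B := dependsOn_comp_mix
    (fun x => ind (residSq H b i j (R j) x + h ∈ U ∧ |residMean H b i j (R j) x| ≤ ε₁)) B ω
  have hdw3 : DependsOn w₃ B := dependsOn_comp_mix
    (fun x => ind (residSq H b i j (R j) x ∈ U ∧ residSq H b i j (R j) x + h ∉ U)) B ω
  have hmean : ∫ a, b (a (noiseSrc u j)) ∂Pr ν = 0 := by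
    rw [integral_coord ν M.meas_noise, M.noise_mean]
  have hvar : ∫ a, b (a (noiseSrc u j)) ^ 2 ∂Pr ν = γ ^ 2 := by
    rw [integral_coord ν (M.meas_noise.pow_const 2), M.noise_var]
  have hw1b : BddMeas w₁ := BddMeas.ind hm1
  have hw3b : BddMeas w₃ := BddMeas.ind hm3
  have key := abs_integral_mul_le he hwb hw1b hw3b (c := ∫ a, w₃ a ∂Pr ν) hvar hmean h1 h3
    (integral_nonneg fun a => ind_nonneg _)
    (by rw [integral_mul_of_dependsOn ν he hw1b (dependsOn_coord b _) hdw1 hdisj, hmean, zero_mul])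
    (integral_mul_of_dependsOn ν (he.max (.const 0)) hw3b
      (dependsOn_coord (fun y => Max.max (b y) 0) _) hdw3 hdisj)
    (integral_mul_of_dependsOn ν (he.neg.max (.const 0)) hw3b
      (dependsOn_coord (fun y => Max.max (-b y) 0) _) hdw3 hdisj)
  refine key.trans (mul_le_mul_of_nonneg_left ?_ (by positivity))
  have hwin := hS.window j hj ω hg U hU
  have hle := hS.window_le hj hg hU
  -- The mass below the threshold is bounded back by the selection probability itself, so the error
  -- becomes relative, with factor `θ / (1 - θ)`.
  have hsub : (Pr ν).real {a | F a + h ∈ U} ≤ (∫ a, w a ∂Pr ν) + δ := by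
    refine le_trans ((measureReal_mono (s₂ := {a | F a + h ∈ U ∧ |D a| ≤ ε₁} ∪ {a | ε₁ < |D a|})
      fun a ha => ?_).trans (measureReal_union_le _ _)) (add_le_add ?_ (hS.dev j hj ω hg))
    · all_goals grind
    · rw [← integral_ind hm1]
      exact BddMeas.integral_mono hw1b hwb _ h1
  rw [integral_ind hm3]
  refine hwin.trans ?_
  change θ * (Pr ν).real {a | F a ∈ U} + t ≤ _
  have h4 : (Pr ν).real {a | F a ∈ U} ≤ 1 / (1 - θ) * ((∫ a, w a ∂Pr ν) + δ + t) :=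
    hle.trans (mul_le_mul_of_nonneg_left (by linarith) (by positivity))
  have h5 := mul_le_mul_of_nonneg_left h4 hθ0
  grind

/-- As `Q` does not read the noise of column `j`, it is a constant in the conditional estimate and
multiplies it. Irregular columns are charged at the crude bound. -/
lemma abs_integral_noise_mul_le
    (hS : SmoothColumns ν H b i u C R g b₁ b₂ ε₁ h θ t δ pb) (hj : j ∈ C)
    (τ : Equiv.Perm (Fin n)) (k : ℕ) {Q : (Source m n → Y) → ℝ} {q : ℝ} (hQ : BddMeas Q)
    (hQq : ∀ ω, |Q ω| ≤ q) (hQj : ∀ a ω, Q (mix (colBlock j) a ω) = Q ω) :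
    |∫ ω, b (ω (noiseSrc u j)) * ind (j ∈ firstK C (splitScore H b i u R ω) τ k ∧
        |residMean H b i j (R j) ω| ≤ ε₁) * Q ω ∂Pr ν|
      ≤ |γ| / 2 * (θ / (1 - θ) * (∫ ω, |Q ω| * ind (j ∈ firstK C (splitScore H b i u R ω) τ k ∧
        |residMean H b i j (R j) ω| ≤ ε₁) ∂Pr ν)
        + q * (θ / (1 - θ) * (t + δ) + t)) + b₂ * q * pb := by
  have hθ : 0 < 1 - θ := by linarith [hS.theta_lt_one]
  have hθ0 := hS.theta_nonneg
  have hij : i ≠ j := fun e => hS.notMem (e ▸ hj)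
  set w : (Source m n → Y) → ℝ := fun ω => ind (j ∈ firstK C (splitScore H b i u R ω) τ k ∧
        |residMean H b i j (R j) ω| ≤ ε₁) with hw
  have hwb : BddMeas w :=
    BddMeas.ind ((M.measurableSet_selected τ k j).inter (M.measurableSet_smallMean j))
  have he : BddMeas fun a : Source m n → Y => b (a (noiseSrc u j)) := M.bddMeas_noise.coord _
  have hf := (he.mul hwb).mul hQ
  have hgn : MeasurableSet {ω | ¬ g j ω} := (hS.meas j hj).compl
  have hgb : BddMeas fun ω => ind (¬ g j ω) := BddMeas.ind hgn
  have hQw := hQ.abs.mul hwb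
  set A := colBlock j with hA
  set t' := θ / (1 - θ) * (t + δ) + t with ht'
  have ht0 : 0 ≤ t' := by have := hS.t_nonneg; have := hS.delta_nonneg; positivity
  have hpt : ∀ ω, |∫ a, b (mix A a ω (noiseSrc u j)) * w (mix A a ω) * Q (mix A a ω) ∂Pr ν|
      ≤ |γ| / 2 * (θ / (1 - θ) * (∫ a, |Q (mix A a ω)| * w (mix A a ω) ∂Pr ν) + q * t')
        + b₂ * q * ind (¬ g j ω) := by
    intro ω
    have hq0 : 0 ≤ q := (abs_nonneg _).trans (hQq ω)
    have hb0 := M.b₂_nonneg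
    have e1 : ∀ a, b (mix A a ω (noiseSrc u j)) = b (a (noiseSrc u j)) := fun a => by
      rw [mix_of_mem (by exact ⟨u, rfl⟩)]
    simp only [hQj, e1, integral_mul_const, integral_const_mul]
    rw [abs_mul]
    have hw0 : 0 ≤ ∫ a, w (mix A a ω) ∂Pr ν := integral_nonneg fun a => ind_nonneg _
    by_cases hg : g j ω
    · rw [ind_of_not (not_not.2 hg)]
      have := M.abs_integral_noise_mix_le hS hj τ k hg
      have h2 := mul_le_mul_of_nonneg_right this (abs_nonneg (Q ω))
      refine h2.trans ?_
      have h3 : |γ| / 2 * (|Q ω| * t') ≤ |γ| / 2 * (q * t') := by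
        have := hQq ω
        gcongr
      linarith
    · rw [ind_of hg]
      have h1 : |∫ a, b (a (noiseSrc u j)) * w (mix A a ω) ∂Pr ν| ≤ b₂ := by
        have := norm_integral_le_of_norm_le_const (μ := Pr ν)
          (f := fun a => b (a (noiseSrc u j)) * w (mix A a ω)) (C := b₂) (ae_of_all _ fun a => by
            rw [norm_eq_abs, abs_mul, abs_of_nonneg (a := w _) (ind_nonneg _)]
            have h1 := M.noise_bound (a (noiseSrc u j))
            have h2 : w (mix A a ω) ≤ 1 := ind_le_one _
            have h3 : 0 ≤ w (mix A a ω) := ind_nonneg _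
            nlinarith [abs_nonneg (b (a (noiseSrc u j)))])
        simpa using this
      have h2 := mul_le_mul h1 (hQq ω) (abs_nonneg _) hb0
      have h3 : 0 ≤ |γ| / 2 * (θ / (1 - θ) * (|Q ω| * ∫ a, w (mix A a ω) ∂Pr ν)
          + q * t') := by positivity
      linarith
  rw [integral_eq_integral_mix ν hf A]
  refine abs_integral_le_integral_abs.trans ?_
  have hm1 := hf.integral_mix_left ν A
  have hm2 := hQw.integral_mix_left ν A
  refine (BddMeas.integral_mono hm1.abs (by fun_prop) _ hpt).trans ?_
  rw [BddMeas.integral_add, integral_const_mul, integral_const_mul,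
    BddMeas.integral_add, integral_const_mul, ← integral_eq_integral_mix ν hQw A, integral_ind hgn]
  simp only [integral_const, probReal_univ, one_smul]
  have hq0 : 0 ≤ q := by
    obtain ⟨ω⟩ : Nonempty (Source m n → Y) := (Pr ν).nonempty_of_neZero
    exact (abs_nonneg _).trans (hQq ω)
  have := mul_le_mul_of_nonneg_left (hS.tail j hj) (mul_nonneg M.b₂_nonneg hq0)
  linarith

lemma bddMeas_rowTerm (j : Fin n) : BddMeas (rowTerm (m := m) H b u C' j) :=
  ((M.bddMeas_noise.coord _).sub ((M.bddMeas_diff j).coord _)).const_mul _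

lemma abs_rowTerm_le (j : Fin n) (ω : Source m n → Y) :
    |rowTerm H b u C' j ω| ≤ 2 * b₁ + b₂ := by
  have h1 := abs_le.1 (M.abs_diff_le j (ω (rowSrc u)))
  have h2 := abs_le.1 (M.noise_bound (ω (noiseSrc u j)))
  unfold rowTerm
  rw [abs_mul, abs_of_nonneg (ind_nonneg _)]
  have h3 : |b (ω (noiseSrc u j)) - H j (ω (rowSrc u))| ≤ 2 * b₁ + b₂ :=
    abs_le.2 ⟨by linarith, by linarith⟩
  nlinarith [ind_le_one (j ∈ C'), ind_nonneg (j ∈ C'),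
    abs_nonneg (b (ω (noiseSrc u j)) - H j (ω (rowSrc u)))]

lemma bddMeas_selectedSum : BddMeas (selectedSum (m := m) H b i u C C' R τ k ε₁) :=
  BddMeas.sum C' fun j _ => (BddMeas.ind (M.measurableSet_smallSelected τ k j)).mul
    ((M.bddMeas_noise.coord _).sub ((M.bddMeas_diff j).coord _))

lemma bddMeas_selectedRest : BddMeas (selectedRest (m := m) H b i u C C' R τ k ε₁ j) := by
  have : {ω | ∀ j' ∈ C.erase j, |residMean H b i j' (R j') ω| ≤ ε₁}
      = ⋂ j' ∈ C.erase j, {ω : Source m n → Y | |residMean H b i j' (R j') ω| ≤ ε₁} := by ext; simp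
  have h2 : MeasurableSet {ω : Source m n → Y |
      ∀ j' ∈ C.erase j, |residMean H b i j' (R j') ω| ≤ ε₁} := by
    rw [this]
    exact measurableSet_biInter _ fun j' _ => M.measurableSet_smallMean j'
  exact (BddMeas.ind h2).mul ((BddMeas.sum_firstK
    (σ := fun j ω => splitScore H b i u R ω j) (g := fun j ω => rowTerm H b u C' j ω)
    (fun j' _ => (M.bddMeas_splitScore (i := i) (u := u) (R := R) j').meas)
    (fun j' _ => M.bddMeas_rowTerm j') τ (k - 1)).sub ((M.bddMeas_diff j).coord _))

lemma abs_selectedRest_le (hk : 0 < k) (ω : Source m n → Y) :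
    |selectedRest H b i u C C' R τ k ε₁ j ω| ≤ k * (2 * b₁ + b₂) := by
  have hb1 := M.b₁_nonneg j
  have hb2 := M.b₂_nonneg
  unfold selectedRest
  rw [abs_mul, abs_of_nonneg (ind_nonneg _)]
  refine (mul_le_of_le_one_left (abs_nonneg _) (ind_le_one _)).trans ?_
  refine (abs_sub _ _).trans ?_
  have h1 : |∑ j' ∈ firstK (C.erase j) (splitScore H b i u R ω) τ (k - 1), rowTerm H b u C' j' ω|
      ≤ ((k : ℝ) - 1) * (2 * b₁ + b₂) := by
    refine (abs_sum_le_sum_abs _ _).trans ?_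
    refine (sum_le_card_nsmul _ _ _ fun j' _ => M.abs_rowTerm_le j' ω).trans ?_
    rw [nsmul_eq_mul]
    refine mul_le_mul_of_nonneg_right ?_ (by positivity)
    have := card_firstK_le (C.erase j) (splitScore H b i u R ω) τ (k - 1)
    have h2 : (#(firstK (C.erase j) (splitScore H b i u R ω) τ (k - 1)) : ℝ) ≤ ((k - 1 : ℕ) : ℝ) :=
      by exact_mod_cast this
    rwa [Nat.cast_sub hk, Nat.cast_one] at h2
  have := M.abs_diff_le j (ω (rowSrc u))
  nlinarith

/-- Individual selection probabilities are unknown, but the dominating events `fewBelow` occur for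
at most `k` columns at once, so their probabilities sum to at most `k`. -/
lemma sum_integral_mul_ind_smallSelected_le
    (hS : SmoothColumns ν H b i u C R g b₁ b₂ ε₁ h θ t δ pb) (hC : C' ⊆ C) (hpb : 0 ≤ pb)
    {f : Fin n → (Source m n → Y) → ℝ} (hc : 0 ≤ c) (hf : ∀ j, BddMeas (f j))
    (hf0 : ∀ j ω, 0 ≤ f j ω) (hfu : ∀ j, DependsOn (f j) (rowBlock u))
    (hfc : ∀ j ∈ C', ∫ ω, f j ω ∂Pr ν ≤ c) :
    ∑ j ∈ C', ∫ ω, f j ω * ind (smallSelected H b i u C R τ k ε₁ j ω) ∂Pr ν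
      ≤ c * (1 / (1 - θ) * (k + #C * t) + #C * pb) := by
  have hθ : 0 < 1 - θ := by linarith [hS.theta_lt_one]
  have ht := hS.t_nonneg
  calc ∑ j ∈ C', ∫ ω, f j ω * ind (smallSelected H b i u C R τ k ε₁ j ω) ∂Pr ν
      ≤ ∑ j ∈ C', c * (1 / (1 - θ) * ((Pr ν).real {ω | fewBelow H b i C R k j ω} + t) + pb) := by
        refine sum_le_sum fun j hj => ?_
        refine (M.integral_mul_ind_smallSelected_le hS (hC hj) τ k (hf j) (hf0 j) (hfu j)).trans ?_
        refine mul_le_mul_of_nonneg_right (hfc j hj) ?_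
        positivity
    _ ≤ ∑ j ∈ C, c * (1 / (1 - θ) * ((Pr ν).real {ω | fewBelow H b i C R k j ω} + t) + pb) := by
        refine sum_le_sum_of_subset_of_nonneg hC fun j _ _ => ?_
        have : 0 ≤ (Pr ν).real {ω | fewBelow H b i C R k j ω} := measureReal_nonneg
        positivity
    _ = c * (1 / (1 - θ) * (∑ j ∈ C, (Pr ν).real {ω | fewBelow H b i C R k j ω}
          + #C * t) + #C * pb) := by
        rw [← mul_sum, sum_add_distrib, ← mul_sum, sum_add_distrib]
        simp [nsmul_eq_mul]
    _ ≤ _ := by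
        have := M.sum_fewBelow_le (i := i) (C := C) (R := R) k
        gcongr

/-- Expand the square as the sum of selected terms times the sum itself. The diagonal noise gives
`γ²` per selected column, about `k γ²` in all; the noise against the rest is nearly uncorrelated by
smoothing, and the signal part is handled by Cauchy–Schwarz. After division by `k²` this is the
noise term `γ² / k`. -/
lemma integral_selectedSum_sq_le
    (hS : SmoothColumns ν H b i u C R g b₁ b₂ ε₁ h θ t δ pb) (hC : C' ⊆ C) (hpb : 0 ≤ pb)
    (hk : 0 < k) {z : ℝ} (hz0 : 0 ≤ z) (hz : ∀ j ∈ C', sg j ≤ z) :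
    ∫ ω, selectedSum H b i u C C' R τ k ε₁ ω ^ 2 ∂Pr ν
      ≤ 3 / 2 * (k * z + γ ^ 2 * (1 + θ / (1 - θ) / 2)) * (1 / (1 - θ) * (k + #C * t) + #C * pb)
        + 9 / 8 * (k ^ 2 * (γ ^ 2 * (θ / (1 - θ)) ^ 2)) + 3 / 2 * (#C * (k * (2 * b₁ + b₂) *
          (|γ| / 2 * (θ / (1 - θ) * (t + δ) + t) + b₂ * pb))) := by
  have hθ : 0 < 1 - θ := by linarith [hS.theta_lt_one]
  have hθ0 := hS.theta_nonneg
  have ht0 := hS.t_nonneg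
  have hd0 := hS.delta_nonneg
  have hb2 := M.b₂_nonneg
  have hk' : (0 : ℝ) < k := by exact_mod_cast hk
  set P := Pr ν with hP
  set V := selectedSum H b i u C C' R τ k ε₁ with hV
  set I : Fin n → (Source m n → Y) → ℝ := fun j ω => ind (smallSelected H b i u C R τ k ε₁ j ω)
    with hI
  set η : Fin n → (Source m n → Y) → ℝ := fun j ω => b (ω (noiseSrc u j)) with hη
  set G : Fin n → (Source m n → Y) → ℝ := fun j ω => H j (ω (rowSrc u)) with hG
  set Q : Fin n → (Source m n → Y) → ℝ := fun j => selectedRest H b i u C C' R τ k ε₁ j with hQ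
  set w : Fin n → (Source m n → Y) → ℝ := fun j ω =>
    ind (j ∈ firstK C (splitScore H b i u R ω) τ k ∧ |residMean H b i j (R j) ω| ≤ ε₁) with hw
  set Φ := 1 / (1 - θ) * (k + #C * t) + #C * pb with hΦ
  set t' := θ / (1 - θ) * (t + δ) + t with ht'
  set ρ := θ / (1 - θ) with hρ
  have hρ0 : 0 ≤ ρ := by positivity
  have hVb : BddMeas V := M.bddMeas_selectedSum
  have hIb : ∀ j, BddMeas (I j) := fun j => BddMeas.ind (M.measurableSet_smallSelected τ k j)
  have hηb : ∀ j, BddMeas (η j) := fun j => M.bddMeas_noise.coord _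
  have hGb : ∀ j, BddMeas (G j) := fun j => (M.bddMeas_diff j).coord _
  have hQb : ∀ j, BddMeas (Q j) := fun j => M.bddMeas_selectedRest
  have hwb : ∀ j, BddMeas (w j) := fun j =>
    BddMeas.ind ((M.measurableSet_selected τ k j).inter (M.measurableSet_smallMean j))
  have hI0 : ∀ j ω, 0 ≤ I j ω := fun j ω => ind_nonneg _
  have hII : ∀ ω, ∑ j ∈ C', I j ω ≤ k := by
    classical
    intro ω
    have h1 : ∀ j ∈ C', I j ω ≤ if j ∈ firstK C (splitScore H b i u R ω) τ k then 1 else 0 := by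
      intro j _
      split_ifs with hc
      · exact ind_le_one _
      · exact (ind_of_not fun h' : smallSelected H b i u C R τ k ε₁ j ω => hc h'.1).le
    refine (sum_le_sum h1).trans ?_
    rw [← sum_filter, sum_const, nsmul_eq_mul, mul_one]
    have h2 : (C'.filter fun j => j ∈ firstK C (splitScore H b i u R ω) τ k)
        ⊆ firstK C (splitScore H b i u R ω) τ k := fun j hj => (mem_filter.1 hj).2
    exact_mod_cast (card_le_card h2).trans (card_firstK_le _ _ _ _)
  -- The requirement that all sample means be small is split: column `j`'s own mean goes into `w`,
  -- the others into `Q`, which vanishes when one of them is large.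
  have hIQ : ∀ j ∈ C', ∀ ω, w j ω * Q j ω = I j ω * (V ω - η j ω) := by
    intro j hj ω
    by_cases hc : smallSelected H b i u C R τ k ε₁ j ω
    · have h1 : I j ω = 1 := ind_of hc
      have h2 : w j ω = 1 := ind_of ⟨hc.1, hc.2 j (hC hj)⟩
      rw [h1, h2]
      simp only [hQ]
      rw [selectedRest_eq hC hj hc]
    · have h1 : I j ω = 0 := ind_of_not hc
      rw [h1, zero_mul]
      by_cases hc2 : j ∈ firstK C (splitScore H b i u R ω) τ k ∧ |residMean H b i j (R j) ω| ≤ ε₁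
      · have : ¬ ∀ j' ∈ C.erase j, |residMean H b i j' (R j') ω| ≤ ε₁ := fun hc3 => hc
          ⟨hc2.1, fun j' hj' => by
            all_goals grind⟩
        have h3 : Q j ω = 0 := by simp only [hQ, selectedRest]; rw [ind_of_not this, zero_mul]
        rw [h3, mul_zero]
      · have : w j ω = 0 := ind_of_not hc2
        rw [this, zero_mul]
  have hV1 : ∀ ω, V ω = ∑ j ∈ C', I j ω * (η j ω - G j ω) := fun ω => rfl
  have hpt : ∀ ω, V ω ^ 2 ≤ ∑ j ∈ C', (η j ω ^ 2 * I j ω + η j ω * w j ω * Q j ω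
      + k * (G j ω ^ 2 * I j ω)) + V ω ^ 2 / 4 := by
    intro ω
    have h1 : V ω ^ 2 = ∑ j ∈ C', I j ω * (η j ω - G j ω) * V ω := by
      rw [← sum_mul, ← hV1, sq]
    have h2 : ∀ j ∈ C', I j ω * (η j ω - G j ω) * V ω ≤ (η j ω ^ 2 * I j ω + η j ω * w j ω * Q j ω
        + k * (G j ω ^ 2 * I j ω)) + I j ω * (V ω ^ 2 / (4 * k)) := by
      intro j hj
      have e : η j ω * w j ω * Q j ω = η j ω * (I j ω * (V ω - η j ω)) := by
        rw [mul_assoc, hIQ j hj]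
      rw [e]
      -- At most `k` columns are selected, so the last term adds up to at most `V² / 4`, which is
      -- absorbed on the left.
      have h3 : -(G j ω * V ω) ≤ k * G j ω ^ 2 + V ω ^ 2 / (4 * k) := by
        have : 0 ≤ (k * G j ω + V ω / 2) ^ 2 / k := by positivity
        have e2 : (k * G j ω + V ω / 2) ^ 2 / k = k * G j ω ^ 2 + V ω ^ 2 / (4 * k)
            + G j ω * V ω := by field_simp; ring
        linarith
      nlinarith [mul_le_mul_of_nonneg_left h3 (hI0 j ω)]
    have h3 := sum_le_sum h2
    rw [← h1, sum_add_distrib, ← sum_mul] at h3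
    have h4 : (∑ j ∈ C', I j ω) * (V ω ^ 2 / (4 * k)) ≤ V ω ^ 2 / 4 := by
      refine (mul_le_mul_of_nonneg_right (hII ω) (by positivity)).trans (le_of_eq ?_)
      field_simp
    linarith
  have hbi : ∀ j, BddMeas fun ω => η j ω ^ 2 * I j ω + η j ω * w j ω * Q j ω
      + k * (G j ω ^ 2 * I j ω) := fun _ => by fun_prop
  have h1 := BddMeas.integral_mono (hVb.pow 2) (by fun_prop) P hpt
  rw [BddMeas.integral_add,
    integral_finsetSum _ fun j _ => (hbi j).integrable _, integral_div] at h1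
  have h2 : ∀ j ∈ C', ∫ ω, η j ω ^ 2 * I j ω + η j ω * w j ω * Q j ω
      + k * (G j ω ^ 2 * I j ω) ∂P = ∫ ω, η j ω ^ 2 * I j ω ∂P + ∫ ω, η j ω * w j ω * Q j ω ∂P
      + k * ∫ ω, G j ω ^ 2 * I j ω ∂P := by
    intro j _
    rw [BddMeas.integral_add, BddMeas.integral_add, integral_const_mul]
  rw [sum_congr rfl h2, sum_add_distrib, sum_add_distrib, ← mul_sum] at h1
  have dη : ∀ (F : ℝ → ℝ) j, DependsOn (fun ω => F (η j ω)) (rowBlock u) := fun F j x y hxy =>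
    congrArg (fun y => F (b y)) (hxy _ (Or.inr ⟨j, rfl⟩))
  have dG : ∀ j, DependsOn (fun ω => G j ω ^ 2) (rowBlock u) := fun j x y hxy =>
    congrArg (fun y => H j y ^ 2) (hxy _ (Or.inl rfl))
  have hη2 : ∀ j, ∫ ω, η j ω ^ 2 ∂P = γ ^ 2 := fun j => by
    have := integral_coord ν (M.meas_noise.pow_const 2) (noiseSrc u j)
    rw [M.noise_var] at this
    exact this
  have a1 : ∑ j ∈ C', ∫ ω, η j ω ^ 2 * I j ω ∂P ≤ γ ^ 2 * Φ :=
    M.sum_integral_mul_ind_smallSelected_le hS hC hpb (sq_nonneg γ) (fun j => (hηb j).pow 2)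
      (fun j ω => sq_nonneg _) (fun j => dη (fun x => x ^ 2) j) fun j _ => (hη2 j).le
  have a2 : ∑ j ∈ C', ∫ ω, G j ω ^ 2 * I j ω ∂P ≤ z * Φ :=
    M.sum_integral_mul_ind_smallSelected_le hS hC hpb hz0 (fun j => (hGb j).pow 2)
      (fun j ω => sq_nonneg _) dG fun j hj => by
        have := integral_coord ν ((M.meas_diff j).pow_const 2) (rowSrc u)
        rw [M.diff_var] at this
        exact this.le.trans (hz j hj)
  have a3 : ∑ j ∈ C', ∫ ω, |η j ω| * I j ω ∂P ≤ |γ| * Φ :=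
    M.sum_integral_mul_ind_smallSelected_le hS hC hpb (abs_nonneg γ) (fun j => (hηb j).abs)
      (fun j ω => abs_nonneg _) (fun j => dη (fun x => |x|) j) fun j _ => by
        have h3 : (∫ ω, |η j ω| ∂P) ^ 2 ≤ ∫ ω, |η j ω| ^ 2 ∂P := by
          have := integral_nonneg (μ := P) (f := fun ω => (|η j ω| - ∫ ω, |η j ω| ∂P) ^ 2)
            fun ω => sq_nonneg _
          have e : ∀ ω, (|η j ω| - ∫ ω, |η j ω| ∂P) ^ 2 = |η j ω| ^ 2
            - (2 * (∫ ω, |η j ω| ∂P) * |η j ω| - (∫ ω, |η j ω| ∂P) ^ 2) := fun ω => by ring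
          simp only [e] at this
          rw [BddMeas.integral_sub, BddMeas.integral_sub, integral_const_mul] at this
          simp only [integral_const, probReal_univ, one_smul] at this
          nlinarith
        simp only [sq_abs] at h3
        rw [hη2 j] at h3
        exact le_trans (le_abs_self _) (sq_le_sq.1 h3)
  have a4 : ∑ j ∈ C', ∫ ω, |Q j ω| * w j ω ∂P ≤ k * ∫ ω, |V ω| ∂P + |γ| * Φ := by
    have e1 : ∀ j ∈ C', ∀ ω, |Q j ω| * w j ω ≤ I j ω * |V ω| + |η j ω| * I j ω := by
      intro j hj ω
      have : |Q j ω| * w j ω = |w j ω * Q j ω| := by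
        rw [abs_mul, abs_of_nonneg (a := w j ω) (ind_nonneg _), mul_comm]
      rw [this, hIQ j hj, abs_mul, abs_of_nonneg (hI0 j ω)]
      nlinarith [mul_le_mul_of_nonneg_left (abs_sub (V ω) (η j ω)) (hI0 j ω)]
    have e2 : ∀ j ∈ C', ∫ ω, |Q j ω| * w j ω ∂P
        ≤ ∫ ω, I j ω * |V ω| ∂P + ∫ ω, |η j ω| * I j ω ∂P := by
      intro j hj
      rw [← BddMeas.integral_add]
      exact BddMeas.integral_mono (by fun_prop) (by fun_prop) P (e1 j hj)
    have e3 := sum_le_sum e2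
    rw [sum_add_distrib, ← integral_finsetSum _ fun j _ => ((hIb j).mul hVb.abs).integrable _] at e3
    have e4 : ∫ ω, ∑ j ∈ C', I j ω * |V ω| ∂P ≤ ∫ ω, k * |V ω| ∂P :=
      BddMeas.integral_mono (by fun_prop) (by fun_prop) P fun ω => by
          rw [← sum_mul]
          exact mul_le_mul_of_nonneg_right (hII ω) (abs_nonneg _)
    rw [integral_const_mul] at e4
    linarith
  have a5 : ∑ j ∈ C', ∫ ω, η j ω * w j ω * Q j ω ∂P ≤ |γ| / 2 * ρ * (k * ∫ ω, |V ω| ∂P + |γ| * Φ)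
        + #C * (k * (2 * b₁ + b₂) * (|γ| / 2 * t' + b₂ * pb)) := by
    have e1 : ∀ j ∈ C', ∫ ω, η j ω * w j ω * Q j ω ∂P ≤ |γ| / 2 * ρ * (∫ ω, |Q j ω| * w j ω ∂P)
        + k * (2 * b₁ + b₂) * (|γ| / 2 * t' + b₂ * pb) := by
      intro j hj
      have := M.abs_integral_noise_mul_le hS (hC hj) τ k (hQb j)
        (fun ω => M.abs_selectedRest_le hk ω)
        (fun a ω => selectedRest_mix_colBlock hS.notMem (hC hj) a ω)
      refine (le_abs_self _).trans (this.trans (le_of_eq ?_))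
      ring
    refine (sum_le_sum e1).trans ?_
    rw [sum_add_distrib, ← mul_sum, sum_const, nsmul_eq_mul]
    refine add_le_add (mul_le_mul_of_nonneg_left a4 (by positivity)) ?_
    rcases C'.eq_empty_or_nonempty with h0 | ⟨j, _⟩
    · rw [h0]
      have hb : 0 ≤ 2 * b₁ + b₂ := by
        have := M.b₁_nonneg i
        linarith
      simp only [card_empty, Nat.cast_zero, zero_mul]
      have ht'0 : 0 ≤ t' := by positivity
      positivity
    · have hb : 0 ≤ 2 * b₁ + b₂ := by
        have := M.b₁_nonneg j
        linarith
      have ht'0 : 0 ≤ t' := by positivity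
      refine mul_le_mul_of_nonneg_right ?_ (by positivity)
      exact_mod_cast card_le_card hC
  -- The correlation term still contains the first absolute moment of `V`; a further `V² / 12` is
  -- spent on it.
  have a6 : |γ| / 2 * ρ * (k * ∫ ω, |V ω| ∂P) ≤ 3 / 4 * (k ^ 2 * (γ ^ 2 * ρ ^ 2))
      + (∫ ω, V ω ^ 2 ∂P) / 12 := by
    have e := BddMeas.integral_mono (hVb.abs.const_mul (|γ| / 2 * ρ * k))
      ((BddMeas.const (3 / 4 * (k ^ 2 * (γ ^ 2 * ρ ^ 2)))).add ((hVb.pow 2).div_const 12)) P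
      fun ω => by
        have := sq_nonneg (|V ω| - 3 * (|γ| * ρ * k))
        have e1 : (|V ω| - 3 * (|γ| * ρ * k)) ^ 2 = V ω ^ 2 - 6 * (|γ| * ρ * k) * |V ω|
            + 9 * (k ^ 2 * (γ ^ 2 * ρ ^ 2)) := by
          rw [← sq_abs (V ω), ← sq_abs γ]; ring
        linarith
    rw [BddMeas.integral_add (.const _) ((hVb.pow 2).div_const 12), integral_const_mul,
      integral_div] at e
    simp only [integral_const, probReal_univ, one_smul] at e
    linarith
  have hk2 := mul_le_mul_of_nonneg_left a2 hk'.le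
  have e7 : |γ| / 2 * ρ * (|γ| * Φ) = γ ^ 2 * (ρ / 2) * Φ := by rw [← sq_abs γ]; ring
  -- The absorbed parts leave `1 - 1 / 4 - 1 / 12 = 2 / 3` of the second moment, whence the factors
  -- `3 / 2` and `9 / 8 = (3 / 2) (3 / 4)`.
  linarith

lemma abs_nbrTerm_sub_le {R : Finset (Fin m)} (hu : u ∈ R)
    (hR : 2 ≤ #R) {ε : ℝ} {ω : Source m n → Y} (hω : |residMean H b i j (R.erase u) ω| ≤ ε) :
    |nbrTerm H b i u j R ω - (b (ω (noiseSrc u j)) - H j (ω (rowSrc u)))|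
      ≤ ε + (2 * (b₁ + b₂) + ε) / #R := by
  have hc : (0 : ℝ) < #R := by exact_mod_cast (show 0 < #R by omega)
  have e : nbrTerm H b i u j R ω - (b (ω (noiseSrc u j)) - H j (ω (rowSrc u)))
      = residMean H b i j (R.erase u) ω + residDev H b i u j (R.erase u) ω / #R := by
    unfold nbrTerm
    rw [residMean_erase hu hR]
    have : residMean H b i j (R.erase u) ω = resid H b i j u ω
      - residDev H b i u j (R.erase u) ω := by simp [residDev]
    rw [this]
    field_simp
    ring
  rw [e]
  refine (abs_add_le _ _).trans (add_le_add hω ?_)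
  rw [abs_div, abs_of_pos hc]
  have h1 := M.abs_resid_le (i := i) (j := j) u ω
  have : |residDev H b i u j (R.erase u) ω| ≤ 2 * (b₁ + b₂) + ε :=
    (abs_sub _ _).trans (add_le_add h1 hω)
  gcongr

/-- On the good event every selected column has small variance, so restricting the sum to `C'` loses
nothing, and each neighbour term differs from its row-`u` noise and signal by at most `e₀`. -/
lemma abs_nbrErr_le_selectedSum (hR : ∀ j ∈ C, 2 ≤ #(R j)) (hu : ∀ j ∈ C, u ∈ R j) (hk : 0 < k)
    (hT : T ⊆ C) (hTk : k ≤ #T) {e₀ : ℝ} (hζ : ∀ j ∈ T, sg j ≤ ζ)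
    (hC' : ∀ j, j ∈ C' ↔ j ∈ C ∧ sg j ≤ ζ + 3 * α / 2 + α ^ 2 / 4 + κ)
    (hκ : ∀ j ∈ C, (2 * (b₁ + b₂) + α / 2) ^ 2 / #(R j) ≤ κ)
    (he₀ : ∀ j ∈ C, α / 2 + (2 * (b₁ + b₂) + α / 2) / #(R j) ≤ e₀) (hε₁ : α / 2 ≤ ε₁)
    {ω : Source m n → Y} (hg : ∀ j ∈ C, goodCol H b i sg γ α j ((R j).erase u) ω) :
    |nbrErr H b i u C R τ k ω|
      ≤ |selectedSum H b i u C C' (fun j => (R j).erase u) τ k ε₁ ω| / k + e₀ := by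
  have hk' : (0 : ℝ) < k := by exact_mod_cast hk
  set R' : Fin n → Finset (Fin m) := fun j => (R j).erase u with hR'
  have hRe : ∀ j ∈ C, (R' j).Nonempty := fun j hj =>
    card_pos.1 (by
      grind)
  have hS : firstK C (nbrScore H b i R ω) τ k = firstK C (splitScore H b i u R' ω) τ k :=
    firstK_congr fun j hj => nbrScore_eq_splitScore (hu j hj) (hR j hj) ω
  have hCC : C' ⊆ C := fun j hj => ((hC' j).1 hj).1
  have hcard : ∀ j ∈ C, ((#(R' j) : ℝ) + 1) = #(R j) := fun j hj => by
    simp only [hR']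
    rw [card_erase_of_mem (hu j hj), Nat.cast_sub (by have := hR j hj; omega)]; simp
  have hSC' : ∀ j ∈ firstK C (splitScore H b i u R' ω) τ k, j ∈ C' := by
    intro j hj
    refine (hC' j).2 ⟨firstK_subset _ _ _ _ hj, ?_⟩
    refine sg_le_of_mem_firstK hRe hT hTk hζ hg (fun j' hj' => ?_) (fun j' hj' => ?_) hj
    · unfold splitScore
      have : 0 ≤ residDev H b i u j' (R' j') ω ^ 2 / (#(R' j') + 1) := by positivity
      linarith
    · unfold splitScore
      have h1 := M.residDev_sq_le (u := u) (hg j' hj').1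
      have h2 : residDev H b i u j' (R' j') ω ^ 2 / (#(R' j') + 1) ≤ κ := by
        refine le_trans ?_ (hκ j' hj')
        rw [hcard j' hj']
        gcongr
      linarith
  rw [selectedSum_eq hCC fun j hj => (hg j hj).1.trans hε₁]
  set S := firstK C (splitScore H b i u R' ω) τ k with hSd
  have hScard : #S = k := card_firstK (hTk.trans (card_le_card hT))
  have hSsub : S ⊆ C := firstK_subset _ _ _ _
  have hx : ∀ j ∈ S, rowTerm H b u C' j ω
      = b (ω (noiseSrc u j)) - H j (ω (rowSrc u)) := fun j hj => by
    rw [rowTerm, ind_of (hSC' j hj), one_mul]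
  have hd : |∑ j ∈ S, nbrTerm H b i u j (R j) ω - ∑ j ∈ S, rowTerm H b u C' j ω| ≤ k * e₀ := by
    rw [← sum_sub_distrib]
    refine (abs_sum_le_sum_abs _ _).trans ?_
    refine (sum_le_card_nsmul _ _ e₀ fun j hj => ?_).trans (by rw [hScard, nsmul_eq_mul])
    rw [hx j hj]
    exact (M.abs_nbrTerm_sub_le (hu j (hSsub hj)) (hR j (hSsub hj)) (hg j (hSsub hj)).1).trans
      (he₀ j (hSsub hj))
  unfold nbrErr
  rw [hS, abs_div, abs_of_pos hk', div_add' _ _ _ hk'.ne', div_le_div_iff_of_pos_right hk']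
  grind

/-- Mean squared error at an observed entry with large noise. -/
lemma integral_nbrErr_sq_le_of_smooth (hR : ∀ j ∈ C, 2 ≤ #(R j))
    (hu : ∀ j ∈ C, u ∈ R j) (τ : Equiv.Perm (Fin n)) (hk : 0 < k)
    (hT : T ⊆ C) (hTk : k ≤ #T) {e₀ e : ℝ} {g : Fin n → (Source m n → Y) → Prop}
    (hS : SmoothColumns ν H b i u C (fun j => (R j).erase u) g b₁ b₂ ε₁ h θ t δ pb)
    (hpb : 0 ≤ pb) (hz : 0 ≤ ζ + 3 * α / 2 + α ^ 2 / 4 + κ) (hζ : ∀ j ∈ T, sg j ≤ ζ)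
    (hκ : ∀ j ∈ C, (2 * (b₁ + b₂) + α / 2) ^ 2 / #(R j) ≤ κ)
    (he₀ : ∀ j ∈ C, α / 2 + (2 * (b₁ + b₂) + α / 2) / #(R j) ≤ e₀) (hε₁ : α / 2 ≤ ε₁) (he : ∀ j ∈ C,
      (Pr ν).real {ω | ¬ goodCol H b i sg γ α j ((R j).erase u) ω} ≤ 4 * e) :
    ∫ ω, nbrErr H b i u C R τ k ω ^ 2 ∂Pr ν
      ≤ 17 / 16 * ((3 / 2 * (k * (ζ + 3 * α / 2 + α ^ 2 / 4 + κ) + γ ^ 2 * (1 + θ / (1 - θ) / 2)) *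
          (1 / (1 - θ) * (k + #C * t) + #C * pb) + 9 / 8 * (k ^ 2 * (γ ^ 2 * (θ / (1 - θ)) ^ 2))
        + 3 / 2 * (#C * (k * (2 * b₁ + b₂) *
          (|γ| / 2 * (θ / (1 - θ) * (t + δ) + t) + b₂ * pb)))) / k ^ 2) + 17 * e₀ ^ 2
        + (2 * (b₁ + 2 * b₂)) ^ 2 * (4 * e * #C) := by
  classical
  have hk' : (0 : ℝ) < k := by exact_mod_cast hk
  have hRn : ∀ j ∈ C, (R j).Nonempty := fun j hj => card_pos.1 (by have := hR j hj; omega)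
  set C' := C.filter fun j => sg j ≤ ζ + 3 * α / 2 + α ^ 2 / 4 + κ with hC'
  set V := selectedSum H b i u C C' (fun j => (R j).erase u) τ k ε₁ with hV
  have hVb : BddMeas V := M.bddMeas_selectedSum
  have hmain := M.integral_selectedSum_sq_le (τ := τ) hS (filter_subset _ _ : C' ⊆ C) hpb hk
    hz fun j hj => (mem_filter.1 hj).2
  change ∫ ω, V ω ^ 2 ∂Pr ν ≤ _ at hmain
  set K := 3 / 2 * (k * (ζ + 3 * α / 2 + α ^ 2 / 4 + κ) + γ ^ 2 * (1 + θ / (1 - θ) / 2)) *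
          (1 / (1 - θ) * (k + #C * t) + #C * pb) + 9 / 8 * (k ^ 2 * (γ ^ 2 * (θ / (1 - θ)) ^ 2))
        + 3 / 2 * (#C * (k * (2 * b₁ + b₂) *
          (|γ| / 2 * (θ / (1 - θ) * (t + δ) + t) + b₂ * pb))) with hK
  have hbd : ∀ ω, (∀ j ∈ C, goodCol H b i sg γ α j ((R j).erase u) ω) →
      |nbrErr H b i u C R τ k ω| ≤ |V ω| / k + e₀ := fun ω hg =>
    M.abs_nbrErr_le_selectedSum (C' := C') hR hu (τ := τ) hk hT hTk hζ
      (fun j => by rw [hC', mem_filter]) hκ he₀ hε₁ hg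
  clear_value K V
  have hgn : ∀ j, MeasurableSet {ω : Source m n → Y | ¬ goodCol H b i sg γ α j ((R j).erase u) ω} :=
    fun j => (M.measurableSet_goodCol _).compl
  have hgb : ∀ j, BddMeas fun ω : Source m n → Y =>
      ind (¬ goodCol H b i sg γ α j ((R j).erase u) ω) := fun j => BddMeas.ind (hgn j)
  have hsum : BddMeas fun ω : Source m n → Y =>
      ∑ j ∈ C, ind (¬ goodCol H b i sg γ α j ((R j).erase u) ω) := by fun_prop
  have hpt : ∀ ω, nbrErr H b i u C R τ k ω ^ 2 ≤ 17 / 16 / k ^ 2 * V ω ^ 2 + 17 * e₀ ^ 2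
      + (2 * (b₁ + 2 * b₂)) ^ 2 * ∑ j ∈ C, ind (¬ goodCol H b i sg γ α j ((R j).erase u) ω) := by
    intro ω
    have hn : 0 ≤ ∑ j ∈ C, ind (¬ goodCol H b i sg γ α j ((R j).erase u) ω) :=
      sum_nonneg fun j _ => ind_nonneg _
    by_cases hg : ∀ j ∈ C, goodCol H b i sg γ α j ((R j).erase u) ω
    · have h1 := hbd ω hg
      have h2 : nbrErr H b i u C R τ k ω ^ 2 ≤ (|V ω| / k + e₀) ^ 2 := by
        rw [← sq_abs]
        exact pow_le_pow_left₀ (abs_nonneg _) h1 2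
      -- Young's inequality with weights `1 + 1 / 16` and `1 + 16`: the bias `e₀ = O(α)` is squared
      -- and can carry the large constant.
      have h3 : (|V ω| / k + e₀) ^ 2 ≤ 17 / 16 / k ^ 2 * V ω ^ 2 + 17 * e₀ ^ 2 := by
        have e1 : 17 / 16 / (k : ℝ) ^ 2 * V ω ^ 2 = 17 / 16 * (|V ω| / k) ^ 2 := by
          rw [div_pow, sq_abs]; ring
        rw [e1]
        nlinarith [sq_nonneg (|V ω| / k / 4 - 4 * e₀)]
      have := mul_nonneg (sq_nonneg (2 * (b₁ + 2 * b₂))) hn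
      linarith
    · push Not at hg
      obtain ⟨j, hj, hjg⟩ := hg
      have h1 : 1 ≤ ∑ j ∈ C, ind (¬ goodCol H b i sg γ α j ((R j).erase u) ω) := by
        refine le_trans (le_of_eq (ind_of hjg).symm) (single_le_sum
          (f := fun j => ind (¬ goodCol H b i sg γ α j ((R j).erase u) ω))
          (fun j _ => ind_nonneg _) hj)
      have := abs_le.1 (M.abs_nbrErr_le (i := i) (u := u) hRn τ hk ω)
      have h2 : nbrErr H b i u C R τ k ω ^ 2 ≤ (2 * (b₁ + 2 * b₂)) ^ 2 := sq_le_sq' this.1 this.2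
      have h3 : 0 ≤ 17 / 16 / (k : ℝ) ^ 2 * V ω ^ 2 + 17 * e₀ ^ 2 := by positivity
      have h4 := mul_le_mul_of_nonneg_left h1 (sq_nonneg (2 * (b₁ + 2 * b₂)))
      linarith
  refine (BddMeas.integral_mono ((M.bddMeas_nbrErr C R τ k).pow 2) (by fun_prop) _ hpt).trans ?_
  rw [BddMeas.integral_add, BddMeas.integral_add, integral_const_mul,
    integral_const_mul, integral_const_mul, integral_finsetSum _ fun j _ => (hgb j).integrable _]
  simp only [integral_const, probReal_univ, one_smul]
  have h4 : ∑ j ∈ C, ∫ ω, ind (¬ goodCol H b i sg γ α j ((R j).erase u) ω) ∂Pr ν ≤ 4 * e * #C := by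
    refine (sum_le_card_nsmul C _ (4 * e) fun j hj => ?_).trans
      (le_of_eq (by rw [nsmul_eq_mul, mul_comm]))
    rw [integral_ind (hgn j)]
    exact he j hj
  have h5 : 17 / 16 / (k : ℝ) ^ 2 * ∫ ω, V ω ^ 2 ∂Pr ν ≤ 17 / 16 * (K / k ^ 2) := by
    rw [div_mul_eq_mul_div, mul_div_assoc]
    gcongr
  nlinarith

/-- Regular columns are smoothed by their noise. -/
lemma smoothColumns_of_regularCol (hγ : γ ≠ 0) {c₀ b₀ s ρ ε L : ℝ} {V₀ lam : Fin n → ℝ}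
    (hi : i ∉ C) (hu : ∀ j ∈ C, u ∉ R j) (hR : ∀ j ∈ C, (R j).Nonempty) (hc₀ : 0 ≤ c₀)
    (hε : 0 ≤ ε) (hε2 : ε ≤ 2) (hs : 0 ≤ s) (hsb : s * b₂ ≤ 1) (hh : 0 ≤ h) (hρ0 : 0 ≤ ρ)
    (hρ1 : ρ < 1) (hκ : c₀ + b₀ ≤ ρ * κ / 2) (hL0 : 0 < L)
    (hpb : ∀ j ∈ C, 2 * exp (-(#(R j) * c₀ ^ 2 / (2 * (b₁ + b₂) ^ 2)))
        + exp (-(4 * ε ^ 2 * γ ^ 4 * #(R j) / (8 * b₂ * (b₁ + b₂)) ^ 2)) ≤ pb)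
    (hδ : ∀ j ∈ C, 2 * exp (-(#(R j) * (s * b₀ - s ^ 2 * γ ^ 2))) ≤ δ)
    (hlam : ∀ j ∈ C, 0 < lam j) (hlJ : ∀ j ∈ C, lam j * (8 * b₂ * (b₁ + b₂)) ≤ 1 / 6)
    (hV₀ : ∀ j ∈ C, 0 < V₀ j)
    (hV : ∀ j ∈ C, V₀ j ≤ (1 - ε) * (4 * γ ^ 4 * #(R j)) - #(R j) * (κ ^ 2 * γ ^ 2))
    (hL : ∀ j ∈ C, lam j ^ 2 * V₀ j = 2 * L)
    (hθ : ∀ j ∈ C, 156 / 125 * (h + 8 * b₂ * (b₁ + b₂)) * lam j / (1 - ρ) ≤ θ)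
    (hθ0 : 0 ≤ θ) (hθ1 : θ < 1) (ht0 : 0 ≤ t) (hδ0 : 0 ≤ δ)
    (ht : ∀ j ∈ C, exp (-L) * (1 + θ / (2 * L))
      + 12 / 5 * #(R j) * (8 * b₂ * (b₁ + b₂) * (h + 2 * (8 * b₂ * (b₁ + b₂)))) * δ
            / ((1 - ρ) * V₀ j) ≤ t) (hgap : ∀ j ∈ C, ∀ j' ∈ C,
      (2 * (b₁ + b₂) + (c₀ + b₀)) ^ 2 * #(R j) < h * (#(R j') + 1)) : SmoothColumns ν H b i u C R
      (fun j => regularCol ν H b i c₀ ((1 - ε) * (4 * γ ^ 4 * #(R j))) j (R j))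
      b₁ b₂ (c₀ + b₀) h θ t δ pb where
  notMem := hi
  row := hu
  nonempty := hR
  meas j _ := M.measurableSet_regularCol _
  inv_row j hj a ω := by
    have : ∀ v ∈ R j, colSignal H b i j v (mix (rowBlock u) a ω) = colSignal H b i j v ω := by
      intro v hv
      have hvu : v ≠ u := ne_of_mem_of_not_mem hv (hu j hj)
      unfold colSignal
      rw [mix_of_notMem (by rintro (h | ⟨_, h⟩) <;> simp [hvu] at h),
        mix_of_notMem (by rintro (h | ⟨_, h⟩) <;> simp [hvu] at h)]
    unfold regularCol
    rw [sum_congr rfl this, sum_congr rfl fun v hv =>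
      congrArg (pairVar (ν (noiseSrc v j)) b) (this v hv)]
  inv_col j hj A hA a ω := by
    have hij : i ≠ j := fun e => hi (e ▸ hj)
    have : ∀ v, colSignal H b i j v (mix A a ω) = colSignal H b i j v ω := by
      intro v
      unfold colSignal
      rw [mix_colBlock_noise hA hij.symm, mix_colBlock_row hA]
    unfold regularCol
    simp only [this]
  tail j hj := (M.regularCol_tail hγ (hR j hj) hc₀ hε hε2).trans (hpb j hj)
  window j hj ω hω U hU := by
    have hij : i ≠ j := fun e => hi (e ▸ hj)
    refine (M.window_residSq hij hγ (hR j hj) hs hsb hω hh hρ0 hρ1 hκ (hδ j hj) hL0 (hlam j hj)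
      (hlJ j hj) (hV₀ j hj) (hV j hj) (hL j hj) hU).trans ?_
    refine add_le_add (mul_le_mul_of_nonneg_right (hθ j hj) measureReal_nonneg) (le_trans ?_ (ht j hj))
    have := hθ j hj
    gcongr
  dev j hj ω hω := by
    have hij : i ≠ j := fun e => hi (e ▸ hj)
    exact (M.residMean_mix_tail hij (hR j hj) hs hsb hω).trans (hδ j hj)
  theta_nonneg := hθ0
  theta_lt_one := hθ1
  t_nonneg := ht0
  delta_nonneg := hδ0
  gap := hgap

lemma goodCol_tail_of_scale (h : Scale (b₁ + 2 * b₂) α c r) (hij : i ≠ j) {R : Finset (Fin m)}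
    (hR : 0.9999 ≤ α ^ 3 * #R) :
    (Pr ν).real {ω | ¬ goodCol H b i sg γ α j R ω} ≤ 4 * exp (-c / α) := by
  have h1 := h.card_pos hR
  exact M.goodCol_tail hij (card_pos.1 (by exact_mod_cast h1)) h.α_pos.le
    (h.exp_mean_le hR) (h.exp_sq_le hR)

lemma integral_nbrErr_sq_le_trivial (hR : ∀ j ∈ C, 0 < #(R j)) (τ : Equiv.Perm (Fin n))
    (hk : 0 < k) : ∫ ω, nbrErr H b i u C R τ k ω ^ 2 ∂Pr ν ≤ (2 * (b₁ + 2 * b₂)) ^ 2 := by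
  have h3 : ∀ ω, nbrErr H b i u C R τ k ω ^ 2 ≤ (2 * (b₁ + 2 * b₂)) ^ 2 := fun ω => by
    have := abs_le.1 (M.abs_nbrErr_le (i := i) (u := u) (fun j hj => card_pos.1 (hR j hj)) τ hk ω)
    exact sq_le_sq' this.1 this.2
  have := BddMeas.integral_mono ((M.bddMeas_nbrErr (i := i) (u := u) C R τ k).pow 2)
    (by fun_prop) (Pr ν) h3
  simpa using this

/-- The direct estimate has the form `F` plus a remainder below `2 α`; replacing `F` by the
logarithmic expression is free unless that expression already reaches the trivial bound. -/
lemma integral_nbrErr_sq_le_mainBound_of_notMem (h : Scale (b₁ + 2 * b₂) α c r)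
    (hi : i ∉ C) (hR : ∀ j ∈ C, 1 ≤ α ^ 3 * #(R j))
    (hu : ∀ j ∈ C, u ∉ R j) (τ : Equiv.Perm (Fin n)) (hk : 0 < k) (hT : T ⊆ C)
    (hTk : k ≤ #T) (hζ0 : 0 < ζ) (hζ : ∀ j ∈ T, sg j ≤ ζ)
    (hF : ζ + 2 * α + γ ^ 2 / k ≤ 2 * (b₁ + 2 * b₂)) : ∫ ω, nbrErr H b i u C R τ k ω ^ 2 ∂Pr ν
      ≤ mainBound (b₁ + 2 * b₂) α (ζ + 2 * α + γ ^ 2 / k)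
        + (2 * (b₁ + 2 * b₂)) ^ 2 * (17 / 4 * exp (-c / α) * #C) := by
  have hα := h.α_pos
  have hαle := h.α_le
  have h0 := h.α_cube_le
  have hcard : ∀ j ∈ C, (1 : ℝ) < #(R j) := fun j hj => by
    have := hR j hj
    nlinarith
  have hR2 : ∀ j ∈ C, 2 ≤ #(R j) := fun j hj => by
    have := hcard j hj
    exact_mod_cast this
  have h1 := M.integral_nbrErr_sq_le_of_notMem (i := i) (u := u) hR2 hu τ hk hT hTk (α := α)
    (κ := 0.02 * α) (e := exp (-c / α)) hα.le (by positivity) hζ0.le hζ (fun j hj => by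
      have h2 := hcard j hj
      have h3 := M.sg_le j
      have h4 := M.gamma_sq_le j
      have h5 := M.b₁_nonneg j
      have h6 := M.b₂_nonneg
      have h7 := h.sq_mul_le
      have h8 := hR j hj
      rw [div_le_iff₀ (by linarith)]
      have h9 : sg j + 2 * γ ^ 2 ≤ (b₁ + 2 * b₂) ^ 2 := by nlinarith [mul_nonneg h5 h6]
      nlinarith)
    fun j hj => M.goodCol_tail_of_scale h (ne_of_mem_of_not_mem hj hi).symm (by linarith [hR j hj])
  have hF0 : 0 < ζ + 2 * α + γ ^ 2 / k := by positivity
  have he : 0 ≤ (2 * (b₁ + 2 * b₂)) ^ 2 * (exp (-c / α) * #C) := by positivity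
  -- The alternative is applied with `M` equal to twice the bound on noisy differences, whose square
  -- bounds the error at every outcome.
  rcases le_two_mul_log_add_sq_or hF0 hF with h2 | h2
  · refine h1.trans ?_
    unfold mainBound
    nlinarith
  · refine le_trans (b := (2 * (b₁ + 2 * b₂)) ^ 2) ?_ ?_
    · exact M.integral_nbrErr_sq_le_trivial (fun j hj => two_pos.trans_le (hR2 j hj)) τ hk
    · unfold mainBound
      nlinarith

lemma smoothColumns_of_smoothScale {q g : ℝ} (h : SmoothScale (b₁ + 2 * b₂) α c r γ b₂ q g)
    (hi : i ∉ C) (hu : ∀ j ∈ C, u ∉ R j) (hR : ∀ j ∈ C, 0.9999 ≤ α ^ 3 * #(R j))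
    (hRR : ∀ j ∈ C, ∀ j' ∈ C, (#(R j) : ℝ) < r * (#(R j') + 1)) : SmoothColumns ν H b i u C R
      (fun j => regularCol ν H b i (α / 2) ((1 - 0.1) * (4 * γ ^ 4 * #(R j))) j (R j))
      b₁ b₂ (α / 2 + 0.43 * α) (r * (2 * (b₁ + b₂) + 0.93 * α) ^ 2) (1.5 * q / g)
      (0.24 * exp (-c / α)) (γ ^ 4 / (825 * (b₁ + 2 * b₂) ^ 4) * exp (-c / α))
      (0.061 * exp (-c / α)) := by
  have hα := h.scale.α_pos
  have hc := h.scale.c_pos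
  have hg := h.g_pos
  have hq := h.q_pos
  have hγ := h.γ_fourth_pos
  have hv : 0 < SmoothScale.varRatio α g := by linarith [h.le_varRatio]
  have hb₂ := h.b₂_nonneg
  have hBp := h.scale.B_pos
  have e : b₁ + b₂ = b₁ + 2 * b₂ - b₂ := by ring
  have hNp : ∀ j ∈ C, (0 : ℝ) < #(R j) := fun j hj => h.scale.card_pos (hR j hj)
  have hV : ∀ j ∈ C, 0 < SmoothScale.varRatio α g * γ ^ 4 * #(R j) := fun j hj => by
    have := hNp j hj
    positivity
  have hL0 : 0 < 1.15 * c / α := by positivity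
  have hlam : ∀ j ∈ C, √(2 * (1.15 * c / α) / (SmoothScale.varRatio α g * γ ^ 4 * #(R j))) ^ 2
      * (SmoothScale.varRatio α g * γ ^ 4 * #(R j)) = 2 * (1.15 * c / α) := fun j hj => by
    have := hV j hj
    rw [sq_sqrt (by positivity), div_mul_cancel₀ _ this.ne']
  have hb₁ : 0 < b₁ + b₂ := by linarith [h.b₂_le]
  rw [e]
  -- The signal mean may reach `α / 2` and the noise mean `0.43 α`; `κ = 7.44 α` is chosen so that
  -- `(1 / 4) κ / 2 = 0.93 α` is their sum. The cut-off costs `κ² = 55.3536 α²` in `V₀`, the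
  -- Chernoff loss `ε = 0.1` turns `4 γ ^ 4` into `3.6 γ ^ 4`, and `s` is a tilt of Bernstein type.
  refine M.smoothColumns_of_regularCol (s := 0.43 * α / (2 * γ ^ 2 + 0.43 * α * b₂)) (κ := 7.44 * α)
    (ρ := 1 / 4) (L := 1.15 * c / α) (V₀ := fun j => SmoothScale.varRatio α g * γ ^ 4 * #(R j))
    (lam := fun j => √(2 * (1.15 * c / α) / (SmoothScale.varRatio α g * γ ^ 4 * #(R j))))
    h.γ_ne hi hu (fun j hj => card_pos.1 (by exact_mod_cast hNp j hj)) (by positivity)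
    (by norm_num) (by norm_num) (by positivity) ?_ ?_ (by norm_num) (by norm_num) ?_ hL0 ?_ ?_ ?_ ?_
    hV ?_ hlam ?_ (by positivity) ?_ (by positivity) (by positivity) ?_ ?_
  · have : 0 < γ ^ 2 := by have := h.γ_ne; positivity
    rw [div_mul_eq_mul_div, div_le_one (by positivity)]
    linarith
  · have := h.r_nonneg
    positivity
  · linarith
  · intro j hj
    have := h.irregular_le (hR j hj)
    rw [← e] at this
    exact this
  · intro j hj
    exact h.noise_tail_le (hR j hj)
  · intro j hj
    have := hV j hj
    positivity
  · intro j hj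
    have := h.lam_mul_jump_le (hR j hj) (hlam j hj) (sqrt_nonneg _)
    rw [← e] at this
    exact this
  · intro j hj
    have h1 : γ ^ 4 * (α / g) = α ^ 2 * γ ^ 2 := by
      rw [h.γ_fourth, h.g_eq]; field_simp
    have e2 : SmoothScale.varRatio α g * γ ^ 4 * #(R j)
        = 3.6 * γ ^ 4 * #(R j) - 55.3536 * (γ ^ 4 * (α / g)) * #(R j) := by
      unfold SmoothScale.varRatio; ring
    rw [e2, h1]
    apply le_of_eq
    ring
  · intro j hj
    have := h.density_le (hR j hj) (hlam j hj)
    rw [← e] at this ⊢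
    exact this
  · rw [div_lt_one hg]
    linarith [h.q_le]
  · intro j hj
    have := h.remainder_le (hR j hj)
    rw [← e] at this ⊢
    exact this
  · intro j hj j' hj'
    have e2 : α / 2 + 0.43 * α = 0.93 * α := by ring
    rw [e2, ← e, mul_comm r, mul_assoc]
    exact mul_lt_mul_of_pos_left (hRR j hj j' hj') (by positivity)

set_option maxHeartbeats 400000 in
lemma integral_nbrErr_sq_le_mainBound_of_largeNoise (h : Scale (b₁ + 2 * b₂) α c r)
    (hi : i ∉ C) (hR : ∀ j ∈ C, 1 ≤ α ^ 3 * #(R j))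
    (hRR : ∀ j ∈ C, ∀ j' ∈ C, (#(R j) : ℝ) ≤ r * #(R j'))
    (hu : ∀ j ∈ C, u ∈ R j) (τ : Equiv.Perm (Fin n)) (hk : 0 < k) (hT : T ⊆ C)
    (hTk : k ≤ #T) (hζ0 : 0 < ζ) (hζ : ∀ j ∈ T, sg j ≤ ζ)
    (hL : LargeNoise ((b₁ + 2 * b₂) / α) (b₁ + 2 * b₂) α r (γ ^ 2 / α) (ζ / α) (γ ^ 2 / k / α)) :
    ∫ ω, nbrErr H b i u C R τ k ω ^ 2 ∂Pr ν ≤ mainBound (b₁ + 2 * b₂) α (ζ + 2 * α + γ ^ 2 / k)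
        + (2 * (b₁ + 2 * b₂)) ^ 2 * (17 / 4 * exp (-c / α) * #C) := by
  have hα := h.α_pos
  have hB := h.B_pos
  have hαle := h.α_le
  have h3 := h.α_cube_le
  have hk' : (1 : ℝ) ≤ k := by exact_mod_cast hk
  have hb₂ := M.b₂_nonneg
  have hb₁ := M.b₁_nonneg i
  have hγb := M.gamma_sq_le i
  have hcard : ∀ j ∈ C, (10000 : ℝ) ≤ #(R j) := fun j hj => by
    exact h.card_ge (hR j hj)
  have hR2 : ∀ j ∈ C, 2 ≤ #(R j) := fun j hj => by
    have := hcard j hj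
    have : (2 : ℝ) ≤ #(R j) := by linarith
    exact_mod_cast this
  have herase : ∀ j ∈ C, ((#((R j).erase u) : ℕ) : ℝ) = #(R j) - 1 := fun j hj => by
    rw [card_erase_of_mem (hu j hj), Nat.cast_sub (by have := hR2 j hj; omega)]
    simp
  have hRe : ∀ j ∈ C, 0.9999 ≤ α ^ 3 * #((R j).erase u) := fun j hj => by
    rw [herase j hj]
    have := hR j hj
    linarith
  set B := b₁ + 2 * b₂ with hBdef
  -- The hypothesis `c · 8 B² (2 B² + 1) ≤ 1` is equivalent to `16 c B⁴ ≤ q²`, the form in which the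
  -- rate enters the smoothing estimates.
  set q := √(2 * B ^ 2 / (2 * B ^ 2 + 1)) with hqdef
  have hq0 : 0 < q := sqrt_pos.2 (by positivity)
  have hq : q ^ 2 * (2 * B ^ 2 + 1) = 2 * B ^ 2 := by
    rw [hqdef, sq_sqrt (by positivity), div_mul_cancel₀ _ (by positivity)]
  obtain ⟨hqg, h43, hsm⟩ := hL.smoothBound_le_normBound hq0 hq
  have hγ_abs : |γ| ≤ b₂ := abs_le_of_sq_le_sq hγb hb₂
  obtain ⟨j₀, hj₀⟩ : C.Nonempty := card_pos.1 (by
    have := card_le_card hT; omega)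
  have hr1 : 1 ≤ r := by
    have h1 := hRR j₀ hj₀ j₀ hj₀
    have h2 := hcard j₀ hj₀
    by_contra hc
    push Not at hc
    nlinarith
  have hS : SmoothScale B α c r γ b₂ q (γ ^ 2 / α) :=
    { scale := h
      r_nonneg := by linarith
      g_eq := by field_simp
      γ_le := hγb
      b₂_nonneg := hb₂
      b₂_le := by linarith
      q_pos := hq0
      q_eq := hq
      q_le := hqg
      α_le_g := (hL.α_le_mul_parameter hq0 hq).trans (by gcongr)
      spread := hL.spread_sq_le (y := |γ| / B) (by positivity) (by gcongr)
        (by rw [div_le_iff₀ hB]; linarith) (by rw [div_pow, sq_abs]; field_simp) h43 }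
  have hsc := M.smoothColumns_of_smoothScale (u := u) hS hi
    (fun j _ => notMem_erase u (R j)) hRe (fun j hj j' hj' => by
      rw [herase j hj, herase j' hj']
      have := hRR j hj j' hj'
      linarith)
  set θ := 1.5 * q / (γ ^ 2 / α) with hθ
  have hg0 : 0 < γ ^ 2 / α := hS.g_pos
  have hθ0 : 0 < θ := by positivity
  have hθ1 : θ ≤ 0.52 := by rw [hθ, div_le_iff₀ hg0]; linarith
  have hmain := M.integral_nbrErr_sq_le_of_smooth hR2 hu τ hk hT hTk (ζ := ζ) (κ := 0.015 * α)
    (e₀ := 0.503 * α) (α := α) (e := exp (-c / α)) hsc (by positivity) (by positivity) hζ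
    (fun j hj => h.score_error_le (by positivity) (by linarith) (hR j hj))
    (fun j hj => h.mean_error_le (by linarith) (hR j hj)) (by linarith)
    fun j hj => M.goodCol_tail_of_scale h (ne_of_mem_of_not_mem hj hi).symm (hRe j hj)
  have hW := hL.smooth_le_mainBound hsm (by linarith)
  have hWM := hL.mainBound_le
  have hψ : 1 ≤ 1 / (1 - θ) := by rw [le_div_iff₀ (by linarith)]; linarith
  have hδ : γ ^ 4 / (825 * B ^ 4) * exp (-c / α) ≤ 0.0001 * exp (-c / α) := by
    gcongr
    rw [div_le_iff₀ (by positivity)]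
    have h7 : 4 * γ ^ 2 ≤ B ^ 2 := by nlinarith
    have h8 : (4 * γ ^ 2) ^ 2 ≤ (B ^ 2) ^ 2 := by gcongr
    have : 0 < B ^ 4 := by positivity
    linarith
  have htot := smooth_total_le (k := k) (z := ζ + 3 * α / 2 + α ^ 2 / 4 + 0.015 * α) (G := γ ^ 2)
    (ψ := 1 / (1 - θ)) (ρ := θ / (1 - θ)) (Cc := #C) (e := exp (-c / α))
    (δ := γ ^ 4 / (825 * B ^ 4) * exp (-c / α)) (M := 2 * B) (S₀ := 17 * (0.503 * α) ^ 2)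
    (W := mainBound B α (ζ + 2 * α + γ ^ 2 / k)) (γ := γ) (b₁ := b₁) (b₂ := b₂)
    hk' (by positivity) (sq_nonneg γ) hψ
    (div_nonneg hθ0.le (by linarith)) (by rw [div_le_iff₀ (by linarith)]; linarith)
    (Nat.cast_nonneg _) (exp_pos _).le hδ hb₁ hb₂ hγ_abs rfl (by positivity) hW hWM
  refine hmain.trans ?_
  linarith

/-- Three estimates cover all parameters: the optimality comparison with the worst variance `b₁²`,
the same comparison with the variance of good columns, and smoothing when the target lies below
both. -/
lemma integral_nbrErr_sq_le_mainBound_of_mem (h : Scale (b₁ + 2 * b₂) α c r)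
    (hi : i ∉ C) (hR : ∀ j ∈ C, 1 ≤ α ^ 3 * #(R j))
    (hRR : ∀ j ∈ C, ∀ j' ∈ C, (#(R j) : ℝ) ≤ r * #(R j'))
    (hu : ∀ j ∈ C, u ∈ R j) (τ : Equiv.Perm (Fin n)) (hk : 0 < k) (hT : T ⊆ C)
    (hTk : k ≤ #T) (hζ0 : 0 < ζ) (hζ : ∀ j ∈ T, sg j ≤ ζ)
    (hF : ζ + 2 * α + γ ^ 2 / k ≤ 2 * (b₁ + 2 * b₂)) : ∫ ω, nbrErr H b i u C R τ k ω ^ 2 ∂Pr ν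
      ≤ mainBound (b₁ + 2 * b₂) α (ζ + 2 * α + γ ^ 2 / k)
        + (2 * (b₁ + 2 * b₂)) ^ 2 * (17 / 4 * exp (-c / α) * #C) := by
  have hα := h.α_pos
  have hB := h.B_pos
  have hk' : (1 : ℝ) ≤ k := by exact_mod_cast hk
  have hb₂ := M.b₂_nonneg
  have hb₁ := M.b₁_nonneg i
  have hγb := M.gamma_sq_le i
  have hcard : ∀ j ∈ C, (10000 : ℝ) ≤ #(R j) := fun j hj => h.card_ge (hR j hj)
  have hR2 : ∀ j ∈ C, 2 ≤ #(R j) := fun j hj => by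
    have : (2 : ℝ) ≤ #(R j) := by linarith [hcard j hj]
    exact_mod_cast this
  have hRe : ∀ j ∈ C, 0.9999 ≤ α ^ 3 * #((R j).erase u) := fun j hj => by
    rw [card_erase_of_mem (hu j hj), Nat.cast_sub (by have := hR2 j hj; omega), Nat.cast_one]
    have := hR j hj
    have := h.α_cube_le
    linarith
  obtain ⟨j₀, hj₀⟩ : C.Nonempty := card_pos.1 (by
    have := card_le_card hT; omega)
  have hr1 : 1 ≤ r := by
    have h1 := hRR j₀ hj₀ j₀ hj₀
    have h2 := hcard j₀ hj₀
    by_contra hc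
    push Not at hc
    nlinarith
  have hE : 0 ≤ (2 * (b₁ + 2 * b₂)) ^ 2 * (1 / 4 * exp (-c / α) * #C) := by positivity
  have key := fun (w z : ℝ) (hw : 0 < w) (hz0 : 0 ≤ z)
      (hz : ∀ j ∈ C, sg j ≤ ζ + 3 * α / 2 + α ^ 2 / 4 → sg j ≤ z) =>
    M.integral_nbrErr_sq_le_of_mem hR2 hi hu τ hk hT hTk hw (by linarith) hRR hζ hz0 hz
    fun j hj => M.goodCol_tail_of_scale h (ne_of_mem_of_not_mem hj hi).symm (hRe j hj)
  have hnb : α * normBound ((b₁ + 2 * b₂) / α) α (ζ / α + 2 + γ ^ 2 / k / α)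
      = mainBound (b₁ + 2 * b₂) α (ζ + 2 * α + γ ^ 2 / k) := by
    rw [← mainBound_eq (B := b₁ + 2 * b₂) (by field_simp)]
    congr 1
    field_simp
  by_cases hcap : normBound ((b₁ + 2 * b₂) / α) α (ζ / α + 2 + γ ^ 2 / k / α)
      < 1.5 * r * ((b₁ + 2 * b₂) / α) * (b₁ + 2 * b₂) + 0.375 * r * α
  swap
  · push Not at hcap
    have h1 := mul_le_mul_of_nonneg_left hcap hα.le
    rw [hnb] at h1
    -- `w = 2` gives weights `3` and `3 / 2`, so that noise and signal combine to `(3 / 2) r (b₁² +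
    -- 4 γ²)`, at most `(3 / 2) r (b₁ + 2 b₂)²`.
    have h2 := key 2 (b₁ ^ 2) two_pos (sq_nonneg _) fun j _ _ => M.sg_le j
    have e : α * (1.5 * r * ((b₁ + 2 * b₂) / α) * (b₁ + 2 * b₂) + 0.375 * r * α)
        = 1.5 * (r * (b₁ + 2 * b₂) ^ 2) + 0.375 * (r * α ^ 2) := by field_simp
    rw [e] at h1
    have h3 : γ ^ 2 ≤ r * γ ^ 2 := le_mul_of_one_le_left (sq_nonneg _) hr1
    have h4 : r * (b₁ ^ 2 + 4 * γ ^ 2) ≤ r * (b₁ + 2 * b₂) ^ 2 := by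
      gcongr
      nlinarith [mul_nonneg hb₁ hb₂]
    linarith
  by_cases hcomp : normBound ((b₁ + 2 * b₂) / α) α (ζ / α + 2 + γ ^ 2 / k / α)
      < (29 / 12 + 58 / 17 * r) * (γ ^ 2 / α) + 29 / 17 * r * (ζ / α + 1.5 + α / 2)
  swap
  · push Not at hcomp
    have h1 := mul_le_mul_of_nonneg_left hcomp hα.le
    rw [hnb] at h1
    -- The weights `29 / 12` and `29 / 17` are those appearing in `LargeNoise.compare`.
    have h2 := key (17 / 12) (ζ + 3 * α / 2 + α ^ 2 / 4) (by norm_num) (by positivity)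
      fun j _ h => h
    have e : α * ((29 / 12 + 58 / 17 * r) * (γ ^ 2 / α) + 29 / 17 * r * (ζ / α + 1.5 + α / 2))
        = (29 / 12 + 58 / 17 * r) * γ ^ 2 + 29 / 17 * r * (ζ + 1.5 * α + α ^ 2 / 2) := by
      field_simp
    rw [e] at h1
    linarith
  exact M.integral_nbrErr_sq_le_mainBound_of_largeNoise h hi hR hRR hu τ hk hT hTk hζ0 hζ
    { α_pos := hα
      α_le := h.α_le
      x_pos := by positivity
      B_eq := by field_simp
      x_ge := by
        rw [le_div_iff₀ hα]
        have h1 := h.c_mul_le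
        have h2 : 11.5 * α * (8 * (b₁ + 2 * b₂) ^ 2 * (2 * (b₁ + 2 * b₂) ^ 2 + 1)) ≤ 1 :=
          le_trans (mul_le_mul_of_nonneg_right h.α_le_c (by positivity)) h1
        nlinarith
      r_le := h.r_le
      r_le' := h.r_le'
      s_nonneg := by positivity
      d_nonneg := by positivity
      d_le := by gcongr; exact div_le_self (sq_nonneg _) hk'
      total_le := by
        rw [← sub_nonneg]
        have e : 2 * ((b₁ + 2 * b₂) / α) - (ζ / α + 2 + γ ^ 2 / k / α)
          = (2 * (b₁ + 2 * b₂) - (ζ + 2 * α + γ ^ 2 / k)) / α := by field_simp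
        rw [e]
        apply div_nonneg _ hα.le
        linarith
      cap := hcap
      compare := hcomp }

/-- Mean squared error at an entry for a fixed pattern of observations and fixed columns. -/
lemma integral_nbrErr_sq_le_mainBound (h : Scale (b₁ + 2 * b₂) α c r)
    (hi : i ∉ C) (hR : ∀ j ∈ C, 1 ≤ α ^ 3 * #(R j))
    (hRR : ∀ j ∈ C, ∀ j' ∈ C, (#(R j) : ℝ) ≤ r * #(R j'))
    (hu : (∀ j ∈ C, u ∉ R j) ∨ ∀ j ∈ C, u ∈ R j) (τ : Equiv.Perm (Fin n)) (hk : 0 < k)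
    (hT : T ⊆ C) (hTk : k ≤ #T) (hζ0 : 0 < ζ) (hζ : ∀ j ∈ T, sg j ≤ ζ)
    (hF : ζ + 2 * α + γ ^ 2 / k ≤ 2 * (b₁ + 2 * b₂)) : ∫ ω, nbrErr H b i u C R τ k ω ^ 2 ∂Pr ν
      ≤ mainBound (b₁ + 2 * b₂) α (ζ + 2 * α + γ ^ 2 / k)
        + (2 * (b₁ + 2 * b₂)) ^ 2 * (17 / 4 * exp (-c / α) * #C) := by
  rcases hu with hu | hu
  · exact M.integral_nbrErr_sq_le_mainBound_of_notMem h hi hR hu τ hk hT hTk hζ0 hζ hF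
  · exact M.integral_nbrErr_sq_le_mainBound_of_mem h hi hR hRR hu τ hk hT hTk hζ0 hζ hF

end ColumnModel

/-! ### From the estimator to centred residuals. -/

lemma sum_sub_avg_sq {κ : Type*} (R : Finset κ) (hR : R.Nonempty) (w : κ → ℝ) :
    ∑ v ∈ R, (w v - (∑ v ∈ R, w v) / #R) ^ 2 = ∑ v ∈ R, w v ^ 2 - (∑ v ∈ R, w v) ^ 2 / #R := by
  have hc : (#R : ℝ) ≠ 0 := by exact_mod_cast hR.card_pos.ne'
  have e : ∀ v ∈ R, (w v - (∑ v ∈ R, w v) / #R) ^ 2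
      = w v ^ 2 - 2 * ((∑ v ∈ R, w v) / #R) * w v + ((∑ v ∈ R, w v) / #R) ^ 2 := fun v _ => by ring
  rw [sum_congr rfl e, sum_add_distrib, sum_sub_distrib, ← mul_sum, sum_const, nsmul_eq_mul]
  field_simp
  ring

section Estimate

variable {m n : ℕ}

lemma abs_colMean_le {Z : Fin m → Fin n → ℝ} {o : Fin m → Fin n → Bool} {i j : Fin n} {B : ℝ}
    (hB : 0 ≤ B) (hZ : ∀ v, |Z v i - Z v j| ≤ B) : |colMean Z o i j| ≤ B := by
  unfold colMean
  rcases (colOverlap o i j).eq_empty_or_nonempty with h | h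
  · simpa [h] using hB
  · have hc : (0 : ℝ) < #(colOverlap o i j) := by exact_mod_cast h.card_pos
    rw [abs_div, abs_of_pos hc, div_le_iff₀ hc]
    refine (abs_sum_le_sum_abs _ _).trans ?_
    refine (sum_le_card_nsmul _ _ B fun v _ => hZ v).trans ?_
    rw [nsmul_eq_mul, mul_comm]

/-- The trivial bound, valid for every pattern. The bound on `a` serves only for the default value
`0` when there is no neighbour. -/
lemma abs_itemEstimate_sub_le {Z : Fin m → Fin n → ℝ} {o : Fin m → Fin n → Bool} {β : ℝ} {k : ℕ}
    {τ : Equiv.Perm (Fin n)} {u : Fin m} {i : Fin n} {B a : ℝ} (hB : 0 ≤ B) (ha : |a| ≤ 2 * B)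
    (hZ : ∀ j v, |Z v i - Z v j| ≤ B) (hZa : ∀ j, |Z u j - a| ≤ B) :
    |itemEstimate Z o β k τ u i - a| ≤ 2 * B := by
  unfold itemEstimate
  rcases (colNearest Z o β k τ u i).eq_empty_or_nonempty with h | h
  · simpa [h] using ha
  · set S := colNearest Z o β k τ u i
    have hc : (0 : ℝ) < #S := by exact_mod_cast h.card_pos
    rw [div_sub' hc.ne', abs_div, abs_of_pos hc, div_le_iff₀ hc]
    have e : ∑ j ∈ S, (Z u j + colMean Z o i j) - #S * a
        = ∑ j ∈ S, ((Z u j - a) + colMean Z o i j) := by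
      rw [← nsmul_eq_mul, ← sum_const, ← sum_sub_distrib]
      exact sum_congr rfl fun j _ => by ring
    rw [e]
    refine (abs_sum_le_sum_abs _ _).trans ?_
    refine (sum_le_card_nsmul _ _ (2 * B) fun j _ => ?_).trans ?_
    · refine (abs_add_le _ _).trans ?_
      linarith [hZa j, abs_colMean_le (o := o) hB (hZ j)]
    · rw [nsmul_eq_mul, mul_comm]

variable {Y : Type*} {H : Fin n → Y → ℝ} {b : Y → ℝ} {mu : Fin n → ℝ} {A : Fin m → Fin n → ℝ}
  {i : Fin n} {o : Fin m → Fin n → Bool} {ω : Source m n → Y}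

lemma noisy_diff (hH : ∀ v j, H j (ω (rowSrc v)) = A v i - A v j - mu j) (j : Fin n) (v : Fin m) :
    (A v i + b (ω (noiseSrc v i))) - (A v j + b (ω (noiseSrc v j))) = resid H b i j v ω + mu j := by
  rw [resid, hH]; ring

lemma colMean_eq (hH : ∀ v j, H j (ω (rowSrc v)) = A v i - A v j - mu j) {j : Fin n}
    (hR : (colOverlap o i j).Nonempty) : colMean (fun v j => A v j + b (ω (noiseSrc v j))) o i j
      = residMean H b i j (colOverlap o i j) ω + mu j := by
  have hc : (#(colOverlap o i j) : ℝ) ≠ 0 := by exact_mod_cast hR.card_pos.ne'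
  unfold colMean residMean
  rw [sum_congr rfl fun v _ => noisy_diff hH j v, sum_add_distrib, sum_const, nsmul_eq_mul]
  field_simp

lemma colVar_eq (hH : ∀ v j, H j (ω (rowSrc v)) = A v i - A v j - mu j) {j : Fin n}
    (hR : (colOverlap o i j).Nonempty) : colVar (fun v j => A v j + b (ω (noiseSrc v j))) o i j
      = nbrScore H b i (fun j => colOverlap o i j) ω j := by
  unfold colVar nbrScore residSq
  rw [colMean_eq hH hR, ← sum_sub_avg_sq _ hR]
  congr 1
  refine sum_congr rfl fun v _ => ?_
  rw [noisy_diff hH, residMean]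
  ring

/-- The error of the estimate in terms of the centred residuals. -/
lemma itemEstimate_sub_eq_nbrErr {β : ℝ} {k : ℕ} {τ : Equiv.Perm (Fin n)} {u : Fin m}
    (hH : ∀ v j, H j (ω (rowSrc v)) = A v i - A v j - mu j) (hk : 0 < k)
    (hkC : k ≤ #(colBase o β u i)) (hR : ∀ j ∈ colBase o β u i, (colOverlap o i j).Nonempty) :
    itemEstimate (fun v j => A v j + b (ω (noiseSrc v j))) o β k τ u i - A u i
      = nbrErr H b i u (colBase o β u i) (fun j => colOverlap o i j) τ k ω := by
  have hk' : (k : ℝ) ≠ 0 := by exact_mod_cast hk.ne'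
  have hS : colNearest (fun v j => A v j + b (ω (noiseSrc v j))) o β k τ u i
      = firstK (colBase o β u i) (nbrScore H b i (fun j => colOverlap o i j) ω) τ k := by
    rw [colNearest_eq_firstK]
    exact firstK_congr fun j hj => colVar_eq hH (hR j hj)
  unfold itemEstimate nbrErr
  rw [hS, card_firstK hkC]
  set S := firstK (colBase o β u i) (nbrScore H b i (fun j => colOverlap o i j) ω) τ k with hSd
  have hSk : #S = k := card_firstK hkC
  rw [div_sub' hk']
  congr 1
  rw [← hSk, ← nsmul_eq_mul, ← sum_const, ← sum_sub_distrib]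
  refine sum_congr rfl fun j hj => ?_
  rw [colMean_eq hH (hR j (firstK_subset _ _ _ _ hj)), nbrTerm, hH]
  ring

end Estimate

/-! ### The model on a canonical product space, with noise truncated so that its bound holds
everywhere. -/

/-- Truncation of a real number to the interval `[-b, b]`. -/
noncomputable def truncate (b t : ℝ) : ℝ := max (-b) (min t b)

lemma abs_truncate_le {b : ℝ} (hb : 0 ≤ b) (t : ℝ) : |truncate b t| ≤ b := by
  unfold truncate
  grind

lemma truncate_of_abs_le {b t : ℝ} (h : |t| ≤ b) : truncate b t = t := by
  obtain ⟨h1, h2⟩ := abs_le.1 h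
  unfold truncate
  rw [min_eq_left h2, max_eq_right h1]

lemma measurable_truncate (b : ℝ) : Measurable (truncate b) := by
  unfold truncate
  fun_prop

/-- Values carried by a source of randomness: a row feature, a column feature, a noise term and an
observation indicator. -/
abbrev Cell (X₁ X₂ : Type*) : Type _ := X₁ × X₂ × ℝ × Bool

/-- Column feature source. -/
abbrev colSrc {m n : ℕ} (i : Fin n) : Source m n := .inl (.inr i)

/-- Observation source. -/
abbrev obsSrc {m n : ℕ} (v : Fin m) (j : Fin n) : Source m n := .inr (.inr (v, j))

section Cells

variable {X₁ X₂ : Type*} {m n : ℕ}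

/-- Row features as functions of the sources. -/
def cellRow (v : Fin m) (ω : Source m n → Cell X₁ X₂) : X₁ := (ω (rowSrc v)).1

/-- Column features as functions of the sources. -/
def cellCol (i : Fin n) (ω : Source m n → Cell X₁ X₂) : X₂ := (ω (colSrc i)).2.1

/-- Truncated noise terms as functions of the sources. -/
noncomputable def cellNoise (Be : ℝ) (v : Fin m) (j : Fin n) (ω : Source m n → Cell X₁ X₂) : ℝ :=
  truncate Be (ω (noiseSrc v j)).2.2.1

/-- Observation indicators as functions of the sources. -/
def cellObs (v : Fin m) (j : Fin n) (ω : Source m n → Cell X₁ X₂) : Bool := (ω (obsSrc v j)).2.2.2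

/-- Observation pattern as a function of the sources. -/
def cellPattern (ω : Source m n → Cell X₁ X₂) : Fin m → Fin n → Bool := fun v j => cellObs v j ω

/-- Sources of the row features and of the noise. -/
def latentBlock {m n : ℕ} : Set (Source m n) := {s | (∃ v, s = rowSrc v) ∨ ∃ v j, s = noiseSrc v j}

/-- Error of the estimate of an entry for a given observation pattern. -/
noncomputable def patternErr (f : X₁ → X₂ → ℝ) (Be β : ℝ) (k : ℕ) (τ : Equiv.Perm (Fin n))
    (u : Fin m) (i : Fin n) (o : Fin m → Fin n → Bool) (ω : Source m n → Cell X₁ X₂) : ℝ :=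
  itemEstimate (noisy f cellRow cellCol (cellNoise Be) ω) o β k τ u i
    - signal f cellRow cellCol ω u i

/-- Error of the estimate of an entry. -/
noncomputable def cellErr (f : X₁ → X₂ → ℝ) (Be β : ℝ) (k : ℕ)
    (τ : (Fin m → Fin n → Bool) → Fin m → Fin n → Equiv.Perm (Fin n)) (u : Fin m) (i : Fin n)
    (ω : Source m n → Cell X₁ X₂) : ℝ :=
  patternErr f Be β k (τ (cellPattern ω) u i) u i (cellPattern ω) ω

variable [MeasurableSpace X₁] [MeasurableSpace X₂]

lemma measurableSet_cell_obs : MeasurableSet {y : Cell X₁ X₂ | y.2.2.2 = true} :=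
  (measurable_snd.comp (measurable_snd.comp measurable_snd)) (MeasurableSet.singleton true)

/-- Marginal laws of the latent variable model. -/
structure CellLaws (ν : Source m n → Measure (Cell X₁ X₂)) (μ₁ : Measure X₁) (μ₂ : Measure X₂)
    (γ Be p : ℝ) : Prop where
  row : ∀ u, (ν (rowSrc u)).map (fun y => y.1) = μ₁
  col : ∀ i, (ν (colSrc i)).map (fun y => y.2.1) = μ₂
  noise_mean : ∀ u i, ∫ y, truncate Be y.2.2.1 ∂(ν (noiseSrc u i)) = 0
  noise_var : ∀ u i, ∫ y, truncate Be y.2.2.1 ^ 2 ∂(ν (noiseSrc u i)) = γ ^ 2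
  obs : ∀ u i, (ν (obsSrc u i)).real {y | y.2.2.2 = true} = p

lemma measurable_cellNoise (Be : ℝ) (v : Fin m) (j : Fin n) :
    Measurable (cellNoise Be v j : (Source m n → Cell X₁ X₂) → ℝ) :=
  (measurable_truncate Be).comp (by fun_prop)

lemma measurable_cellObs (v : Fin m) (j : Fin n) :
    Measurable (cellObs v j : (Source m n → Cell X₁ X₂) → Bool) := by
  unfold cellObs; fun_prop

lemma measurable_cellPattern :
    Measurable (cellPattern : (Source m n → Cell X₁ X₂) → Fin m → Fin n → Bool) :=
  measurable_pi_iff.2 fun v => measurable_pi_iff.2 fun j => measurable_cellObs v j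

lemma measurable_signal {f : X₁ → X₂ → ℝ} (hf : Measurable (Function.uncurry f)) (v : Fin m)
    (j : Fin n) : Measurable fun ω : Source m n → Cell X₁ X₂ => signal f cellRow cellCol ω v j := by
  unfold signal cellRow cellCol
  fun_prop

lemma measurable_noisy {f : X₁ → X₂ → ℝ} (hf : Measurable (Function.uncurry f)) (Be : ℝ)
    (v : Fin m) (j : Fin n) : Measurable fun ω : Source m n → Cell X₁ X₂ =>
      noisy f cellRow cellCol (cellNoise Be) ω v j :=
  (measurable_signal hf v j).add (measurable_cellNoise Be v j)

lemma measurable_sum_firstK {Ω : Type*} [MeasurableSpace Ω] {C : Finset (Fin n)}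
    {σ : Fin n → Ω → ℝ} {g : Fin n → Ω → ℝ} (hσ : ∀ j ∈ C, Measurable (σ j))
    (hg : ∀ j ∈ C, Measurable (g j)) (τ : Equiv.Perm (Fin n)) (k : ℕ) :
    Measurable (fun ω => ∑ j ∈ firstK C (fun j => σ j ω) τ k, g j ω) := by
  classical
  have e : (fun ω => ∑ j ∈ firstK C (fun j => σ j ω) τ k, g j ω)
      = fun ω => ∑ j ∈ C, if j ∈ firstK C (fun j => σ j ω) τ k then g j ω else 0 := by
    ext ω
    rw [← sum_filter]
    refine sum_congr ?_ fun _ _ => rfl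
    ext j
    simp only [mem_filter]
    exact ⟨fun h => ⟨firstK_subset _ _ _ _ h, h⟩, fun h => h.2⟩
  rw [e]
  refine measurable_sum _ fun j hj => ?_
  exact Measurable.ite (measurableSet_mem_firstK C hσ τ k j) (hg j hj) measurable_const

lemma measurable_patternErr {f : X₁ → X₂ → ℝ} (hf : Measurable (Function.uncurry f)) (Be β : ℝ)
    (k : ℕ) (τ : Equiv.Perm (Fin n)) (u : Fin m) (i : Fin n) (o : Fin m → Fin n → Bool) :
    Measurable (patternErr (X₁ := X₁) (X₂ := X₂) f Be β k τ u i o) := by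
  have hZ := fun v j => measurable_noisy (m := m) (n := n) hf Be v j
  have hmean : ∀ j, Measurable fun ω : Source m n → Cell X₁ X₂ =>
      colMean (noisy f cellRow cellCol (cellNoise Be) ω) o i j := fun j => by
    unfold colMean
    fun_prop
  have hvar : ∀ j, Measurable fun ω : Source m n → Cell X₁ X₂ =>
      colVar (noisy f cellRow cellCol (cellNoise Be) ω) o i j := fun j => by
    unfold colVar
    fun_prop
  refine Measurable.sub ?_ (measurable_signal hf u i)
  unfold itemEstimate
  simp only [colNearest_eq_firstK]
  refine Measurable.div (measurable_sum_firstK (fun j _ => hvar j)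
    (fun j _ => (hZ u j).add (hmean j)) τ k) ?_
  have := measurable_sum_firstK (C := colBase o β u i) (fun j _ => hvar j)
    (fun j _ => measurable_const (a := (1 : ℝ))) τ k
  simpa using this

lemma measurable_cellErr {f : X₁ → X₂ → ℝ} (hf : Measurable (Function.uncurry f)) (Be β : ℝ)
    (k : ℕ) (τ : (Fin m → Fin n → Bool) → Fin m → Fin n → Equiv.Perm (Fin n)) (u : Fin m)
    (i : Fin n) : Measurable (cellErr (X₁ := X₁) (X₂ := X₂) f Be β k τ u i) := by
  let g : (Source m n → Cell X₁ X₂) × (Fin m → Fin n → Bool) → ℝ := fun q =>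
    patternErr f Be β k (τ q.2 u i) u i q.2 q.1
  have h : Measurable g :=
    measurable_from_prod_countable_left fun o => measurable_patternErr hf Be β k (τ o u i) u i o
  have h2 : Measurable fun ω : Source m n → Cell X₁ X₂ => (ω, cellPattern ω) :=
    measurable_id.prodMk measurable_cellPattern
  have e : cellErr f Be β k τ u i = g ∘ fun ω => (ω, cellPattern ω) := by
    funext ω
    rw [Function.comp_apply, cellErr]
  rw [e]
  exact h.comp h2

end Cells

/-! ### Auxiliary facts on the signal, on sizes and on the constants. -/

/-- Regularity of the signal and boundedness of the noise. -/
structure SignalBounds {X₁ X₂ : Type*} [MetricSpace X₁] [MetricSpace X₂] (f : X₁ → X₂ → ℝ)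
    (L D₂ Be B₀ : ℝ) : Prop where
  L_pos : 0 < L
  Be_nonneg : 0 ≤ Be
  diam_le : ∀ y y' : X₂, dist y y' ≤ D₂
  B₀_eq : B₀ = L * D₂ + 2 * Be
  lipschitz : ∀ x x' y y', |f x y - f x' y'| ≤ L * max (dist x x') (dist y y')
  bound : ∀ x y, |f x y| ≤ 2 * B₀

lemma mem_colBase {m n : ℕ} {o : Fin m → Fin n → Bool} {β : ℝ} {u : Fin m} {i j : Fin n} :
    j ∈ colBase o β u i ↔ j ≠ i ∧ o u j = true ∧ β ≤ #(colOverlap o i j) := by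
  simp [colBase]

lemma mix_latentBlock {X₁ X₂ : Type*} {m n : ℕ} (a ω : Source m n → Cell X₁ X₂) :
    (∀ v, mix latentBlock a ω (rowSrc v) = a (rowSrc v)) ∧
    (∀ v j, mix latentBlock a ω (noiseSrc v j) = a (noiseSrc v j)) ∧
    (∀ j, mix latentBlock a ω (colSrc j) = ω (colSrc j)) ∧
    (∀ v j, mix latentBlock a ω (obsSrc v j) = ω (obsSrc v j)) ∧
    cellPattern (mix latentBlock a ω) = cellPattern ω := by
  have h : ∀ v j, mix latentBlock a ω (obsSrc v j) = ω (obsSrc v j) :=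
    fun v j => mix_of_notMem (by simp [latentBlock]) _ _
  refine ⟨fun v => mix_of_mem (by simp [latentBlock]) _ _,
    fun v j => mix_of_mem (by simp [latentBlock]) _ _,
    fun j => mix_of_notMem (by simp [latentBlock]) _ _, h, ?_⟩
  funext v j
  simp only [cellPattern, cellObs, h]

lemma ae_ballMass_le {X : Type*} [MetricSpace X] [MeasurableSpace X] (μ : Measure X)
    [IsProbabilityMeasure μ] (r : ℝ) : ∀ᵐ x ∂μ, ballMass μ r ≤ μ.real (Metric.closedBall x r) :=
  ae_essInf_le (isBoundedUnder_of ⟨0, fun _ => measureReal_nonneg⟩)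

lemma pairwiseDisjoint_pair {ι κ : Type*} (s : Set κ) {g h : κ → ι} (hg : g.Injective)
    (hh : h.Injective) (hgh : ∀ a b, g a ≠ h b) :
    s.PairwiseDisjoint fun a => ({g a, h a} : Set ι) := by
  intro a _ b _ hab
  grind

lemma exp_lt_three : exp 1.095 < 3 := by
  have h1 := exp_one_lt_d9
  have h2 := add_one_le_exp (-0.0475 : ℝ)
  have h3 : exp 1.095 * exp (-0.0475) ^ 2 = exp 1 := by
    rw [← exp_nat_mul, ← exp_add]; norm_num
  nlinarith

lemma exp_lt_of_large : exp 11.5 < 99800 := by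
  have h1 := exp_one_lt_d9
  have h3 : exp 11.5 ^ 2 = exp 1 ^ 23 := by
    rw [← exp_nat_mul, ← exp_nat_mul]; norm_num
  have h4 : exp 1 ^ 23 < 99800 ^ 2 :=
    (pow_lt_pow_left₀ h1 (exp_pos 1).le (by norm_num)).trans (by norm_num)
  exact lt_of_pow_lt_pow_left₀ 2 (by norm_num) (h3 ▸ h4)

/-- Sizes for which the tail bound is not trivial. -/
lemma large_of_tail_lt_one {c₁ t x N s : ℝ} (hc₁ : c₁ ≤ 1 / 24) (ht : 0 ≤ t) (htx : t ^ 3 = x)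
    (hxN : x ≤ N) (h : 3 * exp (-c₁ * t) + (N + 9 / 2 * x) * exp (-s) < 1) :
    8 ≤ x ∧ 11.5 ≤ s ∧ N * exp (-s) ≤ 1 := by
  have hx0 : 0 ≤ x := htx ▸ by positivity
  have he := exp_pos (-s)
  have h1 : exp (-c₁ * t) < 1 / 3 := by
    nlinarith
  have h2 : 26.28 ≤ t := by
    by_contra! hlt
    have h3 : exp (-1.095) ≤ exp (-c₁ * t) := exp_le_exp.2 (by nlinarith)
    have h4 : exp (-1.095) * exp 1.095 = 1 := by rw [← exp_add]; norm_num
    nlinarith [exp_lt_three, exp_pos (-1.095), exp_pos 1.095]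
  have h5 : (18149 : ℝ) ≤ x := by
    rw [← htx]
    exact le_trans (by norm_num) (pow_le_pow_left₀ (by norm_num) h2 3)
  have h6 : (N + 9 / 2 * x) * exp (-s) < 1 := by
    linarith [exp_pos (-c₁ * t)]
  refine ⟨by linarith, ?_, by nlinarith⟩
  have h7 : 99800 * exp (-s) < 1 := by nlinarith
  by_contra! hlt
  have h8 : exp (-11.5) ≤ exp (-s) := exp_le_exp.2 (by linarith)
  have h9 : exp (-11.5) * exp 11.5 = 1 := by rw [← exp_add]; norm_num
  nlinarith [exp_lt_of_large, exp_pos (-11.5)]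

/-- Here `r - 1 = 4.8285 v / (1 - 2 v)` and `v B / α = √(c B²) ≤ 0.3025`. Subtracting `0.605 = 2 ·
0.3025` from `B / α` cancels the denominator, and `4.8285 · 0.3025` rounds up to `1.461`. -/
lemma Scale.of_ratio {B α c v : ℝ} (hα : 0 < α) (hB : 0 < B) (hc : c ≤ 1 / 2)
    (hcB : c * (8 * B ^ 2 * (2 * B ^ 2 + 1)) ≤ 1) (hαc : 11.5 * α ≤ c) (hv2 : v ^ 2 = c * α ^ 2) :
    v ≤ 0.03075 ∧ Scale B α c ((1 + 2.8285 * v) / (1 - 2 * v)) := by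
  have hvle : v ≤ 0.03075 := by
    nlinarith
  have h12 : 0 < 1 - 2 * v := by linarith
  refine ⟨hvle, hα, hB, hc, hcB, hαc, ?_, ?_⟩
  · rw [div_le_iff₀ h12]; linarith
  · have hw : v * (B / α) ≤ 0.302501 := by
      refine le_of_sq_le_sq ?_ (by norm_num)
      have e : (v * (B / α)) ^ 2 = c * B ^ 2 := by
        rw [mul_pow, hv2, div_pow]; field_simp
      nlinarith
    have e : (1 + 2.8285 * v) / (1 - 2 * v) - 1 = 4.8285 * v / (1 - 2 * v) := by
      rw [div_sub_one h12.ne']; ring_nf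
    rw [e, div_mul_eq_mul_div, div_le_iff₀ h12]
    nlinarith

lemma constC2_le (cβ : ℝ) {B : ℝ} (hB : 0 < B) :
    constC2 cβ B ≤ cβ ^ 2 / 2 ∧ constC2 cβ B * (8 * B ^ 2 * (2 * B ^ 2 + 1)) ≤ 1 := by
  refine ⟨min_le_left _ _, ?_⟩
  rw [← le_div_iff₀ (by positivity)]
  exact (min_le_right _ _).trans (min_le_right _ _)

lemma constC2_pos {cβ B : ℝ} (hcβ : 0 < cβ) (hB : 0 < B) : 0 < constC2 cβ B := by
  unfold constC2
  positivity

lemma boundF2_pos_and {β : ℝ} (hβ : 0 < β) :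
    0 < boundF2 β ∧ β ^ (1 / 3 : ℝ) = 1 / boundF2 β ∧ boundF2 β ^ 3 * β = 1 := by
  have h : 0 < boundF2 β := rpow_pos_of_pos hβ _
  have e : β ^ (1 / 3 : ℝ) = 1 / boundF2 β := by
    rw [boundF2, rpow_neg hβ.le, div_inv_eq_mul, one_mul]
  refine ⟨h, e, ?_⟩
  have h3 : (β ^ (1 / 3 : ℝ)) ^ 3 = β := by
    rw [← rpow_natCast, ← rpow_mul hβ.le]; norm_num
  grind

/-! ### Overlaps, near columns and the error of one entry. -/

section Latent

variable {X₁ X₂ : Type*} [MetricSpace X₁] [CompactSpace X₁] [MeasurableSpace X₁] [BorelSpace X₁]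
  [MetricSpace X₂] [CompactSpace X₂] [MeasurableSpace X₂] [BorelSpace X₂] {m n : ℕ}
  {f : X₁ → X₂ → ℝ} {L D₂ Be B₀ : ℝ} {μ₁ : Measure X₁} [IsProbabilityMeasure μ₁]
  {μ₂ : Measure X₂} [IsProbabilityMeasure μ₂] {ν : Source m n → Measure (Cell X₁ X₂)}
  [∀ s, IsProbabilityMeasure (ν s)]
  {τ : (Fin m → Fin n → Bool) → Fin m → Fin n → Equiv.Perm (Fin n)} {u : Fin m} {i j : Fin n}
  {k : ℕ} {α β γ c p r a ρ ζ ε ε' ε'' cφ cβ ck : ℝ}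

/-- Mean of the difference of two columns. -/
noncomputable def diffMean (f : X₁ → X₂ → ℝ) (μ₁ : Measure X₁) (y y' : X₂) : ℝ :=
  ∫ x, (f x y - f x y') ∂μ₁

/-- Variance of the difference of two columns. -/
noncomputable def diffVar (f : X₁ → X₂ → ℝ) (μ₁ : Measure X₁) (y y' : X₂) : ℝ :=
  ∫ x, (f x y - f x y' - diffMean f μ₁ y y') ^ 2 ∂μ₁

namespace SignalBounds

variable (hf : SignalBounds f L D₂ Be B₀)

include hf

lemma measurable : Measurable (Function.uncurry f) := by
  have : LipschitzWith ⟨L, hf.L_pos.le⟩ (Function.uncurry f) :=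
    LipschitzWith.of_dist_le_mul fun a b => by
      rw [dist_eq]
      exact hf.lipschitz a.1 b.1 a.2 b.2
  exact this.continuous.measurable

lemma abs_diff_le (x : X₁) (y y' : X₂) : |f x y - f x y'| ≤ L * dist y y' := by
  have := hf.lipschitz x x y y'
  rwa [dist_self, max_eq_right dist_nonneg] at this

lemma abs_diff_le_diam (x : X₁) (y y' : X₂) : |f x y - f x y'| ≤ L * D₂ :=
  (hf.abs_diff_le x y y').trans (mul_le_mul_of_nonneg_left (hf.diam_le y y') hf.L_pos.le)

lemma bddMeas_diff (y y' : X₂) : BddMeas fun x => f x y - f x y' :=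
  ⟨(hf.measurable.comp (measurable_id.prodMk measurable_const)).sub
    (hf.measurable.comp (measurable_id.prodMk measurable_const)), _, fun x => hf.abs_diff_le x y y'⟩

lemma diffVar_le (μ₁ : Measure X₁) [IsProbabilityMeasure μ₁] (y y' : X₂) :
    diffVar f μ₁ y y' ≤ (L * dist y y') ^ 2 := by
  have hb := hf.bddMeas_diff y y'
  have h1 : ∫ x, (f x y - f x y') ^ 2 ∂μ₁ ≤ ∫ _, (L * dist y y') ^ 2 ∂μ₁ :=
    BddMeas.integral_mono (hb.pow 2) (.const _) μ₁ fun x =>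
      sq_le_sq.2 ((hf.abs_diff_le x y y').trans (le_abs_self _))
  have e : diffVar f μ₁ y y' = ∫ x, (f x y - f x y') ^ 2 ∂μ₁ - diffMean f μ₁ y y' ^ 2 := by
    unfold diffVar
    have e1 : ∀ x, (f x y - f x y' - diffMean f μ₁ y y') ^ 2 = (f x y - f x y') ^ 2
        - 2 * diffMean f μ₁ y y' * (f x y - f x y') + diffMean f μ₁ y y' ^ 2 := fun x => by ring
    simp only [e1]
    rw [BddMeas.integral_add, BddMeas.integral_sub, integral_const_mul]
    simp only [integral_const, probReal_univ, one_smul]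
    rw [← diffMean]
    ring
  simp only [integral_const, probReal_univ, one_smul] at h1
  linarith [sq_nonneg (diffMean f μ₁ y y')]

lemma B₀_nonneg (y : X₂) : 0 ≤ B₀ := by
  have := mul_nonneg hf.L_pos.le (dist_nonneg.trans (hf.diam_le y y))
  linarith [hf.B₀_eq, hf.Be_nonneg]

lemma columnModel (h : CellLaws ν μ₁ μ₂ γ Be p) (hm : 0 < m) (hB : 0 < L * D₂ + 2 * Be)
    (c : Fin n → X₂) (i : Fin n) :
    ColumnModel ν (fun j y => f y.1 (c i) - f y.1 (c j) - diffMean f μ₁ (c i) (c j))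
      (fun y => truncate Be y.2.2.1) (fun j => diffMean f μ₁ (c i) (c j))
      (fun j => diffVar f μ₁ (c i) (c j)) (L * D₂) Be γ where
  meas_diff j := ((hf.bddMeas_diff (c i) (c j)).meas.comp measurable_fst).sub measurable_const
  meas_noise := (measurable_truncate Be).comp (by fun_prop)
  diff_bound j y := by
    rw [sub_add_cancel]
    exact hf.abs_diff_le_diam _ _ _
  noise_bound y := abs_truncate_le hf.Be_nonneg _
  diff_mean v j := by
    have hb := hf.bddMeas_diff (c i) (c j)
    have := integral_map (μ := ν (rowSrc v)) (φ := fun y => y.1) measurable_fst.aemeasurable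
      (f := fun x => f x (c i) - f x (c j) - diffMean f μ₁ (c i) (c j))
      (hb.meas.sub measurable_const).aestronglyMeasurable
    rw [← this, h.row, BddMeas.integral_sub, ← diffMean]
    simp
  diff_var v j := by
    have := integral_map (μ := ν (rowSrc v)) (φ := fun y => y.1) measurable_fst.aemeasurable
      (f := fun x => (f x (c i) - f x (c j) - diffMean f μ₁ (c i) (c j)) ^ 2)
      (((hf.bddMeas_diff _ _).meas.sub measurable_const).pow_const 2).aestronglyMeasurable
    rw [← this, h.row, diffVar]
  noise_mean := h.noise_mean
  noise_var := h.noise_var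
  row_nonempty := ⟨⟨0, hm⟩⟩
  bound_pos := hB

/-- Valid at every outcome; it prices the patterns that are not good and also settles sizes for
which the tail term is at least `1`. -/
lemma abs_cellErr_le (ω : Source m n → Cell X₁ X₂) : |cellErr f Be β k τ u i ω| ≤ 2 * B₀ := by
  have hd := hf.abs_diff_le_diam
  have hn : ∀ v j, |cellNoise Be v j ω| ≤ Be := fun v j => abs_truncate_le hf.Be_nonneg _
  have hB := hf.B₀_eq
  refine abs_itemEstimate_sub_le (hf.B₀_nonneg (cellCol i ω)) (hf.bound _ _) (fun j v => ?_)
    fun j => ?_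
  · have h1 := abs_le.1 (hd (cellRow v ω) (cellCol i ω) (cellCol j ω))
    have h2 := abs_le.1 (hn v i)
    have h3 := abs_le.1 (hn v j)
    simp only [noisy, signal]
    exact abs_le.2 ⟨by linarith, by linarith⟩
  · have h1 := abs_le.1 (hd (cellRow u ω) (cellCol j ω) (cellCol i ω))
    have h3 := abs_le.1 (hn u j)
    simp only [noisy, signal]
    exact abs_le.2 ⟨by linarith, by linarith⟩

lemma bddMeas_cellErr : BddMeas (cellErr f Be β k τ u i : (Source m n → Cell X₁ X₂) → ℝ) :=
  ⟨measurable_cellErr hf.measurable Be β k τ u i, 2 * B₀, hf.abs_cellErr_le⟩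

lemma integral_cellErr_sq_le {Ω : Type*} [MeasurableSpace Ω] (P : Measure Ω)
    [IsProbabilityMeasure P] {G : Ω → Source m n → Cell X₁ X₂} (hG : Measurable G) :
    ∫ x, cellErr f Be β k τ u i (G x) ^ 2 ∂P ≤ (2 * B₀) ^ 2 := by
  refine (BddMeas.integral_mono ((hf.bddMeas_cellErr.pow 2).comp hG) (.const ((2 * B₀) ^ 2)) P
    fun x => sq_le_sq.2 ((hf.abs_cellErr_le (G x)).trans (le_abs_self _))).trans_eq (by simp)

end SignalBounds

open scoped Classical in
/-- Observed columns close to column `i`. -/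
noncomputable def nearCols (ρ : ℝ) (u : Fin m) (i : Fin n) (ω : Source m n → Cell X₁ X₂) :
    Finset (Fin n) :=
  univ.filter fun j => j ≠ i ∧ cellObs u j ω = true ∧ dist (cellCol j ω) (cellCol i ω) ≤ ρ

lemma mem_nearCols {ρ : ℝ} {u : Fin m} {i j : Fin n} {ω : Source m n → Cell X₁ X₂} :
    j ∈ nearCols ρ u i ω ↔ j ≠ i ∧ cellObs u j ω = true ∧ dist (cellCol j ω) (cellCol i ω) ≤ ρ := by
  simp [nearCols]

/-- Conditional error given the observation pattern and the column features. -/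
lemma CellLaws.integral_cellErr_mix_sq_le (h : CellLaws ν μ₁ μ₂ γ Be p)
    (hf : SignalBounds f L D₂ Be B₀) (hs : Scale B₀ α c r) (hβ : α ^ 3 * β = 1) (hk : 0 < k)
    (hζ0 : 0 < ζ) (hρ : (L * ρ) ^ 2 ≤ ζ) (hF : ζ + 2 * α + γ ^ 2 / k ≤ 2 * B₀)
    {ω : Source m n → Cell X₁ X₂} (hlo : ∀ j, j ≠ i → β ≤ #(colOverlap (cellPattern ω) i j))
    (hr : ∀ j j', j ≠ i → j' ≠ i → (#(colOverlap (cellPattern ω) i j) : ℝ)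
      ≤ r * #(colOverlap (cellPattern ω) i j')) (hnear : k ≤ #(nearCols ρ u i ω)) :
    ∫ a, cellErr f Be β k τ u i (mix latentBlock a ω) ^ 2 ∂Pr ν
      ≤ mainBound B₀ α (ζ + 2 * α + γ ^ 2 / k) + (2 * B₀) ^ 2 *
        (17 / 4 * exp (-c / α) * #(colBase (cellPattern ω) β u i)) := by
  have hα := hs.α_pos
  have hBeq := hf.B₀_eq
  have hB : 0 < L * D₂ + 2 * Be := hBeq ▸ hs.B_pos
  set o := cellPattern ω with ho
  have M := hf.columnModel h (Nat.zero_le _ |>.trans_lt u.2) hB (fun j => cellCol j ω) i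
  have hα3 : 0 < α ^ 3 := by positivity
  have hβ0 : 0 < β := pos_of_mul_pos_right (hβ ▸ one_pos) hα3.le
  have hT : nearCols ρ u i ω ⊆ colBase o β u i := fun j hj => by
    have hj := mem_nearCols.1 hj
    exact mem_colBase.2 ⟨hj.1, hj.2.1, hlo j hj.1⟩
  have hR : ∀ j ∈ colBase o β u i, (colOverlap o i j).Nonempty := fun j hj => by
    have := hβ0.trans_le (mem_colBase.1 hj).2.2
    exact card_pos.1 (by exact_mod_cast this)
  have e : ∀ a, cellErr f Be β k τ u i (mix latentBlock a ω)
      = nbrErr (fun j y => f y.1 (cellCol i ω) - f y.1 (cellCol j ω)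
          - diffMean f μ₁ (cellCol i ω) (cellCol j ω)) (fun y => truncate Be y.2.2.1) i u
        (colBase o β u i) (fun j => colOverlap o i j) (τ o u i) k a := fun a => by
    obtain ⟨hrow, hnoise, hcol, -, hp⟩ := mix_latentBlock a ω
    rw [cellErr, hp, ← ho, patternErr, ← itemEstimate_sub_eq_nbrErr
      (A := fun v j => f (a (rowSrc v)).1 (cellCol j ω))
      (mu := fun j => diffMean f μ₁ (cellCol i ω) (cellCol j ω)) (fun v j => rfl) hk
      (hnear.trans (card_le_card hT)) hR]
    congr 2
    · funext v j
      simp only [noisy, signal, cellRow, cellCol, cellNoise, hrow, hcol, hnoise]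
    · simp only [signal, cellRow, cellCol, hrow, hcol]
  simp only [e]
  rw [hBeq] at hs hF ⊢
  refine M.integral_nbrErr_sq_le_mainBound hs (fun hi => (mem_colBase.1 hi).1 rfl)
    (fun j hj => ?_) (fun j hj j' hj' => hr j j' (mem_colBase.1 hj).1
      (mem_colBase.1 hj').1) ?_ (τ o u i) hk hT hnear hζ0 (fun j hj => ?_) hF
  · rw [← hβ]
    exact mul_le_mul_of_nonneg_left (mem_colBase.1 hj).2.2 hα3.le
  -- Candidates are observed in row `u`, so whether `u` lies in an overlap depends only on the
  -- target entry. This is the source of the two cases.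
  · have key : ∀ j ∈ colBase o β u i, (u ∈ colOverlap o i j ↔ o u i = true) := fun j hj => by
      simp [colOverlap, colObs, (mem_colBase.1 hj).2.1]
    all_goals grind
  · refine (hf.diffVar_le μ₁ _ _).trans (le_trans ?_ hρ)
    have hL := hf.L_pos.le
    rw [dist_comm]
    gcongr
    exact (mem_nearCols.1 hj).2.2

/-- Outcomes at which the overlaps are balanced and there are enough close columns. -/
def GoodPattern (β r ρ : ℝ) (k : ℕ) (u : Fin m) (i : Fin n) (ω : Source m n → Cell X₁ X₂) :
    Prop := (∀ j, j ≠ i → β ≤ #(colOverlap (cellPattern ω) i j)) ∧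
  (∀ j j', j ≠ i → j' ≠ i → (#(colOverlap (cellPattern ω) i j) : ℝ)
      ≤ r * #(colOverlap (cellPattern ω) i j')) ∧ k ≤ #(nearCols ρ u i ω)

lemma card_filter_eq_sum_ind {κ : Type*} (s : Finset κ) (q : κ → Prop) [DecidablePred q] :
    (#(s.filter q) : ℝ) = ∑ j ∈ s, ind (q j) := by
  rw [card_filter, Nat.cast_sum]
  refine sum_congr rfl fun j _ => ?_
  by_cases h : q j <;> simp [ind, h]

lemma measurableSet_obs (v : Fin m) (j : Fin n) :
    MeasurableSet {ω : Source m n → Cell X₁ X₂ | cellObs v j ω = true} :=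
  measurable_cellObs v j (MeasurableSet.singleton true)

lemma CellLaws.prob_obs (h : CellLaws ν μ₁ μ₂ γ Be p) (v : Fin m) (j : Fin n) :
    ∫ ω, ind (cellObs v j ω = true) ∂Pr ν = p := by
  have hm := measurableSet_cell_obs (X₁ := X₁) (X₂ := X₂)
  have := integral_coord ν (BddMeas.ind hm).meas (obsSrc v j)
  rw [integral_ind hm, h.obs] at this
  exact this

lemma CellLaws.integral_card_colBase_le (h : CellLaws ν μ₁ μ₂ γ Be p) :
    BddMeas (fun ω : Source m n → Cell X₁ X₂ => (#(colBase (cellPattern ω) β u i) : ℝ)) ∧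
    ∫ ω, (#(colBase (cellPattern ω) β u i) : ℝ) ∂Pr ν ≤ n * p := by
  have hb : BddMeas fun ω : Source m n → Cell X₁ X₂ =>
      (#(colBase (cellPattern ω) β u i) : ℝ) :=
    ⟨(measurable_of_countable fun o : Fin m → Fin n → Bool =>
      (#(colBase o β u i) : ℝ)).comp measurable_cellPattern, n, fun ω => by
      rw [abs_of_nonneg (Nat.cast_nonneg _)]
      exact_mod_cast (card_le_univ _).trans (Fintype.card_fin n).le⟩
  refine ⟨hb, ?_⟩
  have hi : ∀ j, BddMeas fun ω : Source m n → Cell X₁ X₂ => ind (cellObs u j ω = true) :=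
    fun j => BddMeas.ind (measurableSet_obs u j)
  have := BddMeas.integral_mono hb (BddMeas.sum univ fun j _ => hi j) (Pr ν) fun ω => by
      rw [← card_filter_eq_sum_ind]
      exact_mod_cast card_le_card fun j hj => by
        simpa [cellPattern] using (mem_colBase.1 hj).2.1
  rw [integral_finsetSum _ fun j _ => (hi j).integrable _] at this
  simpa [h.prob_obs] using this

lemma measurable_card_nearCols :
    Measurable fun ω : Source m n → Cell X₁ X₂ => (#(nearCols ρ u i ω) : ℝ) := by
  classical
  simp only [nearCols, card_filter_eq_sum_ind]
  refine measurable_sum _ fun j _ => (BddMeas.ind ?_).meas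
  have h1 : MeasurableSet {ω : Source m n → Cell X₁ X₂ | dist (cellCol j ω) (cellCol i ω) ≤ ρ} :=
    measurableSet_le (by unfold cellCol; fun_prop) measurable_const
  exact (MeasurableSet.const _).inter ((measurableSet_obs u j).inter h1)

lemma measurableSet_goodPattern :
    MeasurableSet {ω : Source m n → Cell X₁ X₂ | GoodPattern β r ρ k u i ω} := by
  have hp : MeasurableSet {ω : Source m n → Cell X₁ X₂ | (k : ℝ) ≤ #(nearCols ρ u i ω)} :=
    measurableSet_le measurable_const measurable_card_nearCols
  simp only [Nat.cast_le] at hp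
  have ho : MeasurableSet {o : Fin m → Fin n → Bool | (∀ j, j ≠ i → β ≤ #(colOverlap o i j)) ∧
      ∀ j j', j ≠ i → j' ≠ i → (#(colOverlap o i j) : ℝ) ≤ r * #(colOverlap o i j')} :=
    (Set.toFinite _).measurableSet
  convert (measurable_cellPattern ho).inter hp using 1
  ext ω
  exact and_assoc.symm

lemma CellLaws.integral_cellErr_sq_le (h : CellLaws ν μ₁ μ₂ γ Be p)
    (hf : SignalBounds f L D₂ Be B₀) (hs : Scale B₀ α c r) (hβ : α ^ 3 * β = 1) (hk : 0 < k)
    (hζ0 : 0 < ζ) (hρ : (L * ρ) ^ 2 ≤ ζ) (hF : ζ + 2 * α + γ ^ 2 / k ≤ 2 * B₀) :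
    ∫ ω, cellErr f Be β k τ u i ω ^ 2 ∂Pr ν
      ≤ mainBound B₀ α (ζ + 2 * α + γ ^ 2 / k) + (2 * B₀) ^ 2 * (17 / 4 * exp (-c / α) * (n * p)
          + (Pr ν).real {ω | ¬ GoodPattern β r ρ k u i ω}) := by
  have hα := hs.α_pos
  have hB := hs.B_pos
  have hb := hf.bddMeas_cellErr (β := β) (k := k) (τ := τ) (u := u) (i := i)
  obtain ⟨hC, hCi⟩ := h.integral_card_colBase_le (β := β) (u := u) (i := i)
  have hg : MeasurableSet {ω : Source m n → Cell X₁ X₂ | ¬ GoodPattern β r ρ k u i ω} :=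
    measurableSet_goodPattern.compl
  set F := ζ + 2 * α + γ ^ 2 / k with hFd
  have hF0 : 0 < F := by positivity
  have hmain : 0 ≤ mainBound B₀ α F := by
    have : 0 ≤ log (2 * B₀ / F) := log_nonneg ((one_le_div hF0).2 hF)
    unfold mainBound
    positivity
  rw [integral_eq_integral_mix ν (hb.pow 2) latentBlock]
  have hmono := BddMeas.integral_mono ((hb.pow 2).integral_mix_left (ν := ν) latentBlock)
    (BddMeas.add (.const (mainBound B₀ α F)) (BddMeas.const_mul ((2 * B₀) ^ 2)
      ((hC.const_mul (17 / 4 * exp (-c / α))).add (BddMeas.ind hg)))) (Pr ν) fun ω => by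
      by_cases hgood : GoodPattern β r ρ k u i ω
      · refine (h.integral_cellErr_mix_sq_le hf hs hβ hk hζ0 hρ hF hgood.1 hgood.2.1
          hgood.2.2).trans ?_
        rw [ind_of_not (not_not.2 hgood), add_zero]
      · rw [ind_of hgood]
        refine (hf.integral_cellErr_sq_le _ (measurable_mix_left latentBlock ω)).trans ?_
        have : (0 : ℝ) ≤ (2 * B₀) ^ 2 *
          (17 / 4 * exp (-c / α) * #(colBase (cellPattern ω) β u i)) := by positivity
        linarith
  refine hmono.trans ?_
  rw [BddMeas.integral_add (.const _) (BddMeas.const_mul _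
      ((hC.const_mul _).add (BddMeas.ind hg))), integral_const_mul,
    BddMeas.integral_add (hC.const_mul _) (BddMeas.ind hg), integral_const_mul, integral_ind hg,
    integral_const, probReal_univ, one_smul]
  gcongr

lemma card_colOverlap_eq (ω : Source m n → Cell X₁ X₂) : (#(colOverlap (cellPattern ω) i j) : ℝ)
      = ∑ v, ind (cellObs v i ω = true ∧ cellObs v j ω = true) := by
  classical
  rw [← card_filter_eq_sum_ind]
  congr 2
  ext v
  simp only [colOverlap, colObs, mem_inter, mem_filter, mem_univ, true_and]
  rfl

lemma CellLaws.sum_prob_obs_pair (h : CellLaws ν μ₁ μ₂ γ Be p) (hij : j ≠ i) :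
    ∑ v : Fin m, ∫ ω, ind (cellObs v i ω = true ∧ cellObs v j ω = true) ∂Pr ν = m * p ^ 2 := by
  have hm := measurableSet_cell_obs (X₁ := X₁) (X₂ := X₂)
  have e : ∀ v, ∫ ω, ind (cellObs v i ω = true ∧ cellObs v j ω = true) ∂Pr ν = p ^ 2 := fun v => by
      have := integral_mul_coord ν (BddMeas.ind hm) (BddMeas.ind hm)
        (s := obsSrc v i) (t := obsSrc v j) (by simp [hij.symm])
      rw [integral_ind hm, integral_ind hm, h.obs, h.obs] at this
      rw [sq, ← this]
      exact integral_congr_ae (.of_forall fun ω => ind_and _ _)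
  simp [e]

lemma CellLaws.measureReal_card_colOverlap (h : CellLaws ν μ₁ μ₂ γ Be p) (hij : j ≠ i)
    (hε : 0 ≤ ε) (hε' : ε ≤ 2) : (Pr ν).real
        {ω | (#(colOverlap (cellPattern ω) i j) : ℝ) ≤ (1 - ε) * (m * p ^ 2)}
      ≤ exp (-(ε ^ 2 * (m * p ^ 2) / 2)) ∧ (Pr ν).real
        {ω | (1 + ε) * (m * p ^ 2) ≤ (#(colOverlap (cellPattern ω) i j) : ℝ)}
      ≤ exp (-(ε ^ 2 * (m * p ^ 2) / 4)) := by
  have hX : ∀ v ∈ univ, Measurable fun ω : Source m n → Cell X₁ X₂ =>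
      ind (cellObs v i ω = true ∧ cellObs v j ω = true) := fun v _ =>
    (BddMeas.ind ((measurableSet_obs v i).inter (measurableSet_obs v j))).meas
  have hB : ∀ v ∈ univ, DependsOn (fun ω : Source m n → Cell X₁ X₂ =>
      ind (cellObs v i ω = true ∧ cellObs v j ω = true)) {obsSrc v i, obsSrc v j} :=
    fun v _ x y hxy => by
      simp only [cellObs, hxy (obsSrc v i) (by simp), hxy (obsSrc v j) (by simp)]
  have hd := pairwiseDisjoint_pair ((univ : Finset (Fin m)) : Set (Fin m))
    (g := fun v => obsSrc v i) (h := fun v => obsSrc v j)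
    (fun a b => by simp) (fun a b => by simp) (fun a b => by simp [hij.symm])
  simp only [card_colOverlap_eq]
  refine ⟨?_, measureReal_sum_ge_upper ν hε hε' hX (fun _ _ _ => ind_nonneg _)
    (fun _ _ _ => ind_le_one _) hB hd (h.sum_prob_obs_pair hij).le⟩
  have := measureReal_sum_le_lower ν one_pos hε hε' hX (fun _ _ _ => ind_nonneg _)
    (fun _ _ _ => ind_le_one _) hB hd (h.sum_prob_obs_pair hij).ge
  rwa [mul_one] at this

/-- Freezing the feature of column `i` turns the number of near columns into a sum of independent
indicators. -/
lemma card_nearCols_mix (a b : Source m n → Cell X₁ X₂) :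
    (#(nearCols ρ u i (mix {colSrc i}ᶜ a b)) : ℝ) = ∑ j ∈ univ.erase i,
        ind (cellObs u j a = true ∧ cellCol j a ∈ Metric.closedBall (cellCol i b) ρ) := by
  classical
  rw [← card_filter_eq_sum_ind]
  congr 2
  ext j
  have h0 : mix {colSrc i}ᶜ a b (colSrc i) = b (colSrc i) := mix_of_notMem (by simp) _ _
  have h1 : mix {colSrc i}ᶜ a b (obsSrc u j) = a (obsSrc u j) := mix_of_mem (by simp) _ _
  simp only [mem_nearCols, mem_filter, mem_erase, mem_univ, and_true,
    Metric.mem_closedBall, cellObs, cellCol, h0, h1]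
  refine and_congr_right fun hj => ?_
  have h2 : mix {colSrc i}ᶜ a b (colSrc j) = a (colSrc j) := mix_of_mem (by simp [hj]) _ _
  rw [h2]

lemma measurableSet_nearCols_lt :
    MeasurableSet {ω : Source m n → Cell X₁ X₂ | #(nearCols ρ u i ω) < k} := by
  have := measurableSet_lt (measurable_card_nearCols (X₁ := X₁) (X₂ := X₂) (ρ := ρ) (u := u) (i := i)) (measurable_const (a := (k : ℝ)))
  simpa only [Nat.cast_lt] using this

/-- For almost every centre the ball has mass at least the essential infimum, so the Chernoff bound
holds conditionally on the feature of column `i` with a deterministic mean. -/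
lemma CellLaws.measureReal_nearCols_lt (h : CellLaws ν μ₁ μ₂ γ Be p) (hp : 0 ≤ p)
    (hε : 0 ≤ ε) (hε' : ε ≤ 2) (hk : k ≤ (1 - ε) * (((n : ℝ) - 1) * p * ballMass μ₂ ρ)) :
    (Pr ν).real {ω | #(nearCols ρ u i ω) < k}
      ≤ exp (-(ε ^ 2 * (((n : ℝ) - 1) * p * ballMass μ₂ ρ) / 2)) := by
  have hm := measurableSet_cell_obs (X₁ := X₁) (X₂ := X₂)
  have hcol : Measurable fun y : Cell X₁ X₂ => y.2.1 := by fun_prop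
  have hae : ∀ᵐ b ∂Pr ν, ballMass μ₂ ρ ≤ μ₂.real (Metric.closedBall (cellCol i b) ρ) := by
    have e : (Pr ν).map (cellCol i) = μ₂ := by
      rw [← h.col i, ← (measurePreserving_eval ν (colSrc i)).map_eq,
        Measure.map_map hcol (measurable_pi_apply _)]
      rfl
    have h2 := ae_ballMass_le μ₂ ρ
    rw [← e] at h2
    have h3 := ae_of_ae_map (f := cellCol i)
      (hcol.comp (measurable_pi_apply (colSrc i))).aemeasurable h2
    rwa [e] at h3
  have hb := BddMeas.ind (measurableSet_nearCols_lt (X₁ := X₁) (X₂ := X₂) (ρ := ρ) (u := u)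
    (i := i) (k := k))
  rw [← integral_ind measurableSet_nearCols_lt, integral_eq_integral_mix ν hb {colSrc i}ᶜ]
  have := integral_mono_ae ((hb.integral_mix_left (ν := ν) {colSrc i}ᶜ).integrable
    (Pr ν)) (integrable_const (exp (-(ε ^ 2 * (((n : ℝ) - 1) * p * ballMass μ₂ ρ)
      / 2)))) (hae.mono fun b hφ => ?_)
  · rwa [integral_const, probReal_univ, one_smul] at this
  have hball : MeasurableSet {y : Cell X₁ X₂ | y.2.1 ∈ Metric.closedBall (cellCol i b) ρ} :=
    hcol Metric.isClosed_closedBall.measurableSet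
  have hX : ∀ j, BddMeas fun a : Source m n → Cell X₁ X₂ =>
      ind (cellObs u j a = true ∧ cellCol j a ∈ Metric.closedBall (cellCol i b) ρ) := fun j =>
    BddMeas.ind ((measurableSet_obs u j).inter (hball.preimage (measurable_pi_apply _)))
  have hsum : ((n : ℝ) - 1) * p * ballMass μ₂ ρ ≤ ∑ j ∈ univ.erase i,
      ∫ a, ind (cellObs u j a = true ∧ cellCol j a ∈ Metric.closedBall (cellCol i b) ρ) ∂Pr ν := by
    have e : ∀ j, ∫ a, ind (cellObs u j a = true ∧
        cellCol j a ∈ Metric.closedBall (cellCol i b) ρ) ∂Pr ν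
        = p * μ₂.real (Metric.closedBall (cellCol i b) ρ) := fun j => by
      have := integral_mul_coord ν (BddMeas.ind hm) (BddMeas.ind hball)
        (s := obsSrc u j) (t := colSrc j) (by simp)
      rw [integral_ind hm, integral_ind hball, h.obs] at this
      rw [← h.col j, map_measureReal_apply hcol Metric.isClosed_closedBall.measurableSet]
      exact (integral_congr_ae (.of_forall fun ω => ind_and _ _)).trans this
    simp only [e]
    rw [sum_const, card_erase_of_mem (mem_univ _), card_univ,
      Fintype.card_fin, nsmul_eq_mul, Nat.cast_sub (lt_of_le_of_lt (Nat.zero_le _) i.2),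
      Nat.cast_one, mul_assoc]
    have : (0 : ℝ) ≤ (n : ℝ) - 1 := by
      have : (1 : ℝ) ≤ n := by exact_mod_cast lt_of_le_of_lt (Nat.zero_le _) i.2
      linarith
    gcongr
  have key := measureReal_sum_le_lower ν one_pos hε hε' (s := univ.erase i)
    (B := fun j => {obsSrc u j, colSrc j}) (fun j _ => (hX j).meas)
    (fun _ _ _ => ind_nonneg _) (fun _ _ _ => ind_le_one _) (fun j _ x y hxy => by
      simp only [cellObs, cellCol, hxy (obsSrc u j) (by simp), hxy (colSrc j) (by simp)])
    (pairwiseDisjoint_pair _ (fun a b => by simp) (fun a b => by simp) fun a b => by simp) hsum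
  rw [mul_one] at key
  have hmix : MeasurableSet {a | #(nearCols ρ u i (mix {colSrc i}ᶜ a b)) < k} :=
    measurableSet_nearCols_lt.preimage (measurable_mix_left {colSrc i}ᶜ b)
  refine le_trans (le_of_eq (integral_ind hmix _)) (le_trans (measureReal_mono fun a ha => ?_) key)
  rw [Set.mem_ofPred_eq] at ha ⊢
  rw [← card_nearCols_mix]
  exact le_trans (by exact_mod_cast ha.le) hk

/-- Union bound over the columns. The threshold `β` may fail with probability `exp (-a)`, whereas
the two balance conditions are asked to fail with probability at most its square, so that the factor
`n` on them can be absorbed later. -/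
lemma CellLaws.measureReal_not_goodPattern_le (h : CellLaws ν μ₁ μ₂ γ Be p)
    (hβ : β = (1 - ε) * (m * p ^ 2)) (hε : 0 ≤ ε) (hε2 : ε ≤ 1) (hε' : 0 ≤ ε') (hε'2 : ε' < 1)
    (hε'' : 0 ≤ ε'') (hε''2 : ε'' ≤ 2) (hr : r = (1 + ε'') / (1 - ε'))
    (ha : 2 * a ≤ ε ^ 2 * (m * p ^ 2)) (ha' : 4 * a ≤ ε' ^ 2 * (m * p ^ 2))
    (ha'' : 8 * a ≤ ε'' ^ 2 * (m * p ^ 2)) : (Pr ν).real {ω | ¬ GoodPattern β r ρ k u i ω}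
      ≤ n * (exp (-a) + 2 * exp (-a) ^ 2) + (Pr ν).real {ω | #(nearCols ρ u i ω) < k} := by
  set q := m * p ^ 2 with hq
  let E : Fin n → Set (Source m n → Cell X₁ X₂) := fun j =>
    {ω | (#(colOverlap (cellPattern ω) i j) : ℝ) ≤ (1 - ε) * q} ∪
    ({ω | (#(colOverlap (cellPattern ω) i j) : ℝ) ≤ (1 - ε') * q} ∪
      {ω | (1 + ε'') * q ≤ (#(colOverlap (cellPattern ω) i j) : ℝ)})
  have hsub : {ω : Source m n → Cell X₁ X₂ | ¬ GoodPattern β r ρ k u i ω}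
      ⊆ (⋃ j ∈ univ.erase i, E j) ∪ {ω | #(nearCols ρ u i ω) < k} := by
    intro ω hω
    by_contra hn
    simp only [E, Set.mem_union, Set.mem_iUnion, mem_erase, mem_univ, and_true,
      Set.mem_ofPred_eq, not_or, not_exists, not_le, not_lt] at hn
    obtain ⟨hn, hnear⟩ := hn
    refine hω ⟨fun j hj => hβ ▸ (hn j hj).1.le, fun j j' hj hj' => ?_, hnear⟩
    rw [hr, div_mul_eq_mul_div, le_div_iff₀ (by linarith)]
    have h1 := (hn j hj).2.2.le
    have h2 := (hn j' hj').2.1.le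
    nlinarith
  have hE : ∀ j ∈ univ.erase i, (Pr ν).real (E j) ≤ exp (-a) + 2 * exp (-a) ^ 2 := fun j hj => by
    have hj := ne_of_mem_erase hj
    have h1 := (h.measureReal_card_colOverlap hj hε (by linarith)).1
    have h2 := (h.measureReal_card_colOverlap hj hε' (by linarith)).1
    have h3 := (h.measureReal_card_colOverlap hj hε'' hε''2).2
    rw [← hq] at h1 h2 h3
    have e1 : exp (-(ε ^ 2 * q / 2)) ≤ exp (-a) := exp_le_exp.2 (by linarith)
    have e0 : exp (-a) ^ 2 = exp (-(2 * a)) := by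
      rw [← exp_nat_mul]; ring_nf
    have e2 : exp (-(ε' ^ 2 * q / 2)) ≤ exp (-a) ^ 2 := e0 ▸ exp_le_exp.2 (by linarith)
    have e3 : exp (-(ε'' ^ 2 * q / 4)) ≤ exp (-a) ^ 2 := e0 ▸ exp_le_exp.2 (by linarith)
    have h4 := measureReal_union_le (μ := Pr ν)
      {ω | (#(colOverlap (cellPattern ω) i j) : ℝ) ≤ (1 - ε') * q}
      {ω | (1 + ε'') * q ≤ (#(colOverlap (cellPattern ω) i j) : ℝ)}
    refine (measureReal_union_le _ _).trans ?_
    linarith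
  refine (measureReal_mono hsub).trans ((measureReal_union_le _ _).trans ?_)
  refine add_le_add ((measureReal_biUnion_finset_le _ _).trans ?_) le_rfl
  refine (sum_le_card_nsmul _ _ _ hE).trans ?_
  rw [nsmul_eq_mul]
  gcongr
  exact (card_le_univ _).trans (Fintype.card_fin n).le

/-- The expected number of near columns is at least `cφ (n p)^(1/3) / 2`, because `n - 1 ≥ n / 2`,
and `k` is at most the fraction `ck / 2` of the guaranteed mean. -/
lemma CellLaws.measureReal_nearCols_lt_le (h : CellLaws ν μ₁ μ₂ γ Be p) (hp0 : 0 < p)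
    (hck : ck ∈ Set.Ico (0 : ℝ) 1) (hn : (2 : ℝ) ≤ n)
    (hφ : cφ * (n * p) ^ (-(2 / 3) : ℝ) ≤ ballMass μ₂ ρ) (hcφ : 0 ≤ cφ)
    (hk : (k : ℝ) ≤ ck / 2 * ((n : ℝ) - 1) * p * ballMass μ₂ ρ) :
    (Pr ν).real {ω | #(nearCols ρ u i ω) < k} ≤ exp (-constC1 cφ ck * (n * p) ^ (1 / 3 : ℝ)) := by
  obtain ⟨hck0, hck1⟩ := hck
  have hx : (0 : ℝ) < n * p := by positivity
  refine (h.measureReal_nearCols_lt (ε := 1 - ck / 2) hp0.le (by linarith) (by linarith)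
    (hk.trans_eq (by ring))).trans (exp_le_exp.2 ?_)
  set t := ((n : ℝ) * p) ^ (1 / 3 : ℝ) with ht
  have ht0 : 0 < t := rpow_pos_of_pos hx _
  have e : (n * p) * ((n : ℝ) * p) ^ (-(2 / 3) : ℝ) = t := by
    rw [ht, ← rpow_one_add' hx.le (by norm_num)]; norm_num
  have h1 : constC1 cφ ck ≤ cφ * (1 - ck) ^ 2 / 8 := min_le_right _ _
  have h2 : cφ * t / 2 ≤ ((n : ℝ) - 1) * p * ballMass μ₂ ρ := by
    calc _ = (n * p) / 2 * (cφ * (n * p) ^ (-(2 / 3) : ℝ)) := by rw [← e]; ring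
      _ ≤ (((n : ℝ) - 1) * p) * ballMass μ₂ ρ := by
          refine mul_le_mul (by nlinarith) hφ (by positivity) ?_
          exact mul_nonneg (by linarith) hp0.le
  have h3 : (1 - ck) ^ 2 * (cφ * t / 2)
      ≤ (1 - ck / 2) ^ 2 * (((n : ℝ) - 1) * p * ballMass μ₂ ρ) := by
    gcongr
    linarith
  have h4 : constC1 cφ ck * t ≤ cφ * (1 - ck) ^ 2 / 8 * t := by gcongr
  nlinarith

/-- Bound on the mean squared error of an entry. -/
lemma CellLaws.integral_cellErr_sq_le_bound (h : CellLaws ν μ₁ μ₂ γ Be p)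
    (hf : SignalBounds f L D₂ Be B₀) (hcφ : 0 ≤ cφ) (hcβ : cβ ∈ Set.Ioo (0 : ℝ) 1)
    (hck : ck ∈ Set.Ico (0 : ℝ) 1) (hk : 0 < k) (hp0 : 0 < p) (hp : p ≤ 1) (hζ : 0 < ζ)
    (hφ : cφ * (n * p) ^ (-(2 / 3) : ℝ) ≤ ballMass μ₂ (√(ζ / L ^ 2))) (hβ : β = cβ * (m * p ^ 2))
    (hkφ : (k : ℝ) ≤ ck / 2 * ((n : ℝ) - 1) * p * ballMass μ₂ (√(ζ / L ^ 2)))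
    (hF : boundF1 ζ β γ k ≤ 2 * B₀)
    (hlarge : cβ ^ 2 * β ^ (1 / 3 : ℝ) ≤ (1 - cβ) ^ 2 * (m * p ^ 2)) :
    ∫ ω, cellErr f Be β k τ u i ω ^ 2 ∂Pr ν ≤ mainBound B₀ (boundF2 β) (boundF1 ζ β γ k)
        + (2 * B₀) ^ 2 * boundF3 (constC1 cφ ck) (constC2 cβ B₀) n p β := by
  have hm : (0 : ℝ) < m := by exact_mod_cast lt_of_le_of_lt (Nat.zero_le _) u.2
  have hn : (0 : ℝ) < n := by exact_mod_cast lt_of_le_of_lt (Nat.zero_le _) i.2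
  obtain ⟨hcβ0, hcβ1⟩ := hcβ
  have hβ0 : 0 < β := hβ ▸ by positivity
  obtain ⟨hα, hαe, hα3⟩ := boundF2_pos_and hβ0
  have hFe : boundF1 ζ β γ k = ζ + 2 * boundF2 β + γ ^ 2 / k := rfl
  have hF0 : 0 < boundF1 ζ β γ k := by rw [hFe]; positivity
  have hB : 0 < B₀ := by linarith
  obtain ⟨hcc, hcB⟩ := constC2_le cβ hB
  have hc0 := constC2_pos hcβ0 hB
  set c := constC2 cβ B₀
  set α := boundF2 β
  have hx : (0 : ℝ) < n * p := by positivity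
  set t := ((n : ℝ) * p) ^ (1 / 3 : ℝ) with ht
  have ht0 : 0 < t := rpow_pos_of_pos hx _
  have ht3 : t ^ 3 = n * p := by
    rw [ht, ← rpow_natCast, ← rpow_mul hx.le]; norm_num
  have hexp : -c * β ^ (1 / 3 : ℝ) = -(c / α) := by rw [hαe]; ring
  rw [boundF3, ← ht, hexp]
  -- If the tail term reaches `1`, the trivial bound is enough. Otherwise the sizes are forced to be
  -- large; in particular `c / α ≥ 11.5`.
  by_cases h3 : 3 * exp (-constC1 cφ ck * t) + (n + 9 / 2 * (n * p)) * exp (-(c / α)) < 1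
  · obtain ⟨hx8, hcα, hne⟩ := large_of_tail_lt_one (min_le_left _ _) ht0.le ht3
      (mul_le_of_le_one_right hn.le hp) h3
    have hcα' : 11.5 * α ≤ c := (le_div_iff₀ hα).1 hcα
    -- `v²` times the expected overlap is at least `c / α`. The relative deviations `2 v` below and
    -- `2.8285 v ≥ 2 √2 v` above then both have probability at most `exp (-2 c / α)`.
    set v := √c * α with hv
    have hv2 : v ^ 2 = c * α ^ 2 := by rw [hv, mul_pow, sq_sqrt hc0.le]
    have hv0 : 0 ≤ v := by positivity
    obtain ⟨hvle, hs⟩ := Scale.of_ratio hα hB (by nlinarith) hcB hcα' hv2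
    have hq : β ≤ m * p ^ 2 := by
      rw [hβ]; exact mul_le_of_le_one_left (by positivity) hcβ1.le
    have hvq : c / α ≤ v ^ 2 * (m * p ^ 2) := by
      have : c / α = v ^ 2 * β := by
        rw [div_eq_iff hα.ne', hv2]
        linear_combination -c * hα3
      rw [this]
      gcongr
    have hε : 2 * (c / α) ≤ (1 - cβ) ^ 2 * (m * p ^ 2) := by
      refine le_trans ?_ hlarge
      rw [hαe]
      calc 2 * (c / α) = 2 * c * (1 / α) := by ring
        _ ≤ cβ ^ 2 * (1 / α) := by gcongr; linarith
    have hε' : 4 * (c / α) ≤ (2 * v) ^ 2 * (m * p ^ 2) := by linarith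
    have hε'' : 8 * (c / α) ≤ (2.8285 * v) ^ 2 * (m * p ^ 2) := by
      have : 0 ≤ v ^ 2 * (m * p ^ 2) := by positivity
      linarith
    have hβ' : β = (1 - (1 - cβ)) * (m * p ^ 2) := by rw [hβ]; ring
    have hbad := h.measureReal_not_goodPattern_le (u := u) (i := i) (k := k) (ρ := √(ζ / L ^ 2))
      hβ' (by linarith) (by linarith) (by positivity : 0 ≤ 2 * v) (by linarith)
      (by positivity : 0 ≤ 2.8285 * v) (by linarith) rfl hε hε' hε''
    have hL : (L * √(ζ / L ^ 2)) ^ 2 ≤ ζ := by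
      have := hf.L_pos
      rw [mul_pow, sq_sqrt (by positivity)]
      exact le_of_eq (by field_simp)
    have hne2 : (8 : ℝ) ≤ n := hx8.trans (mul_le_of_le_one_right hn.le hp)
    have hnear := h.measureReal_nearCols_lt_le (u := u) (i := i) hp0 hck (by linarith) hφ hcφ hkφ
    rw [← ht] at hnear
    refine (h.integral_cellErr_sq_le hf hs hα3 hk hζ hL hF).trans ?_
    rw [← hFe, neg_div]
    set e := exp (-(c / α))
    have he : 0 < e := exp_pos _
    -- The balance conditions cost `2 n e² ≤ 2 e`, which `n p ≥ 8` converts into `(1 / 4) n p e`;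
    -- with `17 / 4` from the columns this makes `9 / 2`.
    have h1 : n * e * e ≤ 1 * e := mul_le_mul_of_nonneg_right hne he.le
    have h2 : 8 * e ≤ n * p * e := mul_le_mul_of_nonneg_right hx8 he.le
    have h4 := exp_pos (-constC1 cφ ck * t)
    refine add_le_add le_rfl (mul_le_mul_of_nonneg_left ?_ (sq_nonneg _))
    linarith
  · have hlog : 0 ≤ log (2 * B₀ / boundF1 ζ β γ k) := log_nonneg ((one_le_div hF0).2 hF)
    have hmain : 0 ≤ mainBound B₀ α (boundF1 ζ β γ k) := by
      unfold mainBound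
      positivity
    have := hf.integral_cellErr_sq_le (Pr ν) measurable_id (β := β) (k := k) (τ := τ) (u := u) (i := i)
    simp only [id] at this
    nlinarith [sq_nonneg (2 * B₀)]

end Latent

/-! ### Transfer to the given probability space. -/

section Transfer

variable {X₁ X₂ Ω : Type*} [MeasurableSpace X₁] [MeasurableSpace X₂] [MeasurableSpace Ω]
  {m n : ℕ} {P : Measure Ω} [IsProbabilityMeasure P] {μ₁ : Measure X₁} {μ₂ : Measure X₂}
  {γ Be p : ℝ} {x₁ : Fin m → Ω → X₁} {x₂ : Fin n → Ω → X₂} {η : Fin m → Fin n → Ω → ℝ}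
  {o : Fin m → Fin n → Ω → Bool}

/-- The random data of the model as a family of cells indexed by the sources. -/
def toCells (y₁ : X₁) (y₂ : X₂) (x₁ : Fin m → Ω → X₁) (x₂ : Fin n → Ω → X₂)
    (η : Fin m → Fin n → Ω → ℝ) (o : Fin m → Fin n → Ω → Bool) : Source m n → Ω → Cell X₁ X₂
  | .inl (.inl u), ω => (x₁ u ω, y₂, 0, false)
  | .inl (.inr i), ω => (y₁, x₂ i ω, 0, false)
  | .inr (.inl e), ω => (y₁, y₂, η e.1 e.2 ω, false)
  | .inr (.inr e), ω => (y₁, y₂, 0, o e.1 e.2 ω)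

variable (y₁ : X₁) (y₂ : X₂)

lemma measurable_toCells_sourceSigma (s : Source m n) :
    Measurable[sourceSigma x₁ x₂ η o s] (toCells y₁ y₂ x₁ x₂ η o s) := by
  rcases s with (u | i) | (e | e)
  · exact (measurable_id.prodMk measurable_const).comp (comap_measurable (x₁ u))
  · exact (measurable_const.prodMk (measurable_id.prodMk measurable_const)).comp
      (comap_measurable (x₂ i))
  · exact (measurable_const.prodMk (measurable_const.prodMk
      (measurable_id.prodMk measurable_const))).comp (comap_measurable (η e.1 e.2))
  · exact (measurable_const.prodMk (measurable_const.prodMk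
      (measurable_const.prodMk measurable_id))).comp (comap_measurable (o e.1 e.2))

namespace IsLatentModel

variable (h : IsLatentModel P μ₁ μ₂ γ Be p x₁ x₂ η o)
include h

lemma measurable_toCells (s : Source m n) : Measurable (toCells y₁ y₂ x₁ x₂ η o s) := by
  refine (measurable_toCells_sourceSigma y₁ y₂ s).mono ?_ le_rfl
  rcases s with (u | i) | (e | e)
  · exact (h.measurable_row u).comap_le
  · exact (h.measurable_col i).comap_le
  · exact (h.measurable_noise e.1 e.2).comap_le
  · exact (h.measurable_obs e.1 e.2).comap_le

/-- Each cell is measurable with respect to its own source, so independence of the sources makes the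
joint law of the cells a product measure. -/
lemma map_toCells : P.map (fun ω s => toCells y₁ y₂ x₁ x₂ η o s ω)
      = Pr fun s => P.map (toCells y₁ y₂ x₁ x₂ η o s) :=
  (iIndepFun_iff_map_fun_eq_pi_map fun s => (h.measurable_toCells y₁ y₂ s).aemeasurable).1
    (iIndep_of_iIndep_of_le h.indep fun s => (measurable_toCells_sourceSigma y₁ y₂ s).comap_le)

lemma cellLaws (hp : 0 ≤ p) :
    CellLaws (fun s => P.map (toCells y₁ y₂ x₁ x₂ η o s)) μ₁ μ₂ γ Be p := by
  have hm := h.measurable_toCells y₁ y₂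
  have hae : ∀ u i, ∀ᵐ ω ∂P, truncate Be (η u i ω) = η u i ω := fun u i =>
    (h.noise_bound u i).mono fun ω hω => truncate_of_abs_le hω
  have ht : Measurable fun y : Cell X₁ X₂ => truncate Be y.2.2.1 :=
    (measurable_truncate Be).comp (by fun_prop)
  refine ⟨fun u => ?_, fun i => ?_, fun u i => ?_, fun u i => ?_, fun u i => ?_⟩
  · rw [Measure.map_map measurable_fst (hm _)]; exact h.law_row u
  · rw [Measure.map_map (by fun_prop) (hm _)]; exact h.law_col i
  · rw [integral_map (hm _).aemeasurable ht.aestronglyMeasurable, ← h.noise_mean u i]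
    exact integral_congr_ae (hae u i)
  · rw [integral_map (hm _).aemeasurable (ht.pow_const 2).aestronglyMeasurable, ← h.noise_var u i,
      variance_of_integral_eq_zero (h.measurable_noise u i).aemeasurable (h.noise_mean u i)]
    exact integral_congr_ae ((hae u i).mono fun ω hω => congrArg (· ^ 2) hω)
  · rw [map_measureReal_apply (hm _) measurableSet_cell_obs, Measure.real]
    exact (congrArg ENNReal.toReal (h.obs_prob u i)).trans (ENNReal.toReal_ofReal hp)

lemma avgSqError_ae_eq (f : X₁ → X₂ → ℝ) (β : ℝ) (k : ℕ)
    (τ : (Fin m → Fin n → Bool) → Fin m → Fin n → Equiv.Perm (Fin n)) :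
    avgSqError f x₁ x₂ η o β k τ =ᵐ[P] fun ω => (1 / ((m : ℝ) * n)) * ∑ u, ∑ i,
      cellErr f Be β k τ u i (fun s => toCells y₁ y₂ x₁ x₂ η o s ω) ^ 2 := by
  filter_upwards [ae_all_iff.2 fun u => ae_all_iff.2 fun i => h.noise_bound u i] with ω hω
  have e : noisy f x₁ x₂ η ω = noisy f cellRow cellCol (cellNoise Be)
      (fun s => toCells y₁ y₂ x₁ x₂ η o s ω) := by
    funext u i
    have : cellNoise Be u i (fun s => toCells y₁ y₂ x₁ x₂ η o s ω) = η u i ω :=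
      truncate_of_abs_le (hω u i)
    rw [noisy, noisy, this]
    rfl
  rw [avgSqError, e]
  rfl

end IsLatentModel

end Transfer

lemma IsLatentModel.integral_avgSqError_le {X₁ X₂ Ω : Type*}
    [MetricSpace X₁] [CompactSpace X₁] [MeasurableSpace X₁] [BorelSpace X₁]
    [MetricSpace X₂] [CompactSpace X₂] [MeasurableSpace X₂] [BorelSpace X₂] [MeasurableSpace Ω]
    {m n : ℕ} {P : Measure Ω} [IsProbabilityMeasure P] {μ₁ : Measure X₁} [IsProbabilityMeasure μ₁]
    {μ₂ : Measure X₂} [IsProbabilityMeasure μ₂]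
    {γ Be p : ℝ} {x₁ : Fin m → Ω → X₁} {x₂ : Fin n → Ω → X₂} {η : Fin m → Fin n → Ω → ℝ}
    {o : Fin m → Fin n → Ω → Bool} (h : IsLatentModel P μ₁ μ₂ γ Be p x₁ x₂ η o)
    {f : X₁ → X₂ → ℝ} {L D₂ B₀ β ζ cφ cβ ck : ℝ} {k : ℕ}
    (τ : (Fin m → Fin n → Bool) → Fin m → Fin n → Equiv.Perm (Fin n))
    (hf : SignalBounds f L D₂ Be B₀) (hcφ : 0 ≤ cφ) (hcβ : cβ ∈ Set.Ioo (0 : ℝ) 1)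
    (hck : ck ∈ Set.Ico (0 : ℝ) 1) (hm : 0 < m) (hn : 0 < n) (hk : 0 < k) (hp0 : 0 < p)
    (hp : p ≤ 1) (hζ : 0 < ζ) (hφ : cφ * (n * p) ^ (-(2 / 3) : ℝ) ≤ ballMass μ₂ (√(ζ / L ^ 2)))
    (hβ : β = cβ * (m * p ^ 2))
    (hkφ : (k : ℝ) ≤ ck / 2 * ((n : ℝ) - 1) * p * ballMass μ₂ (√(ζ / L ^ 2)))
    (hF : boundF1 ζ β γ k ≤ 2 * B₀)
    (hlarge : cβ ^ 2 * β ^ (1 / 3 : ℝ) ≤ (1 - cβ) ^ 2 * (m * p ^ 2)) :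
    Integrable (avgSqError f x₁ x₂ η o β k τ) P ∧
    ∫ ω, avgSqError f x₁ x₂ η o β k τ ω ∂P ≤ mainBound B₀ (boundF2 β) (boundF1 ζ β γ k)
        + (2 * B₀) ^ 2 * boundF3 (constC1 cφ ck) (constC2 cβ B₀) n p β := by
  -- Arbitrary points filling the components of a cell that its source does not carry.
  obtain ⟨y₁⟩ : Nonempty X₁ := nonempty_of_isProbabilityMeasure μ₁
  obtain ⟨y₂⟩ : Nonempty X₂ := nonempty_of_isProbabilityMeasure μ₂
  have hae := h.avgSqError_ae_eq y₁ y₂ f β k τ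
  set Ψ : Ω → Source m n → Cell X₁ X₂ := fun ω s => toCells y₁ y₂ x₁ x₂ η o s ω with hΨ
  have hΨm : Measurable Ψ := measurable_pi_iff.2 fun s => h.measurable_toCells y₁ y₂ s
  have hb : ∀ u i, BddMeas fun ω => cellErr f Be β k τ u i (Ψ ω) ^ 2 := fun u i =>
    (hf.bddMeas_cellErr.comp hΨm).pow 2
  have hsum : ∀ u ∈ univ, BddMeas fun ω => ∑ i, cellErr f Be β k τ u i (Ψ ω) ^ 2 :=
    fun u _ => BddMeas.sum _ fun i _ => hb u i
  have hmn : (0 : ℝ) < m * n := by positivity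
  refine ⟨(((BddMeas.sum _ hsum).const_mul _).integrable P).congr hae.symm, ?_⟩
  have hprob : ∀ s, IsProbabilityMeasure (P.map (toCells y₁ y₂ x₁ x₂ η o s)) := fun s =>
    Measure.isProbabilityMeasure_map (h.measurable_toCells y₁ y₂ s).aemeasurable
  set V := mainBound B₀ (boundF2 β) (boundF1 ζ β γ k)
    + (2 * B₀) ^ 2 * boundF3 (constC1 cφ ck) (constC2 cβ B₀) n p β with hV
  have hentry : ∀ u i, ∫ ω, cellErr f Be β k τ u i (Ψ ω) ^ 2 ∂P ≤ V := fun u i => by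
    have h1 := (h.cellLaws y₁ y₂ hp0.le).integral_cellErr_sq_le_bound (τ := τ) (u := u) (i := i)
      hf hcφ hcβ hck hk hp0 hp hζ hφ hβ hkφ hF hlarge
    rw [← h.map_toCells y₁ y₂, integral_map hΨm.aemeasurable
      (hf.bddMeas_cellErr.pow 2).meas.aestronglyMeasurable] at h1
    exact h1
  rw [integral_congr_ae hae, integral_const_mul,
    integral_finsetSum _ fun u hu => (hsum u hu).integrable P]
  simp only [integral_finsetSum _ fun i (_ : i ∈ univ) => (hb _ i).integrable P]
  rw [one_div_mul_eq_div, div_le_iff₀ hmn]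
  refine (sum_le_sum fun u _ => sum_le_sum fun i _ => hentry u i).trans_eq ?_
  simp only [sum_const, card_univ, Fintype.card_fin, nsmul_eq_mul]
  ring

/-! ### Vanishing of the tail term, and the theorem. -/

lemma tendsto_rpow_sub_mul_atBot {δ c : ℝ} (hδ : δ < 1) (hc : 0 < c) :
    Tendsto (fun s : ℝ => s ^ δ - c * s) atTop atBot := by
  have h1 : Tendsto (fun s : ℝ => s ^ (-(1 - δ)) - c) atTop (𝓝 (0 - c)) :=
    (tendsto_rpow_neg_atTop (by linarith)).sub_const c
  refine (tendsto_id.atTop_mul_neg (by linarith : 0 - c < 0) h1).congr' ?_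
  filter_upwards [eventually_gt_atTop 0] with s hs
  have : s * s ^ (-(1 - δ)) = s ^ δ := by
    have := rpow_add hs 1 (-(1 - δ))
    rw [rpow_one] at this
    rw [← this]
    congr 1
    ring
  rw [id, mul_sub, this, mul_comm c]

/-- The tail bound vanishes in the limit of large sizes. -/
lemma tendsto_boundF3 {c₁ c₂ cβ δ δ' : ℝ} (hc₁ : 0 < c₁) (hc₂ : 0 < c₂) (hcβ : 0 < cβ)
    (hδ : 0 < δ) (hδ' : δ' < 1) {ms ns : ℕ → ℕ} {ps : ℕ → ℝ} (hm : Tendsto ms atTop atTop)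
    (hn : Tendsto ns atTop atTop) (h : ∀ᶠ t in atTop, ps t ≤ 1 ∧
      max ((ms t : ℝ) ^ (-(1 / 2) + δ)) ((ns t : ℝ) ^ (-1 + δ)) ≤ ps t ∧
      log (ns t) < ((ms t : ℝ) * ps t ^ 2) ^ (δ' / 3)) :
    Tendsto (fun t => boundF3 c₁ c₂ (ns t) (ps t) (cβ * ((ms t : ℝ) * ps t ^ 2))) atTop (𝓝 0) := by
  have hx : Tendsto (fun t => (ns t : ℝ) * ps t) atTop atTop := by
    refine tendsto_atTop_mono' _ ?_
      ((tendsto_rpow_atTop hδ).comp (tendsto_natCast_atTop_atTop.comp hn))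
    filter_upwards [h, hn.eventually_gt_atTop 0] with t ht h0
    have h0 : (0 : ℝ) < ns t := by exact_mod_cast h0
    calc (ns t : ℝ) ^ δ = ns t * (ns t : ℝ) ^ (-1 + δ) := by
          rw [rpow_add h0, rpow_neg_one]; field_simp
      _ ≤ _ := by gcongr; exact (le_max_right _ _).trans ht.2.1
  have hq : Tendsto (fun t => (ms t : ℝ) * ps t ^ 2) atTop atTop := by
    refine tendsto_atTop_mono' _ ?_ ((tendsto_rpow_atTop (by linarith : 0 < 2 * δ)).comp
      (tendsto_natCast_atTop_atTop.comp hm))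
    filter_upwards [h, hm.eventually_gt_atTop 0] with t ht h0
    have h0 : (0 : ℝ) < ms t := by exact_mod_cast h0
    calc (ms t : ℝ) ^ (2 * δ) = ms t * ((ms t : ℝ) ^ (-(1 / 2) + δ)) ^ 2 := by
          rw [← rpow_natCast, ← rpow_mul h0.le]
          conv_rhs => rw [← rpow_one (ms t : ℝ), ← rpow_mul h0.le, ← rpow_add h0]
          congr 1
          push_cast
          ring
      _ ≤ _ := by gcongr; exact (le_max_left _ _).trans ht.2.1
  have hroot : Tendsto (fun y : ℝ => y ^ (1 / 3 : ℝ)) atTop atTop :=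
    tendsto_rpow_atTop (by norm_num)
  have h1 : Tendsto (fun t => 3 * exp (-c₁ * ((ns t : ℝ) * ps t) ^ (1 / 3 : ℝ))) atTop (𝓝 0) := by
    have := (tendsto_exp_atBot.comp
      ((hroot.comp hx).const_mul_atTop_of_neg (neg_neg_of_pos hc₁))).const_mul 3
    simpa using this
  set c := c₂ * cβ ^ (1 / 3 : ℝ) with hc
  have hc0 : 0 < c := mul_pos hc₂ (rpow_pos_of_pos hcβ _)
  have h2 : Tendsto (fun t => 11 / 2 * exp
      ((((ms t : ℝ) * ps t ^ 2) ^ (1 / 3 : ℝ)) ^ δ' - c * ((ms t : ℝ) * ps t ^ 2) ^ (1 / 3 : ℝ)))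
      atTop (𝓝 0) := by
    have := (tendsto_exp_atBot.comp ((tendsto_rpow_sub_mul_atBot hδ' hc0).comp
      (hroot.comp hq))).const_mul (11 / 2)
    simpa using this
  have h3 := h1.add h2
  rw [add_zero] at h3
  refine squeeze_zero' ?_ ?_ h3
  · filter_upwards [hx.eventually_ge_atTop 0] with t ht
    unfold boundF3
    positivity
  · filter_upwards [h, hn.eventually_gt_atTop 0, hq.eventually_gt_atTop 0] with t ht h0 hq0
    have h0 : (0 : ℝ) < ns t := by exact_mod_cast h0
    unfold boundF3
    refine add_le_add le_rfl ?_
    have e1 : (ns t : ℝ) + 9 / 2 * (ns t * ps t) ≤ 11 / 2 * ns t := by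
      have := mul_le_of_le_one_right h0.le ht.1
      linarith
    -- With `s = (m p²)^(1/3)` the hypothesis reads `log n < s ^ δ'`, of smaller order than the
    -- exponent `c s` because `δ' < 1`.
    have e2 : (ns t : ℝ) ≤ exp ((((ms t : ℝ) * ps t ^ 2) ^ (1 / 3 : ℝ)) ^ δ') := by
      rw [← rpow_mul hq0.le, one_div_mul_eq_div]
      exact (exp_log h0).ge.trans (exp_le_exp.2 ht.2.2.le)
    rw [mul_rpow hcβ.le hq0.le, sub_eq_add_neg, exp_add,
      show -c₂ * (cβ ^ (1 / 3 : ℝ) * ((ms t : ℝ) * ps t ^ 2) ^ (1 / 3 : ℝ))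
        = -(c * ((ms t : ℝ) * ps t ^ 2) ^ (1 / 3 : ℝ)) by rw [hc]; ring]
    refine (mul_le_mul_of_nonneg_right (e1.trans (mul_le_mul_of_nonneg_left e2 (by norm_num)))
      (exp_pos _).le).trans_eq ?_
    ring

theorem theorem4p2
    {X₁ X₂ Ω : Type*}
    [MetricSpace X₁] [CompactSpace X₁] [MeasurableSpace X₁] [BorelSpace X₁]
    [MetricSpace X₂] [CompactSpace X₂] [MeasurableSpace X₂] [BorelSpace X₂]
    [MeasurableSpace Ω]
    (μ₁ : Measure X₁) [IsProbabilityMeasure μ₁]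
    (μ₂ : Measure X₂) [IsProbabilityMeasure μ₂]
    (P : Measure Ω) [IsProbabilityMeasure P]
    (f : X₁ → X₂ → ℝ) (L D₂ Be B₀ : ℝ)
    (hL : 0 < L) (hBe : 0 ≤ Be)
    (hD₂ : ∀ y y' : X₂, dist y y' ≤ D₂)
    (hB₀ : B₀ = L * D₂ + 2 * Be)
    (hf : ∀ x x' y y', |f x y - f x' y'| ≤ L * max (dist x x') (dist y y'))
    (hfB : ∀ x y, |f x y| ≤ 2 * B₀)
    (δ cφ cβ ck : ℝ)
    (hδ : 0 < δ) (hcφ : 0 ≤ cφ) (hcβ : cβ ∈ Set.Ioo (0 : ℝ) 1) (hck : ck ∈ Set.Ico (0 : ℝ) 1) :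
    (∀ (m n k : ℕ) (p γ ζ β : ℝ)
      (x₁ : Fin m → Ω → X₁) (x₂ : Fin n → Ω → X₂)
      (η : Fin m → Fin n → Ω → ℝ) (o : Fin m → Fin n → Ω → Bool)
      (τ : (Fin m → Fin n → Bool) → Fin m → Fin n → Equiv.Perm (Fin n)),
      0 < m → 0 < n → 0 < k → p ≤ 1 → 0 < ζ →
      IsLatentModel P μ₁ μ₂ γ Be p x₁ x₂ η o →
      max ((m : ℝ) ^ (-(1 / 2) + δ)) ((n : ℝ) ^ (-1 + δ)) ≤ p →
      cφ * (n * p) ^ (-(2 / 3) : ℝ) ≤ ballMass μ₂ (√(ζ / L ^ 2)) →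
      β = cβ * (m * p ^ 2) →
      (k : ℝ) ≤ ck / 2 * ((n : ℝ) - 1) * p * ballMass μ₂ (√(ζ / L ^ 2)) →
      boundF1 ζ β γ k ≤ 2 * B₀ →
      cβ ^ 2 * β ^ (1 / 3 : ℝ) ≤ (1 - cβ) ^ 2 * (m * p ^ 2) →
      Integrable (avgSqError f x₁ x₂ η o β k τ) P ∧
      ∫ ω, avgSqError f x₁ x₂ η o β k τ ω ∂P ≤
        2 * boundF1 ζ β γ k * Real.log (2 * B₀ / boundF1 ζ β γ k)
          + (boundF1 ζ β γ k + boundF2 β) ^ 2 + 2 * boundF2 β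
          + 4 * B₀ ^ 2 * boundF3 (constC1 cφ ck) (constC2 cβ B₀) n p β) ∧
    (0 < cφ → 0 < B₀ →
      ∀ (δ' : ℝ) (ms ns : ℕ → ℕ) (ps : ℕ → ℝ),
      δ' ∈ Set.Ioo (0 : ℝ) 1 →
      Tendsto ms atTop atTop → Tendsto ns atTop atTop →
      (∀ᶠ t in atTop, ps t ≤ 1 ∧
        max ((ms t : ℝ) ^ (-(1 / 2) + δ)) ((ns t : ℝ) ^ (-1 + δ)) ≤ ps t ∧
        Real.log (ns t) < ((ms t : ℝ) * ps t ^ 2) ^ (δ' / 3)) →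
      Tendsto (fun t => boundF3 (constC1 cφ ck) (constC2 cβ B₀) (ns t) (ps t)
        (cβ * ((ms t : ℝ) * ps t ^ 2))) atTop (𝓝 0)) := by
  have hSB : SignalBounds f L D₂ Be B₀ := ⟨hL, hBe, hD₂, hB₀, hf, hfB⟩
  refine ⟨fun m n k p γ ζ β x₁ x₂ η o τ hm hn hk hp hζ h hpl hφ hβ hkφ hF hlarge => ?_,
    fun hcφ' hB δ' ms ns ps hδ' hms hns hps => ?_⟩
  · have hp0 : 0 < p := lt_of_lt_of_le
      (Real.rpow_pos_of_pos (by exact_mod_cast hm) _) ((le_max_left _ _).trans hpl)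
    obtain ⟨hint, hle⟩ := h.integral_avgSqError_le τ hSB hcφ hcβ hck hm hn hk hp0 hp hζ hφ hβ hkφ
      hF hlarge
    refine ⟨hint, hle.trans_eq ?_⟩
    unfold mainBound
    ring
  · have h1 : 0 < 1 - ck := by linarith [hck.2]
    exact tendsto_boundF3 (lt_min (by norm_num) (by positivity)) (constC2_pos hcβ.1 hB) hcβ.1 hδ
      hδ'.2 hms hns hps
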